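/- **Generalized Taft algebras.** Let $N\ge 2$, let $q\in\mathbb C$ be a primitive $N$-th root of unity, and let $a_1,a_2,b_1,b_2$ be integers with $a_1b_2+b_1a_2\equiv 0$, $a_1a_2\not\equiv 0$, $b_1b_2\not\equiv 0 \pmod N$. Let $n,m$ be the orders of $a_1a_2$, $b_1b_2$ in $\mathbb Z/N$. The generalized Taft algebra of type $A1\times A1$ with parameters $(a_1,a_2;b_1,b_2)$ is the Hopf algebra $H$ over $\mathbb C$ generated by $g,x,y$ with $g^N=1$, $x^n=0$, $y^m=0$, $gx=q^{a_2}xg$, $gy=q^{b_2}yg$, $xy=q^{a_1b_2}yx$ and $\Delta g=g\otimes g$, $\Delta x=1\otimes x+x\otimes g^{a_1}$, $\Delta y=1\otimes y+y\otimes g^{b_1}$, $\varepsilon(g)=1$, $\varepsilon(x)=\varepsilon(y)=0$, $Sg=g^{-1}$, $Sx=-xg^{-a_1}$, $Sy=-yg^{-b_1}$. Let $\mathcal B$ be the rigid monoidal category of finite-dimensional left $H$-modules, $V^*$ being the dual space with $H$ acting through $S$, with the usual $\mathrm{ev}_V:V^*\otimes V\to\mathbf 1$ and $\mathrm{coev}_V:\mathbf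 1\to V\otimes V^*$. For $k\in\mathbb Z/N$ let $T_k$ be the one-dimensional module on which $g$ acts by $q^k$ and $x,y$ by $0$. **Twisted pivotal structures.** A pivotal structure is a monoidal natural isomorphism $x^{**}\cong x$. Let $\alpha$ be an invertible object, with $\alpha^{-1}={}^*\alpha=\alpha^*$, where the left evaluation and coevaluation of $\alpha$ are $\mathrm{coev}_\alpha^{-1}:\alpha\otimes{}^*\alpha\to\mathbf 1$ and $\mathrm{ev}_\alpha^{-1}:\mathbf 1\to{}^*\alpha\otimes\alpha$. An $\alpha$-twisted pivotal structure is a natural isomorphism $\mathfrak p_x:x^{**}\otimes\alpha\to\alpha\otimes x$ such that $\mathfrak p_{\mathbf 1}$ is the canonical isomorphism, $\mathfrak p_{x\otimes y}=(\mathfrak p_x\otimes \mathrm{id}_y)(\mathrm{id}_{x^{**}}\otimes\mathfrak p_y)$ up to the canonical isomorphisms, and (twist relation) the composite $\alpha\xrightarrow{\mathrm{coev}_\alpha\otimes\mathrm{id}}\alpha\otimes\alpha^*\otimes\alpha\cong\alpha\otimes({}^*\alpha)^{**}\otimes\alpha\xrightarrow{\mathrm{id}\otimes\mathfrak p_{{}^*\alpha}}\alpha\otimes\alpha\otimes{}^*\alpha\xrightarrow{\mathrm{id}\otimes\mathrm{coev}_\alpha^{-1}}\alpha$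 is the identity. For $(c,d)\in(\mathbb Z/N)^2$ let $\mathfrak p^{c,d}$ be the family of maps $V^{**}\otimes T_c\to T_c\otimes V$, $v^{**}\otimes 1\mapsto 1\otimes g^d v$. **Twisted string nets on $S^2$.** Foliate the unit sphere $S^2\subset\mathbb R^3$ by the level sets of a coordinate (the height), and orient it by the outward normal. An $\alpha$-twisted string net is a finite graph embedded in $S^2$, with edges coloured by objects of $\mathcal B$ and strictly increasing in height, such that the minimum and the maximum of the height are univalent vertices, the strand leaving the minimum being coloured by $\alpha$ and the strand arriving at the maximum by $\alpha^*$, and with every other vertex labelled by a morphism from the tensor product (from left to right) of the colours of its incoming edges to that of its outgoing edges. Let $\mathcal I$ be the ideal of projective objects. The module $\mathcal{SN}^\alpha_{\mathcal I}(S^2)$ is the $\mathbb C$-vector space generated by the string nets that have an edge coloured by an object of $\mathcal I$, modulo: (i) isotopy through string nets; (ii) $\sum_i\lambda_iT_i=0$ whenever the $T_i$ agree outside a foliated rectangle that avoids the two critical points, have an $\mathcal I$-coloured edge outside it, meet it in progressive diagrams with the same source and target, and $\sum_i\lambda_i f_i=0$ for the values $f_i$ of these diagrams; (iii) sliding over the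 minimum: near it, the strand $\alpha$ with the vertex $\mathrm{coev}_x$ to its right (both legs $x,x^*$ going up) is replaced by the strand $\alpha$ with the vertex $\mathrm{coev}_{x^*}$ to its left, whose right leg $x^{**}$ then meets $\alpha$ in a vertex $\mathfrak p_x:x^{**}\otimes\alpha\to\alpha\otimes x$; (iv) sliding over the maximum: near it, the strand $\alpha^*$ with the vertex $\mathrm{ev}_{x^*}:x^{**}\otimes x^*\to\mathbf 1$ to its right is replaced by the strands $\alpha^*,x^{**}$ meeting in a vertex labelled by the mate $\alpha^*\otimes x^{**}\to x\otimes\alpha^*$ of $\mathfrak p_x$, followed by the vertex $\mathrm{ev}_x:x^*\otimes x\to\mathbf 1$ to the left of the strand $\alpha^*$. **Theorem.** 1. For $N=3$, every primitive third root of unity $q$ and parameters $(a_1,a_2;b_1,b_2)=(1,1;2,1)$, the category $\mathcal B$ is a finite tensor category, $\mathfrak p^{2,0}$ is a twisted pivotal structure on it (with $\alpha=T_2$), and it has no pivotal structure. 2. For $N=9$, every primitive ninth root of unity $q$ and parameters $(a_1,a_2;b_1,b_2)=(1,3;5,3)$, the category $\mathcal B$ is a finite tensor category that is not unimodular (the socle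 of the projective cover of $\mathbf 1$ is not isomorphic to $\mathbf 1$), $\mathfrak p^{6,6}$ is a twisted pivotal structure on it (with $\alpha=T_6$), and $\mathcal{SN}^\alpha_{\mathcal I}(S^2)\neq 0$ for it. -/

import Mathlib

open CategoryTheory MonoidalCategory
open scoped TensorProduct ContDiff

noncomputable section

universe u v

/-! ### Representations of a Hopf algebra: tensor products, trivial representation, duals -/

namespace HopfRep

section

variable {k : Type u} [Field k] {H : Type v} [Ring H] [HopfAlgebra k H]
variable {U V W : Type u} [AddCommGroup U] [Module k U] [AddCommGroup V] [Module k V]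
  [AddCommGroup W] [Module k W]

/-- The action of `H ⊗ H` on `V ⊗ W`. -/
def act₂ (ρ : H →ₐ[k] Module.End k V) (σ : H →ₐ[k] Module.End k W) :
    H ⊗[k] H →ₐ[k] Module.End k (V ⊗[k] W) :=
  Module.endTensorEndAlgHom.comp (Algebra.TensorProduct.map ρ σ)

theorem act₂_tmul (ρ : H →ₐ[k] Module.End k V) (σ : H →ₐ[k] Module.End k W) (a b : H) :
    act₂ ρ σ (a ⊗ₜ b) = TensorProduct.map (ρ a) (σ b) := rfl

/-- `H` acts on `V ⊗ W` through its comultiplication. -/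
def tensor (ρ : H →ₐ[k] Module.End k V) (σ : H →ₐ[k] Module.End k W) :
    H →ₐ[k] Module.End k (V ⊗[k] W) :=
  (act₂ ρ σ).comp (Bialgebra.comulAlgHom k H)

theorem tensor_apply (ρ : H →ₐ[k] Module.End k V) (σ : H →ₐ[k] Module.End k W) (h : H) :
    tensor ρ σ h = act₂ ρ σ (Coalgebra.comul h) := rfl

/-- `H` acts on `k` through its counit. -/
def triv : H →ₐ[k] Module.End k k := (Algebra.lmul k k).comp (Bialgebra.counitAlgHom k H)

theorem triv_apply (h : H) (c : k) :
    (triv : H →ₐ[k] Module.End k k) h c = Coalgebra.counit (R := k) h * c := rfl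

/-- `H` acts on the dual space through its antipode. -/
def dual (ρ : H →ₐ[k] Module.End k V) : H →ₐ[k] Module.End k (Module.Dual k V) :=
  AlgHom.ofLinearMap
    { toFun := fun h => (ρ (HopfAlgebra.antipode k h)).dualMap
      map_add' := fun a b => by ext; simp
      map_smul' := fun c a => by ext; simp }
    (by ext; simp)
    (fun a b => by ext; simp [HopfAlgebra.antipode_mul_antidistrib])

theorem dual_apply (ρ : H →ₐ[k] Module.End k V) (h : H) :
    dual ρ h = (ρ (HopfAlgebra.antipode k h)).dualMap := rfl

theorem assoc_act (ρ : H →ₐ[k] Module.End k U) (σ : H →ₐ[k] Module.End k V)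
    (τ : H →ₐ[k] Module.End k W) (h : H) :
    (TensorProduct.assoc k U V W).toLinearMap ∘ₗ tensor (tensor ρ σ) τ h =
      tensor ρ (tensor σ τ) h ∘ₗ (TensorProduct.assoc k U V W).toLinearMap := by
  have h1 : ∀ t : (H ⊗[k] H) ⊗[k] H, (TensorProduct.assoc k U V W).toLinearMap ∘ₗ
      (Module.endTensorEndAlgHom (R := k) (S := k) (A := k)
        (Algebra.TensorProduct.map (act₂ ρ σ) τ t)) =
      (Module.endTensorEndAlgHom (R := k) (S := k) (A := k) (Algebra.TensorProduct.map ρ (act₂ σ τ)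
        (TensorProduct.assoc k H H H t))) ∘ₗ (TensorProduct.assoc k U V W).toLinearMap := by
    intro t
    induction t with
    | zero => simp
    | add a b ha hb => simp only [map_add, LinearMap.comp_add, LinearMap.add_comp, ha, hb]
    | tmul ab c =>
      induction ab with
      | zero => simp
      | add a b ha hb =>
        simp only [TensorProduct.add_tmul, map_add, LinearMap.comp_add, LinearMap.add_comp, ha, hb]
      | tmul a b => exact TensorProduct.ext_threefold fun x y z => rfl
  have h2 : ∀ t : H ⊗[k] H, act₂ (tensor ρ σ) τ t =
      Module.endTensorEndAlgHom (R := k) (S := k) (A := k)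
        (Algebra.TensorProduct.map (act₂ ρ σ) τ ((Coalgebra.comul (R := k)).rTensor H t)) := by
    intro t
    induction t with
    | zero => simp
    | add a b ha hb => simp only [map_add, ha, hb]
    | tmul a b => rfl
  have h3 : ∀ t : H ⊗[k] H, act₂ ρ (tensor σ τ) t =
      Module.endTensorEndAlgHom (R := k) (S := k) (A := k)
        (Algebra.TensorProduct.map ρ (act₂ σ τ) ((Coalgebra.comul (R := k)).lTensor H t)) := by
    intro t
    induction t with
    | zero => simp
    | add a b ha hb => simp only [map_add, ha, hb]
    | tmul a b => rfl
  rw [tensor_apply, tensor_apply, h2, h3, h1, Coalgebra.coassoc_apply]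

theorem lid_act (ρ : H →ₐ[k] Module.End k V) (h : H) :
    (TensorProduct.lid k V).toLinearMap ∘ₗ tensor triv ρ h =
      ρ h ∘ₗ (TensorProduct.lid k V).toLinearMap := by
  have key : ∀ t : H ⊗[k] H, (TensorProduct.lid k V).toLinearMap ∘ₗ act₂ triv ρ t =
      ρ (TensorProduct.lid k H ((Coalgebra.counit (R := k)).rTensor H t)) ∘ₗ
        (TensorProduct.lid k V).toLinearMap := by
    intro t
    induction t with
    | zero => simp
    | add a b ha hb => simp only [map_add, LinearMap.comp_add, LinearMap.add_comp, ha, hb]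
    | tmul a b => exact TensorProduct.ext' fun c v => by simp [act₂_tmul, triv_apply, mul_smul]
  rw [tensor_apply, key, Coalgebra.rTensor_counit_comul]
  simp

theorem rid_act (ρ : H →ₐ[k] Module.End k V) (h : H) :
    (TensorProduct.rid k V).toLinearMap ∘ₗ tensor ρ triv h =
      ρ h ∘ₗ (TensorProduct.rid k V).toLinearMap := by
  have key : ∀ t : H ⊗[k] H, (TensorProduct.rid k V).toLinearMap ∘ₗ act₂ ρ triv t =
      ρ (TensorProduct.rid k H ((Coalgebra.counit (R := k)).lTensor H t)) ∘ₗ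
        (TensorProduct.rid k V).toLinearMap := by
    intro t
    induction t with
    | zero => simp
    | add a b ha hb => simp only [map_add, LinearMap.comp_add, LinearMap.add_comp, ha, hb]
    | tmul a b => exact TensorProduct.ext' fun v c => by simp [act₂_tmul, triv_apply, mul_smul]
  rw [tensor_apply, key, Coalgebra.lTensor_counit_comul]
  simp

theorem map_act {V' W' : Type u} [AddCommGroup V'] [Module k V'] [AddCommGroup W'] [Module k W']
    {ρ : H →ₐ[k] Module.End k V} {ρ' : H →ₐ[k] Module.End k V'}
    {σ : H →ₐ[k] Module.End k W} {σ' : H →ₐ[k] Module.End k W'}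
    {f : V →ₗ[k] V'} {g : W →ₗ[k] W'} (hf : ∀ h, f ∘ₗ ρ h = ρ' h ∘ₗ f)
    (hg : ∀ h, g ∘ₗ σ h = σ' h ∘ₗ g) (h : H) :
    TensorProduct.map f g ∘ₗ tensor ρ σ h = tensor ρ' σ' h ∘ₗ TensorProduct.map f g := by
  have key : ∀ t : H ⊗[k] H, TensorProduct.map f g ∘ₗ act₂ ρ σ t =
      act₂ ρ' σ' t ∘ₗ TensorProduct.map f g := by
    intro t
    induction t with
    | zero => simp
    | add a b ha hb => simp only [map_add, LinearMap.comp_add, LinearMap.add_comp, ha, hb]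
    | tmul a b =>
      rw [act₂_tmul, act₂_tmul, ← TensorProduct.map_comp, ← TensorProduct.map_comp, hf, hg]
  exact key _

theorem ev_act (ρ : H →ₐ[k] Module.End k V) (h : H) :
    contractLeft k V ∘ₗ tensor (dual ρ) ρ h = triv h ∘ₗ contractLeft k V := by
  have key : ∀ t : H ⊗[k] H, contractLeft k V ∘ₗ act₂ (dual ρ) ρ t =
      contractLeft k V ∘ₗ LinearMap.lTensor _
        (ρ (LinearMap.mul' k H ((HopfAlgebra.antipode k).rTensor H t))) := by
    intro t
    induction t with
    | zero => simp
    | add a b ha hb => simp only [map_add, LinearMap.comp_add, LinearMap.lTensor_add, ha, hb]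
    | tmul a b => exact TensorProduct.ext' fun ξ v => by simp [act₂_tmul, dual_apply]
  rw [tensor_apply, key, HopfAlgebra.mul_antipode_rTensor_comul_apply]
  exact TensorProduct.ext' fun ξ v => by simp [triv_apply]

theorem coev_act [FiniteDimensional k V] (ρ : H →ₐ[k] Module.End k V) (h : H) :
    coevaluation k V ∘ₗ triv h = tensor ρ (dual ρ) h ∘ₗ coevaluation k V := by
  obtain ⟨e, he, hinj⟩ : ∃ e : V ⊗[k] Module.Dual k V →ₗ[k] Module.End k V,
      (∀ v ξ w, e (v ⊗ₜ ξ) w = ξ w • v) ∧ Function.Injective e :=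
    ⟨dualTensorHom k V V ∘ₗ (TensorProduct.comm k V (Module.Dual k V)).toLinearMap,
      fun v ξ w => rfl,
      (dualTensorHomEquiv k V V).injective.comp
        (TensorProduct.comm k V (Module.Dual k V)).injective⟩
  have key : ∀ t : H ⊗[k] H, e (act₂ ρ (dual ρ) t (coevaluation k V 1)) =
      ρ (LinearMap.mul' k H ((HopfAlgebra.antipode k).lTensor H t)) := by
    intro t
    induction t with
    | zero => simp
    | add a b ha hb => simp only [map_add, LinearMap.add_apply, ha, hb]
    | tmul a b =>
      ext v
      have hs := (Module.Basis.ofVectorSpace k V).sum_repr (ρ (HopfAlgebra.antipode k b) v)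
      rw [act₂_tmul, coevaluation_apply_one]
      dsimp only
      rw [map_sum, map_sum, LinearMap.sum_apply, LinearMap.lTensor_tmul, LinearMap.mul'_apply,
        map_mul, Module.End.mul_apply]
      conv_rhs => rw [← hs, map_sum]
      refine Finset.sum_congr rfl fun i _ => ?_
      rw [TensorProduct.map_tmul, he, dual_apply, map_smul]
      rfl
  have h1 : e (coevaluation k V 1) = 1 := by
    have := key 1
    rwa [map_one (act₂ ρ (dual ρ)), Algebra.TensorProduct.one_def, LinearMap.lTensor_tmul,
      LinearMap.mul'_apply, HopfAlgebra.antipode_one, mul_one, map_one ρ,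
      Module.End.one_apply] at this
  apply LinearMap.ext_ring
  apply hinj
  have h2 : (triv h : Module.End k k) 1 = Coalgebra.counit (R := k) h • (1 : k) := rfl
  have h3 := key (Coalgebra.comul h)
  rw [HopfAlgebra.mul_antipode_lTensor_comul_apply, AlgHom.commutes,
    Algebra.algebraMap_eq_smul_one] at h3
  rw [LinearMap.comp_apply, h2, map_smul, map_smul, h1, ← h3]
  rfl

end

end HopfRep

/-! ### The category of finite-dimensional modules -/

/-- A finite-dimensional left module over the `k`-algebra `H`: a finite-dimensional vector space
with an algebra homomorphism from `H` to its endomorphisms. -/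
structure FDMod (k : Type u) [Field k] (H : Type v) [Ring H] [Algebra k H] where
  carrier : Type u
  [addCommGroup : AddCommGroup carrier]
  [module : Module k carrier]
  [finite : FiniteDimensional k carrier]
  ρ : H →ₐ[k] Module.End k carrier

namespace FDMod

attribute [instance] FDMod.addCommGroup FDMod.module FDMod.finite

section Category

variable {k : Type u} [Field k] {H : Type v} [Ring H] [Algebra k H]

/-- An `H`-linear map. -/
@[ext] structure Hom (V W : FDMod k H) where
  toLin : V.carrier →ₗ[k] W.carrier
  comm : ∀ h : H, toLin ∘ₗ V.ρ h = W.ρ h ∘ₗ toLin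

instance : Category (FDMod k H) where
  Hom := Hom
  id V := ⟨LinearMap.id, fun _ => rfl⟩
  comp f g := ⟨g.toLin ∘ₗ f.toLin, fun h => by
    rw [LinearMap.comp_assoc, f.comm, ← LinearMap.comp_assoc, g.comm, LinearMap.comp_assoc]⟩

theorem hom_ext {V W : FDMod k H} {f g : V ⟶ W} (h : f.toLin = g.toLin) : f = g :=
  Hom.ext h

/-- An `H`-linear bijection is an isomorphism. -/
def mkIso {V W : FDMod k H} (e : V.carrier ≃ₗ[k] W.carrier)
    (he : ∀ h, e.toLinearMap ∘ₗ V.ρ h = W.ρ h ∘ₗ e.toLinearMap) : V ≅ W where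
  hom := ⟨e.toLinearMap, he⟩
  inv := ⟨e.symm.toLinearMap, fun h => by
    ext w
    have := LinearMap.congr_fun (he h) (e.symm w)
    simp only [LinearMap.comp_apply, LinearEquiv.coe_coe, LinearEquiv.apply_symm_apply] at this
    simp [← this]⟩
  hom_inv_id := hom_ext (LinearMap.ext fun v => e.symm_apply_apply v)
  inv_hom_id := hom_ext (LinearMap.ext fun v => e.apply_symm_apply v)

instance (V W : FDMod k H) : Zero (V ⟶ W) := ⟨⟨0, fun _ => by simp⟩⟩

instance (V W : FDMod k H) : Add (V ⟶ W) :=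
  ⟨fun f g => ⟨f.toLin + g.toLin, fun h => by
    rw [LinearMap.add_comp, LinearMap.comp_add, f.comm, g.comm]⟩⟩

instance (V W : FDMod k H) : Neg (V ⟶ W) :=
  ⟨fun f => ⟨-f.toLin, fun h => by rw [LinearMap.neg_comp, LinearMap.comp_neg, f.comm]⟩⟩

instance (V W : FDMod k H) : SMul k (V ⟶ W) :=
  ⟨fun c f => ⟨c • f.toLin, fun h => by rw [LinearMap.smul_comp, LinearMap.comp_smul, f.comm]⟩⟩

instance homAddCommGroup (V W : FDMod k H) : AddCommGroup (V ⟶ W) where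
  add_assoc f g h := hom_ext (add_assoc f.toLin g.toLin h.toLin)
  zero_add f := hom_ext (zero_add f.toLin)
  add_zero f := hom_ext (add_zero f.toLin)
  neg_add_cancel f := hom_ext (neg_add_cancel f.toLin)
  add_comm f g := hom_ext (add_comm f.toLin g.toLin)
  nsmul := nsmulRec
  zsmul := zsmulRec

instance homModule (V W : FDMod k H) : Module k (V ⟶ W) where
  one_smul f := hom_ext (one_smul k f.toLin)
  mul_smul c d f := hom_ext (mul_smul c d f.toLin)
  smul_zero c := hom_ext (smul_zero (A := V.carrier →ₗ[k] W.carrier) c)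
  smul_add c f g := hom_ext (smul_add c f.toLin g.toLin)
  add_smul c d f := hom_ext (add_smul c d f.toLin)
  zero_smul f := hom_ext (zero_smul k f.toLin)

instance : Preadditive (FDMod k H) where
  add_comp _ _ _ f f' g := hom_ext (LinearMap.comp_add f.toLin f'.toLin g.toLin)
  comp_add _ _ _ f g g' := hom_ext (LinearMap.add_comp f.toLin g'.toLin g.toLin)

instance : CategoryTheory.Linear k (FDMod k H) where
  smul_comp _ _ _ c f g := hom_ext (LinearMap.ext fun v => map_smul g.toLin c (f.toLin v))
  comp_smul _ _ _ _ _ _ := hom_ext (LinearMap.ext fun _ => rfl)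

end Category

section Monoidal

variable {k : Type u} [Field k] {H : Type v} [Ring H] [HopfAlgebra k H]

instance : MonoidalCategoryStruct (FDMod k H) where
  tensorObj V W := ⟨V.carrier ⊗[k] W.carrier, HopfRep.tensor V.ρ W.ρ⟩
  tensorUnit := ⟨k, HopfRep.triv⟩
  whiskerLeft _ _ _ f :=
    ⟨TensorProduct.map LinearMap.id f.toLin, HopfRep.map_act (fun _ => rfl) f.comm⟩
  whiskerRight f _ :=
    ⟨TensorProduct.map f.toLin LinearMap.id, HopfRep.map_act f.comm (fun _ => rfl)⟩
  tensorHom f g := ⟨TensorProduct.map f.toLin g.toLin, HopfRep.map_act f.comm g.comm⟩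
  associator U V W := mkIso (TensorProduct.assoc k U.carrier V.carrier W.carrier)
    (HopfRep.assoc_act U.ρ V.ρ W.ρ)
  leftUnitor V := mkIso (TensorProduct.lid k V.carrier) (HopfRep.lid_act V.ρ)
  rightUnitor V := mkIso (TensorProduct.rid k V.carrier) (HopfRep.rid_act V.ρ)

instance : MonoidalCategory (FDMod k H) where
  tensorHom_def _ _ := hom_ext (TensorProduct.ext' fun _ _ => rfl)
  id_tensorHom_id _ _ := hom_ext (TensorProduct.ext' fun _ _ => rfl)
  tensorHom_comp_tensorHom _ _ _ _ := hom_ext (TensorProduct.ext' fun _ _ => rfl)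
  whiskerLeft_id _ _ := hom_ext (TensorProduct.ext' fun _ _ => rfl)
  id_whiskerRight _ _ := hom_ext (TensorProduct.ext' fun _ _ => rfl)
  associator_naturality _ _ _ := hom_ext (TensorProduct.ext_threefold fun _ _ _ => rfl)
  leftUnitor_naturality f := hom_ext (TensorProduct.ext' fun _ _ => (map_smul f.toLin _ _).symm)
  rightUnitor_naturality f := hom_ext (TensorProduct.ext' fun _ _ => (map_smul f.toLin _ _).symm)
  pentagon _ _ _ _ := hom_ext (TensorProduct.ext_fourfold fun _ _ _ _ => rfl)
  triangle _ _ := hom_ext (TensorProduct.ext_threefold fun v c w =>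
    (TensorProduct.smul_tmul (R := k) c v w).symm)

/-- The right dual: the dual space, with `H` acting through the antipode. -/
def dualObj (V : FDMod k H) : FDMod k H := ⟨Module.Dual k V.carrier, HopfRep.dual V.ρ⟩

instance exactPairing (V : FDMod k H) : ExactPairing V (dualObj V) where
  coevaluation' := ⟨coevaluation k V.carrier, HopfRep.coev_act V.ρ⟩
  evaluation' := ⟨contractLeft k V.carrier, HopfRep.ev_act V.ρ⟩
  coevaluation_evaluation' := hom_ext (contractLeft_assoc_coevaluation k V.carrier)
  evaluation_coevaluation' := hom_ext (contractLeft_assoc_coevaluation' k V.carrier)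

instance : RightRigidCategory (FDMod k H) where
  rightDual V := { rightDual := dualObj V, exact := exactPairing V }

end Monoidal

end FDMod

/-! ### Duals, invertible objects, pivotal and twisted pivotal structures -/

namespace TwPiv

section Rigid

variable {C : Type u} [Category.{v} C] [MonoidalCategory C] [RightRigidCategory C]

/-- The chosen right dual `x*`, with `coev : 𝟙 ⟶ x ⊗ x*` and `ev : x* ⊗ x ⟶ 𝟙`. -/
def dual (x : C) : C := (RightRigidCategory.rightDual x).rightDual

/-- The pairing that exhibits `x*` as the right dual of `x`. -/
@[reducible] def pairing (x : C) : ExactPairing x (dual x) := (RightRigidCategory.rightDual x).exact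

def coev (x : C) : 𝟙_ C ⟶ x ⊗ dual x := (pairing x).coevaluation'

def ev (x : C) : dual x ⊗ x ⟶ 𝟙_ C := (pairing x).evaluation'

/-- The dual `f* : y* ⟶ x*` of `f : x ⟶ y`. -/
def dualMap {x y : C} (f : x ⟶ y) : dual y ⟶ dual x :=
  @rightAdjointMate C _ _ x y (RightRigidCategory.rightDual x) (RightRigidCategory.rightDual y) f

/-- The canonical isomorphism `𝟙* ≅ 𝟙`. -/
def dualUnit : dual (𝟙_ C) ≅ 𝟙_ C := rightDualIso (pairing (𝟙_ C)) exactPairingUnit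

/-- The canonical isomorphism `(x ⊗ y)* ≅ y* ⊗ x*`. -/
def dualTensor (x y : C) : dual (x ⊗ y) ≅ dual y ⊗ dual x :=
  rightDualIso (pairing (x ⊗ y))
    (@ExactPairing.tensor C _ _ x y (dual x) (dual y) (pairing x) (pairing y))

/-- The canonical isomorphism `𝟙** ≅ 𝟙`, as a morphism. -/
def ddUnit : dual (dual (𝟙_ C)) ⟶ 𝟙_ C := dualMap (dualUnit (C := C)).inv ≫ dualUnit.hom

/-- The canonical isomorphism `(x ⊗ y)** ≅ x** ⊗ y**`, as a morphism. -/
def ddTensor (x y : C) : dual (dual (x ⊗ y)) ⟶ dual (dual x) ⊗ dual (dual y) :=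
  dualMap (dualTensor x y).inv ≫ (dualTensor (dual y) (dual x)).hom

/-- `α` is invertible: its evaluation and coevaluation are isomorphisms. -/
def IsInvertible (α : C) : Prop := IsIso (coev α) ∧ IsIso (ev α)

/-- The inverses of the evaluation and coevaluation of an invertible object `α` exhibit `α*` also
as a left dual `*α` of `α`. -/
@[reducible] def leftPairing {α : C} (hα : IsInvertible α) : ExactPairing (dual α) α :=
  haveI := hα.1
  haveI := hα.2
  { coevaluation' := inv (ev α)
    evaluation' := inv (coev α)
    coevaluation_evaluation' := by
      have h := (pairing α).evaluation_coevaluation'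
      change coev α ▷ α ≫ (α_ _ _ _).hom ≫ α ◁ ev α = _ at h
      have h' := congrArg (fun f => (α ◁ inv (ev α)) ≫ (α_ _ _ _).inv ≫ (inv (coev α) ▷ α) ≫ f ≫
        (ρ_ α).hom ≫ (λ_ α).inv) h
      simpa [← comp_whiskerRight_assoc, ← whiskerLeft_comp_assoc] using h'.symm
    evaluation_coevaluation' := by
      have h := (pairing α).coevaluation_evaluation'
      change dual α ◁ coev α ≫ (α_ _ _ _).inv ≫ ev α ▷ dual α = _ at h
      have h' := congrArg (fun f => (inv (ev α) ▷ dual α) ≫ (α_ _ _ _).hom ≫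
        (dual α ◁ inv (coev α)) ≫ f ≫ (λ_ (dual α)).hom ≫ (ρ_ (dual α)).inv) h
      simpa [← comp_whiskerRight_assoc, ← whiskerLeft_comp_assoc] using h'.symm }

/-- The canonical isomorphism `α ≅ (*α)*`. -/
def doubleDualLeft {α : C} (hα : IsInvertible α) : α ≅ dual (dual α) :=
  rightDualIso (leftPairing hα) (pairing (dual α))

variable (C) in
/-- A pivotal structure: a monoidal natural isomorphism `x** ≅ x`. -/
structure PivotalStructure where
  app (x : C) : dual (dual x) ≅ x
  naturality {x y : C} (f : x ⟶ y) : dualMap (dualMap f) ≫ (app y).hom = (app x).hom ≫ f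
  app_unit : (app (𝟙_ C)).hom = ddUnit
  app_tensor (x y : C) : (app (x ⊗ y)).hom = ddTensor x y ≫ ((app x).hom ⊗ₘ (app y).hom)

/-- An `α`-twisted pivotal structure, for an invertible object `α`: a natural isomorphism
`x** ⊗ α ≅ α ⊗ x`, compatible with the monoidal structure, that satisfies the twist relation. -/
structure TwistedPivotalStructure (α : C) where
  invertible : IsInvertible α
  app (x : C) : dual (dual x) ⊗ α ≅ α ⊗ x
  naturality {x y : C} (f : x ⟶ y) :
    dualMap (dualMap f) ▷ α ≫ (app y).hom = (app x).hom ≫ α ◁ f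
  app_unit : (app (𝟙_ C)).hom = ddUnit ▷ α ≫ (λ_ α).hom ≫ (ρ_ α).inv
  app_tensor (x y : C) : (app (x ⊗ y)).hom =
    ddTensor x y ▷ α ≫ (α_ _ _ _).hom ≫ dual (dual x) ◁ (app y).hom ≫ (α_ _ _ _).inv ≫
      (app x).hom ▷ y ≫ (α_ _ _ _).hom
  /-- The composite `α ⟶ α ⊗ α* ⊗ α ≅ α ⊗ (*α)** ⊗ α ⟶ α ⊗ α ⊗ *α ⟶ α` is the identity. -/
  twist : (λ_ α).inv ≫ coev α ▷ α ≫ (α_ _ _ _).hom ≫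
    α ◁ (dualMap (doubleDualLeft invertible).inv ▷ α ≫ (app (dual α)).hom ≫
      (leftPairing invertible).evaluation') ≫ (ρ_ α).hom = 𝟙 α

/-- The map `α* ⊗ x** ⟶ x ⊗ α*` that a twisted pivotal structure induces by duality. -/
def TwistedPivotalStructure.mate {α : C} (P : TwistedPivotalStructure α) (x : C) :
    dual α ⊗ dual (dual x) ⟶ x ⊗ dual α :=
  (ρ_ _).inv ≫ (dual α ⊗ dual (dual x)) ◁ coev α ≫ (α_ _ _ _).inv ≫
    ((α_ _ _ _).hom ≫ dual α ◁ (P.app x).hom ≫ (α_ _ _ _).inv ≫ ev α ▷ x ≫ (λ_ x).hom) ▷ dual α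

end Rigid

/-! ### Finite tensor categories -/

section Finite

/-- A `k`-linear monoidal category with right duals is a finite tensor category if it has left
duals, its tensor product is bilinear, its unit has one-dimensional endomorphism space, and its
underlying linear category is the category of finite-dimensional modules over some
finite-dimensional algebra. -/
def IsFiniteTensorCategory (k : Type u) [Field k] (C : Type (u + 1)) [Category.{u} C]
    [Preadditive C] [CategoryTheory.Linear k C] [MonoidalCategory C] [RightRigidCategory C] :
    Prop :=
  (∀ x : C, ∃ y : C, Nonempty (ExactPairing y x)) ∧
  (∃ _ : MonoidalPreadditive C, MonoidalLinear k C) ∧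
  Module.finrank k (𝟙_ C ⟶ 𝟙_ C) = 1 ∧
  ∃ (A : Type u) (_ : Ring A) (_ : Algebra k A) (_ : FiniteDimensional k A)
    (F : C ≌ FDMod k A) (_ : F.functor.Additive), F.functor.Linear k

variable {C : Type u} [Category.{v} C]

/-- `π : P ⟶ x` is a projective cover: `P` is projective and `π` is an essential epimorphism. -/
def IsProjectiveCover {P x : C} (π : P ⟶ x) : Prop :=
  Projective P ∧ Epi π ∧ ∀ (Q : C) (h : Q ⟶ P), Epi (h ≫ π) → Epi h

variable [Preadditive C] [MonoidalCategory C]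

variable (C) in
/-- A finite tensor category is unimodular if every simple subobject of the projective cover of
the unit (there is only one, the distinguished invertible object up to duality) is isomorphic to
the unit. -/
def IsUnimodular : Prop :=
  ∀ (D P : C) (π : P ⟶ 𝟙_ C) (i : D ⟶ P), IsProjectiveCover π → Simple D → Mono i →
    Nonempty (D ≅ 𝟙_ C)

end Finite

/-! ### Evaluation of progressive diagrams -/

section Words

variable {C : Type u} [Category.{v} C] [MonoidalCategory C]

/-- The tensor product of a list of objects. -/
def tens : List C → C
  | [] => 𝟙_ C
  | x :: xs => x ⊗ tens xs

/-- The canonical isomorphism between the tensor product of a concatenation and the tensor product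
of the tensor products. -/
def tensAppend : (xs ys : List C) → (tens (xs ++ ys) ≅ tens xs ⊗ tens ys)
  | [], ys => (λ_ (tens ys)).symm
  | x :: xs, ys => whiskerLeftIso x (tensAppend xs ys) ≪≫ (α_ x (tens xs) (tens ys)).symm

/-- The canonical isomorphism from a tensor product of two objects to that of a list of two. -/
def tensPair (x y : C) : x ⊗ y ≅ tens [x, y] := whiskerLeftIso x (ρ_ y).symm

end Words

section StringNets

/-- What a string net shows at a point of the surface: nothing, a singularity of the foliation
(with the end of the strand at it), a point in the interior of an edge coloured by an object, or a
vertex with incoming and outgoing edges (from left to right) labelled by a morphism. -/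
inductive PointLabel (C : Type u) [Category.{v} C] [MonoidalCategory C] : Type (max u v)
  | empty
  | singular
  | edge (x : C)
  | vertex (ins outs : List C) (f : tens ins ⟶ tens outs)

variable {C : Type u} [Category.{v} C] [MonoidalCategory C]

/-- The diagram `D`, given in coordinates `(θ, φ)` where `φ` is the height and `θ` increases to the
right, consists over the heights in `s`, between the walls `L` and `R`, of disjoint smooth strands
`u i`, transverse to the level lines and ordered from left to right, with colours `xs`. -/
def IsStrandFamily (D : ℝ → ℝ → PointLabel C) (L R : ℝ → ℝ) (s : Set ℝ) (xs : List C)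
    (u : Fin xs.length → ℝ → ℝ) : Prop :=
  (∀ i, ContDiffOn ℝ ∞ (u i) s) ∧
  ∀ h ∈ s, StrictMono (fun i => u i h) ∧
    (∀ i, L h < u i h ∧ u i h < R h ∧ D (u i h) h = .edge (xs.get i)) ∧
    ∀ θ ∈ Set.Icc (L h) (R h), (∀ i, θ ≠ u i h) → D θ h = .empty

/-- Between the walls `L` and `R` and the heights `a` and `b` the diagram `D` consists of one
vertex, labelled by `f`, in the interior, the edges `xs` coming in from the bottom, and the edges
`ys` going out to the top. -/
def IsCorolla (D : ℝ → ℝ → PointLabel C) (L R : ℝ → ℝ) (a b : ℝ) (xs ys : List C)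
    (f : tens xs ⟶ tens ys) : Prop :=
  ∃ θ₀ h₀ : ℝ, a < h₀ ∧ h₀ < b ∧ L h₀ < θ₀ ∧ θ₀ < R h₀ ∧ D θ₀ h₀ = .vertex xs ys f ∧
    (∀ θ ∈ Set.Icc (L h₀) (R h₀), θ ≠ θ₀ → D θ h₀ = .empty) ∧
    (∃ u, IsStrandFamily D L R (Set.Ico a h₀) xs u ∧
      ∀ i, Filter.Tendsto (u i) (nhdsWithin h₀ (Set.Iio h₀)) (nhds θ₀)) ∧
    (∃ u, IsStrandFamily D L R (Set.Ioc h₀ b) ys u ∧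
      ∀ i, Filter.Tendsto (u i) (nhdsWithin h₀ (Set.Ioi h₀)) (nhds θ₀))

/-- The heights from `a` to `b` and the walls `L` and `R` bound a rectangle. -/
def IsBox (L R : ℝ → ℝ) (a b : ℝ) : Prop :=
  a < b ∧ ContinuousOn L (Set.Icc a b) ∧ ContinuousOn R (Set.Icc a b) ∧
    ∀ h ∈ Set.Icc a b, L h < R h

/-- `Eval D L R a b xs ys f`: the progressive diagram that `D` shows in the rectangle between the
walls `L` and `R` and the heights `a` and `b` has the source `xs` at the bottom, the target `ys` at
the top, and the value `f`. Every such diagram decomposes into strands and vertices by horizontal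
and vertical cuts. -/
inductive Eval (D : ℝ → ℝ → PointLabel C) : (L R : ℝ → ℝ) → (a b : ℝ) → (xs ys : List C) →
    (tens xs ⟶ tens ys) → Prop
  | strands {L R : ℝ → ℝ} {a b : ℝ} {xs : List C} {u : Fin xs.length → ℝ → ℝ} :
      IsBox L R a b → IsStrandFamily D L R (Set.Icc a b) xs u → Eval D L R a b xs xs (𝟙 _)
  | corolla {L R : ℝ → ℝ} {a b : ℝ} {xs ys : List C} {f : tens xs ⟶ tens ys} :
      IsBox L R a b → IsCorolla D L R a b xs ys f → Eval D L R a b xs ys f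
  | hcomp {L M R : ℝ → ℝ} {a b : ℝ} {xs ys xs' ys' : List C} {f : tens xs ⟶ tens ys}
      {g : tens xs' ⟶ tens ys'} :
      Eval D L M a b xs ys f → Eval D M R a b xs' ys' g →
        Eval D L R a b (xs ++ xs') (ys ++ ys')
          ((tensAppend xs xs').hom ≫ (f ⊗ₘ g) ≫ (tensAppend ys ys').inv)
  | vcomp {L R : ℝ → ℝ} {a b c : ℝ} {xs ys zs : List C} {f : tens xs ⟶ tens ys}
      {g : tens ys ⟶ tens zs} :
      Eval D L R a c xs ys f → Eval D L R c b ys zs g → Eval D L R a b xs zs (f ≫ g)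

/-! ### Twisted string nets on the sphere -/

/-- The unit sphere, foliated by the level sets of the height function `p ↦ p 0`. -/
abbrev S2 : Type := Metric.sphere (0 : EuclideanSpace ℝ (Fin 3)) 1

/-- The point of longitude `θ` and latitude `φ`. For the outward orientation of the sphere and
upwards progressing strands, `θ` increases from left to right. -/
def pt (θ φ : ℝ) : S2 :=
  ⟨!₂[Real.sin φ, Real.cos φ * Real.cos θ, Real.cos φ * Real.sin θ], by
    have h1 := Real.sin_sq_add_cos_sq φ
    have h2 := Real.sin_sq_add_cos_sq θ
    rw [mem_sphere_zero_iff_norm, EuclideanSpace.norm_eq, Real.sqrt_eq_one, Fin.sum_univ_three]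
    simp only [Real.norm_eq_abs, sq_abs, Matrix.cons_val_zero, Matrix.cons_val_one,
      Matrix.cons_val]
    linear_combination h1 + Real.cos φ ^ 2 * h2⟩

def northPole : S2 := pt 0 (Real.pi / 2)

def southPole : S2 := pt 0 (-(Real.pi / 2))

/-- A labelled sphere in the coordinates longitude and latitude. -/
def chart (T : S2 → PointLabel C) (θ φ : ℝ) : PointLabel C := T (pt θ φ)

/-- Over the latitudes in `s`, the labelled sphere `T` shows exactly one strand, coloured by `x`, at
the longitudes `g`. -/
def IsSingleStrand (T : S2 → PointLabel C) (s : Set ℝ) (x : C) (g : ℝ → ℝ) : Prop :=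
  ∀ φ ∈ s, ∀ θ, ((∃ n : ℤ, θ = g φ + n * (2 * Real.pi)) → chart T θ φ = .edge x) ∧
    ((∀ n : ℤ, θ ≠ g φ + n * (2 * Real.pi)) → chart T θ φ = .empty)

variable [RightRigidCategory C]

/-- An `α`-twisted string net on the sphere: an embedded progressive graph, coloured by objects and
morphisms of the category, with one outgoing strand coloured by `α` at the minimum and one incoming
strand coloured by `α* = α⁻¹` at the maximum of the height. -/
structure StringNet (α : C) where
  label : S2 → PointLabel C
  south : label southPole = .singular
  north : label northPole = .singular
  local_progressive : ∀ θ φ : ℝ, -(Real.pi / 2) < φ → φ < Real.pi / 2 →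
    ∃ l r a b : ℝ, l < θ ∧ θ < r ∧ -(Real.pi / 2) < a ∧ a < φ ∧ φ < b ∧ b < Real.pi / 2 ∧
      ((∃ xs u, IsStrandFamily (chart label) (fun _ => l) (fun _ => r) (Set.Icc a b) xs u) ∨
        ∃ xs ys f, IsCorolla (chart label) (fun _ => l) (fun _ => r) a b xs ys f)
  near_south : ∃ a g, -(Real.pi / 2) < a ∧ ContinuousOn g (Set.Icc (-(Real.pi / 2)) a) ∧
    IsSingleStrand label (Set.Ioc (-(Real.pi / 2)) a) α g
  near_north : ∃ c g, c < Real.pi / 2 ∧ ContinuousOn g (Set.Icc c (Real.pi / 2)) ∧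
    IsSingleStrand label (Set.Ico c (Real.pi / 2)) (dual α) g

/-- A string net is admissible for an ideal if some edge is coloured by an object of the ideal. -/
def StringNet.Admissible {α : C} (I : C → Prop) (T : StringNet α) : Prop :=
  ∃ p x, T.label p = .edge x ∧ I x

/-- The string nets `T` and `T'` are isotopic: an isotopy of the sphere moves `T` to `T'` through
string nets. -/
def Isotopic {α : C} (T T' : StringNet α) : Prop :=
  ∃ (Φ : unitInterval → S2 → S2) (Ts : unitInterval → StringNet α),
    Continuous (fun q : unitInterval × S2 => Φ q.1 q.2) ∧ (∀ t, Function.Bijective (Φ t)) ∧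
    (∀ p, Φ 0 p = p) ∧ (∀ t p, (Ts t).label (Φ t p) = T.label p) ∧ Ts 1 = T'

/-- The part of the sphere between the walls `L` and `R` and the latitudes `a` and `b`. -/
def boxRegion (L R : ℝ → ℝ) (a b : ℝ) : Set S2 :=
  {p | ∃ θ φ, a ≤ φ ∧ φ ≤ b ∧ L φ ≤ θ ∧ θ ≤ R φ ∧ p = pt θ φ}

/-- The linear combination `c` of string nets is an admissible progressive skein relation: the
string nets in it agree outside some rectangle, where an edge is coloured by an object of the ideal
`I`, have the same source and target in the rectangle, and the linear combination of their values in
the rectangle vanishes. -/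
def IsSkeinRelation {k : Type*} [Field k] [Preadditive C] [CategoryTheory.Linear k C] {α : C}
    (I : C → Prop) (c : {T : StringNet α // T.Admissible I} →₀ k) : Prop :=
  ∃ (L R : ℝ → ℝ) (a b : ℝ) (xs ys : List C)
    (f : {T : StringNet α // T.Admissible I} → (tens xs ⟶ tens ys)),
    IsBox L R a b ∧ -(Real.pi / 2) < a ∧ b < Real.pi / 2 ∧
    (∀ φ ∈ Set.Icc a b, R φ < L φ + 2 * Real.pi) ∧
    (∀ T ∈ c.support, Eval (chart T.1.label) L R a b xs ys (f T)) ∧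
    (∀ T ∈ c.support, ∀ T' ∈ c.support, ∀ p ∉ boxRegion L R a b, T.1.label p = T'.1.label p) ∧
    (∀ T ∈ c.support, ∃ p ∉ boxRegion L R a b, ∃ x, T.1.label p = .edge x ∧ I x) ∧
    c.sum (fun T r => r • f T) = 0

/-- `T` and `T'` differ by sliding a strand over the singularity of index 0. Below `c`, with all
longitudes from left to right, `T` shows the strand `α` that starts at the singularity and, to its
right, the coevaluation of `x`; while in `T'` the coevaluation of `x*` starts to the left of `α`, and
then its right leg `x**` crosses `α` by the twisted pivotal structure. -/
def IsSlideZero {α : C} (P : TwistedPivotalStructure α) (T T' : StringNet α) : Prop :=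
  ∃ (x : C) (a b c : ℝ) (g g' L M L' M' K' : ℝ → ℝ) (u u' w' : Fin 1 → ℝ → ℝ),
    -(Real.pi / 2) < a ∧ a < b ∧ b < c ∧ c < Real.pi / 2 ∧
    (∀ θ φ, c ≤ φ → φ ≤ Real.pi / 2 → chart T.label θ φ = chart T'.label θ φ) ∧
    IsSingleStrand T.label (Set.Ioc (-(Real.pi / 2)) a) α g ∧
    IsSingleStrand T'.label (Set.Ioc (-(Real.pi / 2)) a) α g' ∧
    IsBox L M a c ∧ IsBox M (fun φ => L φ + 2 * Real.pi) a c ∧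
    IsStrandFamily (chart T.label) L M (Set.Icc a c) [α] u ∧
    IsCorolla (chart T.label) M (fun φ => L φ + 2 * Real.pi) a c [] [x, dual x]
      (coev x ≫ (tensPair _ _).hom) ∧
    ContinuousOn L' (Set.Icc a c) ∧
    IsBox L' M' a b ∧ IsBox M' (fun φ => L' φ + 2 * Real.pi) a b ∧
    IsCorolla (chart T'.label) L' M' a b [] [dual x, dual (dual x)]
      (coev (dual x) ≫ (tensPair _ _).hom) ∧
    IsStrandFamily (chart T'.label) M' (fun φ => L' φ + 2 * Real.pi) (Set.Icc a b) [α] u' ∧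
    IsBox L' K' b c ∧ IsBox K' (fun φ => L' φ + 2 * Real.pi) b c ∧
    IsStrandFamily (chart T'.label) L' K' (Set.Icc b c) [dual x] w' ∧
    IsCorolla (chart T'.label) K' (fun φ => L' φ + 2 * Real.pi) b c [dual (dual x), α] [α, x]
      ((tensPair _ _).inv ≫ (P.app x).hom ≫ (tensPair _ _).hom)

/-- `T` and `T'` differ by sliding a strand over the singularity of index 2. Above `a`, with all
longitudes from left to right, `T` shows the strand `α*` that ends at the singularity and, to its
right, the evaluation of `x*`; while in `T'` the strand `x**` first crosses `α*` by the mate of the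
twisted pivotal structure, and then the evaluation of `x` follows to the left of `α*`. -/
def IsSlideTwo {α : C} (P : TwistedPivotalStructure α) (T T' : StringNet α) : Prop :=
  ∃ (x : C) (a b c : ℝ) (g g' L M L' M' K' : ℝ → ℝ) (u u' w' : Fin 1 → ℝ → ℝ),
    -(Real.pi / 2) < a ∧ a < b ∧ b < c ∧ c < Real.pi / 2 ∧
    (∀ θ φ, -(Real.pi / 2) ≤ φ → φ ≤ a → chart T.label θ φ = chart T'.label θ φ) ∧
    IsSingleStrand T.label (Set.Ico c (Real.pi / 2)) (dual α) g ∧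
    IsSingleStrand T'.label (Set.Ico c (Real.pi / 2)) (dual α) g' ∧
    IsBox L M a c ∧ IsBox M (fun φ => L φ + 2 * Real.pi) a c ∧
    IsStrandFamily (chart T.label) L M (Set.Icc a c) [dual α] u ∧
    IsCorolla (chart T.label) M (fun φ => L φ + 2 * Real.pi) a c [dual (dual x), dual x] []
      ((tensPair _ _).inv ≫ ev (dual x)) ∧
    ContinuousOn L' (Set.Icc a c) ∧
    IsBox L' K' a b ∧ IsBox K' (fun φ => L' φ + 2 * Real.pi) a b ∧
    IsStrandFamily (chart T'.label) L' K' (Set.Icc a b) [dual x] w' ∧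
    IsCorolla (chart T'.label) K' (fun φ => L' φ + 2 * Real.pi) a b [dual α, dual (dual x)]
      [x, dual α] ((tensPair _ _).inv ≫ P.mate x ≫ (tensPair _ _).hom) ∧
    IsBox L' M' b c ∧ IsBox M' (fun φ => L' φ + 2 * Real.pi) b c ∧
    IsCorolla (chart T'.label) L' M' b c [dual x, x] [] ((tensPair _ _).inv ≫ ev x) ∧
    IsStrandFamily (chart T'.label) M' (fun φ => L' φ + 2 * Real.pi) (Set.Icc b c) [dual α] u'

/-- The subspace of relations between string nets on the sphere. -/
def relations (k : Type*) [Field k] [Preadditive C] [CategoryTheory.Linear k C] {α : C}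
    (P : TwistedPivotalStructure α) (I : C → Prop) :
    Submodule k ({T : StringNet α // T.Admissible I} →₀ k) :=
  Submodule.span k
    ({c | IsSkeinRelation I c} ∪
     {c | ∃ T T', (Isotopic T.1 T'.1 ∨ IsSlideZero P T.1 T'.1 ∨ IsSlideTwo P T.1 T'.1) ∧
        c = Finsupp.single T 1 - Finsupp.single T' 1})

/-- The `α`-twisted string net module of the sphere with coefficients in an ideal. -/
abbrev SphereSkein (k : Type*) [Field k] [Preadditive C] [CategoryTheory.Linear k C] {α : C}
    (P : TwistedPivotalStructure α) (I : C → Prop) : Type _ :=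
  ({T : StringNet α // T.Admissible I} →₀ k) ⧸ relations k P I

end StringNets

end TwPiv

/-! ### Generalized Taft algebras of type A1×A1 -/

/-- The parameters of a generalized Taft algebra of type A1×A1. -/
structure TaftData where
  N : ℕ
  a₁ : ℕ
  a₂ : ℕ
  b₁ : ℕ
  b₂ : ℕ
  q : ℂ
  primitive : IsPrimitiveRoot q N
  two_le : 2 ≤ N
  dvd : N ∣ a₁ * b₂ + b₁ * a₂
  not_dvd_a : ¬ N ∣ a₁ * a₂
  not_dvd_b : ¬ N ∣ b₁ * b₂

namespace TaftData

variable (D : TaftData)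

/-- The order of `a₁ a₂` in `ℤ/N`. -/
def n : ℕ := addOrderOf ((D.a₁ * D.a₂ : ℕ) : ZMod D.N)

/-- The order of `b₁ b₂` in `ℤ/N`. -/
def m : ℕ := addOrderOf ((D.b₁ * D.b₂ : ℕ) : ZMod D.N)

/-- The relations between the generators `g`, `x`, `y`. -/
structure Rels {A : Type*} [Ring A] [Algebra ℂ A] (g x y : A) : Prop where
  g_pow : g ^ D.N = 1
  x_pow : x ^ D.n = 0
  y_pow : y ^ D.m = 0
  gx : g * x = D.q ^ D.a₂ • (x * g)
  gy : g * y = D.q ^ D.b₂ • (y * g)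
  xy : x * y = D.q ^ (D.a₁ * D.b₂) • (y * x)

end TaftData

/-- The generators of a generalized Taft algebra. -/
inductive TaftGen
  | g
  | x
  | y

namespace TaftGen

open FreeAlgebra in
/-- The defining relations of a generalized Taft algebra in the free algebra. -/
inductive Rel (D : TaftData) : FreeAlgebra ℂ TaftGen → FreeAlgebra ℂ TaftGen → Prop
  | g_pow : Rel D (ι ℂ g ^ D.N) 1
  | x_pow : Rel D (ι ℂ x ^ D.n) 0
  | y_pow : Rel D (ι ℂ y ^ D.m) 0
  | gx : Rel D (ι ℂ g * ι ℂ x) (D.q ^ D.a₂ • (ι ℂ x * ι ℂ g))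
  | gy : Rel D (ι ℂ g * ι ℂ y) (D.q ^ D.b₂ • (ι ℂ y * ι ℂ g))
  | xy : Rel D (ι ℂ x * ι ℂ y) (D.q ^ (D.a₁ * D.b₂) • (ι ℂ y * ι ℂ x))

end TaftGen

/-- The generalized Taft algebra of type A1×A1: the algebra generated by `g`, `x`, `y` with the
relations `g ^ N = 1`, `x ^ n = 0`, `y ^ m = 0`, `g x = q ^ a₂ x g`, `g y = q ^ b₂ y g` and
`x y = q ^ (a₁ b₂) y x`. -/
def GenTaft (D : TaftData) : Type := RingQuot (TaftGen.Rel D)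

namespace GenTaft

variable (D : TaftData)

instance : Ring (GenTaft D) := inferInstanceAs (Ring (RingQuot (TaftGen.Rel D)))

instance : Algebra ℂ (GenTaft D) := inferInstanceAs (Algebra ℂ (RingQuot (TaftGen.Rel D)))

/-- The quotient map from the free algebra. -/
def mk : FreeAlgebra ℂ TaftGen →ₐ[ℂ] GenTaft D := RingQuot.mkAlgHom ℂ (TaftGen.Rel D)

def g : GenTaft D := mk D (FreeAlgebra.ι ℂ .g)

def x : GenTaft D := mk D (FreeAlgebra.ι ℂ .x)

def y : GenTaft D := mk D (FreeAlgebra.ι ℂ .y)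

theorem mk_rel {a b : FreeAlgebra ℂ TaftGen} (h : TaftGen.Rel D a b) : mk D a = mk D b :=
  RingQuot.mkAlgHom_rel ℂ h

theorem rels : D.Rels (g D) (x D) (y D) where
  g_pow := by simpa [g] using mk_rel D .g_pow
  x_pow := by simpa [x] using mk_rel D .x_pow
  y_pow := by simpa [y] using mk_rel D .y_pow
  gx := by simpa [g, x] using mk_rel D .gx
  gy := by simpa [g, y] using mk_rel D .gy
  xy := by simpa [x, y] using mk_rel D .xy

variable {D}

/-- The algebra homomorphism out of a generalized Taft algebra given by three elements that satisfy
the relations. -/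
def lift {A : Type*} [Ring A] [Algebra ℂ A] {g' x' y' : A} (h : D.Rels g' x' y') :
    GenTaft D →ₐ[ℂ] A :=
  RingQuot.liftAlgHom ℂ ⟨FreeAlgebra.lift ℂ fun | .g => g' | .x => x' | .y => y', by
    intro a b hab
    cases hab
    · simpa using h.g_pow
    · simpa using h.x_pow
    · simpa using h.y_pow
    · simpa using h.gx
    · simpa using h.gy
    · simpa using h.xy⟩

section Lift

variable {A : Type*} [Ring A] [Algebra ℂ A] {g' x' y' : A} (h : D.Rels g' x' y')

theorem lift_mk (a : FreeAlgebra ℂ TaftGen) :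
    lift h (mk D a) = FreeAlgebra.lift ℂ (fun | .g => g' | .x => x' | .y => y') a :=
  RingQuot.liftAlgHom_mkAlgHom_apply ..

@[simp] theorem lift_g : lift h (g D) = g' := by simp [g, lift_mk]

@[simp] theorem lift_x : lift h (x D) = x' := by simp [x, lift_mk]

@[simp] theorem lift_y : lift h (y D) = y' := by simp [y, lift_mk]

theorem algHom_ext {φ ψ : GenTaft D →ₐ[ℂ] A} (hg : φ (g D) = ψ (g D)) (hx : φ (x D) = ψ (x D))
    (hy : φ (y D) = ψ (y D)) : φ = ψ := by
  refine RingQuot.ringQuot_ext' (S := ℂ) (s := TaftGen.Rel D) (f := φ) (g := ψ) (FreeAlgebra.hom_ext (funext fun i => ?_))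
  cases i
  exacts [hg, hx, hy]

end Lift

theorem induction {p : GenTaft D → Prop} (hc : ∀ c : ℂ, p (algebraMap ℂ _ c)) (hg : p (g D))
    (hx : p (x D)) (hy : p (y D)) (hmul : ∀ a b, p a → p b → p (a * b))
    (hadd : ∀ a b, p a → p b → p (a + b)) (a : GenTaft D) : p a := by
  obtain ⟨a, rfl⟩ := RingQuot.mkAlgHom_surjective ℂ (TaftGen.Rel D) a
  change p (mk D a)
  induction a with
  | grade0 c => rw [AlgHom.commutes]; exact hc c
  | grade1 i => cases i; exacts [hg, hx, hy]
  | mul a b ha hb => rw [map_mul]; exact hmul _ _ ha hb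
  | add a b ha hb => rw [map_add]; exact hadd _ _ ha hb

/-! The relations hold for the values of the comultiplication and the antipode. -/

section Powers

variable {A : Type*} [Ring A] [Algebra ℂ A]

theorem pow_comm {a b : A} {w : ℂ} (h : a * b = w • (b * a)) (k : ℕ) :
    a ^ k * b = w ^ k • (b * a ^ k) := by
  induction k with
  | zero => simp
  | succ k ih =>
    rw [pow_succ, mul_assoc, h, mul_smul_comm, ← mul_assoc, ih, smul_mul_assoc, smul_smul,
      mul_assoc, ← pow_succ']

theorem comm_pow {a b : A} {w : ℂ} (h : a * b = w • (b * a)) (k : ℕ) :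
    a * b ^ k = w ^ k • (b ^ k * a) := by
  induction k with
  | zero => simp
  | succ k ih =>
    rw [pow_succ, ← mul_assoc, ih, smul_mul_assoc, mul_assoc, h, mul_smul_comm, smul_smul,
      mul_assoc, ← pow_succ]

theorem exists_mul_pow {a b : A} {w : ℂ} (h : a * b = w • (b * a)) (k : ℕ) :
    ∃ c : ℂ, (b * a) ^ k = c • (b ^ k * a ^ k) := by
  induction k with
  | zero => exact ⟨1, by simp⟩
  | succ k ih =>
    obtain ⟨c, hc⟩ := ih
    refine ⟨c * w ^ k, ?_⟩
    rw [pow_succ, hc, smul_mul_assoc, mul_assoc, ← mul_assoc (a ^ k), pow_comm h k, smul_mul_assoc,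
      mul_smul_comm, smul_smul, pow_succ, pow_succ, mul_assoc, mul_assoc]

/-- The coefficient of `a ^ i b ^ j` in `(a + b) ^ (i + j)` if `b a = w a b`. -/
def qBinom (w : ℂ) : ℕ → ℕ → ℂ
  | 0, _ => 1
  | _ + 1, 0 => 1
  | i + 1, j + 1 => qBinom w i (j + 1) + w ^ (i + 1) * qBinom w (i + 1) j

theorem qBinom_mul (w : ℂ) (i j : ℕ) :
    qBinom w i j * (∏ s ∈ Finset.range i, ∑ r ∈ Finset.range (s + 1), w ^ r) *
      (∏ s ∈ Finset.range j, ∑ r ∈ Finset.range (s + 1), w ^ r) =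
      ∏ s ∈ Finset.range (i + j), ∑ r ∈ Finset.range (s + 1), w ^ r := by
  induction i generalizing j with
  | zero => simp [qBinom]
  | succ i ih =>
    induction j with
    | zero => simp [qBinom]
    | succ j ihj =>
      have h1 := ih (j + 1)
      have h2 : ∑ r ∈ Finset.range (i + 1 + (j + 1)), w ^ r =
          ∑ r ∈ Finset.range (i + 1), w ^ r +
            w ^ (i + 1) * ∑ r ∈ Finset.range (j + 1), w ^ r := by
        rw [Finset.sum_range_add, Finset.mul_sum]
        simp only [pow_add]
      have h3 : ∏ s ∈ Finset.range (i + 1 + (j + 1)), ∑ r ∈ Finset.range (s + 1), w ^ r =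
          (∏ s ∈ Finset.range (i + 1 + j), ∑ r ∈ Finset.range (s + 1), w ^ r) *
            ∑ r ∈ Finset.range (i + 1 + (j + 1)), w ^ r :=
        Finset.prod_range_succ _ _
      have h4 : qBinom w (i + 1) (j + 1) =
          qBinom w i (j + 1) + w ^ (i + 1) * qBinom w (i + 1) j := by
        rw [qBinom]
      rw [show i + (j + 1) = i + 1 + j by ring] at h1
      have h5 := Finset.prod_range_succ (fun s => ∑ r ∈ Finset.range (s + 1), w ^ r) i
      have h6 := Finset.prod_range_succ (fun s => ∑ r ∈ Finset.range (s + 1), w ^ r) j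
      rw [h3, h2, h4]
      rw [h5] at ihj ⊢
      rw [h6] at h1 ⊢
      linear_combination (∑ r ∈ Finset.range (i + 1), w ^ r) * h1 +
        (w ^ (i + 1) * ∑ r ∈ Finset.range (j + 1), w ^ r) * ihj

theorem add_pow_eq {a b : A} {w : ℂ} (h : b * a = w • (a * b)) (k : ℕ) :
    (a + b) ^ k = ∑ ij ∈ Finset.HasAntidiagonal.antidiagonal k, qBinom w ij.1 ij.2 • (a ^ ij.1 * b ^ ij.2) := by
  induction k with
  | zero => simp [qBinom]
  | succ k ih =>
    have hb : ∀ i j, b * (a ^ i * b ^ j) = w ^ i • (a ^ i * b ^ (j + 1)) := fun i j => by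
      rw [← mul_assoc, comm_pow h, smul_mul_assoc, mul_assoc, ← pow_succ']
    rw [pow_succ', ih, add_mul, Finset.mul_sum, Finset.mul_sum]
    simp only [mul_smul_comm, hb, ← mul_assoc a, ← pow_succ', smul_smul]
    cases k with
    | zero => simp [qBinom, Finset.Nat.antidiagonal_succ, add_comm]
    | succ k =>
      rw [Finset.Nat.sum_antidiagonal_succ' (n := k)
          (f := fun ij => qBinom w ij.1 ij.2 • (a ^ (ij.1 + 1) * b ^ ij.2)),
        Finset.Nat.sum_antidiagonal_succ (n := k)
          (f := fun ij => (qBinom w ij.1 ij.2 * w ^ ij.1) • (a ^ ij.1 * b ^ (ij.2 + 1))),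
        Finset.Nat.sum_antidiagonal_succ (n := k + 1),
        Finset.Nat.sum_antidiagonal_succ' (n := k)]
      have h2 : ∀ j, qBinom w 0 j = 1 := fun j => by rw [qBinom]
      have h3 : ∀ i, qBinom w i 0 = 1 := fun i => by cases i <;> rw [qBinom]
      simp only [h2, h3, qBinom, add_smul, Finset.sum_add_distrib, pow_zero, mul_one, one_smul,
        mul_comm (w ^ _)]
      abel

theorem add_pow_eq_zero {a b : A} {w : ℂ} {k : ℕ} (hw : IsPrimitiveRoot w k) (hk : 1 < k)
    (h : b * a = w • (a * b)) (ha : a ^ k = 0) (hb : b ^ k = 0) : (a + b) ^ k = 0 := by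
  have hne : ∀ i < k, ∏ s ∈ Finset.range i, ∑ r ∈ Finset.range (s + 1), w ^ r ≠ 0 := by
    intro i hi
    refine Finset.prod_ne_zero_iff.2 fun s hs h0 => ?_
    have := geom_sum_mul w (s + 1)
    rw [h0, zero_mul] at this
    exact hw.pow_ne_one_of_pos_of_lt s.succ_ne_zero
      (lt_of_le_of_lt (Finset.mem_range.1 hs) hi) (sub_eq_zero.1 this.symm)
  rw [add_pow_eq h]
  refine Finset.sum_eq_zero fun ij hij => ?_
  obtain ⟨i, j⟩ := ij
  have hij : i + j = k := Finset.HasAntidiagonal.mem_antidiagonal.1 hij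
  rcases Nat.eq_zero_or_pos i with rfl | hi
  · rw [show j = k by omega, hb, mul_zero, smul_zero]
  rcases Nat.eq_zero_or_pos j with rfl | hj
  · rw [show i = k by omega, ha, zero_mul, smul_zero]
  have h0 : ∏ s ∈ Finset.range k, ∑ r ∈ Finset.range (s + 1), w ^ r = 0 :=
    Finset.prod_eq_zero (i := k - 1) (Finset.mem_range.2 (by omega))
      (by rw [show k - 1 + 1 = k by omega]; exact hw.geom_sum_eq_zero hk)
  have h1 := qBinom_mul w i j
  rw [hij, h0] at h1
  have h2 : qBinom w i j = 0 := by
    simpa [hne i (by omega), hne j (by omega)] using h1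
  rw [h2, zero_smul]

end Powers

end GenTaft

namespace TaftData

variable (D : TaftData)

theorem one_lt_and_primitive {k : ℕ} (hk : ¬ D.N ∣ k) :
    1 < addOrderOf ((k : ℕ) : ZMod D.N) ∧
      IsPrimitiveRoot (D.q ^ k) (addOrderOf ((k : ℕ) : ZMod D.N)) := by
  have hN : D.N ≠ 0 := by have := D.two_le; omega
  have : NeZero D.N := ⟨hN⟩
  constructor
  · have h0 : 0 < addOrderOf ((k : ℕ) : ZMod D.N) := addOrderOf_pos _
    have h1 : addOrderOf ((k : ℕ) : ZMod D.N) ≠ 1 := fun h =>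
      hk ((ZMod.natCast_eq_zero_iff _ _).1 (AddMonoid.addOrderOf_eq_one_iff.1 h))
    omega
  · have hk0 : k ≠ 0 := fun h => hk (h ▸ dvd_zero _)
    rw [ZMod.addOrderOf_coe _ hN, D.primitive.eq_orderOf, ← orderOf_pow' _ hk0]
    exact IsPrimitiveRoot.orderOf _

end TaftData

namespace GenTaft

variable (D : TaftData)

open TensorProduct

theorem rels_counit : D.Rels (1 : ℂ) 0 0 where
  g_pow := one_pow _
  x_pow := zero_pow (by have := (D.one_lt_and_primitive D.not_dvd_a).1; unfold TaftData.n; omega)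
  y_pow := zero_pow (by have := (D.one_lt_and_primitive D.not_dvd_b).1; unfold TaftData.m; omega)
  gx := by simp
  gy := by simp
  xy := by simp

theorem q_pow (k l : ℕ) (h : D.N ∣ k + l) : D.q ^ k * D.q ^ l = 1 := by
  rw [← pow_add]
  exact (D.primitive.pow_eq_one_iff_dvd _).2 h

theorem rels_comul : D.Rels (g D ⊗ₜ[ℂ] g D) (1 ⊗ₜ[ℂ] x D + x D ⊗ₜ[ℂ] (g D ^ D.a₁))
    (1 ⊗ₜ[ℂ] y D + y D ⊗ₜ[ℂ] (g D ^ D.b₁)) where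
  g_pow := by
    rw [Algebra.TensorProduct.tmul_pow, (rels D).g_pow]; rfl
  x_pow := by
    obtain ⟨h1, h2⟩ := D.one_lt_and_primitive D.not_dvd_a
    refine add_pow_eq_zero h2 h1 ?_ ?_ ?_
    · rw [Algebra.TensorProduct.tmul_mul_tmul, Algebra.TensorProduct.tmul_mul_tmul,
        pow_comm (rels D).gx, ← pow_mul, mul_comm D.a₂, one_mul, mul_one, tmul_smul]
    · rw [Algebra.TensorProduct.tmul_pow]
      exact (congrArg _ (rels D).x_pow).trans (tmul_zero _ _)
    · rw [Algebra.TensorProduct.tmul_pow]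
      exact (congrArg (fun z => z ⊗ₜ[ℂ] _) (rels D).x_pow).trans (zero_tmul _ _)
  y_pow := by
    obtain ⟨h1, h2⟩ := D.one_lt_and_primitive D.not_dvd_b
    refine add_pow_eq_zero h2 h1 ?_ ?_ ?_
    · rw [Algebra.TensorProduct.tmul_mul_tmul, Algebra.TensorProduct.tmul_mul_tmul,
        pow_comm (rels D).gy, ← pow_mul, mul_comm D.b₂, one_mul, mul_one, tmul_smul]
    · rw [Algebra.TensorProduct.tmul_pow]
      exact (congrArg _ (rels D).y_pow).trans (tmul_zero _ _)
    · rw [Algebra.TensorProduct.tmul_pow]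
      exact (congrArg (fun z => z ⊗ₜ[ℂ] _) (rels D).y_pow).trans (zero_tmul _ _)
  gx := by
    simp only [mul_add, add_mul, Algebra.TensorProduct.tmul_mul_tmul, (rels D).gx, smul_add,
      one_mul, mul_one, tmul_smul, ← smul_tmul', pow_mul_comm']
  gy := by
    simp only [mul_add, add_mul, Algebra.TensorProduct.tmul_mul_tmul, (rels D).gy, smul_add,
      one_mul, mul_one, tmul_smul, ← smul_tmul', pow_mul_comm']
  xy := by
    have h1 := pow_comm (rels D).gx D.b₁
    have h2 := pow_comm (rels D).gy D.a₁
    simp only [mul_add, add_mul, Algebra.TensorProduct.tmul_mul_tmul, (rels D).xy, smul_add,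
      one_mul, mul_one, tmul_smul, ← smul_tmul', h1, h2, smul_smul, ← pow_mul, ← pow_add,
      mul_comm D.b₂, mul_comm D.a₂, add_comm D.a₁ D.b₁]
    rw [(D.primitive.pow_eq_one_iff_dvd _).2 D.dvd, one_smul]
    abel

/-- The comultiplication: `Δ g = g ⊗ g`, `Δ x = 1 ⊗ x + x ⊗ g ^ a₁`, `Δ y = 1 ⊗ y + y ⊗ g ^ b₁`. -/
def comul : GenTaft D →ₐ[ℂ] GenTaft D ⊗[ℂ] GenTaft D := lift (rels_comul D)

/-- The counit: `ε g = 1`, `ε x = ε y = 0`. -/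
def counit : GenTaft D →ₐ[ℂ] ℂ := lift (rels_counit D)

/-- The inverse of `g`. -/
def ginv : GenTaft D := g D ^ (D.N - 1)

theorem g_mul_ginv : g D * ginv D = 1 := by
  rw [ginv, ← pow_succ', Nat.sub_add_cancel (by have := D.two_le; omega), (rels D).g_pow]

theorem ginv_mul_g : ginv D * g D = 1 := by
  rw [ginv, ← pow_succ, Nat.sub_add_cancel (by have := D.two_le; omega), (rels D).g_pow]

theorem g_pow_mul_ginv_pow (k : ℕ) : g D ^ k * ginv D ^ k = 1 := by
  rw [← (show Commute (g D) (ginv D) from (g_mul_ginv D).trans (ginv_mul_g D).symm).mul_pow,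
    g_mul_ginv, one_pow]

theorem ginv_pow_mul_g_pow (k : ℕ) : ginv D ^ k * g D ^ k = 1 := by
  rw [← (show Commute (ginv D) (g D) from (ginv_mul_g D).trans (g_mul_ginv D).symm).mul_pow,
    ginv_mul_g, one_pow]

variable {D} in
theorem ginv_comm {a : GenTaft D} {w : ℂ} (hw : w ≠ 0) (h : g D * a = w • (a * g D)) :
    ginv D * a = w⁻¹ • (a * ginv D) := by
  have h1 : ginv D * (g D * a) * ginv D = ginv D * (w • (a * g D)) * ginv D := by rw [h]
  rw [← mul_assoc, ginv_mul_g, one_mul, mul_smul_comm, smul_mul_assoc, mul_assoc, mul_assoc a,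
    g_mul_ginv, mul_one] at h1
  rw [h1, smul_smul, inv_mul_cancel₀ hw, one_smul]

open MulOpposite in
/-- The antipode is given by elements of the opposite algebra that satisfy the relations. -/
theorem rels_antipode : D.Rels (op (ginv D)) (op (-(x D * ginv D ^ D.a₁)))
    (op (-(y D * ginv D ^ D.b₁))) := by
  have hq : D.q ≠ 0 := D.primitive.ne_zero (by have := D.two_le; omega)
  have hx := ginv_comm (pow_ne_zero D.a₂ hq) (rels D).gx
  have hy := ginv_comm (pow_ne_zero D.b₂ hq) (rels D).gy
  have hqn : ∀ k, D.q ^ k ≠ 0 := fun k => pow_ne_zero k hq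
  constructor
  · rw [← op_pow, ← op_one, ginv, ← pow_mul, mul_comm, pow_mul, (rels D).g_pow, one_pow]
  · obtain ⟨c, hc⟩ := exists_mul_pow (pow_comm hx D.a₁) D.n
    rw [← op_pow, neg_pow, hc, (rels D).x_pow, zero_mul, smul_zero, mul_zero, op_zero]
  · obtain ⟨c, hc⟩ := exists_mul_pow (pow_comm hy D.b₁) D.m
    rw [← op_pow, neg_pow, hc, (rels D).y_pow, zero_mul, smul_zero, mul_zero, op_zero]
  · rw [← op_mul, ← op_mul, ← op_smul, mul_neg, neg_mul, ← mul_assoc (ginv D), hx, smul_mul_assoc,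
      smul_neg, smul_smul, mul_inv_cancel₀ (hqn _), one_smul, mul_assoc, mul_assoc, ← pow_succ,
      ← pow_succ']
  · rw [← op_mul, ← op_mul, ← op_smul, mul_neg, neg_mul, ← mul_assoc (ginv D), hy, smul_mul_assoc,
      smul_neg, smul_smul, mul_inv_cancel₀ (hqn _), one_smul, mul_assoc, mul_assoc, ← pow_succ,
      ← pow_succ']
  · have h1 := pow_comm hx D.b₁
    have h2 := pow_comm hy D.a₁
    have h3 : x D * y D = D.q ^ (D.a₁ * D.b₂) • (y D * x D) := (rels D).xy
    have h4 := (D.primitive.pow_eq_one_iff_dvd _).2 D.dvd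
    rw [← op_mul, ← op_mul, ← op_smul, neg_mul_neg, neg_mul_neg]
    congr 1
    calc y D * ginv D ^ D.b₁ * (x D * ginv D ^ D.a₁)
        = y D * (ginv D ^ D.b₁ * x D) * ginv D ^ D.a₁ := by simp only [mul_assoc]
      _ = (D.q ^ D.a₂)⁻¹ ^ D.b₁ • (y D * x D * (ginv D ^ D.b₁ * ginv D ^ D.a₁)) := by
          rw [h1, mul_smul_comm, smul_mul_assoc]; simp only [mul_assoc]
      _ = D.q ^ (D.a₁ * D.b₂) • (D.q ^ D.b₂)⁻¹ ^ D.a₁ • D.q ^ (D.a₁ * D.b₂) •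
            (y D * x D * (ginv D ^ D.b₁ * ginv D ^ D.a₁)) := by
          rw [smul_smul, smul_smul]
          congr 1
          rw [inv_pow, inv_pow, ← pow_mul, ← pow_mul, mul_comm D.b₂, mul_comm D.a₂]
          rw [pow_add] at h4
          have := hqn (D.b₁ * D.a₂)
          have := hqn (D.a₁ * D.b₂)
          field_simp
          linear_combination -h4
      _ = D.q ^ (D.a₁ * D.b₂) • (D.q ^ D.b₂)⁻¹ ^ D.a₁ •
            (x D * y D * (ginv D ^ D.a₁ * ginv D ^ D.b₁)) := by
          rw [h3, smul_mul_assoc, ← pow_add, ← pow_add, add_comm]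
      _ = D.q ^ (D.a₁ * D.b₂) • (x D * ginv D ^ D.a₁ * (y D * ginv D ^ D.b₁)) := by
          rw [mul_assoc (x D) (ginv D ^ D.a₁), ← mul_assoc (ginv D ^ D.a₁), h2, smul_mul_assoc,
            mul_smul_comm]
          simp only [mul_assoc]

/-- The antipode: `S g = g⁻¹`, `S x = -x g ^ (-a₁)`, `S y = -y g ^ (-b₁)`. -/
def antipode : GenTaft D →ₗ[ℂ] GenTaft D :=
  (MulOpposite.opLinearEquiv ℂ).symm.toLinearMap ∘ₗ (lift (rels_antipode D)).toLinearMap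

theorem antipode_mul (a b : GenTaft D) :
    antipode D (a * b) = antipode D b * antipode D a := by
  simp [antipode]

theorem antipode_algebraMap (c : ℂ) : antipode D (algebraMap ℂ _ c) = algebraMap ℂ _ c := by
  simp [antipode]

theorem antipode_g : antipode D (g D) = ginv D := by simp [antipode]

theorem antipode_x : antipode D (x D) = -(x D * ginv D ^ D.a₁) := by simp [antipode]

theorem antipode_y : antipode D (y D) = -(y D * ginv D ^ D.b₁) := by simp [antipode]

theorem antipode_g_pow (k : ℕ) : antipode D (g D ^ k) = ginv D ^ k := by
  induction k with
  | zero => simpa using antipode_algebraMap D 1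
  | succ k ih => rw [pow_succ, antipode_mul, ih, antipode_g, ← pow_succ']

instance : Bialgebra ℂ (GenTaft D) :=
  Bialgebra.ofAlgHom (comul D) (counit D)
    (algHom_ext (by simp [comul])
      (by simp [comul, tmul_add, add_tmul, Algebra.TensorProduct.one_def, add_assoc])
      (by simp [comul, tmul_add, add_tmul, Algebra.TensorProduct.one_def, add_assoc]))
    (algHom_ext (by simp [comul, counit])
      (by simp [comul, counit])
      (by simp [comul, counit]))
    (algHom_ext (by simp [comul, counit])
      (by simp [comul, counit])
      (by simp [comul, counit]))

instance : HopfAlgebra ℂ (GenTaft D) where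
  antipode := antipode D
  mul_antipode_rTensor_comul := by
    have key : ∀ (X Y : GenTaft D ⊗[ℂ] GenTaft D) (c : ℂ),
        LinearMap.mul' ℂ _ ((antipode D).rTensor _ X) = algebraMap ℂ _ c →
        LinearMap.mul' ℂ _ ((antipode D).rTensor _ (X * Y)) =
          c • LinearMap.mul' ℂ _ ((antipode D).rTensor _ Y) := by
      intro X Y c hX
      induction Y with
      | zero => simp
      | add Y Z hY hZ => simp only [mul_add, map_add, hY, hZ, smul_add]
      | tmul s t =>
        have h1 : ∀ X : GenTaft D ⊗[ℂ] GenTaft D,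
            LinearMap.mul' ℂ _ ((antipode D).rTensor _ (X * s ⊗ₜ t)) =
              antipode D s * LinearMap.mul' ℂ _ ((antipode D).rTensor _ X) * t := by
          intro X
          induction X with
          | zero => simp
          | add X Z hX hZ => simp only [mul_add, add_mul, map_add, hX, hZ]
          | tmul a b => simp [antipode_mul, mul_assoc]
        rw [h1, hX, ← Algebra.commutes, mul_assoc, ← Algebra.smul_def]
        simp
    refine LinearMap.ext fun h => ?_
    change LinearMap.mul' ℂ _ ((antipode D).rTensor _ (comul D h)) =
      algebraMap ℂ _ (counit D h)
    induction h using induction with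
    | hc c => simp [Algebra.TensorProduct.algebraMap_apply, antipode_algebraMap]
    | hg => simp [comul, counit, antipode_g, ginv_mul_g]
    | hx =>
      have := antipode_algebraMap D 1
      rw [map_one] at this
      simp [comul, counit, antipode_x, this, mul_assoc, ginv_pow_mul_g_pow]
    | hy =>
      have := antipode_algebraMap D 1
      rw [map_one] at this
      simp [comul, counit, antipode_y, this, mul_assoc, ginv_pow_mul_g_pow]
    | hmul a b ha hb =>
      rw [map_mul, key _ _ _ ha, hb, map_mul, map_mul, ← Algebra.smul_def]
    | hadd a b ha hb => simp only [map_add, ha, hb]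
  mul_antipode_lTensor_comul := by
    have key : ∀ (X Y : GenTaft D ⊗[ℂ] GenTaft D) (c : ℂ),
        LinearMap.mul' ℂ _ ((antipode D).lTensor _ Y) = algebraMap ℂ _ c →
        LinearMap.mul' ℂ _ ((antipode D).lTensor _ (X * Y)) =
          c • LinearMap.mul' ℂ _ ((antipode D).lTensor _ X) := by
      intro X Y c hY
      induction X with
      | zero => simp
      | add X Z hX hZ => simp only [add_mul, map_add, hX, hZ, smul_add]
      | tmul s t =>
        have h1 : ∀ Y : GenTaft D ⊗[ℂ] GenTaft D,
            LinearMap.mul' ℂ _ ((antipode D).lTensor _ (s ⊗ₜ t * Y)) =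
              s * LinearMap.mul' ℂ _ ((antipode D).lTensor _ Y) * antipode D t := by
          intro Y
          induction Y with
          | zero => simp
          | add Y Z hY hZ => simp only [mul_add, add_mul, map_add, hY, hZ]
          | tmul a b => simp [antipode_mul, mul_assoc]
        rw [h1, hY, ← Algebra.commutes, mul_assoc, ← Algebra.smul_def]
        simp
    refine LinearMap.ext fun h => ?_
    change LinearMap.mul' ℂ _ ((antipode D).lTensor _ (comul D h)) =
      algebraMap ℂ _ (counit D h)
    induction h using induction with
    | hc c =>
      have := antipode_algebraMap D 1
      rw [map_one] at this
      simp [Algebra.TensorProduct.algebraMap_apply, this]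
    | hg => simp [comul, counit, antipode_g, g_mul_ginv]
    | hx => simp [comul, counit, antipode_x, antipode_g_pow]
    | hy => simp [comul, counit, antipode_y, antipode_g_pow]
    | hmul a b ha hb =>
      rw [map_mul, key _ _ _ hb, ha, map_mul, mul_comm, map_mul, ← Algebra.smul_def]
    | hadd a b ha hb => simp only [map_add, ha, hb]

/-- The one-dimensional module `T_k`, on which `g` acts by `q ^ k` and `x` and `y` act by `0`. -/
def T (k : ℕ) : FDMod ℂ (GenTaft D) :=
  ⟨ℂ, (Algebra.lmul ℂ ℂ).comp (lift (g' := D.q ^ k) (x' := 0) (y' := 0)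
    { (rels_counit D) with
      g_pow := by rw [← pow_mul, mul_comm, pow_mul, D.primitive.pow_eq_one, one_pow]
      gx := by simp
      gy := by simp })⟩

/-- The twisted pivotal structure for `T_c` is the map `v** ⊗ 1 ↦ 1 ⊗ g ^ d v`. -/
def IsGivenBy {c : ℕ} (P : TwPiv.TwistedPivotalStructure (T D c)) (d : ℕ) : Prop :=
  ∀ (V : FDMod ℂ (GenTaft D)) (v : V.carrier),
    (P.app V).hom.toLin (Module.Dual.eval ℂ V.carrier v ⊗ₜ[ℂ] (1 : ℂ)) =
      (1 : ℂ) ⊗ₜ[ℂ] V.ρ (g D ^ d) v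

end GenTaft

/-- The parameters `N = 3` and `(1, 1; 2, 1)`. -/
def taftThree (q : ℂ) (hq : IsPrimitiveRoot q 3) : TaftData where
  N := 3
  a₁ := 1
  a₂ := 1
  b₁ := 2
  b₂ := 1
  q := q
  primitive := hq
  two_le := by norm_num
  dvd := by norm_num
  not_dvd_a := by norm_num
  not_dvd_b := by norm_num

/-- The parameters `N = 9` and `(1, 3; 5, 3)`. -/
def taftNine (q : ℂ) (hq : IsPrimitiveRoot q 9) : TaftData where
  N := 9
  a₁ := 1
  a₂ := 3
  b₁ := 5
  b₂ := 3
  q := q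
  primitive := hq
  two_le := by norm_num
  dvd := by norm_num
  not_dvd_a := by norm_num
  not_dvd_b := by norm_num

end

noncomputable section

universe u v

namespace TwPiv

open Set Filter Topology
open Real
open Module (Dual evalEquiv End)
open LinearMap renaming congr_fun → lcongr, ext → lext
open Finset (sum_congr)
open List (append_nil append_assoc length_append mem_append_right)
open TensorProduct renaming map → tmap, comm → tcomm, mk → tmk
open TensorProduct (rid lid smul_tmul tmul_smul tmul_add smul_tmul_smul map_tmul)

theorem toLin_congr {k : Type u} [Field k] {H : Type v} [Ring H] [Algebra k H] {V W : FDMod k H}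
    {f g : V ⟶ W} (h : f = g) (v : V.carrier) : f.toLin v = g.toLin v := by rw [h]

theorem comm_apply {k : Type u} [Field k] {H : Type v} [Ring H] [Algebra k H] {V W : FDMod k H}
    (f : V ⟶ W) (h : H) (v : V.carrier) : f.toLin (V.ρ h v) = W.ρ h (f.toLin v) :=
  LinearMap.congr_fun (f.comm h) v

variable {C : Type u} [Category.{v} C] [MonoidalCategory C]
variable {k : Type u} [Field k] {H : Type v} [Ring H] [HopfAlgebra k H]

local notation "𝓜" => FDMod k H
local notation "Plan" C:max => ℝ → ℝ → PointLabel C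
local notation:max "Labels" C:max => List (PointLabel C)
local notation:max "recast" h:max => eqToHom (congrArg tens h)

variable {D : Plan C} {W : Labels C}

/-- The horizontal composite of two morphisms between tensor products of lists. -/
def hprod {xs ys xs' ys' : List C} (f : tens xs ⟶ tens ys) (g : tens xs' ⟶ tens ys') :
    tens (xs ++ xs') ⟶ tens (ys ++ ys') :=
  (tensAppend xs xs').hom ≫ (f ⊗ₘ g) ≫ (tensAppend ys ys').inv

theorem hprod_id (xs ys : List C) : hprod (𝟙 (tens xs)) (𝟙 (tens ys)) = 𝟙 _ := by
  simp [hprod]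

theorem hprod_comp {xs ys zs xs' ys' zs' : List C} (f : tens xs ⟶ tens ys) (f' : tens ys ⟶ tens zs)
    (g : tens xs' ⟶ tens ys') (g' : tens ys' ⟶ tens zs') :
    hprod (f ≫ f') (g ≫ g') = hprod f g ≫ hprod f' g' := by
  rw [hprod, hprod, hprod, ← tensorHom_comp_tensorHom]
  simp only [Category.assoc, Iso.inv_hom_id_assoc]

theorem eqToHom_whisker (x : C) {X Y : List C} (h : X = Y) :
    x ◁ recast h = recast (congrArg (x :: ·) h) := by
  subst h; exact whiskerLeft_id _ _

theorem cons_assoc_aux {x A B D AB BD L R : C} {p : L ⟶ AB ⊗ D} {q : AB ⟶ A ⊗ B} {e : L ⟶ R}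
    {r : R ⟶ A ⊗ BD} {s : BD ⟶ B ⊗ D} (h : p ≫ q ▷ D ≫ (α_ A B D).hom = e ≫ r ≫ A ◁ s) :
    (x ◁ p ≫ (α_ x AB D).inv) ≫ (x ◁ q ≫ (α_ x A B).inv) ▷ D ≫ (α_ (x ⊗ A) B D).hom =
      x ◁ e ≫ (x ◁ r ≫ (α_ x A BD).inv) ≫ (x ⊗ A) ◁ s := by
  have h' := congrArg (fun f => x ◁ f ≫ (α_ x A (B ⊗ D)).inv) h
  simpa using h'

theorem cons_nil_aux {x A B : C} {p : B ⟶ A ⊗ 𝟙_ C} {e : B ⟶ A} (h : p = e ≫ (ρ_ A).inv) :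
    x ◁ p ≫ (α_ x A (𝟙_ C)).inv = x ◁ e ≫ (ρ_ (x ⊗ A)).inv := by
  subst h; simp

theorem nil_assoc_aux {L A B : C} (a : L ⟶ A ⊗ B) :
    a ≫ (λ_ A).inv ▷ B ≫ (α_ _ _ _).hom = 𝟙 L ≫ (λ_ L).inv ≫ 𝟙_ C ◁ a := by simp

theorem tensAppend_assoc (xs ys zs : List C) :
    (tensAppend (xs ++ ys) zs).hom ≫ (tensAppend xs ys).hom ▷ tens zs ≫ (α_ _ _ _).hom =
      recast (append_assoc xs ys zs) ≫ (tensAppend xs (ys ++ zs)).hom ≫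
        tens xs ◁ (tensAppend ys zs).hom := by
  induction xs with
  | nil =>
    exact nil_assoc_aux _
  | cons x xs ih =>
    refine (cons_assoc_aux (x := x) ih).trans ?_
    rw [eqToHom_whisker x (append_assoc xs ys zs)]
    rfl

theorem tensAppend_nil (xs : List C) :
    (tensAppend xs []).hom = recast (append_nil xs) ≫ (ρ_ (tens xs)).inv := by
  induction xs with
  | nil => exact unitors_inv_equal.trans (Category.id_comp _).symm
  | cons x xs ih =>
    refine (cons_nil_aux (x := x) ih).trans ?_
    rw [eqToHom_whisker x (append_nil xs)]
    rfl

theorem hprod_eqToHom {X X' Y Y' : List C} (h : X = X') (h' : Y = Y') :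
    hprod (recast h) (recast h') =
      recast (congrArg₂ (· ++ ·) h h') := by
  subst h h'; simp [hprod_id]

theorem hprod_assoc_aux {A B D A' B' D' AB BD AB' BD' L R L' R' : C} {p : L ≅ AB ⊗ D}
    {q : AB ≅ A ⊗ B} {e : L ⟶ R} {r : R ≅ A ⊗ BD} {s : BD ≅ B ⊗ D}
    {p' : L' ≅ AB' ⊗ D'} {q' : AB' ≅ A' ⊗ B'} {e' : L' ⟶ R'} {r' : R' ≅ A' ⊗ BD'}
    {s' : BD' ≅ B' ⊗ D'} {f : A ⟶ A'} {g : B ⟶ B'} {h : D ⟶ D'}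
    (h1 : p.hom ≫ q.hom ▷ D ≫ (α_ A B D).hom = e ≫ r.hom ≫ A ◁ s.hom)
    (h2 : p'.hom ≫ q'.hom ▷ D' ≫ (α_ A' B' D').hom = e' ≫ r'.hom ≫ A' ◁ s'.hom)
    (e'' : R' ⟶ L') (he : e' ≫ e'' = 𝟙 _) :
    p.hom ≫ ((q.hom ≫ (f ⊗ₘ g) ≫ q'.inv) ⊗ₘ h) ≫ p'.inv =
      e ≫ (r.hom ≫ (f ⊗ₘ (s.hom ≫ (g ⊗ₘ h) ≫ s'.inv)) ≫ r'.inv) ≫ e'' := by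
  have h3 : (A' ◁ s'.inv) ≫ r'.inv ≫ e'' = (α_ A' B' D').inv ≫ q'.inv ▷ D' ≫ p'.inv := by
    rw [← cancel_epi (p'.hom ≫ q'.hom ▷ D' ≫ (α_ A' B' D').hom)]
    conv_lhs => rw [h2]
    simp [he]
  have h4 : f ⊗ₘ (s.hom ≫ (g ⊗ₘ h) ≫ s'.inv) =
      A ◁ s.hom ≫ (f ⊗ₘ (g ⊗ₘ h)) ≫ A' ◁ s'.inv := by
    simp only [← id_tensorHom, tensorHom_comp_tensorHom, Category.id_comp, Category.comp_id]
  have h5 : (q.hom ≫ (f ⊗ₘ g) ≫ q'.inv) ⊗ₘ h =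
      q.hom ▷ D ≫ ((f ⊗ₘ g) ⊗ₘ h) ≫ q'.inv ▷ D' := by
    simp only [← tensorHom_id, tensorHom_comp_tensorHom, Category.id_comp, Category.comp_id]
  have h6 : e ≫ (r.hom ≫ (A ◁ s.hom ≫ (f ⊗ₘ (g ⊗ₘ h)) ≫ A' ◁ s'.inv) ≫ r'.inv) ≫ e'' =
      (e ≫ r.hom ≫ A ◁ s.hom) ≫ (f ⊗ₘ (g ⊗ₘ h)) ≫ (A' ◁ s'.inv ≫ r'.inv ≫ e'') := by
    simp only [Category.assoc]
  rw [h4, h5, h6, h3, ← h1]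
  simp only [Category.assoc]
  rw [← associator_naturality_assoc]
  simp

theorem hprod_assoc {xs ys zs xs' ys' zs' : List C} (f : tens xs ⟶ tens xs')
    (g : tens ys ⟶ tens ys') (h : tens zs ⟶ tens zs') :
    hprod (hprod f g) h = recast (append_assoc xs ys zs) ≫
      hprod f (hprod g h) ≫ eqToHom (congrArg tens (append_assoc xs' ys' zs').symm) := by
  exact hprod_assoc_aux (tensAppend_assoc xs ys zs) (tensAppend_assoc xs' ys' zs') _ (by simp)

theorem hprod_nil_left {ys zs : List C} (g : tens ys ⟶ tens zs) :
    hprod (𝟙 (tens ([] : List C))) g = g := by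
  change (λ_ _).inv ≫ (𝟙 _ ⊗ₘ g) ≫ (λ_ _).hom = g
  simp

theorem hprod_nil_right {ys zs : List C} (g : tens ys ⟶ tens zs) :
    hprod g (𝟙 (tens ([] : List C))) = recast (append_nil ys) ≫ g ≫
      eqToHom (congrArg tens (append_nil zs).symm) := by
  have key : ∀ {A B A' B' : C} (p : A ≅ A' ⊗ 𝟙_ C) (p' : B ≅ B' ⊗ 𝟙_ C) (e : A ⟶ A') (e' : B' ⟶ B)
      (e'' : B ⟶ B') (g : A' ⟶ B'), p.hom = e ≫ (ρ_ _).inv → p'.hom = e'' ≫ (ρ_ _).inv →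
      e'' ≫ e' = 𝟙 _ → p.hom ≫ (g ⊗ₘ 𝟙 (𝟙_ C)) ≫ p'.inv = e ≫ g ≫ e' := by
    intro A B A' B' p p' e e' e'' g h h' h''
    have h3 : (ρ_ B').inv ≫ p'.inv = e' := by
      rw [← Category.comp_id e', ← p'.hom_inv_id, h', ← Category.assoc, ← Category.assoc,
        ← cancel_mono p'.hom]
      have : IsIso e'' := by
        have : e'' = p'.hom ≫ (ρ_ _).hom := by rw [h']; simp
        rw [this]; infer_instance
      rw [← cancel_epi e'']
      simp [reassoc_of% h'', h']
    rw [h, ← h3]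
    simp [MonoidalCategory.tensorHom_def]
  exact key _ _ _ _ _ _ (tensAppend_nil ys) (tensAppend_nil zs) (by simp)

namespace PointLabel

/-- The colours of the strands just below a point. -/
def ins : PointLabel C → List C
  | edge x => [x]
  | vertex xs _ _ => xs
  | _ => []

/-- The colours of the strands just above a point. -/
def outs : PointLabel C → List C
  | edge x => [x]
  | vertex _ ys _ => ys
  | _ => []

/-- The value of a point. -/
def mor : (w : PointLabel C) → (tens w.ins ⟶ tens w.outs)
  | edge _ => 𝟙 _
  | vertex _ _ f => f
  | empty => 𝟙 _
  | singular => 𝟙 _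

end PointLabel

/-- The colours of the strands just below a level. -/
def insW : Labels C → List C
  | [] => []
  | w :: W => w.ins ++ insW W

/-- The colours of the strands just above a level. -/
def outsW : Labels C → List C
  | [] => []
  | w :: W => w.outs ++ outsW W

/-- The value of a level. -/
def val : (W : Labels C) → (tens (insW W) ⟶ tens (outsW W))
  | [] => 𝟙 _
  | w :: W => hprod w.mor (val W)

/-- A level without vertices. -/
def edges (X : List C) : Labels C := X.map .edge

theorem insW_append (W1 W2 : Labels C) : insW (W1 ++ W2) = insW W1 ++ insW W2 := by
  induction W1 with
  | nil => rfl
  | cons w W ih => simp [insW, ih]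

theorem outsW_append (W1 W2 : Labels C) : outsW (W1 ++ W2) = outsW W1 ++ outsW W2 := by
  induction W1 with
  | nil => rfl
  | cons w W ih => simp [outsW, ih]

@[simp] theorem insW_edges (X : List C) : insW (edges X) = X := by
  induction X with
  | nil => rfl
  | cons x X ih => exact congrArg (x :: ·) ih

@[simp] theorem outsW_edges (X : List C) : outsW (edges X) = X := by
  induction X with
  | nil => rfl
  | cons x X ih => exact congrArg (x :: ·) ih

theorem edges_append (X Y : List C) : edges (X ++ Y) = edges X ++ edges Y := List.map_append

theorem val_edges (X : List C) :
    val (edges X) = recast ((insW_edges X).trans (outsW_edges X).symm) := by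
  induction X with
  | nil => rfl
  | cons x X ih =>
    change hprod (𝟙 (tens [x])) (val (edges X)) = _
    rw [ih]
    exact hprod_eqToHom rfl ((insW_edges X).trans (outsW_edges X).symm)

theorem val_append (W1 W2 : Labels C) :
    val (W1 ++ W2) = recast (insW_append W1 W2) ≫ hprod (val W1) (val W2) ≫
      eqToHom (congrArg tens (outsW_append W1 W2).symm) := by
  induction W1 with
  | nil =>
    have h : hprod (𝟙 (tens [])) (val W2) = val W2 := hprod_nil_left _
    exact h.symm.trans ((Category.id_comp _).trans (Category.comp_id _)).symm
  | cons w W ih =>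
    have h1 := hprod_eqToHom (rfl : w.ins = w.ins) (insW_append W W2)
    have h2 := hprod_eqToHom (rfl : w.outs = w.outs) (outsW_append W W2).symm
    have h3 : hprod w.mor (val (W ++ W2)) =
        hprod (recast (rfl : w.ins = w.ins) ≫ w.mor ≫
          recast (rfl : w.outs = w.outs))
          (recast (insW_append W W2) ≫ hprod (val W) (val W2) ≫
            eqToHom (congrArg tens (outsW_append W W2).symm)) := by
      rw [ih]; simp
    rw [hprod_comp, hprod_comp, h1, h2] at h3
    refine h3.trans ?_
    have h4 := hprod_assoc w.mor (val W) (val W2)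
    have h5 : hprod w.mor (hprod (val W) (val W2)) =
        eqToHom (congrArg tens (append_assoc _ _ _).symm) ≫
          hprod (hprod w.mor (val W)) (val W2) ≫
          recast (append_assoc _ _ _) := by rw [h4]; simp
    rw [h5]
    simp only [Category.assoc, eqToHom_trans, eqToHom_trans_assoc]
    rfl

/-- A list of objects with a generalized element of its tensor product. -/
abbrev KState (Z : C) : Type (max u v) := Σ Y : List C, (Z ⟶ tens Y)

local notation:max "wires" xs:max => (Sigma.mk xs (𝟙 _) : KState (tens xs))
local notation:max "cap" x:max => (Sigma.mk [] (Iso.inv (tensPair _ _) ≫ ev x) : KState (tens [dual x, x]))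

theorem KState.mk_eqToHom {Z : C} {X Y : List C} (h : X = Y) (f : Z ⟶ tens X) :
    (⟨Y, f ≫ recast h⟩ : KState Z) = ⟨X, f⟩ := by
  subst h; simp

/-- `k'` arises from `k` by passing the level `W`. -/
def KStep (W : Labels C) {Z : C} (k k' : KState Z) : Prop :=
  ∃ f : Z ⟶ tens (insW W), k = ⟨insW W, f⟩ ∧ k' = ⟨outsW W, f ≫ val W⟩

/-- The horizontal product of generalized elements. -/
def kprod {Z1 Z2 : C} (k1 : KState Z1) (k2 : KState Z2) : KState (Z1 ⊗ Z2) :=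
  ⟨k1.1 ++ k2.1, (k1.2 ⊗ₘ k2.2) ≫ (tensAppend k1.1 k2.1).inv⟩

theorem KStep.edges {Z : C} (k : KState Z) : KStep (edges k.1) k k := by
  obtain ⟨X, f⟩ := k
  refine ⟨f ≫ eqToHom (congrArg tens (insW_edges X).symm),
    (KState.mk_eqToHom (insW_edges X).symm f).symm, ?_⟩
  rw [val_edges, Category.assoc, eqToHom_trans]
  exact (KState.mk_eqToHom (outsW_edges X).symm f).symm

theorem KStep.fst {Z : C} {k k' : KState Z} (h : KStep W k k') :
    k.1 = insW W := by obtain ⟨f, rfl, rfl⟩ := h; rfl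

theorem KStep.snd {Z : C} {k k' : KState Z} (h : KStep W k k') :
    k'.1 = outsW W := by obtain ⟨f, rfl, rfl⟩ := h; rfl

theorem KStep.unique {Z : C} {k k' k'' : KState Z} (h : KStep W k k')
    (h' : KStep W k k'') : k' = k'' := by
  obtain ⟨f, rfl, rfl⟩ := h
  obtain ⟨f', hf, rfl⟩ := h'
  rw [Sigma.mk.injEq] at hf
  rw [eq_of_heq hf.2]

theorem KStep.append {W1 W2 : Labels C} {Z1 Z2 : C} {k1 k1' : KState Z1}
    {k2 k2' : KState Z2} (h₁ : KStep W1 k1 k1') (h₂ : KStep W2 k2 k2') :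
    KStep (W1 ++ W2) (kprod k1 k2) (kprod k1' k2') := by
  obtain ⟨f, rfl, rfl⟩ := h₁
  obtain ⟨g, rfl, rfl⟩ := h₂
  have key : ∀ (X Y : List C) (hX : insW W1 ++ insW W2 = X) (hY : outsW W1 ++ outsW W2 = Y)
      (F : Z1 ⊗ Z2 ⟶ tens (insW W1 ++ insW W2)), ∃ F' : Z1 ⊗ Z2 ⟶ tens X,
      (⟨insW W1 ++ insW W2, F⟩ : KState (Z1 ⊗ Z2)) = ⟨X, F'⟩ ∧
      (⟨outsW W1 ++ outsW W2, F ≫ hprod (val W1) (val W2)⟩ : KState (Z1 ⊗ Z2)) =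
        ⟨Y, F' ≫ recast hX.symm ≫ hprod (val W1) (val W2) ≫
          recast hY⟩ := by
    rintro X Y rfl rfl F
    exact ⟨F, rfl, by simp⟩
  obtain ⟨F', h1, h2⟩ := key _ _ (insW_append W1 W2).symm (outsW_append W1 W2).symm
    ((f ⊗ₘ g) ≫ (tensAppend _ _).inv)
  refine ⟨F', h1, ?_⟩
  rw [val_append]
  refine Eq.trans ?_ h2
  simp only [kprod, hprod, Category.assoc, Iso.inv_hom_id_assoc,
    ← tensorHom_comp_tensorHom_assoc]

theorem KStep.exists {Z : C} {k : KState Z} (h : k.1 = insW W) :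
    ∃ k', KStep W k k' := by
  obtain ⟨X, f⟩ := k
  change X = _ at h
  subst h
  exact ⟨_, f, rfl, rfl⟩

/-- Precomposition of generalized elements. -/
def KState.pre {Z Z' : C} (f : Z ⟶ Z') (k : KState Z') : KState Z := ⟨k.1, f ≫ k.2⟩

theorem KStep.pre {Z Z' : C} (f : Z ⟶ Z') {k k' : KState Z'}
    (h : KStep W k k') : KStep W (k.pre f) (k'.pre f) := by
  obtain ⟨g, rfl, rfl⟩ := h
  exact ⟨f ≫ g, rfl, by simp [KState.pre]⟩

theorem KStep.single {w : PointLabel C} {Z : C} (f : Z ⟶ tens w.ins) :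
    KStep [w] ⟨w.ins, f⟩ ⟨w.outs, f ≫ w.mor⟩ := by
  have hi : w.ins = insW [w] := (append_nil _).symm
  have ho : w.outs = outsW [w] := (append_nil _).symm
  refine ⟨f ≫ recast hi, (KState.mk_eqToHom hi f).symm, ?_⟩
  have h : val [w] = recast hi.symm ≫ w.mor ≫ recast ho :=
    hprod_nil_right _
  rw [h, ← KState.mk_eqToHom ho]
  simp

variable (k H) in
/-- A list of modules with an element of its tensor product. -/
abbrev VState :=
  Σ X : List 𝓜, (tens X).carrier

namespace VState

/-- The value of a generalized element at a vector. -/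
def app {Z : 𝓜} (K : KState Z) (z : Z.carrier) : VState k H := ⟨K.1, K.2.toLin z⟩

/-- `e'` arises from `e` by passing the level `W`. -/
def Step (W : Labels 𝓜) (e e' : VState k H) : Prop :=
  ∃ v : (tens (insW W)).carrier, e = ⟨insW W, v⟩ ∧ e' = ⟨outsW W, (val W).toLin v⟩

/-- The element `v ⊗ w` of the tensor product of a concatenation. -/
def inc (X Y : List 𝓜) :
    (tens X).carrier ⊗[k] (tens Y).carrier →ₗ[k] (tens (X ++ Y)).carrier :=
  (tensAppend X Y).inv.toLin

def prj (X Y : List 𝓜) :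
    (tens (X ++ Y)).carrier →ₗ[k] (tens X).carrier ⊗[k] (tens Y).carrier :=
  (tensAppend X Y).hom.toLin

theorem inc_prj (X Y : List 𝓜) (v) : inc X Y (prj X Y v) = v :=
  lcongr (congrArg FDMod.Hom.toLin (tensAppend X Y).hom_inv_id) v

theorem prj_inc (X Y : List 𝓜) (v) : prj X Y (inc X Y v) = v :=
  lcongr (congrArg FDMod.Hom.toLin (tensAppend X Y).inv_hom_id) v

/-- The concatenation of states. -/
def mul (e1 e2 : VState k H) : VState k H := ⟨e1.1 ++ e2.1, inc e1.1 e2.1 (e1.2 ⊗ₜ e2.2)⟩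

theorem app_kprod {Z1 Z2 : 𝓜} (K1 : KState Z1) (K2 : KState Z2) (z1 : Z1.carrier)
    (z2 : Z2.carrier) :
    app (kprod K1 K2) (z1 ⊗ₜ z2 : Z1.carrier ⊗[k] Z2.carrier) = mul (app K1 z1) (app K2 z2) := rfl

theorem Step.of_kStep {W : Labels 𝓜} {Z : 𝓜} {K K' : KState Z}
    (h : KStep W K K') (z : Z.carrier) : Step W (app K z) (app K' z) := by
  obtain ⟨f, rfl, rfl⟩ := h
  exact ⟨f.toLin z, rfl, rfl⟩

theorem Step.fst {W : Labels 𝓜} {e e' : VState k H} (h : Step W e e') :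
    e.1 = insW W := by obtain ⟨f, rfl, rfl⟩ := h; rfl

theorem Step.snd {W : Labels 𝓜} {e e' : VState k H} (h : Step W e e') :
    e'.1 = outsW W := by obtain ⟨f, rfl, rfl⟩ := h; rfl

theorem Step.unique {W : Labels 𝓜} {e e' e'' : VState k H} (h : Step W e e')
    (h' : Step W e e'') : e' = e'' := by
  obtain ⟨f, rfl, rfl⟩ := h
  obtain ⟨f', hf, rfl⟩ := h'
  rw [Sigma.mk.injEq] at hf
  rw [eq_of_heq hf.2]

theorem Step.exists {W : Labels 𝓜} {e : VState k H} (h : e.1 = insW W) :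
    ∃ e', Step W e e' := by
  obtain ⟨X, f⟩ := e
  change X = _ at h
  subst h
  exact ⟨_, f, rfl, rfl⟩

theorem Step.edges (e : VState k H) : Step (edges e.1) e e :=
  Step.of_kStep (KStep.edges wires e.1) e.2

theorem Step.single {w : PointLabel 𝓜} (v : (tens w.ins).carrier) :
    Step [w] ⟨w.ins, v⟩ ⟨w.outs, w.mor.toLin v⟩ :=
  Step.of_kStep (KStep.single (𝟙 (tens w.ins))) v

theorem Step.mul {W1 W2 : Labels 𝓜} {e1 e1' e2 e2' : VState k H}
    (h1 : Step W1 e1 e1') (h2 : Step W2 e2 e2') :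
    Step (W1 ++ W2) (mul e1 e2) (mul e1' e2') := by
  obtain ⟨v, rfl, rfl⟩ := h1
  obtain ⟨w, rfl, rfl⟩ := h2
  have h1 : KStep W1 ⟨insW W1, 𝟙 _⟩ ⟨outsW W1, val W1⟩ := ⟨𝟙 _, rfl, by simp⟩
  have h2 : KStep W2 ⟨insW W2, 𝟙 _⟩ ⟨outsW W2, val W2⟩ := ⟨𝟙 _, rfl, by simp⟩
  exact Step.of_kStep (h1.append h2) (v ⊗ₜ w : _ ⊗[k] _)

/-- A family of states that depends linearly on a vector. -/
def IsLin {M : Type*} [AddCommGroup M] [Module k M] (φ : M → VState k H) : Prop :=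
  ∃ (X : List 𝓜) (l : M →ₗ[k] (tens X).carrier), φ = fun m => ⟨X, l m⟩

theorem IsLin.ext_tmul {M N : Type*} [AddCommGroup M] [Module k M] [AddCommGroup N] [Module k N]
    {φ ψ : M ⊗[k] N → VState k H} (hφ : IsLin φ) (hψ : IsLin ψ)
    (h : ∀ m n, φ (m ⊗ₜ n) = ψ (m ⊗ₜ n)) : φ = ψ := by
  obtain ⟨X, l, rfl⟩ := hφ
  obtain ⟨Y, l', rfl⟩ := hψ
  have h0 : X = Y := congrArg Sigma.fst (h 0 0)
  subst h0
  have : l = l' := TensorProduct.ext' fun m n => by simpa using h m n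
  rw [this]

theorem IsLin.step_tmul {M N : Type*} [AddCommGroup M] [Module k M] [AddCommGroup N] [Module k N]
    {φ ψ : M ⊗[k] N → VState k H} (hφ : IsLin φ) (hψ : IsLin ψ)
    {W : Labels 𝓜}
    (h : ∀ m n, Step W (φ (m ⊗ₜ n)) (ψ (m ⊗ₜ n))) (t) : Step W (φ t) (ψ t) := by
  obtain ⟨X, l, rfl⟩ := hφ
  obtain ⟨Y, l', rfl⟩ := hψ
  obtain rfl : X = _ := (h 0 0).fst
  obtain rfl : Y = _ := (h 0 0).snd
  have : l' = (val W).toLin ∘ₗ l := TensorProduct.ext' fun m n => by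
    obtain ⟨v, h1, h2⟩ := h m n
    simp only [Sigma.mk.injEq, heq_eq_eq, true_and] at h1 h2
    rw [h2, LinearMap.comp_apply, h1]
  exact ⟨l t, rfl, by rw [this]; rfl⟩

theorem IsLin.comp {M N : Type*} [AddCommGroup M] [Module k M] [AddCommGroup N] [Module k N]
    {φ : M → VState k H} (hφ : IsLin φ) (l : N →ₗ[k] M) : IsLin fun n => φ (l n) := by
  obtain ⟨X, l', rfl⟩ := hφ
  exact ⟨X, l' ∘ₗ l, rfl⟩

theorem isLin_mk (X : List 𝓜) : IsLin (fun v => (⟨X, v⟩ : VState k H)) :=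
  ⟨X, LinearMap.id, rfl⟩

theorem IsLin.mul_left {M : Type*} [AddCommGroup M] [Module k M]
    {φ : M → VState k H} (hφ : IsLin φ) (e : VState k H) : IsLin fun m => mul e (φ m) := by
  obtain ⟨X, l, rfl⟩ := hφ
  exact ⟨_, inc e.1 X ∘ₗ tmk k _ _ e.2 ∘ₗ l, rfl⟩

theorem IsLin.mul_right {M : Type*} [AddCommGroup M] [Module k M]
    {φ : M → VState k H} (hφ : IsLin φ) (e : VState k H) : IsLin fun m => mul (φ m) e := by
  obtain ⟨X, l, rfl⟩ := hφ
  exact ⟨_, inc X e.1 ∘ₗ (tmk k _ _).flip e.2 ∘ₗ l, rfl⟩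

theorem mk_eqToHom {A B : List 𝓜} (h : A = B) (a : (tens A).carrier) :
    (⟨A, a⟩ : VState k H) = ⟨B, (recast h).toLin a⟩ := by
  subst h; rfl

theorem mul_assoc (e1 e2 e3 : VState k H) : mul (mul e1 e2) e3 = mul e1 (mul e2 e3) := by
  obtain ⟨X, u⟩ := e1
  obtain ⟨Y, v⟩ := e2
  obtain ⟨Z, w⟩ := e3
  refine (mk_eqToHom (append_assoc X Y Z) _).trans (congrArg (Sigma.mk _) ?_)
  set t := inc (X ++ Y) Z (inc X Y (u ⊗ₜ v) ⊗ₜ w) with ht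
  set s := (recast (append_assoc X Y Z)).toLin t with hs
  have h : TensorProduct.assoc k _ _ _
      ((tmap (prj X Y) .id) (prj (X ++ Y) Z t)) =
      (tmap .id (prj Y Z)) (prj X (Y ++ Z) s) :=
    congrArg (fun f => FDMod.Hom.toLin f t) (tensAppend_assoc X Y Z)
  rw [ht, prj_inc, map_tmul, prj_inc, TensorProduct.assoc_tmul] at h
  have h' := congrArg (fun z => inc X (Y ++ Z) (tmap .id (inc Y Z) z)) h
  simp only [← LinearMap.comp_apply (tmap _ _) (tmap _ _),
    ← TensorProduct.map_comp] at h'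
  have h2 : inc Y Z ∘ₗ prj Y Z = LinearMap.id := lext (inc_prj Y Z)
  rw [h2, LinearMap.id_comp, TensorProduct.map_id] at h'
  exact (h'.trans (inc_prj X (Y ++ Z) s)).symm

/-- A scalar as an element of the empty tensor product. -/
def scalar (c : k) : (tens ([] : List 𝓜)).carrier := c

/-- The element `v ⊗ w` of the tensor product of a nonempty list. -/
def consV (x : 𝓜) (Y : List 𝓜) :
    x.carrier ⊗[k] (tens Y).carrier →ₗ[k] (tens (x :: Y)).carrier := LinearMap.id

theorem mul_nil (e : VState k H) (c : k) : mul e ⟨[], scalar c⟩ = ⟨e.1, c • e.2⟩ := by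
  obtain ⟨X, u⟩ := e
  refine (mk_eqToHom (append_nil X) _).trans (congrArg (Sigma.mk _) ?_)
  set t := inc X [] (u ⊗ₜ scalar c) with ht
  have h1 : rid k _ (prj X [] t) =
      rid k _ ((rid k _).symm
        ((recast (append_nil X)).toLin t)) :=
    congrArg (fun f => rid k _ (FDMod.Hom.toLin f t)) (tensAppend_nil X)
  rw [LinearEquiv.apply_symm_apply] at h1
  refine h1.symm.trans ?_
  rw [ht, prj_inc]
  rfl

theorem nil_mul (e : VState k H) (c : k) : mul ⟨[], scalar c⟩ e = ⟨e.1, c • e.2⟩ := rfl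

/-- A single tensor factor. -/
def letter (x : 𝓜) (v : x.carrier) : VState k H := ⟨[x], consV x [] (v ⊗ₜ[k] scalar 1)⟩

theorem letter_mul (x : 𝓜) (v : x.carrier) (Y : List 𝓜) (w : (tens Y).carrier) :
    mul (letter x v) ⟨Y, w⟩ = ⟨x :: Y, consV x Y (v ⊗ₜ[k] w)⟩ := by
  refine congrArg (Sigma.mk (x :: Y)) ?_
  change v ⊗ₜ[k] ((1 : k) • w) = _
  rw [one_smul]
  rfl

variable (γ : GroupLike k H)

/-- The action of a grouplike element. -/
def actEquiv (V : 𝓜) : V.carrier ≃ₗ[k] V.carrier :=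
  LinearEquiv.ofLinearMap (V.ρ γ.val) (V.ρ (γ⁻¹).val)
    (by rw [← End.mul_eq_comp, ← map_mul, ← GroupLike.val_mul, mul_inv_cancel,
      GroupLike.val_one, map_one]; rfl)
    (by rw [← End.mul_eq_comp, ← map_mul, ← GroupLike.val_mul, inv_mul_cancel,
      GroupLike.val_one, map_one]; rfl)

theorem rho_tensor (V W : 𝓜) (v : V.carrier) (w : W.carrier) :
    (V ⊗ W).ρ γ.val (v ⊗ₜ[k] w) = (V.ρ γ.val v) ⊗ₜ[k] (W.ρ γ.val w) := by
  change HopfRep.tensor V.ρ W.ρ γ.val _ = _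
  rw [HopfRep.tensor_apply, γ.isGroupLikeElem_val.comul_eq_tmul_self, HopfRep.act₂_tmul,
    map_tmul]

theorem rho_unit (c : k) : (𝟙_ 𝓜).ρ γ.val c = c := by
  change Coalgebra.counit (R := k) γ.val * c = c
  rw [γ.isGroupLikeElem_val.counit_eq_one, one_mul]

/-- The strand at the left end is moved around the back to the right end. -/
def rotL (x : 𝓜) (Y : List 𝓜) :
    x.carrier ⊗[k] (tens Y).carrier →ₗ[k] (tens (Y ++ [x])).carrier :=
  inc Y [x] ∘ₗ (tcomm k _ _).toLinearMap ∘ₗ tmap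
    ((rid k _).symm.toLinearMap ∘ₗ (actEquiv γ x).toLinearMap) LinearMap.id

theorem rotL_bijective (x : 𝓜) (Y : List 𝓜) : Function.Bijective (rotL γ x Y) := by
  have h1 : Function.Bijective (inc Y [x]) :=
    ⟨fun a b h => by rw [← prj_inc Y [x] a, h, prj_inc], fun a => ⟨_, inc_prj Y [x] a⟩⟩
  have h2 : rotL γ x Y = inc Y [x] ∘ₗ ((TensorProduct.congr
      ((actEquiv γ x).trans (rid k _).symm) (LinearEquiv.refl k _)).trans
        (tcomm k _ _)).toLinearMap := rfl
  rw [h2]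
  exact h1.comp (LinearEquiv.bijective _)

def rotFun : VState k H → VState k H
  | ⟨[], v⟩ => ⟨[], v⟩
  | ⟨x :: Y, v⟩ => ⟨Y ++ [x], rotL γ x Y v⟩

theorem rotFun_bijective : Function.Bijective (rotFun (k := k) (H := H) γ) := by
  constructor
  · rintro ⟨_ | ⟨x, Y⟩, v⟩ ⟨_ | ⟨x', Y'⟩, v'⟩ h
    · exact h
    · have := congrArg (fun e => e.1.length) h
      simp [rotFun] at this
    · have := congrArg (fun e => e.1.length) h
      simp [rotFun] at this
    · have h0 := congrArg Sigma.fst h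
      obtain ⟨rfl, h1⟩ := List.append_inj' (h0 : Y ++ [x] = Y' ++ [x']) rfl
      obtain rfl : x = x' := by simpa using h1
      have h2 := eq_of_heq (Sigma.mk.inj h).2
      rw [(rotL_bijective γ x Y).1 h2]
  · rintro ⟨Z, w⟩
    rcases List.eq_nil_or_concat Z with rfl | ⟨Y, x, rfl⟩
    · exact ⟨⟨[], w⟩, rfl⟩
    · revert w
      rw [List.concat_eq_append]
      intro w
      obtain ⟨v, rfl⟩ := (rotL_bijective γ x Y).2 w
      exact ⟨⟨x :: Y, v⟩, rfl⟩

/-- Moving the strand at the left end around the back to the right end, where it picks up the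
action of the grouplike element. -/
def rot : Equiv.Perm (VState k H) := Equiv.ofBijective _ (rotFun_bijective γ)

theorem rot_cons (x : 𝓜) (Y : List 𝓜) (v : (tens (x :: Y)).carrier) :
    rot γ ⟨x :: Y, v⟩ = ⟨Y ++ [x], rotL γ x Y v⟩ := rfl

theorem rot_letter_mul (x : 𝓜) (v : x.carrier) (e : VState k H) :
    rot γ (mul (letter x v) e) = mul e (letter x (x.ρ γ.val v)) := by
  obtain ⟨Y, w⟩ := e
  rw [letter_mul, rot_cons]
  rfl

theorem IsLin.rotate {M : Type*} [AddCommGroup M] [Module k M]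
    {φ : M → VState k H} (hφ : IsLin φ) : IsLin fun m => rot γ (φ m) := by
  obtain ⟨X, l, rfl⟩ := hφ
  cases X with
  | nil => exact ⟨[], l, rfl⟩
  | cons x Y => exact ⟨_, rotL γ x Y ∘ₗ l, rfl⟩

theorem IsLin.rotate_iterate {M : Type*} [AddCommGroup M] [Module k M]
    {φ : M → VState k H} (hφ : IsLin φ) (n : ℕ) : IsLin fun m => (rot γ)^[n] (φ m) := by
  induction n generalizing φ with
  | zero => exact hφ
  | succ n ih => exact ih (hφ.rotate γ)

theorem rot_block (X : List 𝓜) (v : (tens X).carrier) (e : VState k H) :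
    (rot γ)^[X.length] (mul ⟨X, v⟩ e) = mul e ⟨X, (tens X).ρ γ.val v⟩ := by
  induction X generalizing e with
  | nil =>
    have : (tens ([] : List 𝓜)).ρ γ.val v = v := rho_unit γ v
    rw [this]
    exact (nil_mul e v).trans (mul_nil e v).symm
  | cons x X ih =>
    have key := IsLin.ext_tmul (M := x.carrier) (N := (tens X).carrier)
      (φ := fun t => (rot γ)^[X.length + 1] (mul ⟨x :: X, consV x X t⟩ e))
      (ψ := fun t => mul e ⟨x :: X, (tens (x :: X)).ρ γ.val (consV x X t)⟩)
      (IsLin.rotate_iterate γ (((isLin_mk (x :: X)).comp (consV x X)).mul_right e) _)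
      (((isLin_mk (x :: X)).comp ((tens (x :: X)).ρ γ.val ∘ₗ consV x X)).mul_left e) (fun a b => by
        have h1 : (tens (x :: X)).ρ γ.val (consV x X (a ⊗ₜ[k] b)) =
            consV x X ((x.ρ γ.val a) ⊗ₜ[k] ((tens X).ρ γ.val b)) := rho_tensor γ x (tens X) a b
        rw [h1, ← letter_mul, ← letter_mul, mul_assoc, Function.iterate_succ_apply,
          rot_letter_mul, mul_assoc, ih, mul_assoc])
    exact congrFun key v

theorem rot_full (X : List 𝓜) (v : (tens X).carrier) :
    (rot γ)^[X.length] ⟨X, v⟩ = ⟨X, (tens X).ρ γ.val v⟩ := by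
  have h := rot_block γ X v ⟨[], scalar 1⟩
  rwa [mul_nil, one_smul, nil_mul, one_smul] at h

/-- The element `v ⊗ w` of the source of a level. -/
def incW (w : PointLabel 𝓜) (W : Labels 𝓜) :
    (tens w.ins).carrier ⊗[k] (tens (insW W)).carrier →ₗ[k] (tens (insW (w :: W))).carrier :=
  inc w.ins (insW W)

theorem Step.rotate {w : PointLabel 𝓜} {W : Labels 𝓜}
    {e e' : VState k H} (h : Step (w :: W) e e') :
    Step (W ++ [w]) ((rot γ)^[w.ins.length] e) ((rot γ)^[w.outs.length] e') := by
  obtain ⟨v, rfl, rfl⟩ := h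
  obtain ⟨t, rfl⟩ : ∃ t, v = incW w W t := ⟨prj w.ins (insW W) v, (inc_prj w.ins (insW W) v).symm⟩
  have h1 : ∀ t, (val (w :: W)).toLin (incW w W t) =
      inc w.outs (outsW W) (tmap w.mor.toLin (val W).toLin t) := by
    intro t
    change inc w.outs (outsW W) (tmap w.mor.toLin (val W).toLin
      (prj w.ins (insW W) (inc w.ins (insW W) t))) = _
    rw [prj_inc]
  refine IsLin.step_tmul
    (φ := fun t => (rot γ)^[w.ins.length] ⟨insW (w :: W), incW w W t⟩)
    (ψ := fun t => (rot γ)^[w.outs.length] ⟨outsW (w :: W), (val (w :: W)).toLin (incW w W t)⟩)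
    (IsLin.rotate_iterate γ ((isLin_mk _).comp _) _)
    (IsLin.rotate_iterate γ ((isLin_mk _).comp ((val (w :: W)).toLin ∘ₗ incW w W)) _) ?_ _
  intro a b
  rw [h1]
  change Step _ ((rot γ)^[w.ins.length] (VState.mul ⟨w.ins, a⟩ ⟨insW W, b⟩))
    ((rot γ)^[w.outs.length] (VState.mul ⟨w.outs, w.mor.toLin a⟩ ⟨outsW W, (val W).toLin b⟩))
  rw [rot_block, rot_block]
  refine Step.mul ⟨b, rfl, rfl⟩ ?_
  have h2 : (tens w.outs).ρ γ.val (w.mor.toLin a) = w.mor.toLin ((tens w.ins).ρ γ.val a) :=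
    (comm_apply w.mor γ.val a).symm
  rw [h2]
  exact Step.single _

end VState

theorem Icc_induction {a b : ℝ} {P : ℝ → Prop} (ha : P a)
    (hl : ∀ x ∈ Ioc a b, (∀ y ∈ Ico a x, P y) → P x)
    (hr : ∀ x ∈ Ico a b, (∀ y ∈ Icc a x, P y) → ∀ᶠ y in 𝓝[>] x, P y) :
    ∀ x ∈ Icc a b, P x := by
  intro x hx
  have hab : a ≤ b := hx.1.trans hx.2
  set S := {x ∈ Icc a b | ∀ y ∈ Icc a x, P y} with hS
  have haS : a ∈ S := ⟨⟨le_rfl, hab⟩, fun y hy => by rwa [le_antisymm hy.2 hy.1]⟩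
  have hbdd : BddAbove S := ⟨b, fun y hy => hy.1.2⟩
  set s := sSup S with hs
  have has : a ≤ s := le_csSup hbdd haS
  have hsb : s ≤ b := csSup_le ⟨a, haS⟩ fun y hy => hy.1.2
  have h1 : ∀ y ∈ Ico a s, P y := fun y hy => by
    obtain ⟨z, hz, hyz⟩ := exists_lt_of_lt_csSup ⟨a, haS⟩ hy.2
    exact hz.2 y ⟨hy.1, hyz.le⟩
  have h2 : ∀ y ∈ Icc a s, P y := fun y hy => by
    rcases hy.2.lt_or_eq with h | h
    · exact h1 y ⟨hy.1, h⟩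
    · rcases has.lt_or_eq with h' | h'
      · rw [h]; exact hl s ⟨h', hsb⟩ h1
      · rw [h, ← h']; exact ha
  rcases hsb.lt_or_eq with h | h
  · exfalso
    obtain ⟨c, hc, hc'⟩ := (mem_nhdsGT_iff_exists_Ioo_subset' h).1 (hr s ⟨has, h⟩ h2)
    obtain ⟨z, hz1, hz2⟩ := exists_between (lt_min hc h)
    have : z ∈ S := ⟨⟨has.trans hz1.le, (hz2.trans_le (min_le_right _ _)).le⟩, fun y hy => by
      rcases le_or_gt y s with hys | hys
      · exact h2 y ⟨hy.1, hys⟩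
      · exact hc' ⟨hys, hy.2.trans_lt (hz2.trans_le (min_le_left _ _))⟩⟩
    exact absurd (le_csSup hbdd this) (not_le.2 hz1)
  · exact h2 x ⟨hx.1, hx.2.trans h.ge⟩

/-- A point label that belongs to an edge or a vertex. -/
def PointLabel.IsProper : PointLabel C → Prop
  | edge _ => True
  | vertex _ _ _ => True
  | _ => False

/-- Between the empty points `l` and `r`, the line `d` shows the labels `W` from left to right. -/
inductive IsLevel (d : ℝ → PointLabel C) : ℝ → ℝ → Labels C → Prop
  | nil {l r : ℝ} : l ≤ r → (∀ θ ∈ Icc l r, d θ = .empty) → IsLevel d l r []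
  | cons {l θ0 m r : ℝ} {w : PointLabel C} {W : Labels C} : l < θ0 → θ0 < m →
      (∀ θ ∈ Icc l m, θ ≠ θ0 → d θ = .empty) → d θ0 = w → w.IsProper → IsLevel d m r W →
      IsLevel d l r (w :: W)

namespace IsLevel

variable {d d' : ℝ → PointLabel C} {l l' m r r' : ℝ} {W W' : Labels C}

theorem le (h : IsLevel d l r W) : l ≤ r := by
  induction h with
  | nil h _ => exact h
  | cons h1 h2 _ _ _ _ ih => linarith

theorem left_empty (h : IsLevel d l r W) : d l = .empty := by
  cases h with
  | nil h h' => exact h' l ⟨le_rfl, h⟩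
  | cons h1 h2 h3 _ _ _ => exact h3 l ⟨le_rfl, by linarith⟩ h1.ne

theorem right_empty (h : IsLevel d l r W) : d r = .empty := by
  induction h with
  | nil h h' => exact h' _ ⟨h, le_rfl⟩
  | cons _ _ _ _ _ _ ih => exact ih

theorem extend_left (h : IsLevel d l r W) (hl : l' ≤ l) (he : ∀ θ ∈ Icc l' l, d θ = .empty) :
    IsLevel d l' r W := by
  cases h with
  | nil h h' =>
    refine .nil (hl.trans h) fun θ hθ => ?_
    rcases le_total θ l with h1 | h1
    · exact he θ ⟨hθ.1, h1⟩
    · exact h' θ ⟨h1, hθ.2⟩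
  | cons h1 h2 h3 h4 h5 h6 =>
    refine .cons (hl.trans_lt h1) h2 (fun θ hθ hne => ?_) h4 h5 h6
    rcases le_total θ l with h | h
    · exact he θ ⟨hθ.1, h⟩
    · exact h3 θ ⟨h, hθ.2⟩ hne

theorem append (h : IsLevel d l m W) (h' : IsLevel d m r W') : IsLevel d l r (W ++ W') := by
  induction h with
  | nil h he => exact h'.extend_left h he
  | cons h1 h2 h3 h4 h5 _ ih => exact .cons h1 h2 h3 h4 h5 (ih h')

theorem extend_right (h : IsLevel d l r W) (hr : r ≤ r') (he : ∀ θ ∈ Icc r r', d θ = .empty) :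
    IsLevel d l r' W := by
  simpa using h.append (.nil hr he)

theorem single {θ0 : ℝ} {w : PointLabel C} (h1 : l < θ0) (h2 : θ0 < r)
    (h3 : ∀ θ ∈ Icc l r, θ ≠ θ0 → d θ = .empty) (h4 : d θ0 = w) (h5 : w.IsProper) :
    IsLevel d l r [w] := by
  obtain ⟨m, hm1, hm2⟩ := exists_between h2
  exact .cons h1 hm1 (fun θ hθ => h3 θ ⟨hθ.1, hθ.2.trans hm2.le⟩) h4 h5
    (.nil hm2.le fun θ hθ => h3 θ ⟨(h1.trans hm1).le.trans hθ.1, hθ.2⟩ (hm1.trans_le hθ.1).ne')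

theorem cut (h : IsLevel d l r W) (hm : m ∈ Icc l r) (he : d m = .empty) :
    ∃ W1 W2, W = W1 ++ W2 ∧ IsLevel d l m W1 ∧ IsLevel d m r W2 := by
  induction h with
  | nil h h' =>
    exact ⟨[], [], rfl, .nil hm.1 fun θ hθ => h' θ ⟨hθ.1, hθ.2.trans hm.2⟩,
      .nil hm.2 fun θ hθ => h' θ ⟨hm.1.trans hθ.1, hθ.2⟩⟩
  | @cons l θ0 n r w W h1 h2 h3 h4 h5 h6 ih =>
    rcases lt_trichotomy m θ0 with h | h | h
    · exact ⟨[], w :: W, rfl, .nil hm.1 fun θ hθ => h3 θ ⟨hθ.1, by linarith [hθ.2]⟩ (by linarith [hθ.2]),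
        .cons h h2 (fun θ hθ => h3 θ ⟨hm.1.trans hθ.1, hθ.2⟩) h4 h5 h6⟩
    · rw [← h, he] at h4; subst h4; exact absurd h5 id
    · rcases le_total m n with h' | h'
      · exact ⟨[w], W, rfl, .single h1 h (fun θ hθ => h3 θ ⟨hθ.1, hθ.2.trans h'⟩) h4 h5,
          h6.extend_left h' fun θ hθ => h3 θ ⟨hm.1.trans hθ.1, hθ.2⟩ (by linarith [hθ.1])⟩
      · obtain ⟨W1, W2, rfl, h7, h8⟩ := ih ⟨h', hm.2⟩
        exact ⟨w :: W1, W2, rfl, .cons h1 h2 h3 h4 h5 h7, h8⟩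

theorem mem (h : IsLevel d l r W) {w : PointLabel C} (hw : w ∈ W) :
    w.IsProper ∧ ∃ θ ∈ Ioo l r, d θ = w := by
  induction h with
  | nil => simp at hw
  | cons h1 h2 h3 h4 h5 h6 ih =>
    rcases List.mem_cons.1 hw with rfl | hw
    · exact ⟨h5, _, ⟨h1, h2.trans_le h6.le⟩, h4⟩
    · obtain ⟨hp, θ, hθ, h⟩ := ih hw
      exact ⟨hp, θ, ⟨by linarith [hθ.1], hθ.2⟩, h⟩

theorem mem_of_ne_empty (h : IsLevel d l r W) {θ : ℝ} (hθ : θ ∈ Icc l r) (hne : d θ ≠ .empty) :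
    d θ ∈ W := by
  induction h with
  | nil _ h' => exact absurd (h' θ hθ) hne
  | @cons l θ0 n r w W h1 h2 h3 h4 h5 h6 ih =>
    rcases le_total θ n with h | h
    · by_cases h' : θ = θ0
      · rw [h', h4]; exact List.mem_cons_self
      · exact absurd (h3 θ ⟨hθ.1, h⟩ h') hne
    · exact List.mem_cons_of_mem _ (ih ⟨h, hθ.2⟩)

theorem eq_nil (h : IsLevel d l r W) (he : ∀ θ ∈ Icc l r, d θ = .empty) : W = [] := by
  cases h with
  | nil => rfl
  | cons h1 h2 h3 h4 h5 h6 =>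
    rw [he _ ⟨h1.le, (h2.trans_le h6.le).le⟩] at h4
    subst h4; exact absurd h5 id

theorem trim_left (h : IsLevel d l r W) (hl : l ≤ l') (hr : l' ≤ r)
    (he : ∀ θ ∈ Icc l l', d θ = .empty) : IsLevel d l' r W := by
  obtain ⟨W1, W2, rfl, h1, h2⟩ := h.cut ⟨hl, hr⟩ (he l' ⟨hl, le_rfl⟩)
  rwa [h1.eq_nil he]

theorem trim_right (h : IsLevel d l r W) (hl : l ≤ r') (hr : r' ≤ r)
    (he : ∀ θ ∈ Icc r' r, d θ = .empty) : IsLevel d l r' W := by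
  obtain ⟨W1, W2, rfl, h1, h2⟩ := h.cut ⟨hl, hr⟩ (he r' ⟨le_rfl, hr⟩)
  rwa [h2.eq_nil he, append_nil]

theorem move (h : IsLevel d l r W) (hl : ∀ θ ∈ uIcc l l', d θ = .empty)
    (hr : ∀ θ ∈ uIcc r r', d θ = .empty) (h1 : l' ≤ r) (h2 : l' ≤ r') : IsLevel d l' r' W := by
  have h' : IsLevel d l' r W := by
    rcases le_total l l' with h3 | h3
    · rw [uIcc_of_le h3] at hl
      exact h.trim_left h3 h1 hl
    · rw [uIcc_of_ge h3] at hl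
      exact h.extend_left h3 hl
  rcases le_total r r' with h3 | h3
  · rw [uIcc_of_le h3] at hr
    exact h'.extend_right h3 hr
  · rw [uIcc_of_ge h3] at hr
    exact h'.trim_right h2 h3 hr

theorem unique (h : IsLevel d l r W) (h' : IsLevel d l r W') : W = W' := by
  induction h generalizing W' with
  | nil _ he => exact (h'.eq_nil he).symm
  | @cons l θ0 n r w W h1 h2 h3 h4 h5 h6 ih =>
    have hw : w ≠ .empty := by rintro rfl; exact h5
    cases h' with
    | nil h he =>
      exact absurd ((h4.symm.trans (he θ0 ⟨h1.le, (h2.trans_le h6.le).le⟩))) hw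
    | @cons _ θ1 n' _ w' W' g1 g2 g3 g4 g5 g6 =>
      have hw' : w' ≠ .empty := by rintro rfl; exact g5
      have hθ : θ0 = θ1 := by
        rcases lt_trichotomy θ0 θ1 with h | h | h
        · exact absurd (h4.symm.trans (g3 θ0 ⟨h1.le, by linarith⟩ h.ne)) hw
        · exact h
        · exact absurd (g4.symm.trans (h3 θ1 ⟨g1.le, by linarith⟩ h.ne)) hw'
      subst hθ
      obtain rfl : w = w' := h4.symm.trans g4
      congr 1
      apply ih
      rcases le_total n n' with h | h
      · exact g6.extend_left h fun θ hθ => g3 θ ⟨by linarith [hθ.1], hθ.2⟩ (by linarith [hθ.1])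
      · exact g6.trim_left h h6.le fun θ hθ =>
          h3 θ ⟨by linarith [hθ.1], hθ.2⟩ (by linarith [hθ.1])

theorem congr (h : IsLevel d l r W) (hd : ∀ θ ∈ Icc l r, d θ = d' θ) : IsLevel d' l r W := by
  induction h with
  | nil h he => exact .nil h fun θ hθ => (hd θ hθ).symm.trans (he θ hθ)
  | cons h1 h2 h3 h4 h5 h6 ih =>
    refine .cons h1 h2 (fun θ hθ hne => ?_) ?_ h5 (ih fun θ hθ => hd θ ⟨by linarith [hθ.1], hθ.2⟩)
    · exact (hd θ ⟨hθ.1, hθ.2.trans h6.le⟩).symm.trans (h3 θ hθ hne)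
    · exact (hd _ ⟨h1.le, (h2.trans_le h6.le).le⟩).symm.trans h4

theorem shift (h : IsLevel d l r W) {s : ℝ} (hd : ∀ θ, d (θ + s) = d θ) :
    IsLevel d (l + s) (r + s) W := by
  have hd' : ∀ θ, d θ = d (θ - s) := fun θ => by rw [← hd (θ - s), sub_add_cancel]
  induction h with
  | nil h he =>
    exact .nil (by linarith) fun θ hθ => by
      rw [hd']; exact he _ ⟨by linarith [hθ.1], by linarith [hθ.2]⟩
  | @cons l θ0 m r w W h1 h2 h3 h4 h5 h6 ih =>
    refine .cons (θ0 := θ0 + s) (m := m + s) (by linarith) (by linarith) (fun θ hθ hne => ?_)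
      (by rw [hd, h4]) h5 ih
    rw [hd']
    exact h3 _ ⟨by linarith [hθ.1], by linarith [hθ.2]⟩ fun h => hne (by linarith)

theorem of_strictMono {xs : List C} {v : Fin xs.length → ℝ} (hlr : l < r) (hv : StrictMono v)
    (h1 : ∀ i, l < v i ∧ v i < r ∧ d (v i) = .edge (xs.get i))
    (h2 : ∀ θ ∈ Icc l r, (∀ i, θ ≠ v i) → d θ = .empty) : IsLevel d l r (edges xs) := by
  induction xs generalizing l with
  | nil => exact .nil hlr.le fun θ hθ => h2 θ hθ fun i => i.elim0
  | cons x xs ih =>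
    have h0 := h1 ⟨0, Nat.zero_lt_succ _⟩
    set θ0 := v ⟨0, Nat.zero_lt_succ _⟩ with hθ0
    have hev : ∀ᶠ m in 𝓝[>] θ0, m < r ∧ θ0 < m ∧ ∀ i : Fin xs.length, m < v i.succ := by
      refine ((eventually_lt_nhds h0.2.1).filter_mono nhdsWithin_le_nhds).and
        (eventually_mem_nhdsWithin.and ?_)
      refine eventually_all.2 fun i => (eventually_lt_nhds ?_).filter_mono nhdsWithin_le_nhds
      exact hv (Fin.succ_pos i)
    obtain ⟨m, hm1, hm2, hm3⟩ := hev.exists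
    refine .cons h0.1 hm2 (fun θ hθ hne => h2 θ ⟨hθ.1, by linarith [hθ.2]⟩ fun i => ?_) h0.2.2
      trivial (ih (v := fun i => v i.succ) hm1 (fun i j hij => hv (Fin.succ_lt_succ_iff.2 hij))
        (fun i => ⟨hm3 i, (h1 i.succ).2⟩) fun θ hθ hne => h2 θ ⟨by linarith [hθ.1, h0.1], hθ.2⟩ fun i => ?_)
    · refine Fin.cases hne (fun j => ?_) i
      exact (hθ.2.trans_lt (hm3 j)).ne
    · refine Fin.cases ?_ (fun j => hne j) i
      exact (hm2.trans_le hθ.1).ne'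

end IsLevel

theorem IsStrandFamily.isLevel {L R : ℝ → ℝ} {s : Set ℝ} {xs : List C}
    {u : Fin xs.length → ℝ → ℝ} (h : IsStrandFamily D L R s xs u) {t : ℝ} (ht : t ∈ s)
    (hLR : L t < R t) : IsLevel (D · t) (L t) (R t) (edges xs) :=
  .of_strictMono hLR (h.2 t ht).1 (h.2 t ht).2.1 (h.2 t ht).2.2

/-- Between the walls `l` and `r` and near the height `h0`, the diagram consists of the labels `W`
at the height `h0` with their edges. -/
structure IsMovie (D : Plan C) (l r h0 : ℝ) (W : Labels C) : Prop where
  level : IsLevel (D · h0) l r W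
  below : ∀ᶠ h in 𝓝[<] h0, IsLevel (D · h) l r (edges (insW W))
  above : ∀ᶠ h in 𝓝[>] h0, IsLevel (D · h) l r (edges (outsW W))

theorem IsMovie.append {l m r h0 : ℝ} {W W' : Labels C}
    (h : IsMovie D l m h0 W) (h' : IsMovie D m r h0 W') : IsMovie D l r h0 (W ++ W') where
  level := h.level.append h'.level
  below := by
    filter_upwards [h.below, h'.below] with t ht ht'
    rw [insW_append, edges_append]
    exact ht.append ht'
  above := by
    filter_upwards [h.above, h'.above] with t ht ht'
    rw [outsW_append, edges_append]
    exact ht.append ht'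

theorem IsMovie.of_nhds {l r h0 : ℝ} {X : List C}
    (h : ∀ᶠ h in 𝓝 h0, IsLevel (D · h) l r (edges X)) : IsMovie D l r h0 (edges X) where
  level := h.self_of_nhds
  below := by rw [insW_edges]; exact h.filter_mono nhdsWithin_le_nhds
  above := by rw [outsW_edges]; exact h.filter_mono nhdsWithin_le_nhds

/-- The local condition on string nets. -/
def IsLocallyProgressive (D : Plan C) (θ h : ℝ) : Prop :=
  ∃ l r a b : ℝ, l < θ ∧ θ < r ∧ a < h ∧ h < b ∧
    ((∃ xs u, IsStrandFamily D (fun _ => l) (fun _ => r) (Icc a b) xs u) ∨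
      ∃ xs ys f, IsCorolla D (fun _ => l) (fun _ => r) a b xs ys f)

/-- `θ` is isolated at the height `h`, and the diagram is progressive near it. -/
def IsIsolated (D : Plan C) (θ h : ℝ) : Prop :=
  ∃ δ > 0, (∀ θ' ∈ Ioo (θ - δ) (θ + δ), θ' ≠ θ → D θ' h = .empty) ∧
    ∀ l ∈ Ioc (θ - δ) θ, ∀ r ∈ Ico θ (θ + δ), D l h = .empty → D r h = .empty →
      ∃ W, IsMovie D l r h W

theorem IsStrandFamily.isIsolated {l r θ h : ℝ} {s : Set ℝ}
    {xs : List C} {u : Fin xs.length → ℝ → ℝ}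
    (hs : IsStrandFamily D (fun _ => l) (fun _ => r) s xs u) (hl : l < θ) (hr : θ < r)
    (hh : s ∈ 𝓝 h) : IsIsolated D θ h := by
  have hmem : h ∈ s := mem_of_mem_nhds hh
  have hcont : ∀ i, ContinuousAt (u i) h := fun i => (hs.1 i).continuousOn.continuousAt hh
  have hδ : ∀ᶠ δ : ℝ in 𝓝[>] 0, l < θ - δ ∧ θ + δ < r ∧ ∀ i, u i h ≠ θ → δ < |u i h - θ| := by
    refine Filter.Eventually.filter_mono nhdsWithin_le_nhds ?_
    refine ((continuous_const.sub continuous_id).continuousAt.eventually_const_lt (by simpa using hl)).and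
      (((continuous_const.add continuous_id).continuousAt.eventually_lt_const (by simpa using hr)).and ?_)
    refine eventually_all.2 fun i => ?_
    by_cases hi : u i h = θ
    · exact .of_forall fun δ h => absurd hi h
    · filter_upwards [eventually_lt_nhds (abs_pos.2 (sub_ne_zero.2 hi))] with δ hδ _ using hδ
  obtain ⟨δ, ⟨h1, h2, h3⟩, hδ0⟩ := (hδ.and eventually_mem_nhdsWithin).exists
  refine ⟨δ, hδ0, fun θ' hθ' hne => ?_, fun l' hl' r' hr' hle hre => ?_⟩
  · refine (hs.2 h hmem).2.2 θ' ⟨by linarith [hθ'.1], by linarith [hθ'.2]⟩ fun i hi => ?_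
    by_cases hi' : u i h = θ
    · exact hne (hi.trans hi')
    · have := h3 i hi'
      rw [← hi] at this
      exact absurd this (not_lt.2 (abs_le.2 ⟨by linarith [hθ'.1], by linarith [hθ'.2]⟩))
  · have hsub : Icc l' r' ⊆ Icc l r :=
      Icc_subset_Icc (by linarith [hl'.1]) (by linarith [hr'.2])
    have hout : ∀ i, u i h ≠ θ → ∀ᶠ t in 𝓝 h, u i t ∉ Icc l' r' := fun i hi => by
      refine (hcont i).eventually (isClosed_Icc.isOpen_compl.mem_nhds fun hmem => ?_)
      exact absurd (h3 i hi) (not_lt.2 (abs_le.2 ⟨by linarith [hmem.1, hl'.1], by linarith [hmem.2, hr'.2]⟩))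
    by_cases hex : ∃ i, u i h = θ
    · obtain ⟨i0, hi0⟩ := hex
      have hθe : D θ h ≠ .empty := by
        rw [← hi0, ((hs.2 h hmem).2.1 i0).2.2]; exact fun h => by cases h
      have hl'' : l' < θ := lt_of_le_of_ne hl'.2 fun h => hθe (h ▸ hle)
      have hr'' : θ < r' := lt_of_le_of_ne hr'.1 fun h => hθe (h ▸ hre)
      refine ⟨edges [xs.get i0], .of_nhds ?_⟩
      have hout' : ∀ᶠ t in 𝓝 h, ∀ i, i ≠ i0 → u i t ∉ Icc l' r' := by
        refine eventually_all.2 fun i => ?_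
        by_cases hi : i = i0
        · exact .of_forall fun t h => absurd hi h
        · filter_upwards [hout i fun h' => hi ((hs.2 h hmem).1.injective (h'.trans hi0.symm))]
            with t ht _ using ht
      filter_upwards [hh, hout', (hcont i0).eventually (Ioo_mem_nhds (hi0 ▸ hl'') (hi0 ▸ hr''))]
        with t ht1 ht2 ht3
      refine .single ht3.1 ht3.2 (fun θ' hθ' hne => (hs.2 t ht1).2.2 θ' (hsub hθ') fun i hi => ?_)
        ((hs.2 t ht1).2.1 i0).2.2 trivial
      by_cases hii : i = i0
      · exact hne (hii ▸ hi)
      · exact ht2 i hii (hi ▸ hθ')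
    · refine ⟨edges [], .of_nhds ?_⟩
      have hout' : ∀ᶠ t in 𝓝 h, ∀ i, u i t ∉ Icc l' r' :=
        eventually_all.2 fun i => hout i fun h => hex ⟨i, h⟩
      filter_upwards [hh, hout'] with t ht1 ht2
      exact .nil (hl'.2.trans hr'.1) fun θ' hθ' => (hs.2 t ht1).2.2 θ' (hsub hθ') fun i hi =>
        ht2 i (hi ▸ hθ')

theorem IsCorolla.isIsolated {l r a b θ h : ℝ} {xs ys : List C}
    {f : tens xs ⟶ tens ys} (hc : IsCorolla D (fun _ => l) (fun _ => r) a b xs ys f)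
    (hl : l < θ) (hr : θ < r) (ha : a < h) (hb : h < b) : IsIsolated D θ h := by
  obtain ⟨θ0, h0, ha0, h0b, hl0, h0r, hv, he, ⟨u, hu, hut⟩, ⟨w, hw, hwt⟩⟩ := hc
  rcases lt_trichotomy h h0 with hh | rfl | hh
  · exact hu.isIsolated hl hr (Ico_mem_nhds ha hh)
  swap
  · exact hw.isIsolated hl hr (Ioc_mem_nhds hh hb)
  have hδ : ∀ᶠ δ : ℝ in 𝓝[>] 0, l < θ - δ ∧ θ + δ < r ∧ (θ0 ≠ θ → δ < |θ0 - θ|) := by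
    refine Filter.Eventually.filter_mono nhdsWithin_le_nhds ?_
    refine ((continuous_const.sub continuous_id).continuousAt.eventually_const_lt (by simpa using hl)).and
      (((continuous_const.add continuous_id).continuousAt.eventually_lt_const (by simpa using hr)).and ?_)
    by_cases hi : θ0 = θ
    · exact .of_forall fun δ h => absurd hi h
    · filter_upwards [eventually_lt_nhds (abs_pos.2 (sub_ne_zero.2 hi))] with δ hδ _ using hδ
  obtain ⟨δ, ⟨h1, h2, h3⟩, hδ0⟩ := (hδ.and eventually_mem_nhdsWithin).exists
  have hmemu : ∀ᶠ t in 𝓝[<] h, t ∈ Ico a h :=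
    (((eventually_gt_nhds ha0).filter_mono nhdsWithin_le_nhds).and eventually_mem_nhdsWithin).mono
      fun t ht => ⟨ht.1.le, ht.2⟩
  have hmemw : ∀ᶠ t in 𝓝[>] h, t ∈ Ioc h b :=
    (((eventually_lt_nhds h0b).filter_mono nhdsWithin_le_nhds).and eventually_mem_nhdsWithin).mono
      fun t ht => ⟨ht.2, ht.1.le⟩
  refine ⟨δ, hδ0, fun θ' hθ' hne => ?_, fun l' hl' r' hr' hle hre => ?_⟩
  · refine he θ' ⟨by linarith [hθ'.1], by linarith [hθ'.2]⟩ fun hi => ?_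
    by_cases hi' : θ0 = θ
    · exact hne (hi.trans hi')
    · have := h3 hi'
      rw [← hi] at this
      exact absurd this (not_lt.2 (abs_le.2 ⟨by linarith [hθ'.1], by linarith [hθ'.2]⟩))
  · have hsub : Icc l' r' ⊆ Icc l r :=
      Icc_subset_Icc (by linarith [hl'.1]) (by linarith [hr'.2])
    by_cases hθ : θ0 = θ
    · subst hθ
      have hθe : D θ0 h ≠ .empty := by rw [hv]; exact fun h => by cases h
      have hl'' : l' < θ0 := lt_of_le_of_ne hl'.2 fun h => hθe (h ▸ hle)
      have hr'' : θ0 < r' := lt_of_le_of_ne hr'.1 fun h => hθe (h ▸ hre)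
      refine ⟨[.vertex xs ys f], .single hl'' hr'' (fun θ' hθ' => he θ' (hsub hθ')) hv trivial, ?_, ?_⟩
      · have : insW [PointLabel.vertex xs ys f] = xs := append_nil _
        rw [this]
        filter_upwards [hmemu, eventually_all.2 fun i => (hut i).eventually (Ioo_mem_nhds hl'' hr'')]
          with t ht1 ht2
        exact .of_strictMono (hl''.trans hr'') (hu.2 t ht1).1
          (fun i => ⟨(ht2 i).1, (ht2 i).2, ((hu.2 t ht1).2.1 i).2.2⟩)
          fun θ' hθ' => (hu.2 t ht1).2.2 θ' (hsub hθ')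
      · have : outsW [PointLabel.vertex xs ys f] = ys := append_nil _
        rw [this]
        filter_upwards [hmemw, eventually_all.2 fun i => (hwt i).eventually (Ioo_mem_nhds hl'' hr'')]
          with t ht1 ht2
        exact .of_strictMono (hl''.trans hr'') (hw.2 t ht1).1
          (fun i => ⟨(ht2 i).1, (ht2 i).2, ((hw.2 t ht1).2.1 i).2.2⟩)
          fun θ' hθ' => (hw.2 t ht1).2.2 θ' (hsub hθ')
    · have hnot : θ0 ∉ Icc l' r' := fun hmem =>
        absurd (h3 hθ) (not_lt.2 (abs_le.2 ⟨by linarith [hmem.1, hl'.1], by linarith [hmem.2, hr'.2]⟩))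
      have hlr : l' ≤ r' := hl'.2.trans hr'.1
      have hcl : (Icc l' r')ᶜ ∈ 𝓝 θ0 := isClosed_Icc.isOpen_compl.mem_nhds hnot
      refine ⟨[], .nil hlr fun θ' hθ' => he θ' (hsub hθ') fun h => hnot (h ▸ hθ'), ?_, ?_⟩
      · filter_upwards [hmemu, eventually_all.2 fun i => (hut i).eventually hcl] with t ht1 ht2
        exact .nil hlr fun θ' hθ' => (hu.2 t ht1).2.2 θ' (hsub hθ') fun i hi => ht2 i (hi ▸ hθ')
      · filter_upwards [hmemw, eventually_all.2 fun i => (hwt i).eventually hcl] with t ht1 ht2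
        exact .nil hlr fun θ' hθ' => (hw.2 t ht1).2.2 θ' (hsub hθ') fun i hi => ht2 i (hi ▸ hθ')

theorem IsLocallyProgressive.isIsolated {θ h : ℝ}
    (hp : IsLocallyProgressive D θ h) : IsIsolated D θ h := by
  obtain ⟨l, r, a, b, h1, h2, h3, h4, ⟨xs, u, h5⟩ | ⟨xs, ys, f, h5⟩⟩ := hp
  · exact h5.isIsolated h1 h2 (Icc_mem_nhds h3 h4)
  · exact h5.isIsolated h1 h2 h3 h4

theorem exists_isMovie {l r h : ℝ} (hlr : l ≤ r)
    (hp : ∀ θ ∈ Icc l r, IsLocallyProgressive D θ h) (hl : D l h = .empty) (hr : D r h = .empty) :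
    ∃ W, IsMovie D l r h W := by
  refine Icc_induction (a := l) (b := r) (P := fun θ => D θ h = .empty → ∃ W, IsMovie D l θ h W)
    ?_ ?_ ?_ r ⟨hlr, le_rfl⟩ hr
  · intro _
    obtain ⟨δ, hδ, -, h2⟩ := (hp l ⟨le_rfl, hlr⟩).isIsolated
    exact h2 l ⟨by linarith, le_rfl⟩ l ⟨le_rfl, by linarith⟩ hl hl
  · intro x hx ih hxe
    obtain ⟨δ, hδ, h1, h2⟩ := (hp x ⟨hx.1.le, hx.2⟩).isIsolated
    obtain ⟨y, hy1, hy2⟩ := exists_between (max_lt hx.1 (by linarith : x - δ < x))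
    have hye : D y h = .empty :=
      h1 y ⟨(le_max_right _ _).trans_lt hy1, by linarith⟩ hy2.ne
    obtain ⟨W, hW⟩ := ih y ⟨(le_max_left _ _).trans hy1.le, hy2⟩ hye
    obtain ⟨W', hW'⟩ := h2 y ⟨(le_max_right _ _).trans_lt hy1, hy2.le⟩ x ⟨le_rfl, by linarith⟩ hye hxe
    exact ⟨_, hW.append hW'⟩
  · intro x hx ih
    obtain ⟨δ, hδ, h1, h2⟩ := (hp x ⟨hx.1, hx.2.le⟩).isIsolated
    filter_upwards [Ioo_mem_nhdsGT (by linarith : x < x + δ)] with y hy hye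
    rcases hx.1.lt_or_eq with hlx | rfl
    · obtain ⟨z, hz1, hz2⟩ := exists_between (max_lt hlx (by linarith : x - δ < x))
      have hze : D z h = .empty :=
        h1 z ⟨(le_max_right _ _).trans_lt hz1, by linarith⟩ hz2.ne
      obtain ⟨W, hW⟩ := ih z ⟨(le_max_left _ _).trans hz1.le, hz2.le⟩ hze
      obtain ⟨W', hW'⟩ := h2 z ⟨(le_max_right _ _).trans_lt hz1, hz2.le⟩ y ⟨hy.1.le, hy.2⟩ hze hye
      exact ⟨_, hW.append hW'⟩
    · exact h2 l ⟨by linarith, le_rfl⟩ y ⟨hy.1.le, hy.2⟩ hl hye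

theorem IsLocallyProgressive.empty_nhds {θ h : ℝ}
    (hp : IsLocallyProgressive D θ h) (he : D θ h = .empty) :
    ∀ᶠ p : ℝ × ℝ in 𝓝 (θ, h), D p.1 p.2 = .empty := by
  obtain ⟨δ, hδ, h1, h2⟩ := hp.isIsolated
  have hle : D (θ - δ / 2) h = .empty := h1 _ ⟨by linarith, by linarith⟩ (by linarith)
  have hre : D (θ + δ / 2) h = .empty := h1 _ ⟨by linarith, by linarith⟩ (by linarith)
  obtain ⟨W, hW⟩ := h2 (θ - δ / 2) ⟨by linarith, by linarith⟩ (θ + δ / 2) ⟨by linarith, by linarith⟩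
    hle hre
  have hnil : W = [] := hW.level.eq_nil fun θ' hθ' => by
    by_cases h : θ' = θ
    · rw [h, he]
    · exact h1 _ ⟨by linarith [hθ'.1], by linarith [hθ'.2]⟩ h
  subst hnil
  have hnh : ∀ᶠ t in 𝓝 h, ∀ θ' ∈ Icc (θ - δ / 2) (θ + δ / 2), D θ' t = .empty := by
    have hw : ∀ t, IsLevel (D · t) (θ - δ / 2) (θ + δ / 2) [] →
        ∀ θ' ∈ Icc (θ - δ / 2) (θ + δ / 2), D θ' t = .empty := fun t ht => by
      cases ht with | nil _ h => exact h
    rw [← nhdsLT_sup_nhdsGE, ← Ioi_insert, nhdsWithin_insert]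
    refine eventually_sup.2 ⟨hW.below.mono hw, eventually_sup.2 ⟨?_, hW.above.mono hw⟩⟩
    exact hw h hW.level
  rw [nhds_prod_eq]
  filter_upwards [prod_mem_prod (Icc_mem_nhds (by linarith : θ - δ / 2 < θ)
    (by linarith : θ < θ + δ / 2)) hnh] with p hp
  exact hp.2 p.1 hp.1

section Sections

variable {σ : Type*} {τ : Type*}

/-- `step W e e'` says that the state `e` becomes the state `e'` by passing the level `W`. -/
structure IsStepRel (fst : σ → List C) (step : Labels C → σ → σ → Prop) : Prop where
  exists_step {W e} : fst e = insW W → ∃ e', step W e e'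
  fst_eq {W e e'} : step W e e' → fst e = insW W
  snd_eq {W e e'} : step W e e' → fst e' = outsW W
  unique {W e e' e''} : step W e e' → step W e e'' → e' = e''
  edges_self (e) : step (edges (fst e)) e e

theorem KStep.isStepRel (Z : C) : IsStepRel (Sigma.fst : KState Z → List C) (fun W => KStep W) :=
  ⟨KStep.exists, KStep.fst, KStep.snd, KStep.unique, KStep.edges⟩

theorem VState.Step.isStepRel :
    IsStepRel (Sigma.fst : VState k H → List 𝓜) VState.Step :=
  ⟨VState.Step.exists, VState.Step.fst, VState.Step.snd, VState.Step.unique, VState.Step.edges⟩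

/-- The states `P h` of the levels between the walls `L` and `R` and the heights `a` and `b` evolve
according to the diagram `D`. -/
def IsSec (step : Labels C → σ → σ → Prop) (D : Plan C) (L R : ℝ → ℝ)
    (a b : ℝ) (P : ℝ → σ) : Prop :=
  ∀ h ∈ Icc a b, ∃ W, IsLevel (D · h) (L h) (R h) W ∧ (∃ e', step W (P h) e') ∧
    (∀ᶠ t in 𝓝[<] h, a ≤ t → P t = P h) ∧ ∀ᶠ t in 𝓝[>] h, t ≤ b → step W (P h) (P t)

variable {fst : σ → List C} {step : Labels C → σ → σ → Prop}
  {step' : Labels C → τ → τ → Prop} {D D' : Plan C} {L M R : ℝ → ℝ}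
  {a b c : ℝ} {P P' : ℝ → σ}

namespace IsSec

theorem unique (hs : IsStepRel fst step) (h : IsSec step D L R a b P) (h' : IsSec step D L R a b P')
    (ha : P a = P' a) : ∀ x ∈ Icc a b, P x = P' x := by
  refine Icc_induction ha (fun x hx ih => ?_) fun x hx ih => ?_
  · obtain ⟨W, -, -, h1, -⟩ := h x ⟨hx.1.le, hx.2⟩
    obtain ⟨W', -, -, h1', -⟩ := h' x ⟨hx.1.le, hx.2⟩
    obtain ⟨t, h2, h3, h4⟩ := (h1.and (h1'.and (Ioo_mem_nhdsLT hx.1))).exists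
    rw [← h2 h4.1.le, ← h3 h4.1.le]
    exact ih t ⟨h4.1.le, h4.2⟩
  · obtain ⟨W, h0, -, -, h1⟩ := h x ⟨hx.1, hx.2.le⟩
    obtain ⟨W', h0', -, -, h1'⟩ := h' x ⟨hx.1, hx.2.le⟩
    obtain rfl := h0.unique h0'
    filter_upwards [h1, h1', Ioo_mem_nhdsGT hx.2] with t h2 h3 h4
    refine hs.unique (h2 h4.2.le) ?_
    rw [ih x ⟨hx.1, le_rfl⟩]
    exact h3 h4.2.le

theorem map (h : IsSec step D L R a b P) (φ : σ → τ)
    (hφ : ∀ W e e', step W e e' → step' W (φ e) (φ e')) :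
    IsSec step' D L R a b (fun h => φ (P h)) := fun x hx => by
  obtain ⟨W, h0, ⟨e', h1⟩, h2, h3⟩ := h x hx
  exact ⟨W, h0, ⟨_, hφ _ _ _ h1⟩, h2.mono fun t ht ha => congrArg φ (ht ha),
    h3.mono fun t ht ha => hφ _ _ _ (ht ha)⟩

theorem glue (h : IsSec step D L R a c P) (h' : IsSec step D L R c b P') (hc : P c = P' c) :
    IsSec step D L R a b (fun h => if h ≤ c then P h else P' h) := by
  have hl : ∀ x, x ≤ c → ∀ᶠ t in 𝓝[<] x, t ≤ c := fun x hx =>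
    eventually_mem_nhdsWithin.mono fun t ht => (show t < x from ht).le.trans hx
  have hr : ∀ x, c ≤ x → ∀ᶠ t in 𝓝[>] x, ¬ t ≤ c := fun x hx =>
    eventually_mem_nhdsWithin.mono fun t ht => not_le.2 (hx.trans_lt ht)
  intro x hx
  rcases lt_trichotomy x c with hxc | rfl | hxc
  · obtain ⟨W, h0, h1, h2, h3⟩ := h x ⟨hx.1, hxc.le⟩
    refine ⟨W, h0, by simpa [hxc.le] using h1, ?_, ?_⟩
    · filter_upwards [h2, hl x hxc.le] with t ht htc
      simpa [htc, hxc.le] using ht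
    · filter_upwards [h3, Ioo_mem_nhdsGT hxc] with t ht htc _
      simpa [htc.2.le, hxc.le] using ht htc.2.le
  · obtain ⟨W, h0, h1, h2, -⟩ := h x ⟨hx.1, le_rfl⟩
    obtain ⟨W', h0', -, -, h3⟩ := h' x ⟨le_rfl, hx.2⟩
    obtain rfl := h0.unique h0'
    refine ⟨W, h0, by simpa using h1, ?_, ?_⟩
    · filter_upwards [h2, hl x le_rfl] with t ht htc
      simpa [htc] using ht
    · filter_upwards [h3, hr x le_rfl] with t ht htc
      simpa [htc, hc] using ht
  · obtain ⟨W, h0, h1, h2, h3⟩ := h' x ⟨hxc.le, hx.2⟩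
    refine ⟨W, h0, by simpa [not_le.2 hxc] using h1, ?_, ?_⟩
    · filter_upwards [h2, Ioo_mem_nhdsLT hxc] with t ht htc _
      simpa [not_le.2 htc.1, not_le.2 hxc] using ht htc.1.le
    · filter_upwards [h3, hr x hxc.le] with t ht htc
      simpa [htc, not_le.2 hxc] using ht

theorem restrict (h : IsSec step D L R a b P) {a' b' : ℝ} (ha : a ≤ a') (hb : b' ≤ b) :
    IsSec step D L R a' b' P := fun x hx => by
  obtain ⟨W, h0, h1, h2, h3⟩ := h x ⟨ha.trans hx.1, hx.2.trans hb⟩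
  exact ⟨W, h0, h1, h2.mono fun t ht h => ht (ha.trans h), h3.mono fun t ht h => ht (h.trans hb)⟩

theorem congr (h : IsSec step D L R a b P)
    (hD : ∀ t ∈ Icc a b, ∀ θ ∈ Icc (L t) (R t), D θ t = D' θ t) : IsSec step D' L R a b P :=
  fun x hx => by
  obtain ⟨W, h0, h1⟩ := h x hx
  exact ⟨W, h0.congr (hD x hx), h1⟩

theorem kprod {Z1 Z2 : C} {K1 : ℝ → KState Z1} {K2 : ℝ → KState Z2}
    (h₁ : IsSec (fun W => KStep W) D L M a b K1) (h₂ : IsSec (fun W => KStep W) D M R a b K2) :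
    IsSec (fun W => KStep W) D L R a b (fun h => TwPiv.kprod (K1 h) (K2 h)) := fun x hx => by
  obtain ⟨W, h0, ⟨e, h1⟩, h2, h3⟩ := h₁ x hx
  obtain ⟨W', h0', ⟨e', h1'⟩, h2', h3'⟩ := h₂ x hx
  refine ⟨W ++ W', h0.append h0', ⟨_, h1.append h1'⟩, ?_, ?_⟩
  · filter_upwards [h2, h2'] with t ht ht' hta
    rw [ht hta, ht' hta]
  · filter_upwards [h3, h3'] with t ht ht' hta
    exact (ht hta).append (ht' hta)

end IsSec

/-- The levels of a diagram near one level between moving walls. -/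
structure IsWallMovie (D : Plan C) (L R : ℝ → ℝ) (a b h : ℝ)
    (W : Labels C) : Prop where
  level : IsLevel (D · h) (L h) (R h) W
  below : ∀ᶠ t in 𝓝[<] h, a ≤ t → IsLevel (D · t) (L t) (R t) (edges (insW W))
  above : ∀ᶠ t in 𝓝[>] h, t ≤ b → IsLevel (D · t) (L t) (R t) (edges (outsW W))

theorem eventually_wall_empty {s : Set ℝ} {h : ℝ} (hL : ContinuousWithinAt L s h)
    (hp : IsLocallyProgressive D (L h) h) (he : D (L h) h = .empty) :
    ∀ᶠ t in 𝓝[s] h, ∀ θ ∈ uIcc (L h) (L t), D θ t = .empty := by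
  have h1 := hp.empty_nhds he
  rw [nhds_prod_eq, eventually_prod_iff] at h1
  obtain ⟨p, hp, q, hq, hpq⟩ := h1
  obtain ⟨ε, hε, hball⟩ := Metric.mem_nhds_iff.1 hp
  filter_upwards [hL.eventually (Metric.ball_mem_nhds _ hε), hq.filter_mono nhdsWithin_le_nhds]
    with t ht1 ht2 θ hθ
  exact hpq (hball ((convex_ball (L h) ε).ordConnected.uIcc_subset (Metric.mem_ball_self hε) ht1 hθ))
    ht2

/-- The diagram `D` is progressive between the walls `L` and `R`, which avoid it. -/
structure IsPlanar (D : Plan C) (L R : ℝ → ℝ) (a b : ℝ) : Prop where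
  left : ContinuousOn L (Icc a b)
  right : ContinuousOn R (Icc a b)
  lt : ∀ h ∈ Icc a b, L h < R h
  prog : ∀ h ∈ Icc a b, ∀ θ ∈ Icc (L h) (R h), IsLocallyProgressive D θ h
  left_empty : ∀ h ∈ Icc a b, D (L h) h = .empty
  right_empty : ∀ h ∈ Icc a b, D (R h) h = .empty

theorem IsPlanar.exists_isWallMovie (hP : IsPlanar D L R a b) {h : ℝ} (hh : h ∈ Icc a b) :
    ∃ W, IsWallMovie D L R a b h W := by
  obtain ⟨W, hW⟩ := exists_isMovie (hP.lt h hh).le (hP.prog h hh) (hP.left_empty h hh)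
    (hP.right_empty h hh)
  have hlt := hP.lt h hh
  have h1 := eventually_wall_empty (hP.left h hh) (hP.prog h hh _ ⟨le_rfl, hlt.le⟩)
    (hP.left_empty h hh)
  have h2 := eventually_wall_empty (hP.right h hh) (hP.prog h hh _ ⟨hlt.le, le_rfl⟩)
    (hP.right_empty h hh)
  have h3 := (hP.left h hh).eventually (eventually_lt_nhds hlt)
  have key : ∀ᶠ t in 𝓝 h, t ∈ Icc a b → ∀ V, IsLevel (D · t) (L h) (R h) V →
      IsLevel (D · t) (L t) (R t) V := by
    rw [← eventually_nhdsWithin_iff]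
    filter_upwards [h1, h2, h3, eventually_mem_nhdsWithin] with t t1 t2 t3 t4 V hV
    exact hV.move t1 t2 t3.le (hP.lt t t4).le
  refine ⟨W, hW.level, ?_, ?_⟩
  · filter_upwards [hW.below, key.filter_mono nhdsWithin_le_nhds, eventually_mem_nhdsWithin]
      with t t1 t2 t3 t4
    exact t2 ⟨t4, (show t < h from t3).le.trans hh.2⟩ _ t1
  · filter_upwards [hW.above, key.filter_mono nhdsWithin_le_nhds, eventually_mem_nhdsWithin]
      with t t1 t2 t3 t4
    exact t2 ⟨hh.1.trans (show h < t from t3).le, t4⟩ _ t1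

theorem IsPlanar.mono (hP : IsPlanar D L R a b) {a' b' : ℝ} (ha : a ≤ a') (hb : b' ≤ b) :
    IsPlanar D L R a' b' := by
  have hsub : Icc a' b' ⊆ Icc a b := Icc_subset_Icc ha hb
  exact ⟨hP.left.mono hsub, hP.right.mono hsub, fun h hh => hP.lt h (hsub hh),
    fun h hh => hP.prog h (hsub hh), fun h hh => hP.left_empty h (hsub hh),
    fun h hh => hP.right_empty h (hsub hh)⟩

theorem IsStepRel.isSec_slab (hs : IsStepRel fst step) {h : ℝ} {e e' : σ}
    (hW : IsLevel (D · h) (L h) (R h) W) (hb : ∀ t ∈ Ico a h, IsLevel (D · t) (L t) (R t) (edges (insW W)))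
    (ht : ∀ t ∈ Ioc h b, IsLevel (D · t) (L t) (R t) (edges (outsW W))) (he : step W e e') :
    IsSec step D L R a b (fun t => if t ≤ h then e else e') := by
  intro x hx
  rcases lt_trichotomy x h with hxh | rfl | hxh
  · have h1 : step (edges (insW W)) e e := hs.fst_eq he ▸ hs.edges_self e
    refine ⟨_, hb x ⟨hx.1, hxh⟩, ⟨e, by simpa [hxh.le] using h1⟩, ?_, ?_⟩
    · filter_upwards [eventually_mem_nhdsWithin] with t ht _
      simp [hxh.le, (show t < x from ht).le.trans hxh.le]
    · filter_upwards [Ioo_mem_nhdsGT hxh] with t ht _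
      simpa [hxh.le, ht.2.le] using h1
  · refine ⟨W, hW, ⟨e', by simpa using he⟩, ?_, ?_⟩
    · filter_upwards [eventually_mem_nhdsWithin] with t ht _
      simp [(show t < x from ht).le]
    · filter_upwards [eventually_mem_nhdsWithin] with t ht _
      simpa [not_le.2 (show x < t from ht)] using he
  · have h1 : step (edges (outsW W)) e' e' := hs.snd_eq he ▸ hs.edges_self e'
    refine ⟨_, ht x ⟨hxh, hx.2⟩, ⟨e', by simpa [not_le.2 hxh] using h1⟩, ?_, ?_⟩
    · filter_upwards [Ioo_mem_nhdsLT hxh] with t ht _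
      simp [not_le.2 hxh, not_le.2 ht.1]
    · filter_upwards [eventually_mem_nhdsWithin] with t ht _
      simpa [not_le.2 hxh, not_le.2 (hxh.trans ht)] using h1

theorem exists_Ioc_of_nhdsGT {p : ℝ → Prop} {x b : ℝ} (hx : x < b) (h : ∀ᶠ t in 𝓝[>] x, p t) :
    ∀ᶠ y in 𝓝[>] x, y < b ∧ x < y ∧ ∀ t ∈ Ioc x y, p t := by
  obtain ⟨c, hc, hc'⟩ := (mem_nhdsGT_iff_exists_Ioo_subset' hx).1 h
  filter_upwards [Ioo_mem_nhdsGT (lt_min hx hc)] with y hy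
  exact ⟨hy.2.trans_le (min_le_left _ _), hy.1, fun t ht =>
    hc' ⟨ht.1, ht.2.trans_lt (hy.2.trans_le (min_le_right _ _))⟩⟩

theorem exists_Ico_of_nhdsLT {p : ℝ → Prop} {x a : ℝ} (hx : a < x) (h : ∀ᶠ t in 𝓝[<] x, p t) :
    ∃ y, a < y ∧ y < x ∧ ∀ t ∈ Ico y x, p t := by
  obtain ⟨c, hc, hc'⟩ := (mem_nhdsLT_iff_exists_Ioo_subset' hx).1 h
  obtain ⟨y, hy1, hy2⟩ := exists_between (max_lt hx hc)
  exact ⟨y, (le_max_left _ _).trans_lt hy1, hy2, fun t ht =>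
    hc' ⟨((le_max_right _ _).trans_lt hy1).trans_le ht.1, ht.2⟩⟩

theorem IsPlanar.exists_isSec (hs : IsStepRel fst step) (hP : IsPlanar D L R a b) (hab : a ≤ b)
    (hW : IsLevel (D · a) (L a) (R a) W) {e : σ} (he : fst e = insW W) :
    ∃ P, IsSec step D L R a b P ∧ P a = e := by
  refine Icc_induction (a := a) (b := b) (P := fun x => ∃ P, IsSec step D L R a x P ∧ P a = e)
    ?_ (fun x hx ih => ?_) (fun x hx ih => ?_) b ⟨hab, le_rfl⟩
  · obtain ⟨e', he'⟩ := hs.exists_step he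
    exact ⟨_, hs.isSec_slab (h := a) hW (fun t ht => absurd ht.1 (not_le.2 ht.2))
      (fun t ht => absurd ht.1 (not_lt.2 ht.2)) he', by simp⟩
  · obtain ⟨V, hV⟩ := hP.exists_isWallMovie ⟨hx.1.le, hx.2⟩
    obtain ⟨y, hy1, hy2, hy3⟩ := exists_Ico_of_nhdsLT hx.1 hV.below
    obtain ⟨P, hP1, hP2⟩ := ih y ⟨hy1.le, hy2⟩
    obtain ⟨V', h1, ⟨e', h2⟩, -⟩ := hP1 y ⟨hy1.le, le_rfl⟩
    obtain rfl := h1.unique (hy3 y ⟨le_rfl, hy2⟩ hy1.le)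
    have h3 := hs.fst_eq h2
    rw [insW_edges] at h3
    obtain ⟨e'', h4⟩ := hs.exists_step h3
    refine ⟨_, hP1.glue (hs.isSec_slab (h := x) hV.level (fun t ht => hy3 t ht (hy1.le.trans ht.1))
      (fun t ht => absurd ht.1 (not_lt.2 ht.2)) h4) (by simp [hy2.le]), by simpa [hy1.le] using hP2⟩
  · obtain ⟨V, hV⟩ := hP.exists_isWallMovie ⟨hx.1, hx.2.le⟩
    obtain ⟨P, hP1, hP2⟩ := ih x ⟨hx.1, le_rfl⟩
    obtain ⟨V', h1, ⟨e', h2⟩, -⟩ := hP1 x ⟨hx.1, le_rfl⟩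
    obtain rfl := h1.unique hV.level
    filter_upwards [exists_Ioc_of_nhdsGT hx.2 hV.above] with y hy
    exact ⟨_, hP1.glue (hs.isSec_slab (h := x) hV.level (fun t ht => absurd ht.1 (not_le.2 ht.2))
      (fun t ht => hy.2.2 t ht (ht.2.trans hy.1.le)) h2) (by simp), by simpa [hx.1] using hP2⟩

theorem IsStrandFamily.isSec {xs : List C} {u : Fin xs.length → ℝ → ℝ}
    (hb : IsBox L R a b) (hu : IsStrandFamily D L R (Icc a b) xs u) {Z : C} (f : Z ⟶ tens xs) :
    IsSec (fun W => KStep W) D L R a b (fun _ => (⟨xs, f⟩ : KState Z)) := fun x hx =>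
  ⟨_, hu.isLevel hx (hb.2.2.2 x hx), ⟨_, KStep.edges (⟨xs, f⟩ : KState Z)⟩, .of_forall fun _ _ => rfl,
    .of_forall fun _ _ => KStep.edges (⟨xs, f⟩ : KState Z)⟩

theorem IsCorolla.isSec {xs ys : List C} {f : tens xs ⟶ tens ys} (hb : IsBox L R a b)
    (hc : IsCorolla D L R a b xs ys f) : ∃ K : ℝ → KState (tens xs),
      IsSec (fun W => KStep W) D L R a b K ∧ K a = ⟨xs, 𝟙 _⟩ ∧ K b = ⟨ys, f⟩ ∧
      IsLevel (D · a) (L a) (R a) (edges xs) ∧ IsLevel (D · b) (L b) (R b) (edges ys) := by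
  obtain ⟨θ0, h0, ha0, h0b, hl0, h0r, hv, he, ⟨u, hu, hut⟩, ⟨w, hw, hwt⟩⟩ := hc
  have hst : KStep [.vertex xs ys f] wires xs ⟨ys, 𝟙 _ ≫ f⟩ :=
    KStep.single (w := .vertex xs ys f) (𝟙 _)
  rw [Category.id_comp] at hst
  have hi : insW [PointLabel.vertex xs ys f] = xs := append_nil _
  have ho : outsW [PointLabel.vertex xs ys f] = ys := append_nil _
  have hlt : ∀ t ∈ Icc a b, L t < R t := hb.2.2.2
  have h1 : ∀ t ∈ Ico a h0, IsLevel (D · t) (L t) (R t) (edges xs) := fun t ht =>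
    hu.isLevel ht (hlt t ⟨ht.1, ht.2.le.trans h0b.le⟩)
  have h2 : ∀ t ∈ Ioc h0 b, IsLevel (D · t) (L t) (R t) (edges ys) := fun t ht =>
    hw.isLevel ht (hlt t ⟨ha0.le.trans ht.1.le, ht.2⟩)
  refine ⟨_, (KStep.isStepRel (tens xs)).isSec_slab (h := h0) (a := a) (b := b)
    (.single hl0 h0r he hv trivial) ?_ ?_ hst, ?_, ?_, h1 a ⟨le_rfl, ha0⟩, h2 b ⟨h0b, le_rfl⟩⟩
  · rwa [hi]
  · rwa [ho]
  · simp [ha0.le]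
  · simp [not_le.2 h0b]

theorem Eval.isSec {xs ys : List C} {f : tens xs ⟶ tens ys} (h : Eval D L R a b xs ys f) :
    ∃ K : ℝ → KState (tens xs),
      IsSec (fun W => KStep W) D L R a b K ∧ K a = ⟨xs, 𝟙 _⟩ ∧ K b = ⟨ys, f⟩ ∧
      IsLevel (D · a) (L a) (R a) (edges xs) ∧ IsLevel (D · b) (L b) (R b) (edges ys) ∧ a < b := by
  induction h with
  | strands hb hu =>
    exact ⟨_, hu.isSec hb (𝟙 _), rfl, rfl, hu.isLevel ⟨le_rfl, hb.1.le⟩ (hb.2.2.2 _ ⟨le_rfl, hb.1.le⟩),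
      hu.isLevel ⟨hb.1.le, le_rfl⟩ (hb.2.2.2 _ ⟨hb.1.le, le_rfl⟩), hb.1⟩
  | corolla hb hc =>
    obtain ⟨K, h1, h2, h3, h4, h5⟩ := hc.isSec hb
    exact ⟨K, h1, h2, h3, h4, h5, hb.1⟩
  | @hcomp L M R a b xs ys xs' ys' f g hf hg ihf ihg =>
    obtain ⟨K1, h1, h2, h3, h4, h5, h6⟩ := ihf
    obtain ⟨K2, g1, g2, g3, g4, g5, g6⟩ := ihg
    refine ⟨_, (h1.kprod g1).map (KState.pre (tensAppend xs xs').hom) fun W e e' h => h.pre _, ?_,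
      ?_, ?_, ?_, h6⟩
    · rw [h2, g2]
      simp [TwPiv.kprod, KState.pre]
    · rw [h3, g3]; rfl
    · rw [edges_append]; exact h4.append g4
    · rw [edges_append]; exact h5.append g5
  | @vcomp L R a b c xs ys zs f g hf hg ihf ihg =>
    obtain ⟨K1, h1, h2, h3, h4, h5, h6⟩ := ihf
    obtain ⟨K2, g1, g2, g3, g4, g5, g6⟩ := ihg
    refine ⟨_, h1.glue (g1.map (KState.pre f) fun W e e' h => h.pre _) ?_, ?_, ?_, h4, g5,
      h6.trans g6⟩
    · rw [h3, g2]; simp [KState.pre]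
    · simp [h6.le, h2]
    · simp only [not_le.2 g6, if_false, g3]; rfl

end Sections

section Periodic

variable {d : ℝ → PointLabel C} {θ θ' : ℝ}
  {W V : Labels C}

/-- A line of labels of period `2 π`. -/
def IsPeriodic (d : ℝ → PointLabel C) : Prop := ∀ θ, d (θ + 2 * π) = d θ

theorem IsPeriodic.add_zsmul (hd : IsPeriodic d) (θ : ℝ) (n : ℤ) :
    d (θ + n • (2 * π)) = d θ :=
  (show Function.Periodic d (2 * π) from hd).zsmul n θ

theorem IsPeriodic.exists_mem (hd : IsPeriodic d) (θ θ' : ℝ) :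
    ∃ τ ∈ Ico θ (θ + 2 * π), d τ = d θ' := by
  obtain ⟨n, hn, -⟩ := existsUnique_add_zsmul_mem_Ico two_pi_pos θ' θ
  exact ⟨_, hn, hd.add_zsmul θ' n⟩

theorem IsLevel.window_nil (hd : IsPeriodic d) (h : IsLevel d θ (θ + 2 * π) W) (hle : θ ≤ θ')
    (he : ∀ τ ∈ Icc θ θ', d τ = .empty) : IsLevel d θ' (θ' + 2 * π) W := by
  have hpi := two_pi_pos
  rcases le_total θ' (θ + 2 * π) with h1 | h1
  · refine (h.trim_left hle h1 he).extend_right (by linarith) fun τ hτ => ?_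
    rw [← sub_add_cancel τ (2 * π), hd]
    exact he _ ⟨by linarith [hτ.1], by linarith [hτ.2]⟩
  · rw [h.eq_nil fun τ hτ => he τ ⟨hτ.1, hτ.2.trans h1⟩]
    refine .nil (by linarith) fun τ hτ => ?_
    obtain ⟨τ', hτ', h2⟩ := hd.exists_mem θ τ
    rw [← h2]
    exact he _ ⟨hτ'.1, hτ'.2.le.trans h1⟩

theorem IsLevel.window_cons (hd : IsPeriodic d) {θ0 m : ℝ} {w : PointLabel C}
    (h : IsLevel d θ (θ + 2 * π) W) (h1 : θ < θ0) (h2 : θ0 < m)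
    (h3 : ∀ τ ∈ Icc θ m, τ ≠ θ0 → d τ = .empty) (h4 : d θ0 = w) (h5 : w.IsProper) :
    ∃ W', W = w :: W' ∧ IsLevel d m (m + 2 * π) (W' ++ [w]) := by
  have hpi := two_pi_pos
  have hne : d θ0 ≠ .empty := by rw [h4]; rintro rfl; exact h5
  have h6 : θ0 < θ + 2 * π := by
    by_contra! h6
    refine hne ?_
    rw [← sub_add_cancel θ0 (2 * π), hd]
    exact h3 _ ⟨by linarith, by linarith⟩ (by linarith)
  obtain ⟨m', hm1, hm2⟩ := exists_between (lt_min h2 h6)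
  have hm3 := hm2.trans_le (min_le_left _ _)
  have hm4 := hm2.trans_le (min_le_right _ _)
  obtain ⟨W1, W2, rfl, h7, h8⟩ := h.cut ⟨(h1.trans hm1).le, hm4.le⟩
    (h3 m' ⟨(h1.trans hm1).le, hm3.le⟩ hm1.ne')
  have h9 : IsLevel d θ m' [w] :=
    .single h1 hm1 (fun τ hτ => h3 τ ⟨hτ.1, hτ.2.trans hm3.le⟩) h4 h5
  obtain rfl := h7.unique h9
  refine ⟨W2, rfl, (h8.append (h9.shift hd)).window_nil hd hm3.le fun τ hτ => ?_⟩
  exact h3 τ ⟨(h1.trans hm1).le.trans hτ.1, hτ.2⟩ (hm1.trans_le hτ.1).ne'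

/-- The number of edges just below the line `d` between `θ` and `θ'`, with a sign. -/
def count (d : ℝ → PointLabel C) (θ θ' : ℝ) : ℤ :=
  open Classical in
  if h : ∃ W, IsLevel d θ θ' W then ((insW h.choose).length : ℤ)
  else if h : ∃ W, IsLevel d θ' θ W then -((insW h.choose).length : ℤ) else 0

theorem count_of_level (h : IsLevel d θ θ' W) : count d θ θ' = (insW W).length := by
  have h' : ∃ W, IsLevel d θ θ' W := ⟨W, h⟩
  rw [count, dif_pos h', h'.choose_spec.unique h]

theorem count_of_level' (h : IsLevel d θ θ' W) : count d θ' θ = -((insW W).length : ℤ) := by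
  by_cases h' : ∃ W, IsLevel d θ' θ W
  · obtain ⟨W', hW'⟩ := h'
    obtain rfl := le_antisymm h.le hW'.le
    rw [count_of_level hW', hW'.eq_nil fun τ hτ => by rw [le_antisymm hτ.2 hτ.1]; exact h.left_empty,
      h.eq_nil fun τ hτ => by rw [le_antisymm hτ.2 hτ.1]; exact h.left_empty]
    simp [insW]
  · have h2 : ∃ W, IsLevel d θ θ' W := ⟨W, h⟩
    rw [count, dif_neg h', dif_pos h2, h2.choose_spec.unique h]

theorem count_add {θ1 : ℝ} (h : IsLevel d θ θ' V)
    (hex : ∀ τ τ', τ ≤ τ' → d τ = .empty → d τ' = .empty → ∃ W, IsLevel d τ τ' W)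
    (he : d θ1 = .empty) : count d θ1 θ' = count d θ1 θ + (insW V).length := by
  rcases le_total θ1 θ with h1 | h1
  · obtain ⟨W, hW⟩ := hex _ _ h1 he h.left_empty
    rw [count_of_level hW, count_of_level (hW.append h), insW_append, length_append]
    push_cast; rfl
  rcases le_total θ1 θ' with h2 | h2
  · obtain ⟨W1, W2, rfl, h3, h4⟩ := h.cut ⟨h1, h2⟩ he
    rw [count_of_level' h3, count_of_level h4, insW_append, length_append]
    push_cast; ring
  · obtain ⟨W, hW⟩ := hex _ _ h2 h.right_empty he
    rw [count_of_level' hW, count_of_level' (h.append hW), insW_append, length_append]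
    push_cast; ring

end Periodic

section Cyl

variable (γ : GroupLike k H)

open VState

theorem rot_fst (e : VState k H) : (rot γ e).1 = e.1.rotate 1 := by
  obtain ⟨_ | ⟨x, Y⟩, v⟩ := e
  · rfl
  · change Y ++ [x] = (x :: Y).rotate 1
    simp

theorem rot_iterate_fst (n : ℕ) (e : VState k H) : ((rot γ)^[n] e).1 = e.1.rotate n := by
  induction n generalizing e with
  | zero => simp
  | succ n ih => rw [Function.iterate_succ_apply, ih, rot_fst, List.rotate_rotate, add_comm]

theorem step_transfer {d : ℝ → PointLabel 𝓜} (hd : IsPeriodic d) {θ θ' : ℝ}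
    {V W W' : Labels 𝓜} {e e' : VState k H} (hV : IsLevel d θ θ' V)
    (hW : IsLevel d θ (θ + 2 * π) W) (hW' : IsLevel d θ' (θ' + 2 * π) W')
    (h : Step W e e') :
    Step W' ((rot γ)^[(insW V).length] e) ((rot γ)^[(outsW V).length] e') := by
  induction hV generalizing W e e' with
  | nil hle he =>
    obtain rfl := (hW.window_nil hd hle he).unique hW'
    exact h
  | cons h1 h2 h3 h4 h5 h6 ih =>
    obtain ⟨W'', rfl, h7⟩ := hW.window_cons hd h1 h2 h3 h4 h5
    have := ih h7 hW' (h.rotate γ)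
    simp only [insW, outsW, length_append]
    rwa [add_comm, Function.iterate_add_apply, add_comm, Function.iterate_add_apply]

theorem step_transfer_inv {d : ℝ → PointLabel 𝓜} (hd : IsPeriodic d) {θ θ' : ℝ}
    {V W W' : Labels 𝓜} {e e' : VState k H} (hV : IsLevel d θ θ' V)
    (hW : IsLevel d θ (θ + 2 * π) W) (hW' : IsLevel d θ' (θ' + 2 * π) W')
    (h : Step W' ((rot γ)^[(insW V).length] e) ((rot γ)^[(outsW V).length] e')) :
    Step W e e' := by
  obtain ⟨f, hf⟩ := Step.exists (e := (⟨insW W, 0⟩ : VState k H)) (W := W) rfl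
  have h1 := (step_transfer γ hd hV hW hW' hf).fst
  have h2 := h.fst
  rw [rot_iterate_fst] at h1 h2
  have h3 : insW W = e.1 := List.rotate_injective _ (h1.trans h2.symm)
  obtain ⟨e'', he''⟩ := Step.exists h3.symm
  have h4 := (step_transfer γ hd hV hW hW' he'').unique h
  rwa [((rot γ).injective.iterate _) h4] at he''

/-- A progressive diagram on a cylinder. -/
structure IsCylDiagram (D : Plan 𝓜) (a b : ℝ) : Prop where
  periodic (h : ℝ) : IsPeriodic (D · h)
  prog : ∀ h ∈ Icc a b, ∀ θ, IsLocallyProgressive D θ h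

/-- The states `S θ h` of the levels of the diagram `D` on the cylinder, cut open at the longitude
`θ`, evolve according to `D`, and `γ` is the monodromy. -/
structure IsCylSec (D : Plan 𝓜) (a b : ℝ) (S : ℝ → ℝ → VState k H) :
    Prop where
  loc : ∀ h ∈ Icc a b, ∀ θ W, IsLevel (D · h) θ (θ + 2 * π) W →
    (S θ h).1 = insW W ∧ (∀ᶠ t in 𝓝[<] h, a ≤ t → S θ t = S θ h) ∧
      ∀ᶠ t in 𝓝[>] h, t ≤ b → Step W (S θ h) (S θ t)
  rotate : ∀ h ∈ Icc a b, ∀ θ θ' W, IsLevel (D · h) θ θ' W →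
    S θ' h = (rot γ)^[(insW W).length] (S θ h)

variable {γ} {D : Plan (FDMod k H)} {a b c h : ℝ} {S S' : ℝ → ℝ → VState k H}

namespace IsCylDiagram

theorem mono (hD : IsCylDiagram D a b) {a' b' : ℝ} (ha : a ≤ a') (hb : b' ≤ b) :
    IsCylDiagram D a' b' :=
  ⟨hD.periodic, fun h hh => hD.prog h ⟨ha.trans hh.1, hh.2.trans hb⟩⟩

theorem exists_empty (hD : IsCylDiagram D a b) (hh : h ∈ Icc a b) (θ0 : ℝ) {ε : ℝ} (hε : 0 < ε) :
    ∃ θ ∈ Ioo θ0 (θ0 + ε), D θ h = .empty := by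
  obtain ⟨δ, hδ, h1, -⟩ := (hD.prog h hh θ0).isIsolated
  obtain ⟨θ, h2, h3⟩ := exists_between (lt_min (lt_add_of_pos_right θ0 hδ) (lt_add_of_pos_right θ0 hε))
  exact ⟨θ, ⟨h2, h3.trans_le (min_le_right _ _)⟩, h1 θ ⟨by linarith, h3.trans_le (min_le_left _ _)⟩ h2.ne'⟩

theorem exists_movie (hD : IsCylDiagram D a b) (hh : h ∈ Icc a b) {θ θ' : ℝ} (hle : θ ≤ θ')
    (h1 : D θ h = .empty) (h2 : D θ' h = .empty) : ∃ W, IsMovie D θ θ' h W :=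
  exists_isMovie hle (fun θ _ => hD.prog h hh θ) h1 h2

theorem exists_level (hD : IsCylDiagram D a b) (hh : h ∈ Icc a b) {θ θ' : ℝ} (hle : θ ≤ θ')
    (h1 : D θ h = .empty) (h2 : D θ' h = .empty) : ∃ W, IsLevel (D · h) θ θ' W := by
  obtain ⟨W, hW⟩ := hD.exists_movie hh hle h1 h2
  exact ⟨W, hW.level⟩

theorem exists_window_movie (hD : IsCylDiagram D a b) (hh : h ∈ Icc a b) {θ : ℝ}
    (h1 : D θ h = .empty) : ∃ W, IsMovie D θ (θ + 2 * π) h W :=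
  hD.exists_movie hh (by linarith [two_pi_pos]) h1 ((hD.periodic h θ).trans h1)

theorem exists_window (hD : IsCylDiagram D a b) (hh : h ∈ Icc a b) {θ : ℝ}
    (h1 : D θ h = .empty) : ∃ W, IsLevel (D · h) θ (θ + 2 * π) W := by
  obtain ⟨W, hW⟩ := hD.exists_window_movie hh h1
  exact ⟨W, hW.level⟩

theorem eventually_empty (hD : IsCylDiagram D a b) (hh : h ∈ Icc a b) {θ : ℝ}
    (h1 : D θ h = .empty) : ∀ᶠ t in 𝓝 h, D θ t = .empty := by
  have := (hD.prog h hh θ).empty_nhds h1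
  exact (Continuous.prodMk_right θ).continuousAt.eventually this

end IsCylDiagram

namespace IsCylSec

theorem mono (hS : IsCylSec γ D a b S) {a' b' : ℝ} (ha : a ≤ a') (hb : b' ≤ b) :
    IsCylSec γ D a' b' S where
  loc h hh θ W hW := by
    obtain ⟨h1, h2, h3⟩ := hS.loc h ⟨ha.trans hh.1, hh.2.trans hb⟩ θ W hW
    exact ⟨h1, h2.mono fun t ht h => ht (ha.trans h), h3.mono fun t ht h => ht (h.trans hb)⟩
  rotate h hh := hS.rotate h ⟨ha.trans hh.1, hh.2.trans hb⟩

theorem congr {D' : Plan 𝓜} (hS : IsCylSec γ D a b S)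
    (hD : ∀ h ∈ Icc a b, ∀ θ, D θ h = D' θ h) : IsCylSec γ D' a b S where
  loc h hh θ W hW := hS.loc h hh θ W (hW.congr fun θ _ => (hD h hh θ).symm)
  rotate h hh θ θ' W hW := hS.rotate h hh θ θ' W (hW.congr fun θ _ => (hD h hh θ).symm)

theorem rel_rotate {ι : Type*} {γ : ι → GroupLike k H} {S : ι → ℝ → ℝ → VState k H}
    {r : (ι → VState k H) → Prop} (hr : ∀ e, r e ↔ r fun i => rot (γ i) (e i))
    (hD : IsCylDiagram D a b) (hS : ∀ i, IsCylSec (γ i) D a b (S i)) (hh : h ∈ Icc a b)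
    {θ0 θ : ℝ} (h0 : D θ0 h = .empty) (h1 : D θ h = .empty) (hrel : r fun i => S i θ0 h) :
    r fun i => S i θ h := by
  have hit : ∀ (n : ℕ) e, r e ↔ r fun i => (rot (γ i))^[n] (e i) := fun n => by
    induction n with
    | zero => exact fun e => Iff.rfl
    | succ n ih => exact fun e => (hr e).trans (ih _)
  rcases le_total θ0 θ with hle | hle
  · obtain ⟨W, hW⟩ := hD.exists_level hh hle h0 h1
    rw [show (fun i => S i θ h) = _ from funext fun i => (hS i).rotate h hh _ _ W hW]
    exact (hit _ _).1 hrel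
  · obtain ⟨W, hW⟩ := hD.exists_level hh hle h1 h0
    rw [show (fun i => S i θ0 h) = _ from funext fun i => (hS i).rotate h hh _ _ W hW] at hrel
    exact (hit _ _).2 hrel

theorem rel {ι : Type*} [Finite ι] {γ : ι → GroupLike k H} {S : ι → ℝ → ℝ → VState k H}
    {r : (ι → VState k H) → Prop} (hr : ∀ e, r e ↔ r fun i => rot (γ i) (e i))
    (hst : ∀ W e e', r e → (∀ i, Step W (e i) (e' i)) → r e') (hD : IsCylDiagram D a b)
    (hS : ∀ i, IsCylSec (γ i) D a b (S i)) {θ0 : ℝ} (h0 : D θ0 a = .empty)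
    (hrel : r fun i => S i θ0 a) : ∀ h ∈ Icc a b, ∀ θ, D θ h = .empty → r fun i => S i θ h := by
  have hab : ∀ x ∈ Icc a b, a ∈ Icc a b := fun x hx => ⟨le_rfl, hx.1.trans hx.2⟩
  intro x hx
  refine Icc_induction (P := fun h => ∀ θ, D θ h = .empty → r fun i => S i θ h)
    (fun θ hθ => rel_rotate hr hD hS (hab x hx) h0 hθ hrel) (fun x hx ih θ hθ => ?_)
    (fun x hx ih => ?_) x hx
  · have hx' : x ∈ Icc a b := ⟨hx.1.le, hx.2⟩
    obtain ⟨W, hW⟩ := hD.exists_window hx' hθ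
    obtain ⟨t, h1, h2, h3⟩ := ((eventually_all.2 fun i => ((hS i).loc x hx' θ W hW).2.1).and
      ((show ∀ᶠ t in 𝓝[<] x, t ∈ Ioo a x from Ioo_mem_nhdsLT hx.1).and
        ((hD.eventually_empty hx' hθ).filter_mono nhdsWithin_le_nhds))).exists
    rw [show (fun i => S i θ x) = _ from funext fun i => (h1 i h2.1.le).symm]
    exact ih t ⟨h2.1.le, h2.2⟩ θ h3
  · have hx' : x ∈ Icc a b := ⟨hx.1, hx.2.le⟩
    obtain ⟨θ, -, hθ⟩ := hD.exists_empty hx' 0 one_pos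
    obtain ⟨W, hW⟩ := hD.exists_window hx' hθ
    filter_upwards [eventually_all.2 fun i => ((hS i).loc x hx' θ W hW).2.2, Ioo_mem_nhdsGT hx.2,
      (hD.eventually_empty hx' hθ).filter_mono nhdsWithin_le_nhds] with t h1 h2 h3 θ' hθ'
    exact rel_rotate hr hD hS ⟨hx.1.trans h2.1.le, h2.2.le⟩ h3 hθ'
      (hst W _ _ (ih x ⟨hx.1, le_rfl⟩ θ hθ) fun i => h1 i h2.2.le)

theorem unique (hD : IsCylDiagram D a b) (hS : IsCylSec γ D a b S) (hS' : IsCylSec γ D a b S')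
    {θ0 : ℝ} (h0 : D θ0 a = .empty) (he : S θ0 a = S' θ0 a) :
    ∀ h ∈ Icc a b, ∀ θ, D θ h = .empty → S θ h = S' θ h :=
  rel (ι := Bool) (γ := fun _ => γ) (S := fun i => bif i then S else S')
    (r := fun e => e true = e false) (fun e => (rot γ).injective.eq_iff.symm)
    (fun W e e' he h => (he ▸ h true).unique (h false)) hD (by rintro (_ | _) <;> assumption) h0 he

theorem eq_of_eq (hD : IsCylDiagram D a b) (hS : IsCylSec γ D a b S) (hS' : IsCylSec γ D a b S')
    {θ0 θ : ℝ} (hh : h ∈ Icc a b) (h0 : D θ0 h = .empty) (h1 : D θ h = .empty)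
    (he : S θ0 h = S' θ0 h) : S θ h = S' θ h :=
  unique (hD.mono hh.1 hh.2) (hS.mono hh.1 hh.2) (hS'.mono hh.1 hh.2) h0 he h ⟨le_rfl, le_rfl⟩ θ h1

theorem glue (hD : IsCylDiagram D a b) (hac : a ≤ c) (hcb : c ≤ b) (hS : IsCylSec γ D a c S)
    (hS' : IsCylSec γ D c b S') {θ0 : ℝ} (h0 : D θ0 c = .empty) (he : S θ0 c = S' θ0 c) :
    IsCylSec γ D a b (fun θ h => if h ≤ c then S θ h else S' θ h) := by
  have hc : ∀ θ, D θ c = .empty → S θ c = S' θ c := fun θ hθ =>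
    eq_of_eq (hD.mono hac hcb) (hS.mono hac le_rfl) (hS'.mono le_rfl hcb) ⟨le_rfl, le_rfl⟩ h0 hθ he
  have hl : ∀ x, x ≤ c → ∀ᶠ t in 𝓝[<] x, t ≤ c := fun x hx =>
    eventually_mem_nhdsWithin.mono fun t ht => (show t < x from ht).le.trans hx
  have hr : ∀ x, c ≤ x → ∀ᶠ t in 𝓝[>] x, ¬ t ≤ c := fun x hx =>
    eventually_mem_nhdsWithin.mono fun t ht => not_le.2 (hx.trans_lt ht)
  refine ⟨fun x hx θ W hW => ?_, fun x hx θ θ' W hW => ?_⟩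
  · rcases lt_trichotomy x c with hxc | rfl | hxc
    · obtain ⟨h1, h2, h3⟩ := hS.loc x ⟨hx.1, hxc.le⟩ θ W hW
      refine ⟨by simpa [hxc.le] using h1, ?_, ?_⟩
      · filter_upwards [h2, hl x hxc.le] with t ht htc
        simpa [htc, hxc.le] using ht
      · filter_upwards [h3, Ioo_mem_nhdsGT hxc] with t ht htc _
        simpa [htc.2.le, hxc.le] using ht htc.2.le
    · obtain ⟨h1, h2, -⟩ := hS.loc x ⟨hx.1, le_rfl⟩ θ W hW
      obtain ⟨-, -, h3⟩ := hS'.loc x ⟨le_rfl, hx.2⟩ θ W hW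
      refine ⟨by simpa using h1, ?_, ?_⟩
      · filter_upwards [h2, hl x le_rfl] with t ht htc
        simpa [htc] using ht
      · filter_upwards [h3, hr x le_rfl] with t ht htc
        simpa [htc, hc θ hW.left_empty] using ht
    · obtain ⟨h1, h2, h3⟩ := hS'.loc x ⟨hxc.le, hx.2⟩ θ W hW
      refine ⟨by simpa [not_le.2 hxc] using h1, ?_, ?_⟩
      · filter_upwards [h2, Ioo_mem_nhdsLT hxc] with t ht htc _
        simpa [not_le.2 htc.1, not_le.2 hxc] using ht htc.1.le
      · filter_upwards [h3, hr x hxc.le] with t ht htc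
        simpa [htc, not_le.2 hxc] using ht
  · rcases le_or_gt x c with hxc | hxc
    · simpa [hxc] using hS.rotate x ⟨hx.1, hxc⟩ θ θ' W hW
    · simpa [not_le.2 hxc] using hS'.rotate x ⟨hxc.le, hx.2⟩ θ θ' W hW

end IsCylSec

variable (γ) in
theorem IsCylDiagram.exists_slab (hD : IsCylDiagram D a b) (hh : h ∈ Icc a b) {θ1 : ℝ}
    {W : Labels 𝓜} (hW : IsLevel (D · h) θ1 (θ1 + 2 * π) W)
    (hb : ∀ t ∈ Ico a h, IsLevel (D · t) θ1 (θ1 + 2 * π) (edges (insW W)))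
    (ht : ∀ t ∈ Ioc h b, IsLevel (D · t) θ1 (θ1 + 2 * π) (edges (outsW W)))
    {e : VState k H} (he : e.1 = insW W) :
    ∃ S, IsCylSec γ D a b S ∧ ∀ t ∈ Icc a h, S θ1 t = e := by
  obtain ⟨e', he'⟩ := Step.exists he
  have hsec := VState.Step.isStepRel.isSec_slab (L := fun _ => θ1) (R := fun _ => θ1 + 2 * π)
    hW hb ht he'
  set base : ℝ → VState k H := fun t => if t ≤ h then e else e' with hbase
  have hemp : ∀ t ∈ Icc a b, D θ1 t = .empty := fun t ht => by
    obtain ⟨V, hV, -⟩ := hsec t ht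
    exact hV.left_empty
  have hiter : ∀ (n : ℕ) (f : VState k H), ((rot γ) ^ (n : ℤ)) f = (rot γ)^[n] f := fun n f => by
    rw [zpow_natCast, Equiv.Perm.iterate_eq_pow]
  have hiter' : ∀ (n : ℕ) (f : VState k H), (rot γ)^[n] (((rot γ) ^ (-(n : ℤ))) f) = f :=
    fun n f => by rw [← hiter, ← Equiv.Perm.mul_apply, ← zpow_add, add_neg_cancel]; simp
  refine ⟨fun θ t => ((rot γ) ^ (count (D · t) θ1 θ)) (base t), ⟨fun x hx θ V hV => ?_,
    fun x hx θ θ' V hV => ?_⟩, fun t ht => ?_⟩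
  · obtain ⟨Wx, hWx, ⟨f, hf⟩, hl, hr⟩ := hsec x hx
    rcases le_total θ1 θ with hle | hle
    · obtain ⟨U, hU⟩ := hD.exists_movie hx hle (hemp x hx) hV.left_empty
      have key : ∀ f, Step Wx (base x) f → Step V (((rot γ) ^ (count (D · x) θ1 θ)) (base x))
          ((rot γ)^[(outsW U).length] f) := fun f hf => by
        rw [count_of_level hU.level, hiter]
        exact step_transfer γ (hD.periodic x) hU.level hWx hV hf
      refine ⟨(key f hf).fst, ?_, ?_⟩
      · filter_upwards [hl, hU.below] with t h1 h2 h3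
        rw [h1 h3, count_of_level h2, count_of_level hU.level, insW_edges]
      · filter_upwards [hr, hU.above] with t h1 h2 h3
        rw [count_of_level h2, insW_edges, hiter]
        exact key _ (h1 h3)
    · obtain ⟨U, hU⟩ := hD.exists_movie hx hle hV.left_empty (hemp x hx)
      have key : ∀ f, Step Wx (base x) f → Step V (((rot γ) ^ (count (D · x) θ1 θ)) (base x))
          (((rot γ) ^ (-((outsW U).length : ℤ))) f) := fun f hf => by
        rw [count_of_level' hU.level]
        refine step_transfer_inv γ (hD.periodic x) hU.level hV hWx ?_
        rwa [hiter', hiter']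
      refine ⟨(key f hf).fst, ?_, ?_⟩
      · filter_upwards [hl, hU.below] with t h1 h2 h3
        rw [h1 h3, count_of_level' h2, count_of_level' hU.level, insW_edges]
      · filter_upwards [hr, hU.above] with t h1 h2 h3
        rw [count_of_level' h2, insW_edges]
        exact key _ (h1 h3)
  · rw [count_add hV (fun τ τ' h1 h2 h3 => hD.exists_level hx h1 h2 h3) (hemp x hx), add_comm,
      zpow_add, Equiv.Perm.mul_apply, hiter]
  · have h1 : IsLevel (D · t) θ1 θ1 [] :=
      .nil le_rfl fun τ hτ => by rw [le_antisymm hτ.2 hτ.1]; exact hemp t ⟨ht.1, ht.2.trans hh.2⟩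
    simp [count_of_level h1, insW, hbase, ht.2]

variable (γ) in
theorem IsCylDiagram.exists_isCylSec (hD : IsCylDiagram D a b) (hab : a ≤ b) {θ0 : ℝ}
    {W : Labels 𝓜} (hW : IsLevel (D · a) θ0 (θ0 + 2 * π) W)
    {e : VState k H} (he : e.1 = insW W) : ∃ S, IsCylSec γ D a b S ∧ S θ0 a = e := by
  refine Icc_induction (a := a) (b := b) (P := fun x => ∃ S, IsCylSec γ D a x S ∧ S θ0 a = e)
    ?_ (fun x hx ih => ?_) (fun x hx ih => ?_) b ⟨hab, le_rfl⟩
  · obtain ⟨S, h1, h2⟩ := (hD.mono le_rfl hab).exists_slab γ (h := a) ⟨le_rfl, le_rfl⟩ hW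
      (fun t ht => absurd ht.1 (not_le.2 ht.2)) (fun t ht => absurd ht.1 (not_lt.2 ht.2)) he
    exact ⟨S, h1, h2 a ⟨le_rfl, le_rfl⟩⟩
  · have hx' : x ∈ Icc a b := ⟨hx.1.le, hx.2⟩
    obtain ⟨θ1, -, hθ1⟩ := hD.exists_empty hx' 0 one_pos
    obtain ⟨V, hV⟩ := hD.exists_window_movie hx' hθ1
    obtain ⟨y, hy1, hy2, hy3⟩ := exists_Ico_of_nhdsLT hx.1 hV.below
    obtain ⟨S, hS1, hS2⟩ := ih y ⟨hy1.le, hy2⟩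
    have hy := hy3 y ⟨le_rfl, hy2⟩
    have h1 := (hS1.loc y ⟨hy1.le, le_rfl⟩ θ1 _ hy).1
    rw [insW_edges] at h1
    obtain ⟨S', h2, h3⟩ := (hD.mono hy1.le hx.2).exists_slab γ (h := x) ⟨hy2.le, le_rfl⟩ hV.level hy3
      (fun t ht => absurd ht.1 (not_lt.2 ht.2)) h1
    exact ⟨_, hS1.glue (hD.mono le_rfl hx.2) hy1.le hy2.le h2 hy.left_empty
      (h3 y ⟨le_rfl, hy2.le⟩).symm, by simpa [hy1.le] using hS2⟩
  · have hx' : x ∈ Icc a b := ⟨hx.1, hx.2.le⟩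
    obtain ⟨θ1, -, hθ1⟩ := hD.exists_empty hx' 0 one_pos
    obtain ⟨V, hV⟩ := hD.exists_window_movie hx' hθ1
    obtain ⟨S, hS1, hS2⟩ := ih x ⟨hx.1, le_rfl⟩
    have h1 := (hS1.loc x ⟨hx.1, le_rfl⟩ θ1 _ hV.level).1
    filter_upwards [exists_Ioc_of_nhdsGT hx.2 hV.above] with y hy
    obtain ⟨S', h2, h3⟩ := (hD.mono hx.1 hy.1.le).exists_slab γ (h := x) ⟨le_rfl, hy.2.1.le⟩ hV.level
      (fun t ht => absurd ht.1 (not_le.2 ht.2)) hy.2.2 h1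
    exact ⟨_, hS1.glue (hD.mono le_rfl hy.1.le) hx.1 hy.2.1.le h2 hθ1
      (h3 x ⟨le_rfl, le_rfl⟩).symm, by simpa [hx.1] using hS2⟩

theorem IsCylSec.isSec (hD : IsCylDiagram D a b) (hS : IsCylSec γ D a b S) {L : ℝ → ℝ}
    (hL : ContinuousOn L (Icc a b)) (he : ∀ h ∈ Icc a b, D (L h) h = .empty) :
    IsSec Step D L (fun h => L h + 2 * π) a b (fun h => S (L h) h) := by
  intro x hx
  obtain ⟨W, hW⟩ := hD.exists_window hx (he x hx)
  obtain ⟨h1, h2, h3⟩ := hS.loc x hx _ W hW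
  have key : ∀ᶠ t in 𝓝 x, t ∈ Icc a b → S (L t) t = S (L x) t := by
    rw [← eventually_nhdsWithin_iff]
    filter_upwards [eventually_wall_empty (hL x hx) (hD.prog x hx _) (he x hx),
      eventually_mem_nhdsWithin] with t t1 t2
    rcases le_total (L x) (L t) with hle | hle
    · rw [uIcc_of_le hle] at t1
      exact hS.rotate t t2 _ _ [] (.nil hle t1)
    · rw [uIcc_of_ge hle] at t1
      exact (hS.rotate t t2 _ _ [] (.nil hle t1)).symm
  refine ⟨W, hW, Step.exists h1, ?_, ?_⟩
  · filter_upwards [h2, key.filter_mono nhdsWithin_le_nhds, eventually_mem_nhdsWithin]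
      with t t1 t2 t3 t4
    rw [t2 ⟨t4, (show t < x from t3).le.trans hx.2⟩, t1 t4]
  · filter_upwards [h3, key.filter_mono nhdsWithin_le_nhds, eventually_mem_nhdsWithin]
      with t t1 t2 t3 t4
    rw [t2 ⟨hx.1.trans (show x < t from t3).le, t4⟩]
    exact t1 t4

theorem IsCylSec.eq_app (hD : IsCylDiagram D a b) (hS : IsCylSec γ D a b S) {L : ℝ → ℝ}
    (hL : ContinuousOn L (Icc a b)) {Z : 𝓜} {K : ℝ → KState Z}
    (hK : IsSec (fun W => KStep W) D L (fun h => L h + 2 * π) a b K) {z : Z.carrier}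
    (ha : S (L a) a = app (K a) z) : ∀ h ∈ Icc a b, S (L h) h = app (K h) z := by
  refine (hS.isSec hD hL fun h hh => ?_).unique VState.Step.isStepRel
    (hK.map (fun K => app K z) fun W e e' h => Step.of_kStep h z) ha
  obtain ⟨W, hW, -⟩ := hK h hh
  exact hW.left_empty

end Cyl

section Rotation

variable (γ : GroupLike k H)

open VState

/-- The map `v ⊗ w ↦ w ⊗ γ v`. -/
def swapAct (V W : 𝓜) : (V ⊗ W).carrier →ₗ[k] (W ⊗ V).carrier :=
  (tcomm k V.carrier W.carrier).toLinearMap ∘ₗ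
    tmap (V.ρ γ.val) LinearMap.id

/-- The canonical isomorphism that appends an object to a word. -/
def snoc (Y : List 𝓜) (x : 𝓜) : tens Y ⊗ x ≅ tens (Y ++ [x]) :=
  whiskerLeftIso (tens Y) (ρ_ x).symm ≪≫ (tensAppend Y [x]).symm

/-- The rotation of the words that start with a given letter. -/
def rotT (x : 𝓜) (Y : List 𝓜) :
    (tens (x :: Y)).carrier →ₗ[k] (tens (Y ++ [x])).carrier := rotL γ x Y

theorem rot_eq_rotT (x : 𝓜) (Y : List 𝓜) (v : (tens (x :: Y)).carrier) :
    rot γ ⟨x :: Y, v⟩ = ⟨Y ++ [x], rotT γ x Y v⟩ := rfl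

theorem rotT_eq (x : 𝓜) (Y : List 𝓜) (v : (tens (x :: Y)).carrier) :
    rotT γ x Y v = (snoc Y x).hom.toLin (swapAct γ x (tens Y) v) := by
  have h : rotL γ x Y = (snoc Y x).hom.toLin ∘ₗ swapAct γ x (tens Y) :=
    TensorProduct.ext' fun a b => rfl
  exact lcongr h v

theorem rot_iff {p : VState k H → Prop} (hp : ∀ e, p e → p (rot γ e))
    (hγ : ∀ X v, p ⟨X, (tens X).ρ γ.val v⟩ → p ⟨X, v⟩) (e : VState k H) : p e ↔ p (rot γ e) := by
  refine ⟨hp e, fun h => ?_⟩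
  obtain ⟨_ | ⟨x, Y⟩, v⟩ := e
  · exact h
  · refine hγ _ _ ?_
    rw [← rot_full, List.length_cons, Function.iterate_succ_apply]
    generalize rot γ ⟨x :: Y, v⟩ = f at h
    induction Y.length generalizing f with
    | zero => exact h
    | succ n ih => exact ih _ (hp _ h)

end Rotation

/-- Vectors on which `H` acts by the character `χ`. -/
def IsInvVec (χ : H →ₐ[k] k) {V : 𝓜} (v : V.carrier) : Prop := ∀ h, V.ρ h v = χ h • v

/-- Functionals on which `H` acts by the character `ψ`. -/
def IsInvFun (ψ : H →ₐ[k] k) {V : 𝓜} (f : V.carrier →ₗ[k] k) : Prop :=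
  ∀ h v, f (V.ρ h v) = ψ h * f v

/-- Vectors on which all functionals on which `H` acts by `ψ` vanish. -/
def IsRadVec (ψ : H →ₐ[k] k) {V : 𝓜} (v : V.carrier) : Prop :=
  ∀ f : V.carrier →ₗ[k] k, IsInvFun ψ f → f v = 0

theorem IsInvVec.map {χ : H →ₐ[k] k} {V W : 𝓜} {v : V.carrier} (hv : IsInvVec χ v)
    (f : V ⟶ W) : IsInvVec χ (f.toLin v) := fun h => by
  rw [← map_smul, ← hv h]
  exact (comm_apply f h v).symm

theorem IsInvFun.comp {ψ : H →ₐ[k] k} {V W : 𝓜} {f : W.carrier →ₗ[k] k}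
    (hf : IsInvFun ψ f) (g : V ⟶ W) : IsInvFun ψ (V := V) (f ∘ₗ g.toLin) := fun h v => by
  have := comm_apply g h v
  simp only [LinearMap.comp_apply] at this ⊢
  rw [this, hf]

theorem IsRadVec.map {ψ : H →ₐ[k] k} {V W : 𝓜} {v : V.carrier} (hv : IsRadVec ψ v)
    (f : V ⟶ W) : IsRadVec ψ (f.toLin v) := fun _ hg => hv _ (hg.comp f)

theorem IsRadVec.of_act {ψ : H →ₐ[k] k} {V : 𝓜} {v : V.carrier} {h : H} (hh : ψ h ≠ 0)
    (hv : IsRadVec ψ (V.ρ h v)) : IsRadVec ψ v := fun f hf => by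
  have := hv f hf
  rw [hf] at this
  exact (mul_eq_zero.1 this).resolve_left hh

variable (k H) in
/-- An integral `Λ` between two characters, whose action commutes with rotations up to a change of
monodromy, and that detects the invariants and coinvariants of projective modules. -/
structure TwistedIntegral where
  bot : GroupLike k H
  top : GroupLike k H
  χ : H →ₐ[k] k
  ψ : H →ₐ[k] k
  Λ : H
  χ_bot : χ bot.val = 1
  ψ_top : ψ top.val = 1
  inv_swap {V W : 𝓜} (v : (V ⊗ W).carrier) : IsInvVec χ v → IsInvVec χ (swapAct bot V W v)
  fun_swap {V W : 𝓜} (f : (W ⊗ V).carrier →ₗ[k] k) : IsInvFun ψ f →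
    IsInvFun ψ (V := V ⊗ W) (f ∘ₗ swapAct top V W)
  Λ_swap {V W : 𝓜} (v : (V ⊗ W).carrier) :
    (W ⊗ V).ρ Λ (swapAct top V W v) = swapAct bot V W ((V ⊗ W).ρ Λ v)
  socle {V : 𝓜} (hV : Projective V) (v : V.carrier) : IsInvVec χ v → ∃ s, V.ρ Λ s = v
  ker {V : 𝓜} (hV : Projective V) (v : V.carrier) : V.ρ Λ v = 0 → IsRadVec ψ v
  projective_tens {X : List 𝓜} {x : 𝓜} : x ∈ X → Projective x →
    Projective (tens X)

namespace TwistedIntegral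

open VState

variable (I : TwistedIntegral k H)

theorem inv_rot (e : VState k H) : IsInvVec I.χ e.2 ↔ IsInvVec I.χ (rot I.bot e).2 := by
  refine rot_iff I.bot (p := fun e => IsInvVec I.χ e.2) (fun e h => ?_) (fun X v h => ?_) e
  · obtain ⟨_ | ⟨x, Y⟩, v⟩ := e
    · exact h
    · rw [rot_eq_rotT]
      dsimp only
      rw [rotT_eq]
      exact (I.inv_swap (V := x) (W := tens Y) v h).map _
  · have h1 : (tens X).ρ I.bot⁻¹.val ((tens X).ρ I.bot.val v) = v := by
      rw [← End.mul_apply, ← map_mul, ← GroupLike.val_mul, inv_mul_cancel,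
        GroupLike.val_one, map_one]; rfl
    intro a
    have h2 := h I.bot⁻¹.val
    dsimp only at h h2
    rw [h1] at h2
    dsimp only
    rw [h2, map_smul, h a]
    exact smul_comm _ _ _

theorem rad_rot (e : VState k H) : IsRadVec I.ψ e.2 ↔ IsRadVec I.ψ (rot I.top e).2 := by
  refine rot_iff I.top (p := fun e => IsRadVec I.ψ e.2) (fun e h => ?_) (fun X v h => ?_) e
  · obtain ⟨_ | ⟨x, Y⟩, v⟩ := e
    · exact h
    · rw [rot_eq_rotT]
      dsimp only
      rw [rotT_eq]
      refine IsRadVec.map (V := tens Y ⊗ x) (W := tens (Y ++ [x])) (fun f hf => ?_) _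
      exact h _ (I.fun_swap (V := x) (W := tens Y) f hf)
  · exact IsRadVec.of_act (by rw [I.ψ_top]; exact one_ne_zero) h

/-- The action of the integral on states. -/
def act (e : VState k H) : VState k H := ⟨e.1, (tens e.1).ρ I.Λ e.2⟩

theorem act_rot (e : VState k H) : I.act (rot I.top e) = rot I.bot (I.act e) := by
  obtain ⟨_ | ⟨x, Y⟩, v⟩ := e
  · rfl
  · have h1 : I.act (rot I.top ⟨x :: Y, v⟩) =
        ⟨Y ++ [x], (tens (Y ++ [x])).ρ I.Λ (rotT I.top x Y v)⟩ := rfl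
    have h2 : rot I.bot (I.act ⟨x :: Y, v⟩) =
        ⟨Y ++ [x], rotT I.bot x Y ((tens (x :: Y)).ρ I.Λ v)⟩ := rfl
    rw [h1, h2, rotT_eq, rotT_eq]
    refine congrArg (Sigma.mk (Y ++ [x])) ?_
    have h3 := comm_apply (snoc Y x).hom I.Λ (swapAct I.top x (tens Y) v)
    have h4 := I.Λ_swap (V := x) (W := tens Y) v
    rw [← h3, h4]
    rfl

theorem act_app {Z : 𝓜} (K : KState Z) (z : Z.carrier) :
    I.act (app K z) = app K (Z.ρ I.Λ z) :=
  congrArg (Sigma.mk K.1) (comm_apply K.2 I.Λ z).symm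

theorem act_step {W : Labels 𝓜} {e e' : VState k H} (h : Step W e e') :
    Step W (I.act e) (I.act e') := by
  obtain ⟨v, rfl, rfl⟩ := h
  exact ⟨_, rfl, congrArg (Sigma.mk (outsW W)) (comm_apply (val W) I.Λ v).symm⟩

/-- Linear combinations of states over a word. -/
def IsComb {ι : Type*} [Fintype ι] (l : ι → k) (p : ∀ V : 𝓜, V.carrier → Prop)
    (e : ι → VState k H) : Prop :=
  ∃ (X : List 𝓜) (v : ι → (tens X).carrier), e = (fun i => ⟨X, v i⟩) ∧
    p (tens X) (∑ i, l i • v i)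

theorem IsComb.step {ι : Type*} [Fintype ι] [Nonempty ι] {l : ι → k} {p : ∀ V : 𝓜, V.carrier → Prop}
    (hp : ∀ {V W : 𝓜} (f : V ⟶ W) v, p V v → p W (f.toLin v)) (W : Labels 𝓜)
    (e e' : ι → VState k H) (he : IsComb l p e) (h : ∀ i, Step W (e i) (e' i)) :
    IsComb l p e' := by
  obtain ⟨X, v, rfl, hv⟩ := he
  obtain rfl : X = insW W := (h (Classical.arbitrary ι)).fst
  refine ⟨outsW W, fun i => (val W).toLin (v i), funext fun i => ?_, ?_⟩
  · exact (h i).unique ⟨v i, rfl, rfl⟩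
  · have := hp (val W) _ hv
    rwa [map_sum, sum_congr rfl fun i _ => map_smul (val W).toLin (l i) (v i)] at this

theorem IsComb.rotate {ι : Type*} [Fintype ι] [Nonempty ι] {l : ι → k}
    {p : ∀ V : 𝓜, V.carrier → Prop} {γ : GroupLike k H}
    (hp : ∀ e : VState k H, p _ e.2 ↔ p _ (rot γ e).2) (e : ι → VState k H) :
    IsComb l p e ↔ IsComb l p (fun i => rot γ (e i)) := by
  constructor
  · rintro ⟨_ | ⟨x, Y⟩, v, rfl, hv⟩
    · exact ⟨[], v, rfl, hv⟩
    · refine ⟨Y ++ [x], fun i => rotT γ x Y (v i), rfl, ?_⟩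
      have h1 := (hp ⟨x :: Y, ∑ i, l i • v i⟩).1 hv
      rw [rot_eq_rotT] at h1
      have h2 : rotT γ x Y (∑ i, l i • v i) = ∑ i, l i • rotT γ x Y (v i) := by
        exact (map_sum (rotT γ x Y) _ _).trans (sum_congr rfl fun i _ =>
          map_smul (rotT γ x Y) (l i) (v i))
      dsimp only at h1
      rwa [h2] at h1
  · rintro ⟨X, v, h, hv⟩
    have h0 : ∀ i, (e i).1 = (e (Classical.arbitrary ι)).1 := fun i => by
      have h3 : ∀ i, (e i).1.rotate 1 = X := fun i => by
        rw [← rot_fst γ]; exact congrArg Sigma.fst (congrFun h i)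
      exact List.rotate_injective 1 ((h3 i).trans (h3 _).symm)
    have h4 : ∀ Z, (∀ i, (e i).1 = Z) → ∀ i, ∃ w : (tens Z).carrier, e i = ⟨Z, w⟩ := by
      intro Z hZ i
      obtain rfl := hZ i
      exact ⟨_, rfl⟩
    obtain ⟨Z, hZ⟩ : ∃ Z, ∀ i, (e i).1 = Z := ⟨_, h0⟩
    choose w hw using h4 Z hZ
    obtain rfl := funext hw
    refine ⟨Z, w, rfl, (hp ⟨Z, ∑ i, l i • w i⟩).2 ?_⟩
    obtain _ | ⟨x, Y⟩ := Z
    · obtain rfl : [] = X := congrArg Sigma.fst (congrFun h (Classical.arbitrary ι))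
      have : w = v := funext fun i => eq_of_heq (Sigma.mk.inj (congrFun h i)).2
      subst this
      exact hv
    · rw [rot_eq_rotT]
      obtain rfl : Y ++ [x] = X := congrArg Sigma.fst (congrFun h (Classical.arbitrary ι))
      have : ∀ i, rotT γ x Y (w i) = v i := fun i => eq_of_heq (Sigma.mk.inj (congrFun h i)).2
      have h2 : rotT γ x Y (∑ i, l i • w i) = ∑ i, l i • v i := by
        exact (map_sum (rotT γ x Y) _ _).trans (sum_congr rfl fun i _ =>
          (map_smul (rotT γ x Y) (l i) (w i)).trans (by rw [this]))
      dsimp only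
      rwa [h2]

end TwistedIntegral

theorem pt_add_two_pi (θ φ : ℝ) : pt (θ + 2 * π) φ = pt θ φ := by
  simp [pt]

theorem chart_periodic (T : S2 → PointLabel C) (φ : ℝ) : IsPeriodic (chart T · φ) := fun θ => by
  simp only [chart, pt_add_two_pi]

theorem IsSingleStrand.window {T : S2 → PointLabel C} {s : Set ℝ} {x : C} {g : ℝ → ℝ}
    (h : IsSingleStrand T s x g) {φ θ : ℝ} (hφ : φ ∈ s) (he : chart T θ φ = .empty) :
    IsLevel (chart T · φ) θ (θ + 2 * π) [.edge x] := by
  obtain ⟨n, hn, hn'⟩ := existsUnique_add_zsmul_mem_Ico two_pi_pos (g φ) θ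
  simp only [zsmul_eq_mul] at hn hn'
  have h1 : chart T (g φ + n * (2 * π)) φ = .edge x := (h φ hφ _).1 ⟨n, rfl⟩
  refine .single (lt_of_le_of_ne hn.1 fun h2 => ?_) hn.2 (fun τ hτ hne => ?_) h1 trivial
  · rw [← h2, he] at h1; cases h1
  · refine (h φ hφ τ).2 fun m hm => ?_
    rcases hτ.2.lt_or_eq with h2 | h2
    · exact hne (by rw [hm, hn' m (by rw [← hm]; exact ⟨hτ.1, h2⟩)])
    · have h3 := (h φ hφ τ).1 ⟨m, hm⟩
      rw [h2] at h3
      cases he.symm.trans ((chart_periodic T φ θ).symm.trans h3)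

variable {α : FDMod k H}

theorem StringNet.isCylDiagram (T : StringNet α) {a b : ℝ} (ha : -(π / 2) < a)
    (hb : b < π / 2) : IsCylDiagram (chart T.label) a b where
  periodic h := chart_periodic T.label h
  prog h hh θ := by
    obtain ⟨l, r, a', b', h1, h2, h3, h4, h5, h6, h7⟩ :=
      T.local_progressive θ h (ha.trans_le hh.1) (hh.2.trans_lt hb)
    exact ⟨l, r, a', b', h1, h2, h4, h5, h7⟩

theorem IsSingleStrand.isCylSec {D : Plan 𝓜} {a b : ℝ} {x : 𝓜}
    (h : ∀ φ ∈ Icc a b, ∀ θ, D θ φ = .empty → IsLevel (D · φ) θ (θ + 2 * π) [.edge x])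
    {γ : GroupLike k H} {v : (tens [x]).carrier} (hv : VState.rot γ ⟨[x], v⟩ = ⟨[x], v⟩) :
    IsCylSec γ D a b (fun _ _ => ⟨[x], v⟩) where
  loc φ hφ θ W hW := by
    obtain rfl := hW.unique (h φ hφ θ hW.left_empty)
    exact ⟨rfl, .of_forall fun _ _ => rfl, .of_forall fun _ _ => VState.Step.edges ⟨[x], v⟩⟩
  rotate φ hφ θ θ' W hW := by
    generalize (insW W).length = n
    induction n with
    | zero => rfl
    | succ n ih => rw [Function.iterate_succ_apply, hv, ← ih]

/-- Up to the latitude `a` the string net shows only the strand at the south pole. -/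
structure StringNet.IsSouth (T : StringNet α) (a : ℝ) : Prop where
  gt : -(π / 2) < a
  lt : a < π / 2
  window : ∀ φ, -(π / 2) < φ → φ ≤ a → ∀ θ, chart T.label θ φ = .empty →
    IsLevel (chart T.label · φ) θ (θ + 2 * π) [.edge α]

/-- From the latitude `b` on, the string net shows only the strand at the north pole. -/
structure StringNet.IsNorth (T : StringNet α) (b : ℝ) : Prop where
  gt : -(π / 2) < b
  lt : b < π / 2
  window : ∀ φ, b ≤ φ → φ < π / 2 → ∀ θ, chart T.label θ φ = .empty →
    IsLevel (chart T.label · φ) θ (θ + 2 * π) [.edge (dual α)]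

namespace StringNet

variable (T T' : StringNet α)

theorem IsSouth.mono {T : StringNet α} {a a' : ℝ} (h : T.IsSouth a) (h1 : -(π / 2) < a')
    (h2 : a' ≤ a) : T.IsSouth a' :=
  ⟨h1, h2.trans_lt h.lt, fun φ h3 h4 => h.window φ h3 (h4.trans h2)⟩

theorem IsNorth.mono {T : StringNet α} {b b' : ℝ} (h : T.IsNorth b) (h1 : b' < π / 2)
    (h2 : b ≤ b') : T.IsNorth b' :=
  ⟨h.gt.trans_le h2, h1, fun φ h3 h4 => h.window φ (h2.trans h3) h4⟩

theorem exists_isSouth : ∃ a, T.IsSouth a := by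
  obtain ⟨a, g, h1, -, h2⟩ := T.near_south
  have hpi := pi_pos
  exact ⟨min a 0, lt_min h1 (by linarith), (min_le_right _ _).trans_lt (by linarith),
    fun φ h3 h4 θ h5 => h2.window ⟨h3, h4.trans (min_le_left _ _)⟩ h5⟩

theorem exists_isNorth : ∃ b, T.IsNorth b := by
  obtain ⟨a, g, h1, -, h2⟩ := T.near_north
  have hpi := pi_pos
  exact ⟨max a 0, (by linarith : -(π / 2) < 0).trans_le (le_max_right _ _),
    max_lt h1 (by linarith), fun φ h3 h4 θ h5 => h2.window ⟨(le_max_left _ _).trans h3, h4⟩ h5⟩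

end StringNet

namespace TwistedIntegral

open VState

/-- The integral acts on the strands at the poles by its two characters. -/
structure Fits (I : TwistedIntegral k H) (α : 𝓜) (a0 : (tens [α]).carrier) : Prop where
  bot : IsInvVec I.χ a0
  top : ∀ h v, (tens [dual α]).ρ h v = I.ψ h • v

variable {I : TwistedIntegral k H} {a0 : (tens [α]).carrier} (hI : I.Fits α a0) {T T' : StringNet α}

include hI

theorem Fits.rot_bot : rot I.bot ⟨[α], a0⟩ = ⟨[α], a0⟩ := by
  have h := rot_full I.bot [α] a0
  rw [hI.bot, I.χ_bot, one_smul] at h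
  exact h

theorem Fits.rot_top (c : (tens [dual α]).carrier) : rot I.top ⟨[dual α], c⟩ = ⟨[dual α], c⟩ := by
  have h := rot_full I.top [dual α] c
  rw [hI.top, I.ψ_top, one_smul] at h
  exact h

omit hI

variable (I a0 T) in
/-- The states of the levels of `T` up to the latitude `h`, starting from the south pole. -/
def IsBot (h : ℝ) (S : ℝ → ℝ → VState k H) : Prop :=
  ∃ a, T.IsSouth a ∧ a ≤ h ∧ IsCylSec I.bot (chart T.label) a h S ∧
    ∀ θ, chart T.label θ a = .empty → S θ a = ⟨[α], a0⟩

variable (I T) in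
/-- The states of the levels of `T` from the latitude `h` on, ending at the north pole. -/
def IsTop (h : ℝ) (S : ℝ → ℝ → VState k H) (c : (tens [dual α]).carrier) : Prop :=
  ∃ b, T.IsNorth b ∧ h ≤ b ∧ IsCylSec I.top (chart T.label) h b S ∧
    ∀ θ, chart T.label θ b = .empty → S θ b = ⟨[dual α], c⟩

variable (I a0 T) in
/-- The state of a level of `T` that comes from the south pole. -/
def BotAt (θ h : ℝ) (e : VState k H) : Prop :=
  chart T.label θ h = .empty ∧ ∃ S, I.IsBot a0 T h S ∧ S θ h = e

variable (I T) in
/-- The state `e` of a level of `T` becomes `c` at the north pole. -/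
def TopAt (θ h : ℝ) (e : VState k H) (c : (tens [dual α]).carrier) : Prop :=
  chart T.label θ h = .empty ∧ ∃ S, I.IsTop T h S c ∧ S θ h = e

theorem IsBot.gt {h : ℝ} {S} (hS : I.IsBot a0 T h S) : -(π / 2) < h := by
  obtain ⟨a, h1, h2, -⟩ := hS
  exact h1.gt.trans_le h2

theorem _root_.TwPiv.IsCylSec.extend {γ : GroupLike k H} {D : Plan 𝓜}
    {a b c : ℝ} {S : ℝ → ℝ → VState k H} (hD : IsCylDiagram D a c) (hS : IsCylSec γ D a b S)
    (hab : a ≤ b) (hbc : b ≤ c) : ∃ S', IsCylSec γ D a c S' ∧ ∀ θ, ∀ h ≤ b, S' θ h = S θ h := by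
  obtain ⟨θ, -, hθ⟩ := hD.exists_empty ⟨hab, hbc⟩ 0 one_pos
  obtain ⟨W, hW⟩ := hD.exists_window ⟨hab, hbc⟩ hθ
  obtain ⟨S', h1, h2⟩ := (hD.mono hab le_rfl).exists_isCylSec γ hbc hW
    (hS.loc b ⟨hab, le_rfl⟩ θ W hW).1
  exact ⟨_, hS.glue hD hab hbc h1 hθ h2.symm, fun θ h hh => if_pos hh⟩

include hI in
theorem Fits.isBot_south {a a' : ℝ} (h1 : T.IsSouth a) (h2 : T.IsSouth a') (hle : a ≤ a')
    {S : ℝ → ℝ → VState k H} (hS : IsCylSec I.bot (chart T.label) a a' S)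
    (hS0 : ∀ θ, chart T.label θ a = .empty → S θ a = ⟨[α], a0⟩) :
    ∀ θ, chart T.label θ a' = .empty → S θ a' = ⟨[α], a0⟩ := fun θ hθ => by
  have hD := T.isCylDiagram h1.gt h2.lt
  obtain ⟨θ0, -, hθ0⟩ := hD.exists_empty ⟨le_rfl, hle⟩ 0 one_pos
  exact hS.unique hD (IsSingleStrand.isCylSec (fun φ hφ => h2.window φ (h1.gt.trans_le hφ.1) hφ.2)
    hI.rot_bot) hθ0 (hS0 θ0 hθ0) a' ⟨hle, le_rfl⟩ θ hθ

include hI in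
theorem Fits.exists_isBot {h₁ h₂ : ℝ} (h1 : -(π / 2) < h₁) (h12 : h₁ ≤ h₂)
    (h2 : h₂ < π / 2) :
    ∃ S, I.IsBot a0 T h₁ S ∧ I.IsBot a0 T h₂ S ∧ IsCylSec I.bot (chart T.label) h₁ h₂ S := by
  obtain ⟨a, ha⟩ := T.exists_isSouth
  have hs := ha.mono (lt_min h1 ha.gt) (min_le_right h₁ a)
  have hD := T.isCylDiagram hs.gt h2
  obtain ⟨S, hS, hS'⟩ := IsCylSec.extend hD (IsSingleStrand.isCylSec (a := min h₁ a)
    (b := min h₁ a) (fun φ hφ => hs.window φ (hs.gt.trans_le hφ.1) hφ.2) hI.rot_bot) le_rfl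
    ((min_le_left _ _).trans h12)
  refine ⟨S, ⟨_, hs, min_le_left _ _, hS.mono le_rfl h12, fun θ _ => hS' θ _ le_rfl⟩,
    ⟨_, hs, (min_le_left _ _).trans h12, hS, fun θ _ => hS' θ _ le_rfl⟩, hS.mono (min_le_left _ _) le_rfl⟩

include hI in
theorem Fits.isBot_unique {h : ℝ} (hlt : h < π / 2) {S S' : ℝ → ℝ → VState k H}
    (hS : I.IsBot a0 T h S) (hS' : I.IsBot a0 T h S') {θ : ℝ} (hθ : chart T.label θ h = .empty) :
    S θ h = S' θ h := by
  obtain ⟨a, h1, h2, h3, h4⟩ := hS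
  obtain ⟨a', h1', h2', h3', h4'⟩ := hS'
  have hD := T.isCylDiagram (h1.mono (lt_min h1.gt h1'.gt) (min_le_left a a')).gt hlt
  wlog hle : a ≤ a' generalizing a a' S S'
  · exact (this a' h1' h2' h3' h4' a h1 h2 h3 h4 (by rwa [min_comm]) (not_le.1 hle).le).symm
  obtain ⟨θ0, -, hθ0⟩ := hD.exists_empty (h := a') ⟨min_le_right _ _, h2'⟩ 0 one_pos
  have h5 := hI.isBot_south h1 h1' hle (h3.mono le_rfl h2') h4
  exact (h3.mono hle le_rfl).unique (hD.mono (min_le_right _ _) le_rfl) h3' hθ0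
    ((h5 θ0 hθ0).trans (h4' θ0 hθ0).symm) h ⟨h2', le_rfl⟩ θ hθ

include hI in
theorem Fits.botAt_unique {θ h : ℝ} (hlt : h < π / 2) {e e' : VState k H}
    (he : I.BotAt a0 T θ h e) (he' : I.BotAt a0 T θ h e') : e = e' := by
  obtain ⟨h1, S, hS, rfl⟩ := he
  obtain ⟨-, S', hS', rfl⟩ := he'
  exact hI.isBot_unique hlt hS hS' h1

theorem BotAt.extend {θ h1 h₂ : ℝ} {e : VState k H} (he : I.BotAt a0 T θ h1 e) (h12 : h1 ≤ h₂)
    (h2 : h₂ < π / 2) : ∃ S, IsCylSec I.bot (chart T.label) h1 h₂ S ∧ S θ h1 = e ∧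
      ∀ θ' h, h1 ≤ h → h ≤ h₂ → chart T.label θ' h = .empty → I.BotAt a0 T θ' h (S θ' h) := by
  obtain ⟨h0, S, ⟨a, h3, h4, h5, h6⟩, rfl⟩ := he
  obtain ⟨S', h7, h8⟩ := h5.extend (T.isCylDiagram h3.gt h2) h4 h12
  refine ⟨S', h7.mono h4 le_rfl, h8 θ _ le_rfl, fun θ' h g1 g2 g3 => ⟨g3, S', ⟨a, h3, h4.trans g1,
    h7.mono le_rfl g2, fun θ hθ => (h8 θ a h4).trans (h6 θ hθ)⟩, rfl⟩⟩

include hI in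
theorem Fits.exists_botAt {θ h : ℝ} (h1 : -(π / 2) < h) (h2 : h < π / 2)
    (hθ : chart T.label θ h = .empty) : ∃ e, I.BotAt a0 T θ h e := by
  obtain ⟨S, hS, -⟩ := hI.exists_isBot (T := T) h1 le_rfl h2
  exact ⟨_, hθ, S, hS, rfl⟩

theorem BotAt.of_section {θ θ' h1 h₂ : ℝ} {S : ℝ → ℝ → VState k H}
    (hS : IsCylSec I.bot (chart T.label) h1 h₂ S) (h12 : h1 ≤ h₂) (h2 : h₂ < π / 2)
    (he : I.BotAt a0 T θ h1 (S θ h1)) (hθ' : chart T.label θ' h₂ = .empty) :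
    I.BotAt a0 T θ' h₂ (S θ' h₂) := by
  have hgt : -(π / 2) < h1 := by obtain ⟨-, S, hS, -⟩ := he; exact hS.gt
  obtain ⟨S', h3, h4, h5⟩ := he.extend h12 h2
  rw [← h3.unique (T.isCylDiagram hgt h2) hS he.1 h4 h₂ ⟨h12, le_rfl⟩ θ' hθ']
  exact h5 θ' h₂ h12 le_rfl hθ'

include hI in
theorem Fits.botAt_inv {θ h : ℝ} (hlt : h < π / 2) {e : VState k H}
    (he : I.BotAt a0 T θ h e) : IsInvVec I.χ e.2 := by
  obtain ⟨h0, S, ⟨a, h3, h4, h5, h6⟩, rfl⟩ := he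
  have hD := T.isCylDiagram h3.gt hlt
  obtain ⟨θ0, -, hθ0⟩ := hD.exists_empty ⟨le_rfl, h4⟩ 0 one_pos
  refine IsCylSec.rel (ι := Unit) (γ := fun _ => I.bot) (S := fun _ => S)
    (r := fun e => IsInvVec I.χ (e ()).2) (fun e => I.inv_rot _) (fun W e e' h1 h2 => ?_) hD
    (fun _ => h5) hθ0 ?_ h ⟨h4, le_rfl⟩ θ h0
  · obtain ⟨v, h7, h8⟩ := h2 ()
    rw [h7] at h1
    rw [h8]
    exact h1.map (val W)
  · dsimp only
    rw [h6 θ0 hθ0]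
    exact hI.bot

theorem BotAt.congr {θ h : ℝ} {e : VState k H} (he : I.BotAt a0 T θ h e)
    (hT : ∀ φ, -(π / 2) < φ → φ ≤ h → ∀ θ, chart T.label θ φ = chart T'.label θ φ) :
    I.BotAt a0 T' θ h e := by
  obtain ⟨h0, S, ⟨a, h3, h4, h5, h6⟩, rfl⟩ := he
  refine ⟨(hT h (h3.gt.trans_le h4) le_rfl θ).symm.trans h0, S, ⟨a, ⟨h3.gt, h3.lt, fun φ g1 g2 θ g3 => ?_⟩, h4,
    h5.congr fun φ hφ θ => hT φ (h3.gt.trans_le hφ.1) hφ.2 θ, fun θ hθ => h6 θ ?_⟩, rfl⟩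
  · exact (h3.window φ g1 g2 θ ((hT φ g1 (g2.trans h4) θ).trans g3)).congr fun τ _ =>
      hT φ g1 (g2.trans h4) τ
  · exact (hT a h3.gt h4 θ).trans hθ

include hI in
theorem Fits.botAt_congr_lt {θ h : ℝ} (hlt : h < π / 2) {e : VState k H}
    (he : I.BotAt a0 T θ h e)
    (hT : ∀ φ, -(π / 2) < φ → φ < h → ∀ θ, chart T.label θ φ = chart T'.label θ φ)
    (hθ : chart T'.label θ h = .empty) : I.BotAt a0 T' θ h e := by
  have hgt : -(π / 2) < h := by obtain ⟨-, S, hS, -⟩ := he; exact hS.gt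
  obtain ⟨e', he'⟩ := hI.exists_botAt hgt hlt hθ
  suffices h : e = e' by rwa [h]
  obtain ⟨h0, S, hS, rfl⟩ := id he
  obtain ⟨-, S', hS', rfl⟩ := id he'
  have key : ∀ {T : StringNet α} {S : ℝ → ℝ → VState k H}, I.IsBot a0 T h S →
      chart T.label θ h = .empty → ∀ᶠ t in 𝓝[<] h, -(π / 2) < t → I.BotAt a0 T θ t (S θ h) := by
    intro T S hS h0
    obtain ⟨S'', g1, g2, g3⟩ := hI.exists_isBot (T := T) (h₁ := (-(π / 2) + h) / 2) (h₂ := h)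
      (by linarith) (by linarith) hlt
    have hmem : h ∈ Icc ((-(π / 2) + h) / 2) h := ⟨by linarith, le_rfl⟩
    have hD := T.isCylDiagram (a := (-(π / 2) + h) / 2) (by linarith) hlt
    obtain ⟨W, hW⟩ := hD.exists_window hmem h0
    filter_upwards [(g3.loc h hmem θ W hW).2.1, (hD.eventually_empty hmem h0).filter_mono
      nhdsWithin_le_nhds, Ioo_mem_nhdsLT (by linarith : (-(π / 2) + h) / 2 < h)]
      with t t1 t2 t3 _
    rw [hI.isBot_unique hlt hS g2 h0, ← t1 t3.1.le]
    obtain ⟨θ0, -, hθ0⟩ := hD.exists_empty (h := (-(π / 2) + h) / 2) ⟨le_rfl, by linarith⟩ 0 one_pos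
    exact BotAt.of_section (θ := θ0) (g3.mono le_rfl t3.2.le) t3.1.le (t3.2.trans hlt)
      ⟨hθ0, S'', g1, rfl⟩ t2
  obtain ⟨t, t1, t2, t3⟩ := ((key hS h0).and ((key hS' hθ).and
    (show ∀ᶠ t in 𝓝[<] h, t ∈ Ioo (-(π / 2)) h from Ioo_mem_nhdsLT hgt))).exists
  exact hI.botAt_unique (t3.2.trans hlt) (BotAt.congr (t1 t3.1) fun φ g1 g2 =>
    hT φ g1 (g2.trans_lt t3.2)) (t2 t3.1)

theorem Fits.topAt_comb (hI : I.Fits α a0) {ι : Type*} [Fintype ι] [Nonempty ι] {l : ι → k}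
    {θ h : ℝ} (hgt : -(π / 2) < h) {e : ι → VState k H} {c : ι → (tens [dual α]).carrier}
    (he : ∀ i, I.TopAt T θ h (e i) (c i)) (hl : IsComb l (fun _ v => IsRadVec I.ψ v) e) :
    ∑ i, l i • c i = 0 := by
  have h0 := (he (Classical.arbitrary ι)).1
  choose _ S hS hSe using he
  choose b h1 h2 h3 h4 using hS
  obtain ⟨B, hB⟩ := T.exists_isNorth
  have hpi : h < π / 2 := (h2 (Classical.arbitrary ι)).trans_lt (h1 _).lt
  have hb : ∃ b', T.IsNorth b' ∧ ∀ i, b i ≤ b' := by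
    obtain ⟨i0, -, hi0⟩ := Finset.exists_max_image Finset.univ b Finset.univ_nonempty
    exact ⟨b i0, h1 i0, fun i => hi0 i (Finset.mem_univ i)⟩
  obtain ⟨b', hb1, hb2⟩ := hb
  have hhb : h ≤ b' := (h2 (Classical.arbitrary ι)).trans (hb2 _)
  have hD := T.isCylDiagram hgt hb1.lt
  have key : ∀ i, ∃ S', IsCylSec I.top (chart T.label) h b' S' ∧ S' θ h = e i ∧
      ∀ θ, chart T.label θ b' = .empty → S' θ b' = ⟨[dual α], c i⟩ := fun i => by
    obtain ⟨θ0, -, hθ0⟩ := hD.exists_empty (h := b i) ⟨h2 i, hb2 i⟩ 0 one_pos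
    refine ⟨_, (h3 i).glue hD (h2 i) (hb2 i) (IsSingleStrand.isCylSec (fun φ hφ => (h1 i).window φ hφ.1
      (hφ.2.trans_lt hb1.lt)) (hI.rot_top (c i))) hθ0 (h4 i θ0 hθ0), by simp [h2 i, hSe], fun θ hθ => ?_⟩
    rcases (hb2 i).lt_or_eq with hlt | heq
    · simp [not_le.2 hlt]
    · simp [← heq, h4 i θ (heq ▸ hθ)]
  choose S' g1 g2 g3 using key
  obtain ⟨θ1, -, hθ1⟩ := hD.exists_empty (h := b') ⟨hhb, le_rfl⟩ 0 one_pos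
  have h5 := IsCylSec.rel (γ := fun _ : ι => I.top) (S := S')
    (r := IsComb l (fun _ v => IsRadVec I.ψ v)) (fun e => IsComb.rotate I.rad_rot e)
    (fun W e e' he h => IsComb.step (fun f v hv => hv.map f) W e e' he h) hD g1 h0
    (by simpa only [g2] using hl) b' ⟨hhb, le_rfl⟩ θ1 hθ1
  simp only [fun i => g3 i θ1 hθ1] at h5
  obtain ⟨X, v, h6, h7⟩ := h5
  obtain rfl : [dual α] = X := congrArg Sigma.fst (congrFun h6 (Classical.arbitrary ι))
  obtain rfl : c = v := funext fun i => eq_of_heq (Sigma.mk.inj (congrFun h6 i)).2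
  refine (Module.forall_dual_apply_eq_zero_iff k _).1 fun f => h7 f fun h v => ?_
  rw [hI.top, map_smul, smul_eq_mul]

include hI in
theorem Fits.topAt_rad {θ h : ℝ} (hgt : -(π / 2) < h) {X : List 𝓜}
    {v v' : (tens X).carrier} {c c' : (tens [dual α]).carrier} (hv : IsRadVec I.ψ (v - v'))
    (h1 : I.TopAt T θ h ⟨X, v⟩ c) (h2 : I.TopAt T θ h ⟨X, v'⟩ c') : c = c' := by
  have := hI.topAt_comb (ι := Bool) (l := fun i => bif i then 1 else -1)
    (e := fun i => ⟨X, bif i then v else v'⟩) (c := fun i => bif i then c else c') hgt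
    (by rintro (_ | _) <;> assumption) ⟨X, fun i => bif i then v else v', rfl, by
      simpa [← sub_eq_add_neg] using hv⟩
  simpa [← sub_eq_add_neg, sub_eq_zero] using this

include hI in
theorem Fits.topAt_unique {θ h : ℝ} (hgt : -(π / 2) < h) {e : VState k H}
    {c c' : (tens [dual α]).carrier} (h1 : I.TopAt T θ h e c) (h2 : I.TopAt T θ h e c') : c = c' :=
  hI.topAt_rad hgt (X := e.1) (v := e.2) (v' := e.2) (by rw [sub_self]; exact fun f _ => map_zero f)
    h1 h2

theorem TopAt.of_section {θ θ' h₁ h₂ : ℝ} {S : ℝ → ℝ → VState k H} {c} (hgt : -(π / 2) < h₁)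
    (hS : IsCylSec I.top (chart T.label) h₁ h₂ S) (h12 : h₁ ≤ h₂)
    (he : I.TopAt T θ' h₂ (S θ' h₂) c) (hθ : chart T.label θ h₁ = .empty) :
    I.TopAt T θ h₁ (S θ h₁) c := by
  obtain ⟨h0, S', ⟨b, h1, h2, h3, h4⟩, h5⟩ := he
  have hD := T.isCylDiagram hgt h1.lt
  refine ⟨hθ, _, ⟨b, h1, h12.trans h2, hS.glue hD h12 h2 h3 h0 h5.symm, fun τ hτ => ?_⟩, by simp [h12]⟩
  rcases h2.lt_or_eq with hlt | rfl
  · simpa [not_le.2 hlt] using h4 τ hτ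
  · have := (hS.mono h12 le_rfl).eq_of_eq (hD.mono h12 le_rfl) h3 ⟨le_rfl, le_rfl⟩ h0 hτ h5.symm
    simpa [this] using h4 τ hτ

include hI in
theorem Fits.exists_topAt {θ h : ℝ} (h1 : -(π / 2) < h) (h2 : h < π / 2)
    (hθ : chart T.label θ h = .empty) {W} (hW : IsLevel (chart T.label · h) θ (θ + 2 * π) W)
    {e : VState k H} (he : e.1 = insW W) : ∃ c, I.TopAt T θ h e c := by
  obtain ⟨b, hb⟩ := T.exists_isNorth
  have hn := hb.mono (max_lt hb.lt h2) (le_max_left b h)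
  have hD := T.isCylDiagram h1 hn.lt
  obtain ⟨S, hS, hSe⟩ := hD.exists_isCylSec I.top (le_max_right b h) hW he
  obtain ⟨θ0, -, hθ0⟩ := hD.exists_empty (h := max b h) ⟨le_max_right _ _, le_rfl⟩ 0 one_pos
  have h3 := (hS.loc (max b h) ⟨le_max_right _ _, le_rfl⟩ θ0 _
    (hn.window _ le_rfl hn.lt θ0 hθ0)).1
  obtain ⟨c, hc⟩ : ∃ c : (tens [dual α]).carrier, S θ0 (max b h) = ⟨[dual α], c⟩ := by
    generalize S θ0 (max b h) = f at h3
    obtain ⟨X, v⟩ := f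
    obtain rfl : X = [dual α] := h3
    exact ⟨v, rfl⟩
  refine ⟨c, hθ, S, ⟨_, hn, le_max_right _ _, hS, fun τ hτ => ?_⟩, hSe⟩
  have hconst := IsSingleStrand.isCylSec (D := chart T.label) (a := max b h) (b := max b h)
    (fun φ hφ => hn.window φ hφ.1 (hφ.2.trans_lt hn.lt)) (hI.rot_top c)
  exact (hS.mono (le_max_right _ _) le_rfl).eq_of_eq (hD.mono (le_max_right _ _) le_rfl) hconst
    ⟨le_rfl, le_rfl⟩ hθ0 hτ hc

include hI in
theorem Fits.topAt_section {θ θ' h1 h₂ : ℝ} {S : ℝ → ℝ → VState k H} {c}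
    (hgt : -(π / 2) < h1) (hS : IsCylSec I.top (chart T.label) h1 h₂ S) (h12 : h1 ≤ h₂)
    (h2 : h₂ < π / 2) (he : I.TopAt T θ h1 (S θ h1) c) (hθ' : chart T.label θ' h₂ = .empty) :
    I.TopAt T θ' h₂ (S θ' h₂) c := by
  have hD := T.isCylDiagram (hgt.trans_le h12) h2
  obtain ⟨W, hW⟩ := hD.exists_window ⟨le_rfl, le_rfl⟩ hθ'
  obtain ⟨c', hc'⟩ := hI.exists_topAt (hgt.trans_le h12) h2 hθ' hW
    (hS.loc h₂ ⟨h12, le_rfl⟩ θ' W hW).1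
  rwa [hI.topAt_unique hgt he (hc'.of_section hgt hS h12 he.1)]

theorem TopAt.congr {θ h : ℝ} {e : VState k H} {c} (he : I.TopAt T θ h e c)
    (hT : ∀ φ, h ≤ φ → φ < π / 2 → ∀ θ, chart T.label θ φ = chart T'.label θ φ) :
    I.TopAt T' θ h e c := by
  obtain ⟨h0, S, ⟨b, h3, h4, h5, h6⟩, rfl⟩ := he
  refine ⟨(hT h le_rfl (h4.trans_lt h3.lt) θ).symm.trans h0, S, ⟨b, ⟨h3.gt, h3.lt, fun φ g1 g2 θ g3 => ?_⟩,
    h4, h5.congr fun φ hφ θ => hT φ hφ.1 (hφ.2.trans_lt h3.lt) θ, fun θ hθ => h6 θ ?_⟩, rfl⟩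
  · exact (h3.window φ g1 g2 θ ((hT φ (h4.trans g1) g2 θ).trans g3)).congr fun τ _ =>
      hT φ (h4.trans g1) g2 τ
  · exact (hT b h4 h3.lt θ).trans hθ

variable (I a0 T) in
/-- The invariant of a string net. -/
def FVal (c : (tens [dual α]).carrier) : Prop :=
  ∃ θ h X, ∃ s v : (tens X).carrier, -(π / 2) < h ∧ h < π / 2 ∧
    I.BotAt a0 T θ h ⟨X, v⟩ ∧ Projective (tens X) ∧ (tens X).ρ I.Λ s = v ∧ I.TopAt T θ h ⟨X, s⟩ c

theorem act_section {θ θ' h1 h₂ : ℝ} {S S' : ℝ → ℝ → VState k H}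
    (hgt : -(π / 2) < h1) (hS : IsCylSec I.bot (chart T.label) h1 h₂ S)
    (hS' : IsCylSec I.top (chart T.label) h1 h₂ S') (h12 : h1 ≤ h₂) (h2 : h₂ < π / 2)
    (hθ : chart T.label θ h1 = .empty) (he : S θ h1 = I.act (S' θ h1))
    (hθ' : chart T.label θ' h₂ = .empty) : S θ' h₂ = I.act (S' θ' h₂) := by
  refine IsCylSec.rel (ι := Bool) (γ := fun i => bif i then I.bot else I.top)
    (S := fun i => bif i then S else S') (r := fun e => e true = I.act (e false)) (fun e => ?_)
    (fun W e e' h3 h4 => ?_) (T.isCylDiagram hgt h2) (by rintro (_ | _) <;> assumption)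
    hθ he h₂ ⟨h12, le_rfl⟩ θ' hθ'
  · simp only [cond_true, cond_false]
    rw [I.act_rot, (rot I.bot).injective.eq_iff]
  · exact (h3 ▸ h4 true).unique (I.act_step (h4 false))

include hI in
theorem Fits.fVal_unique {c c'} (hc : I.FVal a0 T c) (hc' : I.FVal a0 T c') : c = c' := by
  obtain ⟨θ, h, X, s, v, h1, h2, h3, h4, h5, h6⟩ := hc
  obtain ⟨θ', h', X', s', v', h1', h2', h3', h4', h5', h6'⟩ := hc'
  wlog hle : h ≤ h' generalizing c c' θ h X s v θ' h' X' s' v'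
  · exact (this _ _ _ _ _ h1' h2' h3' h4' h5' h6' _ _ _ _ _ h1 h2 h3 h4 h5 h6 (not_le.1 hle).le).symm
  obtain ⟨S, g1, g2, g3⟩ := h3.extend hle h2'
  have hD := T.isCylDiagram h1 h2'
  obtain ⟨W, hW⟩ := hD.exists_window ⟨le_rfl, hle⟩ h3.1
  obtain ⟨S', g4, g5⟩ := hD.exists_isCylSec I.top hle hW (e := ⟨X, s⟩) (by
    have := (g1.loc h ⟨le_rfl, hle⟩ θ W hW).1
    rwa [g2] at this)
  have g6 := act_section h1 g1 g4 hle h2' h3.1 (by rw [g2, g5, ← h5]; rfl) h3'.1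
  have g7 := hI.topAt_section h1 g4 hle h2' (by rwa [g5]) h3'.1
  have g8 := hI.botAt_unique h2' (g3 θ' h' hle le_rfl h3'.1) h3'
  rw [g6] at g8
  generalize S' θ' h' = f at g7 g8
  obtain ⟨Y, t⟩ := f
  obtain rfl : Y = X' := congrArg Sigma.fst g8
  have g9 : (tens Y).ρ I.Λ t = v' := eq_of_heq (Sigma.mk.inj g8).2
  exact hI.topAt_rad h1' (I.ker h4' _ (by rw [map_sub, g9, h5', sub_self])) g7 h6'

include hI in
theorem Fits.exists_fVal_of_level {θ h : ℝ} (h1 : -(π / 2) < h) (h2 : h < π / 2) {W}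
    (hW : IsLevel (chart T.label · h) θ (θ + 2 * π) W) (hp : Projective (tens (insW W))) :
    ∃ c, I.FVal a0 T c := by
  obtain ⟨e, he⟩ := hI.exists_botAt (T := T) h1 h2 hW.left_empty
  have h3 : e.1 = insW W := by
    obtain ⟨-, S, ⟨a, -, g1, g2, -⟩, rfl⟩ := he
    exact (g2.loc h ⟨g1, le_rfl⟩ θ W hW).1
  obtain ⟨X, v⟩ := e
  obtain rfl : X = insW W := h3
  obtain ⟨s, hs⟩ := I.socle hp v (hI.botAt_inv h2 he)
  obtain ⟨c, hc⟩ := hI.exists_topAt h1 h2 hW.left_empty hW (e := ⟨insW W, s⟩) rfl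
  exact ⟨c, θ, h, _, s, v, h1, h2, he, hp, hs, hc⟩

end TwistedIntegral

theorem pt_eq_iff {θ θ' φ φ' : ℝ} (h1 : -(π / 2) < φ) (h2 : φ < π / 2)
    (h1' : -(π / 2) < φ') (h2' : φ' < π / 2) :
    pt θ φ = pt θ' φ' ↔ φ = φ' ∧ ∃ n : ℤ, θ = θ' + n • (2 * π) := by
  constructor
  · intro h
    have h0 : ∀ i, (pt θ φ).1 i = (pt θ' φ').1 i := fun i => by rw [h]
    have e0 : sin φ = sin φ' := h0 0
    have e1 : cos φ * cos θ = cos φ' * cos θ' := h0 1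
    have e2 : cos φ * sin θ = cos φ' * sin θ' := h0 2
    obtain rfl : φ = φ' := injOn_sin ⟨h1.le, h2.le⟩ ⟨h1'.le, h2'.le⟩ e0
    have hc := (cos_pos_of_mem_Ioo ⟨h1, h2⟩).ne'
    refine ⟨rfl, ?_⟩
    obtain ⟨n, hn⟩ := Angle.angle_eq_iff_two_pi_dvd_sub.1
      (Angle.cos_sin_inj (mul_left_cancel₀ hc e1) (mul_left_cancel₀ hc e2))
    exact ⟨n, by rw [zsmul_eq_mul]; linarith⟩
  · rintro ⟨rfl, n, rfl⟩
    exact ((show Function.Periodic (fun θ => pt θ φ) (2 * π) from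
      fun θ => pt_add_two_pi θ φ).zsmul n θ')

theorem exists_pt (p : S2) : ∃ θ φ, -(π / 2) ≤ φ ∧ φ ≤ π / 2 ∧ p = pt θ φ := by
  have hp : p.1 0 ^ 2 + p.1 1 ^ 2 + p.1 2 ^ 2 = 1 := by
    have := p.2
    rw [mem_sphere_zero_iff_norm, EuclideanSpace.norm_eq, Real.sqrt_eq_one, Fin.sum_univ_three] at this
    simpa only [Real.norm_eq_abs, sq_abs] using this
  have h1 : -1 ≤ p.1 0 := by nlinarith [sq_nonneg (p.1 1), sq_nonneg (p.1 2)]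
  have h2 : p.1 0 ≤ 1 := by nlinarith [sq_nonneg (p.1 1), sq_nonneg (p.1 2)]
  set z : ℂ := ⟨p.1 1, p.1 2⟩ with hz
  have hn : ‖z‖ = cos (arcsin (p.1 0)) := by
    rw [cos_arcsin, Complex.norm_def, Complex.normSq_mk]
    congr 1
    linarith
  refine ⟨z.arg, arcsin (p.1 0), neg_pi_div_two_le_arcsin _, arcsin_le_pi_div_two _, ?_⟩
  ext i
  fin_cases i
  · exact (sin_arcsin h1 h2).symm
  · change p.1 1 = cos (arcsin (p.1 0)) * cos z.arg
    rw [← hn, Complex.norm_mul_cos_arg]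
  · change p.1 2 = cos (arcsin (p.1 0)) * sin z.arg
    rw [← hn, Complex.norm_mul_sin_arg]

theorem pt_pi_div_two (θ : ℝ) : pt θ (π / 2) = northPole := by
  simp [pt, northPole]

theorem pt_neg_pi_div_two (θ : ℝ) : pt θ (-(π / 2)) = southPole := by
  simp [pt, southPole]

theorem StringNet.exists_pt_of_edge {T : StringNet α} {p : S2} {x : 𝓜}
    (hp : T.label p = .edge x) :
    ∃ θ φ, -(π / 2) < φ ∧ φ < π / 2 ∧ p = pt θ φ := by
  obtain ⟨θ, φ, h1, h2, rfl⟩ := exists_pt p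
  refine ⟨θ, φ, lt_of_le_of_ne h1 ?_, lt_of_le_of_ne h2 ?_, rfl⟩
  · rintro rfl
    rw [pt_neg_pi_div_two, T.south] at hp
    cases hp
  · rintro rfl
    rw [pt_pi_div_two, T.north] at hp
    cases hp

theorem mem_insW {x : C}
    (h : PointLabel.edge x ∈ W) : x ∈ insW W := by
  induction W with
  | nil => simp at h
  | cons w W ih =>
    rcases List.mem_cons.1 h with rfl | h
    · exact List.mem_cons_self
    · exact mem_append_right _ (ih h)

theorem IsCylSec.eq_of_agree_lt {γ : GroupLike k H} {D D' : Plan 𝓜}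
    {a b θ0 θ : ℝ} {S S' : ℝ → ℝ → VState k H} (hD : IsCylDiagram D a b) (hD' : IsCylDiagram D' a b)
    (hS : IsCylSec γ D a b S) (hS' : IsCylSec γ D' a b S') (hab : a < b)
    (hDD : ∀ h ∈ Ico a b, ∀ θ, D θ h = D' θ h) (h0 : D θ0 a = .empty) (he : S θ0 a = S' θ0 a)
    (h1 : D θ b = .empty) (h2 : D' θ b = .empty) : S θ b = S' θ b := by
  have hb : b ∈ Icc a b := ⟨hab.le, le_rfl⟩
  obtain ⟨W, hW⟩ := hD.exists_window hb h1
  obtain ⟨W', hW'⟩ := hD'.exists_window hb h2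
  obtain ⟨t, t1, t2, t3, t4⟩ := ((hS.loc b hb θ W hW).2.1.and ((hS'.loc b hb θ W' hW').2.1.and
    (((hD.eventually_empty hb h1).filter_mono nhdsWithin_le_nhds).and
    (show ∀ᶠ t in 𝓝[<] b, t ∈ Ioo a b from Ioo_mem_nhdsLT hab)))).exists
  rw [← t1 t4.1.le, ← t2 t4.1.le]
  exact (hS.mono le_rfl t4.2.le).unique (hD.mono le_rfl t4.2.le)
    ((hS'.mono le_rfl t4.2.le).congr fun h hh θ => (hDD h ⟨hh.1, hh.2.trans_lt t4.2⟩ θ).symm)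
    h0 he t ⟨t4.1.le, le_rfl⟩ θ t3

namespace TwistedIntegral

open VState

theorem IsComb.cross {ι : Type*} [Fintype ι] [Nonempty ι] {l : ι → k}
    {p : ∀ V : 𝓜, V.carrier → Prop} {γ : GroupLike k H}
    (hp : ∀ {V W : 𝓜} (f : V ⟶ W) v, p V v → p W (f.toLin v))
    (hpr : ∀ e : VState k H, p _ e.2 ↔ p _ (rot γ e).2)
    {D : ι → Plan 𝓜} {b B : ℝ} (hbB : b < B)
    (hD : ∀ i, IsCylDiagram (D i) b B) {S : ι → ℝ → ℝ → VState k H}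
    (hS : ∀ i, IsCylSec γ (D i) b B (S i))
    (hag : ∀ i j, ∀ h ∈ Ioc b B, ∀ θ, D i θ h = D j θ h) {θ : ℝ} {W : Labels 𝓜}
    (hW : ∀ i, IsLevel (D i · b) θ (θ + 2 * π) W) (he : IsComb l p fun i => S i θ b)
    {i0 : ι} {θ' : ℝ} (hθ' : D i0 θ' B = .empty) : IsComb l p fun i => S i θ' B := by
  have hb : b ∈ Icc b B := ⟨le_rfl, hbB.le⟩
  obtain ⟨t, t1, t2, t3⟩ := ((eventually_all.2 fun i => ((hS i).loc b hb θ W (hW i)).2.2).and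
    ((((hD i0).eventually_empty hb (hW i0).left_empty).filter_mono nhdsWithin_le_nhds).and
    (show ∀ᶠ t in 𝓝[>] b, t ∈ Ioo b B from Ioo_mem_nhdsGT hbB))).exists
  exact IsCylSec.rel (γ := fun _ : ι => γ) (S := S) (r := IsComb l p)
    (fun e => IsComb.rotate hpr e) (fun W e e' he h => IsComb.step hp W e e' he h)
    ((hD i0).mono t3.1.le le_rfl) (fun i => ((hS i).mono t3.1.le le_rfl).congr fun h hh θ =>
      hag i i0 h ⟨t3.1.trans_le hh.1, hh.2⟩ θ) t2
    (IsComb.step hp W _ _ he fun i => t1 i t3.2.le) B ⟨t3.2.le, le_rfl⟩ θ' hθ'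

theorem isComb_app {ι : Type*} [Fintype ι] {l : ι → k} {xs ys : List 𝓜}
    {f : ι → (tens xs ⟶ tens ys)} (hf : ∑ i, l i • f i = 0) {Z : 𝓜} (κ : KState Z)
    (z : (tens xs ⊗ Z).carrier) {p : ∀ V : 𝓜, V.carrier → Prop} (hp : ∀ V, p V 0) :
    IsComb l p (fun i => app (kprod (⟨ys, f i⟩ : KState (tens xs)) κ) z) := by
  let Ψ : (tens xs ⟶ tens ys) →ₗ[k] (tens (ys ++ κ.1)).carrier :=
    { toFun := fun f => inc ys κ.1 (tmap f.toLin κ.2.toLin z)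
      map_add' := fun f g => by
        rw [show (f + g).toLin = f.toLin + g.toLin from rfl, TensorProduct.map_add_left,
          LinearMap.add_apply, map_add]
      map_smul' := fun c f => by
        rw [show (c • f).toLin = c • f.toLin from rfl, TensorProduct.map_smul_left,
          LinearMap.smul_apply, map_smul]; rfl }
  refine ⟨ys ++ κ.1, fun i => Ψ (f i), rfl, ?_⟩
  rw [← sum_congr rfl fun i _ => map_smul Ψ (l i) (f i), ← map_sum, hf, map_zero]
  exact hp _

theorem exists_eq_app {X Y : List 𝓜} {e : VState k H} (he : e.1 = X ++ Y) :
    ∃ z, e = app (kprod wires X wires Y) z := by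
  obtain ⟨_, v⟩ := e
  change _ = X ++ Y at he
  subst he
  refine ⟨prj X Y v, ?_⟩
  refine congrArg (Sigma.mk (X ++ Y)) ?_
  change v = inc X Y (tmap .id .id (prj X Y v))
  rw [TensorProduct.map_id, LinearMap.id_apply, inc_prj]

theorem app_kprod_whisker {A Z : 𝓜} (K : KState A) (κ : KState Z) (z : (A ⊗ Z).carrier) :
    app (kprod K wires κ.1) ((𝟙 A ⊗ₘ κ.2).toLin z) = app (kprod K κ) z := by
  refine congrArg (Sigma.mk (K.1 ++ κ.1)) ?_
  have h : (𝟙 A ⊗ₘ κ.2) ≫ (K.2 ⊗ₘ 𝟙 (tens κ.1)) ≫ (tensAppend K.1 κ.1).inv =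
      (K.2 ⊗ₘ κ.2) ≫ (tensAppend K.1 κ.1).inv := by
    rw [← Category.assoc, MonoidalCategory.tensorHom_comp_tensorHom, Category.id_comp,
      Category.comp_id]
  exact toLin_congr h z

theorem zero_rot (γ : GroupLike k H) (e : VState k H) : e.2 = 0 ↔ (rot γ e).2 = 0 := by
  obtain ⟨_ | ⟨x, Y⟩, v⟩ := e
  · exact Iff.rfl
  · exact (map_eq_zero_iff (rotT γ x Y) (rotL_bijective γ x Y).1).symm

variable {I : TwistedIntegral k H} {a0 : (tens [α]).carrier}

theorem Fits.sum_eq_zero_of_topAt (hI : I.Fits α a0) {ι : Type*} [Fintype ι] [Nonempty ι] {l : ι → k}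
    {T : ι → StringNet α} {b θ : ℝ} (hgt : -(π / 2) < b) (hlt : b < π / 2)
    (hag : ∀ i j, ∀ h, b < h → h < π / 2 → ∀ θ, chart (T i).label θ h = chart (T j).label θ h)
    {W : Labels 𝓜}
    (hW : ∀ i, IsLevel (chart (T i).label · b) θ (θ + 2 * π) W) {e : ι → VState k H}
    (he : IsComb l (fun _ v => IsRadVec I.ψ v) e) {c : ι → (tens [dual α]).carrier}
    (hc : ∀ i, I.TopAt (T i) θ b (e i) (c i)) : ∑ i, l i • c i = 0 := by
  obtain ⟨B, hB1, hB2⟩ := exists_between hlt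
  have hD := fun i => (T i).isCylDiagram hgt hB2
  have h1 : ∀ i, (e i).1 = insW W := fun i => by
    obtain ⟨-, S, ⟨b', -, g1, g2, -⟩, g3⟩ := hc i
    rw [← g3]
    exact (g2.loc b ⟨le_rfl, g1⟩ θ W (hW i)).1
  choose S hS hSe using fun i => (hD i).exists_isCylSec I.top hB1.le (hW i) (h1 i)
  let i0 : ι := Classical.arbitrary ι
  obtain ⟨θ', -, hθ'⟩ := (hD i0).exists_empty (h := B) ⟨hB1.le, le_rfl⟩ 0 one_pos
  have hag' : ∀ i j, ∀ h, B ≤ h → h < π / 2 → ∀ θ,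
      chart (T i).label θ h = chart (T j).label θ h := fun i j h h1 h2 =>
    hag i j h (hB1.trans_le h1) h2
  refine hI.topAt_comb (T := T i0) (θ := θ') (hgt.trans hB1) (fun i => ?_)
    (IsComb.cross (fun f v hv => hv.map f) I.rad_rot hB1 hD hS
      (fun i j h hh => hag i j h hh.1 (hh.2.trans_lt hB2)) hW (by simpa only [hSe] using he) hθ')
  refine TopAt.congr (hI.topAt_section hgt (hS i) hB1.le hB2 (θ := θ) (by rw [hSe]; exact hc i) ?_)
    (hag' i i0)
  rw [hag' i i0 B le_rfl hB2]; exact hθ'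

theorem Fits.skein (hI : I.Fits α a0) {ι : Type*} [Fintype ι] [Nonempty ι] {l : ι → k}
    {T : ι → StringNet α} {L R : ℝ → ℝ} {a b : ℝ} {xs ys : List 𝓜}
    {f : ι → (tens xs ⟶ tens ys)} (hbox : IsBox L R a b) (ha : -(π / 2) < a)
    (hb : b < π / 2) (hLR : ∀ φ ∈ Icc a b, R φ < L φ + 2 * π)
    (hev : ∀ i, Eval (chart (T i).label) L R a b xs ys (f i))
    (hag : ∀ i j, ∀ p ∉ boxRegion L R a b, (T i).label p = (T j).label p)
    {p : S2} (hp : p ∉ boxRegion L R a b) {x : 𝓜} (hx : Projective x)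
    (hpx : ∀ i, (T i).label p = .edge x) (hf : ∑ i, l i • f i = 0)
    {c : ι → (tens [dual α]).carrier} (hc : ∀ i, I.FVal a0 (T i) (c i)) : ∑ i, l i • c i = 0 := by
  have hab : a < b := hbox.1
  have hpi := two_pi_pos
  have hbnd : ∀ {h}, h ∈ Icc a b → -(π / 2) < h ∧ h < π / 2 := fun hh =>
    ⟨ha.trans_le hh.1, hh.2.trans_lt hb⟩
  let i0 : ι := Classical.arbitrary ι
  have hag1 : ∀ i j, ∀ h, -(π / 2) < h → h < π / 2 → h ∉ Icc a b → ∀ θ,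
      chart (T i).label θ h = chart (T j).label θ h := fun i j h h1 h2 h3 θ => by
    refine hag i j _ ?_
    rintro ⟨θ', φ', g1, g2, -, -, g3⟩
    have g4 := hbnd ⟨g1, g2⟩
    obtain ⟨rfl, -⟩ := (pt_eq_iff h1 h2 g4.1 g4.2).1 g3
    exact h3 ⟨g1, g2⟩
  choose K hK hKa hKb hLa hLb _ using fun i => (hev i).isSec
  have hLe : ∀ i, ∀ h ∈ Icc a b, chart (T i).label (L h) h = .empty := fun i h hh => by
    obtain ⟨W, hW, -⟩ := hK i h hh; exact hW.left_empty
  have hRe : ∀ i, ∀ h ∈ Icc a b, chart (T i).label (R h) h = .empty := fun i h hh => by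
    obtain ⟨W, hW, -⟩ := hK i h hh; exact hW.right_empty
  have hLe' : ∀ i, ∀ h ∈ Icc a b, chart (T i).label (L h + 2 * π) h = .empty := fun i h hh =>
    (chart_periodic _ h (L h)).trans (hLe i h hh)
  have hag2 : ∀ i j, ∀ h ∈ Icc a b, ∀ θ ∈ Icc (R h) (L h + 2 * π),
      chart (T i).label θ h = chart (T j).label θ h := fun i j h hh θ hθ => by
    rcases hθ.1.lt_or_eq with h1 | rfl
    swap
    · rw [hRe i h hh, hRe j h hh]
    rcases hθ.2.lt_or_eq with h2 | rfl
    swap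
    · rw [hLe' i h hh, hLe' j h hh]
    refine hag i j _ ?_
    rintro ⟨θ', φ', g1, g2, g3, g4, g5⟩
    have g6 := hbnd ⟨g1, g2⟩
    obtain ⟨rfl, n, rfl⟩ := (pt_eq_iff (hbnd hh).1 (hbnd hh).2 g6.1 g6.2).1 g5
    rw [zsmul_eq_mul] at h1 h2
    have g7 : (0 : ℝ) < n := by
      by_contra! hn
      nlinarith
    have g8 : (n : ℝ) < 1 := by
      by_contra! hn
      nlinarith
    have g9 : (0 : ℤ) < n := by exact_mod_cast g7
    have g10 : n < (1 : ℤ) := by exact_mod_cast g8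
    omega
  have hD : ∀ i, IsCylDiagram (chart (T i).label) a b := fun i => (T i).isCylDiagram ha hb
  have hout : IsPlanar (chart (T i0).label) R (fun h => L h + 2 * π) a b :=
    ⟨hbox.2.2.1, hbox.2.1.add continuousOn_const, hLR, fun h hh θ _ => (hD i0).prog h hh θ,
      hRe i0, hLe' i0⟩
  obtain ⟨Wa, hWa⟩ := hout.exists_isWallMovie ⟨le_rfl, hab.le⟩
  obtain ⟨Wb, hWb⟩ := hout.exists_isWallMovie ⟨hab.le, le_rfl⟩
  have hamem : a ∈ Icc a b := ⟨le_rfl, hab.le⟩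
  have hbmem : b ∈ Icc a b := ⟨hab.le, le_rfl⟩
  have hwina : ∀ i, IsLevel (chart (T i).label · a) (L a) (L a + 2 * π) (edges xs ++ Wa) :=
    fun i => (hLa i).append (hWa.level.congr fun θ hθ => hag2 i0 i a hamem θ hθ)
  have hwinb : ∀ i, IsLevel (chart (T i).label · b) (L b) (L b + 2 * π) (edges ys ++ Wb) :=
    fun i => (hLb i).append (hWb.level.congr fun θ hθ => hag2 i0 i b hbmem θ hθ)
  have hrad : ∀ V : 𝓜, IsRadVec I.ψ (0 : V.carrier) := fun V f _ => map_zero f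
  have hfin : ∀ {Z : 𝓜} (κ : KState Z) (z : (tens xs ⊗ Z).carrier),
      (∀ i, I.TopAt (T i) (L b) b (app (kprod (⟨ys, f i⟩ : KState (tens xs)) κ) z) (c i)) →
      ∑ i, l i • c i = 0 := fun κ z h =>
    hI.sum_eq_zero_of_topAt (hbnd hbmem).1 hb (fun i j h h1 h2 => hag1 i j h
      ((hbnd hbmem).1.trans h1) h2 fun h3 => absurd h3.2 (not_le.2 h1)) hwinb
      (isComb_app hf κ z hrad) h
  obtain ⟨Ko, hKo, hKoa⟩ := hout.exists_isSec (KStep.isStepRel (tens (insW Wa))) hab.le hWa.level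
    (e := wires (insW Wa)) rfl
  have hsecout : ∀ {a'} {Z : 𝓜} {Ko : ℝ → KState Z}, a ≤ a' →
      IsSec (fun W => KStep W) (chart (T i0).label) R (fun h => L h + 2 * π) a' b Ko →
      ∀ i, IsSec (fun W => KStep W) (chart (T i).label) L (fun h => L h + 2 * π) a' b
        (fun h => kprod (K i h) (Ko h)) := fun ha' hKo i =>
    ((hK i).restrict ha' le_rfl).kprod (hKo.congr fun h hh θ hθ =>
      hag2 i0 i h ⟨ha'.trans hh.1, hh.2⟩ θ hθ)
  obtain ⟨θp, φp, hp1, hp2, rfl⟩ := StringNet.exists_pt_of_edge (hpx i0)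
  have hproj : ∀ {W} {θ : ℝ} i, IsLevel (chart (T i).label · φp) θ (θ + 2 * π) W → x ∈ insW W :=
    fun {W θ} i hW => by
    obtain ⟨τ, hτ, hτ'⟩ := (chart_periodic (T i).label φp).exists_mem θ θp
    have h1 : chart (T i).label τ φp = .edge x := hτ'.trans (hpx i)
    have h2 := hW.mem_of_ne_empty ⟨hτ.1, hτ.2.le⟩
      (show chart (T i).label τ φp ≠ .empty by rw [h1]; exact fun h => by cases h)
    rw [h1] at h2
    exact mem_insW h2
  have hD0 : ∀ i, IsCylDiagram (chart (T i).label) φp φp := fun i => (T i).isCylDiagram hp1 hp2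
  rcases lt_or_ge φp a with hpa | hpa
  · have hag3 : ∀ i j, ∀ h, -(π / 2) < h → h < a → ∀ θ,
        chart (T i).label θ h = chart (T j).label θ h := fun i j h h1 h2 =>
      hag1 i j h h1 (h2.trans (hab.trans hb)) fun h3 => absurd h3.1 (not_le.2 h2)
    obtain ⟨θ0, -, hθ0⟩ := (hD0 i0).exists_empty ⟨le_rfl, le_rfl⟩ 0 one_pos
    have hθ0' : ∀ i, chart (T i).label θ0 φp = .empty := fun i => by
      rw [hag3 i i0 φp hp1 hpa]; exact hθ0
    obtain ⟨W, hW⟩ := (hD0 i0).exists_window ⟨le_rfl, le_rfl⟩ hθ0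
    have hW' : ∀ i, IsLevel (chart (T i).label · φp) θ0 (θ0 + 2 * π) W := fun i =>
      hW.congr fun θ _ => hag3 i0 i φp hp1 hpa θ
    obtain ⟨⟨X, v⟩, he⟩ := hI.exists_botAt hp1 hp2 hθ0
    have hX : X = insW W := by
      obtain ⟨-, S, ⟨a, -, g1, g2, -⟩, g3⟩ := id he
      have := (g2.loc φp ⟨g1, le_rfl⟩ θ0 W hW).1
      rwa [g3] at this
    have hP : Projective (tens X) := I.projective_tens (by rw [hX]; exact hproj i0 hW) hx
    obtain ⟨s, hs⟩ := I.socle hP v (hI.botAt_inv hp2 he)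
    have htop : ∀ i, I.TopAt (T i) θ0 φp ⟨X, s⟩ (c i) := fun i => by
      obtain ⟨c', hc'⟩ := hI.exists_topAt hp1 hp2 (hθ0' i) (hW' i) (e := ⟨X, s⟩) hX
      have := hI.fVal_unique (hc i) ⟨θ0, φp, X, s, v, hp1, hp2, he.congr fun φ h1 h2 =>
        hag3 i0 i φ h1 (h2.trans_lt hpa), hP, hs, hc'⟩
      rwa [this]
    have hD1 : ∀ i, IsCylDiagram (chart (T i).label) φp b := fun i => (T i).isCylDiagram hp1 hb
    choose S hS hSe using fun i => (hD1 i).exists_isCylSec I.top (hpa.le.trans hab.le) (hW' i)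
      (e := ⟨X, s⟩) hX
    have hSa : ∀ i, S i (L a) a = S i0 (L a) a := fun i =>
      ((hS i).mono le_rfl hab.le).eq_of_agree_lt ((hD1 i).mono le_rfl hab.le)
        ((hD1 i0).mono le_rfl hab.le) ((hS i0).mono le_rfl hab.le) hpa
        (fun h hh => hag3 i i0 h (hp1.trans_le hh.1) hh.2) (hθ0' i) ((hSe i).trans (hSe i0).symm)
        (hLe i a hamem) (hLe i0 a hamem)
    have hfst := ((hS i0).loc a ⟨hpa.le, hab.le⟩ _ _ (hwina i0)).1
    rw [insW_append, insW_edges] at hfst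
    obtain ⟨z, hz⟩ := exists_eq_app hfst
    refine hfin (Ko b) z fun i => ?_
    have h3 := ((hS i).mono hpa.le le_rfl).eq_app (hD i) hbox.2.1 (hsecout le_rfl hKo i) (z := z)
      (by rw [hKa, hKoa, hSa, hz]) b hbmem
    rw [hKb] at h3
    rw [← h3]
    exact hI.topAt_section hp1 (hS i) (hpa.le.trans hab.le) hb (by rw [hSe]; exact htop i)
      (hLe i b hbmem)
  obtain ⟨e, he⟩ := hI.exists_botAt (hbnd hamem).1 (hbnd hamem).2 (hLe i0 a hamem)
  have hfst : e.1 = xs ++ insW Wa := by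
    obtain ⟨-, S, ⟨a', -, g1, g2, -⟩, g3⟩ := id he
    have := (g2.loc a ⟨g1, le_rfl⟩ _ _ (hwina i0)).1
    rwa [insW_append, insW_edges, g3] at this
  have heinv := hI.botAt_inv (hbnd hamem).2 he
  obtain ⟨z, hz⟩ := exists_eq_app hfst
  have hbot : ∀ i, ∀ h ∈ Icc a b, I.BotAt a0 (T i) (L h) h (app (kprod (K i h) (Ko h)) z) :=
    fun i h hh => by
    have h1 : I.BotAt a0 (T i) (L a) a e := hI.botAt_congr_lt (hbnd hamem).2 he
      (fun φ g1 g2 => hag1 i0 i φ g1 (g2.trans (hab.trans hb)) fun h3 => absurd h3.1 (not_le.2 g2))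
      (hLe i a hamem)
    obtain ⟨S, h2, h3, h4⟩ := h1.extend hab.le hb
    rw [← h2.eq_app (hD i) hbox.2.1 (hsecout le_rfl hKo i) (z := z)
      (by rw [hKa, hKoa, h3, hz]) h hh]
    exact h4 _ _ hh.1 hh.2 (hLe i h hh)
  rcases le_or_gt φp b with hpb | hpb
  · have hpm : φp ∈ Icc a b := ⟨hpa, hpb⟩
    obtain ⟨Wp, hWp⟩ := hout.exists_isWallMovie hpm
    have hX2 : (Ko φp).1 = insW Wp := by
      obtain ⟨W, h1, ⟨e', h2⟩, -⟩ := hKo φp hpm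
      rw [h2.fst, h1.unique hWp.level]
    have hxW : x ∈ insW Wp := by
      obtain ⟨n, hn, -⟩ := existsUnique_add_zsmul_mem_Ico hpi θp (L φp)
      have h1 : chart (T i0).label (θp + n • (2 * π)) φp = .edge x :=
        ((chart_periodic (T i0).label φp).add_zsmul θp n).trans (hpx i0)
      have h2 : R φp ≤ θp + n • (2 * π) := by
        by_contra! h2
        exact hp ⟨_, φp, hpa, hpb, hn.1, h2.le,
          ((pt_eq_iff hp1 hp2 hp1 hp2).2 ⟨rfl, n, rfl⟩).symm⟩
      have h3 := hWp.level.mem_of_ne_empty ⟨h2, hn.2.le⟩ (by rw [h1]; exact fun h => by cases h)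
      rw [h1] at h3
      exact mem_insW h3
    have hxX : x ∈ (Ko φp).1 := by rwa [hX2]
    have hzinv : IsInvVec I.χ z := by
      rw [hz] at heinv
      have h1 := heinv.map (tensAppend xs (insW Wa)).hom
      have h2 : ((𝟙 (tens xs) ⊗ₘ 𝟙 (tens (insW Wa))) ≫ (tensAppend xs (insW Wa)).inv) ≫
          (tensAppend xs (insW Wa)).hom = 𝟙 _ := by simp
      have h3 : ∀ z' : (tens xs ⊗ tens (insW Wa)).carrier, z' = z → IsInvVec I.χ z' →
          IsInvVec I.χ z := fun z' h => h ▸ id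
      exact h3 _ (toLin_congr h2 z) h1
    obtain ⟨s, hs⟩ := I.socle (I.projective_tens (mem_append_right xs hxX) hx) _
      (hzinv.map ((𝟙 (tens xs) ⊗ₘ (Ko φp).2) ≫ (tensAppend xs (Ko φp).1).inv))
    set z' : (tens xs ⊗ tens (Ko φp).1).carrier := (tensAppend xs (Ko φp).1).hom.toLin s with hz'
    have hΛz : (tens xs ⊗ tens (Ko φp).1).ρ I.Λ z' = (𝟙 (tens xs) ⊗ₘ (Ko φp).2).toLin z := by
      have h1 := comm_apply (tensAppend xs (Ko φp).1).hom I.Λ s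
      rw [hz', ← h1, hs]
      have h2 : ((𝟙 (tens xs) ⊗ₘ (Ko φp).2) ≫ (tensAppend xs (Ko φp).1).inv) ≫
          (tensAppend xs (Ko φp).1).hom = 𝟙 (tens xs) ⊗ₘ (Ko φp).2 := by simp
      exact toLin_congr h2 z
    set κ : KState (tens (Ko φp).1) := ⟨(Ko φp).1, 𝟙 _⟩ with hκ
    have hact : ∀ i, I.act (app (kprod (K i φp) κ) z') = app (kprod (K i φp) (Ko φp)) z := fun i => by
      rw [act_app, hΛz, hκ, app_kprod_whisker]
    obtain ⟨K', hK', hK'a⟩ := (hout.mono hpa le_rfl).exists_isSec (KStep.isStepRel _) hpb hWp.level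
      (e := κ) hX2
    have hsec := fun i => hsecout hpa hK' i
    have hfst' : ∀ i, ∃ W, IsLevel (chart (T i).label · φp) (L φp) (L φp + 2 * π) W ∧
        (app (kprod (K i φp) κ) z').1 = insW W := fun i => by
      obtain ⟨W, h1, ⟨e', h2⟩, -⟩ := hsec i φp ⟨le_rfl, hpb⟩
      refine ⟨W, h1, ?_⟩
      dsimp only at h2
      rw [hK'a] at h2
      exact h2.fst
    refine hfin (K' b) z' fun i => ?_
    obtain ⟨W, hW, hWe⟩ := hfst' i
    obtain ⟨c', hc'⟩ := hI.exists_topAt hp1 hp2 hW.left_empty hW hWe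
    have hB := hbot i φp hpm
    rw [← hact i] at hB
    have hcc := hI.fVal_unique (hc i) ⟨L φp, φp, _, _, _, hp1, hp2, hB,
      I.projective_tens (mem_append_right _ hxX) hx, rfl, hc'⟩
    obtain ⟨S, hS, hSe⟩ := ((hD i).mono hpa le_rfl).exists_isCylSec I.top hpb hW hWe
    have h3 := hS.eq_app ((hD i).mono hpa le_rfl) (hbox.2.1.mono (Icc_subset_Icc hpa le_rfl))
      (hsec i) (z := z') (by rw [hSe, hK'a]) b ⟨hpb, le_rfl⟩
    rw [hKb] at h3
    rw [← h3, hcc]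
    exact hI.topAt_section hp1 hS hpb hb (by rw [hSe]; exact hc') (hLe i b hbmem)
  · have hag3 : ∀ i j, ∀ h, b < h → h < π / 2 → ∀ θ,
        chart (T i).label θ h = chart (T j).label θ h := fun i j h h1 h2 =>
      hag1 i j h ((hbnd hbmem).1.trans h1) h2 fun h3 => absurd h3.2 (not_le.2 h1)
    have hD1 : ∀ i, IsCylDiagram (chart (T i).label) b φp := fun i =>
      (T i).isCylDiagram (hbnd hbmem).1 hp2
    choose S hS hSe hSb using fun i => (hbot i b hbmem).extend hpb.le hp2
    obtain ⟨θ0, -, hθ0⟩ := (hD0 i0).exists_empty ⟨le_rfl, le_rfl⟩ 0 one_pos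
    obtain ⟨W, hW⟩ := (hD0 i0).exists_window ⟨le_rfl, le_rfl⟩ hθ0
    have hW' : ∀ i, IsLevel (chart (T i).label · φp) θ0 (θ0 + 2 * π) W := fun i =>
      hW.congr fun θ _ => hag3 i0 i φp hpb hp2 θ
    obtain ⟨X, v, hXv, hsum⟩ := IsComb.cross (l := l) (p := fun _ v => v = 0)
      (fun f v hv => by rw [hv, map_zero]) (zero_rot I.bot) hpb hD1 hS
      (fun i j h hh => hag3 i j h hh.1 (hh.2.trans_lt hp2)) hwinb
      (by simp only [hSe, hKb]; exact isComb_app hf _ _ fun _ => rfl) hθ0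
    have hX : X = insW W := by
      have h1 := ((hS i0).loc φp ⟨hpb.le, le_rfl⟩ θ0 W hW).1
      rwa [congrFun hXv i0] at h1
    have hP : Projective (tens X) := I.projective_tens (by rw [hX]; exact hproj i0 hW) hx
    have hB : ∀ i, I.BotAt a0 (T i) θ0 φp ⟨X, v i⟩ := fun i => by
      rw [← congrFun hXv i]
      exact hSb i θ0 φp hpb.le le_rfl (hW' i).left_empty
    choose s hs using fun i => I.socle hP (v i) (hI.botAt_inv hp2 (hB i))
    refine hI.topAt_comb (T := T i0) (θ := θ0) hp1 (e := fun i => ⟨X, s i⟩) (fun i => ?_)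
      ⟨X, s, rfl, I.ker hP _ ?_⟩
    · obtain ⟨c', hc'⟩ := hI.exists_topAt hp1 hp2 (hW' i).left_empty (hW' i) (e := ⟨X, s i⟩) hX
      rw [hI.fVal_unique (hc i) ⟨θ0, φp, X, s i, v i, hp1, hp2, hB i, hP, hs i, hc'⟩]
      exact hc'.congr fun φ h1 h2 => hag3 i i0 φ (hpb.trans_le h1) h2
    · rw [map_sum, sum_congr rfl fun i _ => by rw [map_smul, hs i]]
      exact hsum

end TwistedIntegral

section Shift

variable {σ : Type*}

theorem IsSec.shift {step : Labels C → σ → σ → Prop}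
    {L R : ℝ → ℝ} {a b s : ℝ} {P : ℝ → σ} (h : IsSec step D L R a b P)
    (hD : ∀ t θ, D (θ + s) t = D θ t) : IsSec step D (fun t => L t + s) (fun t => R t + s) a b P :=
  fun x hx => by
  obtain ⟨W, h0, h1⟩ := h x hx
  exact ⟨W, h0.shift fun θ => hD x θ, h1⟩

end Shift

section Pairings

variable (V : Type u) [AddCommGroup V] [Module k V] [FiniteDimensional k V]

theorem exists_dualTensorEnd : ∃ e : V ⊗[k] Dual k V →ₗ[k] Module.End k V,
    (∀ v ξ w, e (v ⊗ₜ ξ) w = ξ w • v) ∧ Function.Injective e :=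
  ⟨dualTensorHom k V V ∘ₗ (tcomm k V (Dual k V)).toLinearMap,
    fun _ _ _ => rfl, (dualTensorHomEquiv k V V).injective.comp
      (tcomm k V (Dual k V)).injective⟩

theorem dualTensorEnd_coevaluation {e : V ⊗[k] Dual k V →ₗ[k] Module.End k V}
    (he : ∀ v ξ w, e (v ⊗ₜ ξ) w = ξ w • v) : e (coevaluation k V 1) = 1 := by
  ext w
  rw [coevaluation_apply_one, map_sum, LinearMap.sum_apply]
  simp only [he]
  exact (Module.Basis.ofVectorSpace k V).sum_repr w

theorem coevaluation_dual : coevaluation k (Dual k V) 1 =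
    tmap .id (Dual.eval k V)
      (tcomm k _ _ (coevaluation k V 1)) := by
  obtain ⟨e, he, hinj⟩ := exists_dualTensorEnd (k := k) (Dual k V)
  apply hinj
  rw [dualTensorEnd_coevaluation _ he, coevaluation_apply_one, map_sum, map_sum, map_sum]
  ext f w
  rw [LinearMap.sum_apply, LinearMap.sum_apply]
  conv_lhs => rw [End.one_apply, ← (Module.Basis.ofVectorSpace k V).sum_repr w, map_sum]
  refine sum_congr rfl fun i _ => ?_
  rw [TensorProduct.comm_tmul, map_tmul, he, LinearMap.smul_apply, map_smul,
    Dual.eval_apply]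
  exact mul_comm _ _

theorem sum_coevaluation (ξ : Dual k V) : lid k _
    (tmap ξ .id (coevaluation k V 1)) = ξ := by
  have h := lcongr (contractLeft_assoc_coevaluation k V) (ξ ⊗ₜ (1 : k))
  have h2 : ∀ t : V ⊗[k] Dual k V, (contractLeft k V).rTensor _
      ((TensorProduct.assoc k _ _ _).symm (ξ ⊗ₜ t)) = tmap ξ .id t := fun t => by
    induction t with
    | zero => simp
    | add a b ha hb => rw [tmul_add, map_add, map_add, ha, hb, map_add]
    | tmul a b => rfl
  have h3 := h2 (coevaluation k V 1)
  rw [← h3]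
  refine (congrArg (lid k _) h).trans ?_
  simp

end Pairings

/-- The isomorphism `v** ⊗ a ↦ a ⊗ γ v`. -/
def IsSwapBy (P : TwistedPivotalStructure α) (γ : H) : Prop :=
  ∀ (V : 𝓜) (v : V.carrier) (a : α.carrier),
    (P.app V).hom.toLin (Dual.eval k V.carrier v ⊗ₜ[k] a) = a ⊗ₜ[k] V.ρ γ v

theorem IsSwapBy.mate {P : TwistedPivotalStructure α} {γ : H} (hP : IsSwapBy P γ) (V : 𝓜)
    (v : V.carrier) (ξ : Dual k α.carrier) :
    (P.mate V).toLin (ξ ⊗ₜ[k] Dual.eval k V.carrier v) = V.ρ γ v ⊗ₜ[k] ξ := by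
  let F : (dual α ⊗ dual (dual V)).carrier ⊗[k] (α.carrier ⊗[k] (dual α).carrier) →ₗ[k]
      (V ⊗ dual α).carrier :=
    ((((α_ _ _ _).hom ≫ dual α ◁ (P.app V).hom ≫ (α_ _ _ _).inv ≫ ev α ▷ V ≫ (λ_ V).hom) ▷
      dual α : ((dual α ⊗ dual (dual V)) ⊗ α) ⊗ dual α ⟶ V ⊗ dual α).toLin ∘ₗ
      (α_ (dual α ⊗ dual (dual V)) α (dual α)).inv.toLin)
  have h1 : (P.mate V).toLin (ξ ⊗ₜ[k] Dual.eval k V.carrier v) =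
      F ((ξ ⊗ₜ[k] Dual.eval k V.carrier v : (dual α ⊗ dual (dual V)).carrier) ⊗ₜ[k]
        coevaluation k α.carrier 1) := rfl
  have h2 : ∀ (a : α.carrier) (f : (dual α).carrier),
      F ((ξ ⊗ₜ[k] Dual.eval k V.carrier v : (dual α ⊗ dual (dual V)).carrier) ⊗ₜ[k]
        (a ⊗ₜ[k] f)) = (ξ a • V.ρ γ v) ⊗ₜ[k] f := fun a f => by
    have h3 : F ((ξ ⊗ₜ[k] Dual.eval k V.carrier v : (dual α ⊗ dual (dual V)).carrier) ⊗ₜ[k]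
        (a ⊗ₜ[k] f)) = ((ev α ▷ V ≫ (λ_ V).hom : (dual α ⊗ α) ⊗ V ⟶ V).toLin
          ((α_ (dual α) α V).inv.toLin (ξ ⊗ₜ[k] ((P.app V).hom.toLin
            (Dual.eval k V.carrier v ⊗ₜ[k] a))))) ⊗ₜ[k] f := rfl
    rw [h3, hP]
    rfl
  have h4 : ∀ t : α.carrier ⊗[k] (dual α).carrier,
      F ((ξ ⊗ₜ[k] Dual.eval k V.carrier v : (dual α ⊗ dual (dual V)).carrier) ⊗ₜ[k] t) =
        V.ρ γ v ⊗ₜ[k] lid k _ (tmap ξ .id t) := fun t => by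
    induction t with
    | zero => simp
    | add a b ha hb =>
      rw [tmul_add, map_add, ha, hb, map_add, map_add, tmul_add]
    | tmul a f =>
      rw [h2, map_tmul, TensorProduct.lid_tmul, smul_tmul]
      rfl
  exact h1.trans ((h4 _).trans
    (congrArg (fun z => V.ρ γ v ⊗ₜ[k] z) (sum_coevaluation α.carrier ξ)))

namespace VState

theorem letter_mul_letter (x y : 𝓜) (v : x.carrier) (w : y.carrier) :
    mul (letter x v) (letter y w) = ⟨[x, y], (tensPair x y).hom.toLin (v ⊗ₜ[k] w)⟩ :=
  letter_mul x v [y] _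

theorem rot_coev {P : TwistedPivotalStructure α} {γ : GroupLike k H} (hP : IsSwapBy P γ.val)
    (x : 𝓜) {a : α.carrier} (ha : α.ρ γ.val a = a) :
    ∃ z : (tens [dual x] ⊗ tens [dual (dual x), α]).carrier,
      mul (app ⟨[dual x, dual (dual x)], coev (dual x) ≫ (tensPair _ _).hom⟩ (1 : k)) (letter α a) =
        app (kprod wires [dual x] ⟨[dual (dual x), α], 𝟙 _⟩) z ∧
      (rot γ) ((rot γ) (mul (letter α a) (app ⟨[x, dual x], coev x ≫ (tensPair _ _).hom⟩ (1 : k)))) =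
        app (kprod wires [dual x] ⟨[α, x],
          (tensPair _ _).inv ≫ (P.app x).hom ≫ (tensPair _ _).hom⟩) z := by
  let ζ : x.carrier ⊗[k] (dual x).carrier →ₗ[k]
      (tens [dual x] ⊗ tens [dual (dual x), α]).carrier :=
    tmap (rid k _).symm.toLinearMap
      ((tmk k _ _).flip (consV α [] (a ⊗ₜ[k] scalar 1)) ∘ₗ Dual.eval k x.carrier) ∘ₗ
      (tcomm k _ _).toLinearMap
  have hζ : ∀ v f, ζ (v ⊗ₜ f) = ((f ⊗ₜ[k] (1 : k) : (dual x).carrier ⊗[k] k) ⊗ₜ[k]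
    ((Dual.eval k x.carrier v ⊗ₜ[k] (a ⊗ₜ[k] (1 : k)) : Dual k (Dual k x.carrier) ⊗[k]
      (α.carrier ⊗[k] k))) : ((dual x).carrier ⊗[k] k) ⊗[k]
        (Dual k (Dual k x.carrier) ⊗[k] (α.carrier ⊗[k] k))) := fun v f => rfl
  refine ⟨ζ (coevaluation k x.carrier 1), ?_, ?_⟩
  · have h1 : app ⟨[dual x, dual (dual x)], coev (dual x) ≫ (tensPair _ _).hom⟩ (1 : k) =
        ⟨[dual x, dual (dual x)], (tensPair (dual x) (dual (dual x))).hom.toLin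
          (coevaluation k (Dual k x.carrier) 1)⟩ := rfl
    rw [h1, coevaluation_dual]
    refine congrFun (IsLin.ext_tmul
      (φ := fun t => mul ⟨[dual x, dual (dual x)], (tensPair (dual x) (dual (dual x))).hom.toLin
        (tmap .id (Dual.eval k x.carrier)
          (tcomm k _ _ t))⟩ (letter α a))
      (ψ := fun t => app (kprod wires [dual x]
        ⟨[dual (dual x), α], 𝟙 _⟩) (ζ t)) ?_ ?_ ?_) _
    · exact ((isLin_mk [dual x, dual (dual x)]).comp ((tensPair (dual x) (dual (dual x))).hom.toLin ∘ₗ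
        tmap .id (Dual.eval k x.carrier) ∘ₗ
          (tcomm k _ _).toLinearMap)).mul_right _
    · exact ⟨_, (kprod wires [dual x]
        ⟨[dual (dual x), α], 𝟙 _⟩).2.toLin ∘ₗ ζ, rfl⟩
    · intro v f
      rw [hζ]
      refine Eq.trans ?_ (app_kprod _ _ _ _).symm
      refine (congrArg (fun e => mul e (letter α a))
        (letter_mul_letter (dual x) (dual (dual x)) f (Dual.eval k x.carrier v)).symm).trans ?_
      rw [mul_assoc]
      exact congrArg (mul (letter (dual x) f))
        (letter_mul (dual (dual x)) (Dual.eval k x.carrier v) [α] _)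
  · refine congrFun (IsLin.ext_tmul
      (φ := fun t => (rot γ) ((rot γ) (mul (letter α a) ⟨[x, dual x],
        (tensPair x (dual x)).hom.toLin t⟩)))
      (ψ := fun t => app (kprod wires [dual x] ⟨[α, x],
          (tensPair _ _).inv ≫ (P.app x).hom ≫ (tensPair _ _).hom⟩) (ζ t)) ?_ ?_ ?_) _
    · exact (((isLin_mk [x, dual x]).comp (tensPair x (dual x)).hom.toLin).mul_left
        _).rotate_iterate γ 2
    · exact ⟨_, (kprod wires [dual x] ⟨[α, x],
          (tensPair _ _).inv ≫ (P.app x).hom ≫ (tensPair _ _).hom⟩).2.toLin ∘ₗ ζ, rfl⟩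
    · intro v f
      rw [hζ]
      refine Eq.trans ?_ (app_kprod _ _ _ _).symm
      rw [← letter_mul_letter, rot_letter_mul, ha, mul_assoc, rot_letter_mul, mul_assoc,
        letter_mul_letter]
      refine congrArg (mul (letter (dual x) f)) ?_
      refine congrArg (Sigma.mk [α, x]) ?_
      have h1 := hP x v a
      have h2 : ((tensPair (dual (dual x)) α).inv ≫ (P.app x).hom ≫ (tensPair α x).hom).toLin
          (Dual.eval k x.carrier v ⊗ₜ[k] (a ⊗ₜ[k] (1 : k)) :
            Dual k (Dual k x.carrier) ⊗[k] (α.carrier ⊗[k] k)) =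
          (tensPair α x).hom.toLin ((P.app x).hom.toLin
            (Dual.eval k x.carrier v ⊗ₜ[k] ((1 : k) • a))) := rfl
      rw [one_smul, h1] at h2
      exact h2.symm

end VState

/-- The canonical map to the double dual. -/
def evalD (x : 𝓜) : x.carrier →ₗ[k] (dual (dual x)).carrier := Dual.eval k x.carrier

/-- The value of a functional at a vector. -/
def pair (x : 𝓜) (f : (dual x).carrier) (v : x.carrier) : k :=
  contractLeft k x.carrier (f ⊗ₜ v)

theorem rho_dual_dual (γ : GroupLike k H) (x : 𝓜) (v : x.carrier) :
    (dual (dual x)).ρ γ.val (evalD x v) =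
      evalD x (x.ρ γ.val v) := by
  have h1 : HopfAlgebra.antipode k (HopfAlgebra.antipode k γ.val) = γ.val := by
    rw [← GroupLike.val_inv, ← GroupLike.val_inv, inv_inv]
  have h2 : (dual (dual x)).ρ γ.val (evalD x v) = evalD x
    (x.ρ (HopfAlgebra.antipode k (HopfAlgebra.antipode k γ.val)) v) := rfl
  rw [h2, h1]

theorem IsSwapBy.mate_evalD {P : TwistedPivotalStructure α} {γ : H} (hP : IsSwapBy P γ)
    (V : 𝓜) (v : V.carrier) (ξ : (dual α).carrier) :
    (P.mate V).toLin (ξ ⊗ₜ[k] evalD V v) = V.ρ γ v ⊗ₜ[k] ξ := hP.mate V v ξ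

namespace VState

theorem IsLin.ext_tmul₃ {M N O : Type*} [AddCommGroup M] [Module k M] [AddCommGroup N] [Module k N]
    [AddCommGroup O] [Module k O] {φ ψ : M ⊗[k] (N ⊗[k] O) → VState k H} (hφ : IsLin φ)
    (hψ : IsLin ψ) (h : ∀ m n o, φ (m ⊗ₜ (n ⊗ₜ o)) = ψ (m ⊗ₜ (n ⊗ₜ o))) : φ = ψ :=
  hφ.ext_tmul hψ fun m n => congrFun (IsLin.ext_tmul (hφ.comp (tmk k _ _ m))
    (hψ.comp (tmk k _ _ m)) (h m)) n

theorem isLin_app {Z : 𝓜} (K : KState Z) : IsLin (app K) := ⟨K.1, K.2.toLin, rfl⟩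

/-- The tensors `ξ ⊗ v** ⊗ f`, in the three positions that occur when `ξ` and `v**` are moved around
the back of the cylinder and `v**` is then swapped with `ξ`. -/
def evSource (α x : 𝓜) :
    (dual α).carrier ⊗[k] (x.carrier ⊗[k] (dual x).carrier) →ₗ[k]
      (tens [dual α] ⊗ tens [dual (dual x), dual x]).carrier :=
  tmap (rid k _).symm.toLinearMap
    (tmap (evalD x) (rid k _).symm.toLinearMap)

def evMiddle (α x : 𝓜) (c : H) :
    (dual α).carrier ⊗[k] (x.carrier ⊗[k] (dual x).carrier) →ₗ[k]
      (tens [dual x] ⊗ tens [dual α, dual (dual x)]).carrier :=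
  tmap (rid k _).symm.toLinearMap
    (tmap .id ((rid k _).symm.toLinearMap ∘ₗ
      evalD x ∘ₗ x.ρ c)) ∘ₗ (tcomm k _ _).toLinearMap ∘ₗ
    (TensorProduct.assoc k _ _ _).symm.toLinearMap

def evTarget (α x : 𝓜) :
    (dual α).carrier ⊗[k] (x.carrier ⊗[k] (dual x).carrier) →ₗ[k]
      (tens [dual x, x] ⊗ tens [dual α]).carrier :=
  tmap (tmap .id (rid k _).symm.toLinearMap ∘ₗ
    (tcomm k _ _).toLinearMap) (rid k _).symm.toLinearMap ∘ₗ
    (tcomm k _ _).toLinearMap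

theorem evSource_surjective (α x : 𝓜) : Function.Surjective (evSource α x) :=
  TensorProduct.map_surjective (rid k _).symm.surjective
    (TensorProduct.map_surjective (show Function.Surjective (evalD x) from (evalEquiv k x.carrier).surjective)
      (rid k _).symm.surjective)

theorem app_evSource (x : 𝓜) (ξ : (dual α).carrier) (v : x.carrier)
    (f : (dual x).carrier) : app (kprod wires [dual α]
      ⟨[dual (dual x), dual x], 𝟙 _⟩) (evSource α x (ξ ⊗ₜ (v ⊗ₜ f))) =
    mul (letter (dual α) ξ) (mul (letter (dual (dual x)) (evalD x v))
      (letter (dual x) f)) := by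
  rw [letter_mul_letter]
  exact app_kprod wires [dual α] ⟨[dual (dual x), dual x], 𝟙 _⟩ _ _

theorem app_evMiddle (x : 𝓜) (c : H) (ξ : (dual α).carrier) (v : x.carrier)
    (f : (dual x).carrier) : app (kprod wires [dual x]
      ⟨[dual α, dual (dual x)], 𝟙 _⟩) (evMiddle α x c (ξ ⊗ₜ (v ⊗ₜ f))) =
    mul (letter (dual x) f) (mul (letter (dual α) ξ)
      (letter (dual (dual x)) (evalD x (x.ρ c v)))) := by
  rw [letter_mul_letter]
  exact app_kprod wires [dual x] ⟨[dual α, dual (dual x)], 𝟙 _⟩ _ _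

theorem app_evTarget (x : 𝓜) (ξ : (dual α).carrier) (v : x.carrier)
    (f : (dual x).carrier) : app (kprod wires [dual x, x]
      ⟨[dual α], 𝟙 _⟩) (evTarget α x (ξ ⊗ₜ (v ⊗ₜ f))) =
    mul (mul (letter (dual x) f) (letter x v)) (letter (dual α) ξ) := by
  rw [letter_mul_letter]
  exact app_kprod wires [dual x, x] ⟨[dual α], 𝟙 _⟩ _ _

theorem rot_evSource {γ : GroupLike k H} (hα : ∀ ξ, (dual α).ρ γ.val ξ = ξ) (x : 𝓜) (t) :
    rot γ (rot γ (app (kprod wires [dual α]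
      ⟨[dual (dual x), dual x], 𝟙 _⟩) (evSource α x t))) =
    app (kprod wires [dual x]
      ⟨[dual α, dual (dual x)], 𝟙 _⟩) (evMiddle α x γ.val t) := by
  refine congrFun (IsLin.ext_tmul₃ (φ := fun t => rot γ (rot γ (app (kprod
      wires [dual α] ⟨[dual (dual x), dual x], 𝟙 _⟩) (evSource α x t))))
    (ψ := fun t => app (kprod wires [dual x]
      ⟨[dual α, dual (dual x)], 𝟙 _⟩) (evMiddle α x γ.val t))
    ((((isLin_app _).comp (evSource α x)).rotate γ).rotate γ)
    ((isLin_app _).comp (evMiddle α x γ.val)) fun ξ v f => ?_) t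
  refine (congrArg (fun e => rot γ (rot γ e)) (app_evSource x ξ v f)).trans
    (Eq.trans ?_ (app_evMiddle x γ.val ξ v f).symm)
  rw [rot_letter_mul, mul_assoc, rot_letter_mul, hα, mul_assoc, rho_dual_dual]

theorem mate_evMiddle {P : TwistedPivotalStructure α} {β c : H} (hP : IsSwapBy P β)
    (hβ : β * c = 1) (x : 𝓜) (t) :
    app (kprod wires [dual x] ⟨[x, dual α],
      (tensPair _ _).inv ≫ P.mate x ≫ (tensPair _ _).hom⟩) (evMiddle α x c t) =
    app (kprod wires [dual x, x] ⟨[dual α], 𝟙 _⟩)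
      (evTarget α x t) := by
  refine congrFun (IsLin.ext_tmul₃ (φ := fun t => app (kprod
      wires [dual x] ⟨[x, dual α],
      (tensPair _ _).inv ≫ P.mate x ≫ (tensPair _ _).hom⟩) (evMiddle α x c t))
    (ψ := fun t => app (kprod wires [dual x, x]
      ⟨[dual α], 𝟙 _⟩) (evTarget α x t))
    ((isLin_app _).comp (evMiddle α x c)) ((isLin_app _).comp (evTarget α x)) fun ξ v f => ?_) t
  have h1 : app (kprod wires [dual x] ⟨[x, dual α],
      (tensPair _ _).inv ≫ P.mate x ≫ (tensPair _ _).hom⟩) (evMiddle α x c (ξ ⊗ₜ (v ⊗ₜ f))) =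
      mul (letter (dual x) f) ⟨[x, dual α], (tensPair x (dual α)).hom.toLin ((P.mate x).toLin
        (ξ ⊗ₜ[k] ((1 : k) • evalD x (x.ρ c v))))⟩ :=
    app_kprod wires [dual x] ⟨[x, dual α],
      (tensPair _ _).inv ≫ P.mate x ≫ (tensPair _ _).hom⟩ _ _
  have h2 : x.ρ β (x.ρ c v) = v := by
    rw [← End.mul_apply, ← map_mul, hβ, map_one, End.one_apply]
  refine h1.trans (Eq.trans ?_ (app_evTarget x ξ v f).symm)
  rw [one_smul, hP.mate_evalD, h2, mul_assoc, letter_mul_letter x (dual α)]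

theorem ev_evTarget (x : 𝓜) (t) :
    app (kprod cap x
      wires [dual α]) (evTarget α x t) =
    app (kprod wires [dual α] (⟨[], (tensPair _ _).inv ≫ ev (dual x)⟩ :
      KState (tens [dual (dual x), dual x]))) (evSource α x t) := by
  refine congrFun (IsLin.ext_tmul₃
    (φ := fun t => app (kprod cap x
      wires [dual α]) (evTarget α x t))
    (ψ := fun t => app (kprod wires [dual α]
      (⟨[], (tensPair _ _).inv ≫ ev (dual x)⟩ : KState (tens [dual (dual x), dual x])))
      (evSource α x t))
    ((isLin_app _).comp (evTarget α x)) ((isLin_app _).comp (evSource α x)) fun ξ v f => ?_) t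
  have h1 : app (kprod cap x
      wires [dual α]) (evTarget α x (ξ ⊗ₜ (v ⊗ₜ f))) =
      mul ⟨[], scalar (pair x f ((1 : k) • v))⟩ (letter (dual α) ξ) :=
    app_kprod cap x
      wires [dual α] _ _
  have h2 : app (kprod wires [dual α] (⟨[], (tensPair _ _).inv ≫
      ev (dual x)⟩ : KState (tens [dual (dual x), dual x]))) (evSource α x (ξ ⊗ₜ (v ⊗ₜ f))) =
      mul (letter (dual α) ξ) ⟨[], scalar (pair x ((1 : k) • f) v)⟩ :=
    app_kprod wires [dual α] (⟨[], (tensPair _ _).inv ≫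
      ev (dual x)⟩ : KState (tens [dual (dual x), dual x])) _ _
  refine h1.trans (Eq.trans ?_ h2.symm)
  rw [one_smul, one_smul, nil_mul, mul_nil]

end VState

section Colours

variable {D : Plan C}
  {L R : ℝ → ℝ} {a b θ h : ℝ} {y : C}

theorem IsStrandFamily.mem_of_edge {s : Set ℝ} {xs : List C} {u : Fin xs.length → ℝ → ℝ}
    (hu : IsStrandFamily D L R s xs u) (hh : h ∈ s) (hθ : θ ∈ Icc (L h) (R h))
    (he : D θ h = .edge y) : y ∈ xs := by
  by_cases h1 : ∃ i, θ = u i h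
  · obtain ⟨i, rfl⟩ := h1
    obtain rfl := PointLabel.edge.inj (he.symm.trans ((hu.2 h hh).2.1 i).2.2)
    exact List.getElem_mem _
  · have := (hu.2 h hh).2.2 θ hθ (not_exists.1 h1)
    cases he.symm.trans this

theorem IsCorolla.mem_of_edge {xs ys : List C} {f : tens xs ⟶ tens ys}
    (hc : IsCorolla D L R a b xs ys f) (hh : h ∈ Icc a b) (hθ : θ ∈ Icc (L h) (R h))
    (he : D θ h = .edge y) : y ∈ xs ∨ y ∈ ys := by
  obtain ⟨θ0, h0, ha0, h0b, -, -, hv, hee, ⟨u, hu, -⟩, ⟨w, hw, -⟩⟩ := hc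
  rcases lt_trichotomy h h0 with h1 | rfl | h1
  · exact .inl (hu.mem_of_edge ⟨hh.1, h1⟩ hθ he)
  · rcases eq_or_ne θ θ0 with rfl | h2
    · cases he.symm.trans hv
    · cases he.symm.trans (hee θ hθ h2)
  · exact .inr (hw.mem_of_edge ⟨h1, hh.2⟩ hθ he)

theorem IsSingleStrand.eq_of_edge {T : S2 → PointLabel C} {s : Set ℝ} {x : C} {g : ℝ → ℝ}
    (hT : IsSingleStrand T s x g) (hh : h ∈ s) (he : chart T θ h = .edge y) : y = x := by
  by_cases h1 : ∃ n : ℤ, θ = g h + n * (2 * π)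
  · exact PointLabel.edge.inj (he.symm.trans ((hT h hh θ).1 h1))
  · cases he.symm.trans ((hT h hh θ).2 (not_exists.1 h1))

theorem eq_edges_of_rotate {x y z : C} (hne : ¬ (x = y ∧ y = z)) {W1 W2 : Labels C}
    (h1 : W1 ++ W2 = edges [x, y, z]) (h2 : W2 ++ W1 = edges [z, x, y]) : W1 = edges [x, y] := by
  simp only [edges, List.map_cons, List.map_nil] at *
  rcases W1 with _ | ⟨w1, _ | ⟨w2, _ | ⟨w3, _ | ⟨w4, W⟩⟩⟩⟩
  · obtain rfl : W2 = _ := h1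
    simp only [append_nil, List.cons.injEq, PointLabel.edge.injEq] at h2
    exact absurd ⟨h2.2.1.symm, h2.2.2.1.symm⟩ hne
  · simp only [List.cons_append, List.nil_append, List.cons.injEq] at h1
    obtain ⟨rfl, rfl⟩ := h1
    simp only [List.cons_append, List.nil_append, List.cons.injEq, PointLabel.edge.injEq] at h2
    exact absurd ⟨h2.2.2.1, h2.1⟩ hne
  · simp only [List.cons_append, List.nil_append, List.cons.injEq] at h1
    obtain ⟨rfl, rfl, -⟩ := h1
    rfl
  · simp only [List.cons_append, List.nil_append, List.cons.injEq] at h1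
    obtain ⟨rfl, rfl, rfl, rfl⟩ := h1
    simp only [List.nil_append, List.cons.injEq, PointLabel.edge.injEq] at h2
    exact absurd ⟨h2.2.1.symm, h2.2.2.1.symm⟩ hne
  · simp at h1

end Colours

theorem StringNet.exists_window_of_edge (T : StringNet α) {θ φ : ℝ} {x : 𝓜}
    (h1 : -(π / 2) < φ) (h2 : φ < π / 2) (he : chart T.label θ φ = .edge x) :
    ∃ θ0 W, IsLevel (chart T.label · φ) θ0 (θ0 + 2 * π) W ∧ x ∈ insW W := by
  have hD := T.isCylDiagram h1 h2
  have hpi := pi_gt_three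
  obtain ⟨θ0, h3, h4⟩ := hD.exists_empty ⟨le_rfl, le_rfl⟩ (θ - 1) one_pos
  obtain ⟨W, hW⟩ := hD.exists_window ⟨le_rfl, le_rfl⟩ h4
  refine ⟨θ0, W, hW, mem_insW ?_⟩
  rw [← he]
  exact hW.mem_of_ne_empty ⟨by linarith [h3.2], by linarith [h3.1]⟩
    (by rw [he]; exact fun h => by cases h)

namespace TwistedIntegral

open VState

variable {I : TwistedIntegral k H} {a0 : (tens [α]).carrier} (hI : I.Fits α a0) {T T' : StringNet α}

include hI

theorem Fits.botAt_south {θ a : ℝ} (h : T.IsSouth a) (hθ : chart T.label θ a = .empty) :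
    I.BotAt a0 T θ a ⟨[α], a0⟩ :=
  ⟨hθ, fun _ _ => ⟨[α], a0⟩, ⟨a, h, le_rfl, IsSingleStrand.isCylSec
    (fun φ hφ => h.window φ (h.gt.trans_le hφ.1) hφ.2) hI.rot_bot, fun _ _ => rfl⟩, rfl⟩

theorem Fits.topAt_north {θ b : ℝ} (h : T.IsNorth b) (hθ : chart T.label θ b = .empty)
    (c : (tens [dual α]).carrier) : I.TopAt T θ b ⟨[dual α], c⟩ c :=
  ⟨hθ, fun _ _ => ⟨[dual α], c⟩, ⟨b, h, le_rfl, IsSingleStrand.isCylSec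
    (fun φ hφ => h.window φ hφ.1 (hφ.2.trans_lt h.lt)) (hI.rot_top c), fun _ _ => rfl⟩, rfl⟩

theorem Fits.fVal_of_botAt {θ c : ℝ} {e : VState k H} (he : I.BotAt a0 T θ c e)
    (he' : I.BotAt a0 T' θ c e) (hag : ∀ φ, c ≤ φ → φ < π / 2 → ∀ θ,
      chart T.label θ φ = chart T'.label θ φ) {θ1 φ : ℝ} (hcφ : c ≤ φ) (hφ : φ < π / 2)
    {W} (hW : IsLevel (chart T.label · φ) θ1 (θ1 + 2 * π) W)
    (hp : Projective (tens (insW W))) {z} (hz : I.FVal a0 T z) : I.FVal a0 T' z := by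
  have hgt : -(π / 2) < c := by obtain ⟨-, S, h, -⟩ := he; exact h.gt
  obtain ⟨S, h1, h2, h3⟩ := he.extend hcφ hφ
  have h4 := h3 θ1 φ hcφ le_rfl hW.left_empty
  have h1' := h1.congr (D' := chart T'.label) fun h hh θ => hag h hh.1 (hh.2.trans_lt hφ) θ
  have h4' := BotAt.of_section (T := T') h1' hcφ hφ (θ := θ) (by rwa [h2])
    (θ' := θ1) (by rw [← hag φ hcφ hφ]; exact hW.left_empty)
  have h5 := (h1.loc φ ⟨hcφ, le_rfl⟩ θ1 W hW).1
  have h6 := hI.botAt_inv hφ h4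
  revert h4 h4' h5 h6
  generalize S θ1 φ = f
  obtain ⟨X, v⟩ := f
  intro h4 h4' h5 h6
  change X = _ at h5
  subst h5
  obtain ⟨s, hs⟩ := I.socle hp v h6
  obtain ⟨z', hz'⟩ := hI.exists_topAt (hgt.trans_le hcφ) hφ hW.left_empty hW (e := ⟨insW W, s⟩) rfl
  obtain rfl := hI.fVal_unique hz ⟨θ1, φ, _, s, v, hgt.trans_le hcφ, hφ, h4, hp, hs, hz'⟩
  exact ⟨θ1, φ, _, s, v, hgt.trans_le hcφ, hφ, h4', hp, hs,
    hz'.congr fun φ' h7 h8 => hag φ' (hcφ.trans h7) h8⟩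

theorem Fits.fVal_of_topAt {θ a : ℝ} (ha : a < π / 2)
    {Wa} (hWa : IsLevel (chart T.label · a) θ (θ + 2 * π) Wa)
    (htop : ∀ e z, e.1 = insW Wa → I.TopAt T θ a e z → I.TopAt T' θ a e z)
    (hag : ∀ φ, -(π / 2) < φ → φ ≤ a → ∀ θ, chart T.label θ φ = chart T'.label θ φ) {θ1 φ : ℝ}
    (hφ : -(π / 2) < φ) (hφa : φ ≤ a) {W}
    (hW : IsLevel (chart T.label · φ) θ1 (θ1 + 2 * π) W) (hp : Projective (tens (insW W)))
    {z} (hz : I.FVal a0 T z) : I.FVal a0 T' z := by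
  have hφ' := hφa.trans_lt ha
  obtain ⟨e, he⟩ := hI.exists_botAt (T := T) hφ hφ' hW.left_empty
  have h5 : e.1 = insW W := by
    obtain ⟨-, S, ⟨a, -, g1, g2, -⟩, rfl⟩ := id he
    exact (g2.loc φ ⟨g1, le_rfl⟩ θ1 W hW).1
  have h6 := hI.botAt_inv hφ' he
  obtain ⟨X, v⟩ := e
  change X = _ at h5
  subst h5
  obtain ⟨s, hs⟩ := I.socle hp v h6
  obtain ⟨z', hz'⟩ := hI.exists_topAt hφ hφ' hW.left_empty hW (e := ⟨insW W, s⟩) rfl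
  obtain rfl := hI.fVal_unique hz ⟨θ1, φ, _, s, v, hφ, hφ', he, hp, hs, hz'⟩
  obtain ⟨S, hS, hSe⟩ := (T.isCylDiagram hφ ha).exists_isCylSec I.top hφa hW
    (e := ⟨insW W, s⟩) rfl
  have h7 := hI.topAt_section hφ hS hφa ha (θ := θ1) (by rwa [hSe]) hWa.left_empty
  have h8 := htop _ _ (hS.loc a ⟨hφa, le_rfl⟩ θ Wa hWa).1 h7
  have h9 := TopAt.of_section (T := T') hφ (hS.congr fun h hh θ => hag h (hφ.trans_le hh.1) hh.2 θ)
    hφa h8 (θ := θ1) (by rw [← hag φ hφ hφa]; exact hW.left_empty)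
  rw [hSe] at h9
  exact ⟨θ1, φ, _, s, v, hφ, hφ', he.congr fun φ' g1 g2 => hag φ' g1 (g2.trans hφa), hp, hs, h9⟩

end TwistedIntegral

namespace TwistedIntegral

open VState

variable {I : TwistedIntegral k H} {a0 : (tens [α]).carrier} {T T' : StringNet α}

theorem isLevel_of_rotate {d : ℝ → PointLabel 𝓜} (hd : IsPeriodic d) {θ θ' : ℝ}
    (hθ : θ' ∈ Ico θ (θ + 2 * π)) {x y z : 𝓜} (hne : ¬ (x = y ∧ y = z))
    (h1 : IsLevel d θ (θ + 2 * π) (edges [x, y, z]))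
    (h2 : IsLevel d θ' (θ' + 2 * π) (edges [z, x, y])) : IsLevel d θ θ' (edges [x, y]) := by
  obtain ⟨W1, W2, h3, h4, h5⟩ := h1.cut ⟨hθ.1, hθ.2.le⟩ h2.left_empty
  have h6 := h2.unique (h5.append (h4.shift hd))
  rwa [← eq_edges_of_rotate hne h3.symm h6.symm]

theorem Fits.slideZero (hI : I.Fits α a0) {P : TwistedPivotalStructure α}
    (hP : IsSwapBy P I.bot.val) (hne : α ≠ dual α) (hs : IsSlideZero P T T')
    (hT : T.Admissible Projective) {e} (he : I.FVal a0 T e) : I.FVal a0 T' e := by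
  obtain ⟨x, a, b, c, g, g', L, M, L', M', K', u, u', w', ha, hab, hbc, hc, hag, hg, hg', hLM, hMR,
    hu, hcor, hL', hLM', hMR', hcor', hu', hLK', hKR', hw', hcr⟩ := hs
  have hac := hab.trans hbc
  have hpi := pi_pos
  have hsouth : ∀ {T : StringNet α} {g}, IsSingleStrand T.label (Ioc (-(π / 2)) a) α g →
      T.IsSouth a := fun h => ⟨ha, hac.trans hc, fun φ h1 h2 θ h3 => h.window ⟨h1, h2⟩ h3⟩
  have hamem : a ∈ Icc a c := ⟨le_rfl, hac.le⟩
  have hcmem : c ∈ Icc a c := ⟨hac.le, le_rfl⟩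
  obtain ⟨v, rfl⟩ : ∃ v, a0 = consV α [] (v ⊗ₜ[k] scalar 1) := by
    obtain ⟨v, rfl⟩ := (rid k α.carrier).symm.surjective a0
    exact ⟨v, rfl⟩
  have hv : α.ρ I.bot.val v = v := by
    have h1 := hI.bot I.bot.val
    rw [I.χ_bot, one_smul] at h1
    have h2 := congrArg (rid k α.carrier) ((rho_tensor I.bot α (tens []) v
      (scalar 1)).symm.trans h1)
    have h3 : (tens ([] : List 𝓜)).ρ I.bot.val (scalar 1) = scalar 1 := rho_unit I.bot 1
    rw [h3] at h2
    have h4 : (1 : k) • α.ρ I.bot.val v = (1 : k) • v := h2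
    rwa [one_smul, one_smul] at h4
  obtain ⟨K, hK, hKa, hKc, hKla, hKlc⟩ := hcor.isSec hMR
  have hsec := (hu.isSec hLM (𝟙 (tens [α]))).kprod hK
  have hla := (hu.isLevel hamem (hLM.2.2.2 a hamem)).append hKla
  have hlc := (hu.isLevel hcmem (hLM.2.2.2 c hcmem)).append hKlc
  have hD := T.isCylDiagram ha hc
  obtain ⟨S, hS, hSa, hSb⟩ := (hI.botAt_south (hsouth hg) hla.left_empty).extend hac.le hc
  have hSc := hS.eq_app hD hLM.2.1 hsec
    (z := (consV α [] (v ⊗ₜ[k] scalar 1) ⊗ₜ[k] (1 : k) : (tens [α] ⊗ tens []).carrier)) (by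
      rw [hSa, hKa]
      refine Eq.trans ?_ (app_kprod _ _ _ _).symm
      exact ((mul_nil (letter α v) 1).trans (by rw [one_smul]; rfl)).symm) c hcmem
  rw [hKc] at hSc
  have hbotc := hSb (L c) c hac.le le_rfl hlc.left_empty
  rw [hSc] at hbotc
  obtain ⟨K1, hK1, hK₁a, hK₁b, hK₁la, hK₁lb⟩ := hcor'.isSec hLM'
  obtain ⟨K2, hK2, hK₂b, hK₂c, hK₂lb, hK₂lc⟩ := hcr.isSec hKR'
  obtain ⟨m, hm, -⟩ := existsUnique_add_zsmul_mem_Ico two_pi_pos (L' c) (L c)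
  set s := m • (2 * π) with hs
  have hper : ∀ t θ, chart T'.label (θ + s) t = chart T'.label θ t := fun t θ =>
    (chart_periodic T'.label t).add_zsmul θ m
  have hcomm : (fun h => L' h + 2 * π + s) = fun h => L' h + s + 2 * π :=
    funext fun h => by ring
  have hsec1 := (hK1.kprod (hu'.isSec hMR' (𝟙 (tens [α])))).shift hper
  have hsec2 := ((hw'.isSec hLK' (𝟙 (tens [dual x]))).kprod hK2).shift hper
  have hla' := ((hK₁la.append (hu'.isLevel ⟨le_rfl, hab.le⟩ (hMR'.2.2.2 a ⟨le_rfl, hab.le⟩))).shift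
    (hper a)).left_empty
  have hlc' := ((hw'.isLevel ⟨hbc.le, le_rfl⟩ (hLK'.2.2.2 c ⟨hbc.le, le_rfl⟩)).append hK₂lc).shift
    (hper c)
  rw [hcomm] at hsec1 hsec2
  rw [add_right_comm] at hlc'
  have hD' := T'.isCylDiagram ha hc
  have hLs : ContinuousOn (fun h => L' h + s) (Icc a c) := hL'.add continuousOn_const
  obtain ⟨S', hS', hSa', hSb'⟩ := (hI.botAt_south (hsouth hg') hla').extend hac.le hc
  have hSb'' := (hS'.mono le_rfl hbc.le).eq_app (hD'.mono le_rfl hbc.le)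
    (hLs.mono (Icc_subset_Icc le_rfl hbc.le)) hsec1
    (z := ((1 : k) ⊗ₜ[k] consV α [] (v ⊗ₜ[k] scalar 1) : (tens [] ⊗ tens [α]).carrier)) (by
      rw [hSa', hK₁a]
      refine Eq.trans ?_ (app_kprod _ _ _ _).symm
      exact ((nil_mul (letter α v) 1).trans (by rw [one_smul]; rfl)).symm) b ⟨hab.le, le_rfl⟩
  obtain ⟨z, hz1, hz2⟩ := rot_coev hP x hv
  have hSc' := (hS'.mono hab.le le_rfl).eq_app (hD'.mono hab.le le_rfl)
    (hLs.mono (Icc_subset_Icc hab.le le_rfl)) hsec2 (z := z) (by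
      rw [hSb'', hK₁b, hK₂b, ← hz1]
      exact app_kprod _ _ _ _) c ⟨hbc.le, le_rfl⟩
  rw [hK₂c, ← hz2] at hSc'
  have hagc : ∀ θ, chart T.label θ c = chart T'.label θ c := fun θ =>
    hag θ c le_rfl (by linarith)
  have hrot := isLevel_of_rotate (chart_periodic T.label c) hm
    (x := α) (y := x) (z := dual x) (fun h => hne (h.1.trans (h.2.trans (by rw [h.1])))) hlc
    (hlc'.congr fun θ _ => (hagc θ).symm)
  have hrot' := hS'.rotate c hcmem _ _ _ (hrot.congr fun θ _ => hagc θ)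
  have he' := hSb' (L c) c hac.le le_rfl ((hagc _).symm.trans hlc.left_empty)
  have hfin : S' (L c) c = mul (letter α v)
      (app ⟨[x, dual x], coev x ≫ (tensPair _ _).hom⟩ (1 : k)) :=
    (rot I.bot).injective ((rot I.bot).injective (hrot'.symm.trans hSc'))
  rw [hfin] at he'
  have hbot : I.BotAt (consV α [] (v ⊗ₜ[k] scalar 1)) T (L c) c (mul (letter α v)
      (app ⟨[x, dual x], coev x ≫ (tensPair _ _).hom⟩ (1 : k))) := hbotc
  obtain ⟨p, y, hpy, hy⟩ := hT
  obtain ⟨θ, φ, h1, h2, rfl⟩ := StringNet.exists_pt_of_edge hpy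
  have hagφ : ∀ φ, c ≤ φ → φ < π / 2 → ∀ θ, chart T.label θ φ = chart T'.label θ φ :=
    fun φ h1 h2 θ => hag θ φ h1 h2.le
  rcases le_or_gt c φ with hcφ | hφc
  · obtain ⟨θ0, W, hW, hyW⟩ := T.exists_window_of_edge h1 h2 hpy
    exact hI.fVal_of_botAt hbot he' hagφ hcφ h2 hW (I.projective_tens hyW hy) he
  · refine hI.fVal_of_botAt hbot he' hagφ le_rfl hc hlc (I.projective_tens (x := y) ?_ hy) he
    rw [← edges_append, insW_edges]
    rcases le_or_gt φ a with hφa | haφ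
    · rw [hg.eq_of_edge ⟨h1, hφa⟩ hpy]
      exact List.mem_cons_self
    · have hφ : φ ∈ Icc a c := ⟨haφ.le, hφc.le⟩
      obtain ⟨n, hn, -⟩ := existsUnique_add_zsmul_mem_Ico two_pi_pos θ (L φ)
      have h3 := ((chart_periodic T.label φ).add_zsmul θ n).trans hpy
      rcases le_total (θ + n • (2 * π)) (M φ) with h4 | h4
      · exact List.mem_append_left _ (hu.mem_of_edge hφ ⟨hn.1, h4⟩ h3)
      · exact mem_append_right _ ((hcor.mem_of_edge hφ ⟨h4, hn.2.le⟩ h3).resolve_left (by simp))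

theorem Fits.slideTwo (hI : I.Fits α a0) {P : TwistedPivotalStructure α} {β : H}
    (hP : IsSwapBy P β) (hβ : β * I.top.val = 1) (hne : dual α ≠ dual (dual α))
    (hs : IsSlideTwo P T T') (hT : T.Admissible Projective) {e} (he : I.FVal a0 T e) :
    I.FVal a0 T' e := by
  obtain ⟨x, a, b, c, g, g', L, M, L', M', K', u, u', w', ha, hab, hbc, hc, hag, hg, hg', hLM, hMR,
    hu, hcor, hL', hLK', hKR', hw', hcr, hLM', hMR', hcor', hu'⟩ := hs
  have hac := hab.trans hbc
  have hpi := pi_pos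
  have hnorth : ∀ {T : StringNet α} {g}, IsSingleStrand T.label (Ico c (π / 2)) (dual α) g →
      T.IsNorth c := fun h => ⟨ha.trans hac, hc, fun φ h1 h2 θ h3 => h.window ⟨h1, h2⟩ h3⟩
  have hamem : a ∈ Icc a c := ⟨le_rfl, hac.le⟩
  have hcmem : c ∈ Icc a c := ⟨hac.le, le_rfl⟩
  have hα : ∀ ξ, (dual α).ρ I.top.val ξ = ξ := fun ξ => by
    have h1 := hI.top I.top.val (consV (dual α) [] (ξ ⊗ₜ[k] scalar 1))
    rw [I.ψ_top, one_smul] at h1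
    have h2 := congrArg (rid k (dual α).carrier) ((rho_tensor I.top (dual α) (tens []) ξ
      (scalar 1)).symm.trans h1)
    have h3 : (tens ([] : List 𝓜)).ρ I.top.val (scalar 1) = scalar 1 := rho_unit I.top 1
    rw [h3] at h2
    have h4 : (1 : k) • (dual α).ρ I.top.val ξ = (1 : k) • ξ := h2
    rwa [one_smul, one_smul] at h4
  obtain ⟨K, hK, hKa, hKc, hKla, hKlc⟩ := hcor.isSec hMR
  have hsec := (hu.isSec hLM (𝟙 (tens [dual α]))).kprod hK
  have hla := (hu.isLevel hamem (hLM.2.2.2 a hamem)).append hKla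
  have hlc := (hu.isLevel hcmem (hLM.2.2.2 c hcmem)).append hKlc
  obtain ⟨K1, hK1, hK₁b, hK₁c, hK₁lb, hK₁lc⟩ := hcor'.isSec hLM'
  obtain ⟨K2, hK2, hK₂a, hK₂b, hK₂la, hK₂lb⟩ := hcr.isSec hKR'
  obtain ⟨m, hm, -⟩ := existsUnique_add_zsmul_mem_Ico two_pi_pos (L' a) (L a)
  set s := m • (2 * π) with hs
  have hper : ∀ t θ, chart T'.label (θ + s) t = chart T'.label θ t := fun t θ =>
    (chart_periodic T'.label t).add_zsmul θ m
  have hcomm : (fun h => L' h + 2 * π + s) = fun h => L' h + s + 2 * π :=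
    funext fun h => by ring
  have hsec1 := (hK1.kprod (hu'.isSec hMR' (𝟙 (tens [dual α])))).shift hper
  have hsec2 := ((hw'.isSec hLK' (𝟙 (tens [dual x]))).kprod hK2).shift hper
  have hlc' := ((hK₁lc.append (hu'.isLevel ⟨hbc.le, le_rfl⟩ (hMR'.2.2.2 c ⟨hbc.le, le_rfl⟩))).shift
    (hper c)).left_empty
  have hla' := ((hw'.isLevel ⟨le_rfl, hab.le⟩ (hLK'.2.2.2 a ⟨le_rfl, hab.le⟩)).append hK₂la).shift
    (hper a)
  rw [hcomm] at hsec1 hsec2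
  rw [add_right_comm] at hla'
  have hD := T.isCylDiagram ha hc
  have hD' := T'.isCylDiagram ha hc
  have hLs : ContinuousOn (fun h => L' h + s) (Icc a c) := hL'.add continuousOn_const
  have haga : ∀ θ, chart T.label θ a = chart T'.label θ a := fun θ =>
    hag θ a (by linarith) le_rfl
  have hrot := isLevel_of_rotate (chart_periodic T.label a) hm
    (x := dual α) (y := dual (dual x)) (z := dual x)
    (fun h => hne (h.1.trans (by rw [h.1, h.2]; exact h.2.symm))) hla
    (hla'.congr fun θ _ => (haga θ).symm)
  have htop : ∀ e z, e.1 = insW (edges [dual α] ++ edges [dual (dual x), dual x]) →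
      I.TopAt T (L a) a e z → I.TopAt T' (L a) a e z := by
    intro e z h1 h2
    obtain ⟨S, hS, hSa⟩ := hD.exists_isCylSec I.top hac.le hla h1
    obtain ⟨S', hS', hSa'⟩ := hD'.exists_isCylSec I.top hac.le
      (hla.congr fun θ _ => haga θ) h1
    rw [← edges_append, insW_edges] at h1
    obtain ⟨w, hw⟩ := exists_eq_app (X := [dual α]) (Y := [dual (dual x), dual x]) h1
    obtain ⟨t, rfl⟩ := evSource_surjective α x w
    have hSc := hS.eq_app hD hLM.2.1 hsec (z := evSource α x t) (by rw [hSa, hKa, hw]) c hcmem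
    rw [hKc, ← ev_evTarget] at hSc
    have hrot' := hS'.rotate a hamem _ _ _ (hrot.congr fun θ _ => haga θ)
    have hSa'' : S' (L' a + s) a = app (kprod wires [dual x]
        ⟨[dual α, dual (dual x)], 𝟙 _⟩) (evMiddle α x I.top.val t) := by
      rw [← rot_evSource hα, ← hw, ← hSa']
      exact hrot'
    have hSb' := (hS'.mono le_rfl hbc.le).eq_app (hD'.mono le_rfl hbc.le)
      (hLs.mono (Icc_subset_Icc le_rfl hbc.le)) hsec2 (z := evMiddle α x I.top.val t)
      (by rw [hSa'', hK₂a]) b ⟨hab.le, le_rfl⟩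
    rw [hK₂b, mate_evMiddle hP hβ] at hSb'
    have hSc' := (hS'.mono hab.le le_rfl).eq_app (hD'.mono hab.le le_rfl)
      (hLs.mono (Icc_subset_Icc hab.le le_rfl)) hsec1 (z := evTarget α x t)
      (by rw [hSb', hK₁b]) c ⟨hbc.le, le_rfl⟩
    rw [hK₁c, ← hSc] at hSc'
    have h3 := hI.topAt_section ha hS hac.le hc (θ := L a) (by rwa [hSa]) hlc.left_empty
    rw [hSc] at h3 hSc'
    obtain ⟨ξ, hξ⟩ : ∃ ξ : (tens [dual α]).carrier,
        app (kprod cap x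
          wires [dual α]) (evTarget α x t) = ⟨[dual α], ξ⟩ := ⟨_, rfl⟩
    rw [hξ] at h3 hSc'
    obtain rfl := hI.topAt_unique (ha.trans hac) h3 (hI.topAt_north (hnorth hg) hlc.left_empty ξ)
    have h4 := hI.topAt_north (hnorth hg') hlc' z
    have h5 := TopAt.of_section ha hS' hac.le (by rw [hSc']; exact h4) (θ := L a)
      ((haga _).symm.trans hla.left_empty)
    rwa [hSa'] at h5
  obtain ⟨p, y, hpy, hy⟩ := hT
  obtain ⟨θ, φ, h1, h2, rfl⟩ := StringNet.exists_pt_of_edge hpy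
  have hagφ : ∀ φ, -(π / 2) < φ → φ ≤ a → ∀ θ, chart T.label θ φ = chart T'.label θ φ :=
    fun φ h1 h2 θ => hag θ φ h1.le h2
  rcases le_or_gt φ a with hφa | haφ
  · obtain ⟨θ0, W, hW, hyW⟩ := T.exists_window_of_edge h1 h2 hpy
    exact hI.fVal_of_topAt (hac.trans hc) hla htop hagφ h1 hφa hW (I.projective_tens hyW hy) he
  · refine hI.fVal_of_topAt (hac.trans hc) hla htop hagφ ha le_rfl hla
      (I.projective_tens (x := y) ?_ hy) he
    rw [← edges_append, insW_edges]
    rcases le_or_gt c φ with hcφ | hφc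
    · rw [hg.eq_of_edge ⟨hcφ, h2⟩ hpy]
      exact List.mem_cons_self
    · have hφ : φ ∈ Icc a c := ⟨haφ.le, hφc.le⟩
      obtain ⟨n, hn, -⟩ := existsUnique_add_zsmul_mem_Ico two_pi_pos θ (L φ)
      have h3 := ((chart_periodic T.label φ).add_zsmul θ n).trans hpy
      rcases le_total (θ + n • (2 * π)) (M φ) with h4 | h4
      · exact List.mem_append_left _ (hu.mem_of_edge hφ ⟨hn.1, h4⟩ h3)
      · exact mem_append_right _
          ((hcor.mem_of_edge hφ ⟨h4, hn.2.le⟩ h3).resolve_right (by simp))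

theorem Fits.exists_fVal (hI : I.Fits α a0) (hT : T.Admissible Projective) : ∃ c, I.FVal a0 T c := by
  obtain ⟨p, y, hpy, hy⟩ := hT
  obtain ⟨θ, φ, h1, h2, rfl⟩ := StringNet.exists_pt_of_edge hpy
  obtain ⟨θ0, W, hW, hyW⟩ := T.exists_window_of_edge h1 h2 hpy
  exact hI.exists_fVal_of_level h1 h2 hW (I.projective_tens hyW hy)

end TwistedIntegral

theorem eventually_lt_of_pos {c : ℝ} (hc : 0 < c) : ∀ᶠ ρ in 𝓝[>] (0 : ℝ), ρ < c :=
  mem_of_superset (Ioo_mem_nhdsGT hc) fun _ h => h.2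

theorem exists_Icc_of_eventually {P : ℝ → Prop} {x b : ℝ} (h : ∀ᶠ y in 𝓝 x, P y) (hb : 0 < b) :
    ∃ ε > 0, ε < b ∧ ∀ y ∈ Icc (x - ε) (x + ε), P y := by
  obtain ⟨ε, hε, h⟩ := Metric.nhds_basis_closedBall.eventually_iff.1 h
  rw [closedBall_eq_Icc] at h
  have := min_le_left ε (b / 2)
  exact ⟨min ε (b / 2), lt_min hε (by linarith), (min_le_right _ _).trans_lt (by linarith),
    fun y hy => h ⟨by linarith [hy.1], by linarith [hy.2]⟩⟩

section Deformation

theorem IsLevel.eq_of_single {d : ℝ → PointLabel C} {l r θ θ' : ℝ} {w : PointLabel C}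
    (h : IsLevel d l r [w]) (hθ : θ ∈ Icc l r) (hθ' : θ' ∈ Icc l r) (h1 : d θ ≠ .empty)
    (h2 : d θ' ≠ .empty) : θ = θ' := by
  cases h with
  | @cons _ θ0 m _ _ _ ha hb hc hd he hf =>
    cases hf with
    | nil hg hk =>
      have key : ∀ τ ∈ Icc l r, d τ ≠ .empty → τ = θ0 := fun τ hτ hne => by
        by_contra hτ0
        rcases le_total τ m with hm | hm
        · exact hne (hc τ ⟨hτ.1, hm⟩ hτ0)
        · exact hne (hk τ ⟨hm, hτ.2⟩)
      rw [key θ hθ h1, key θ' hθ' h2]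

theorem eventually_nhds_of_sides {p : ℝ → Prop} {x : ℝ} (h0 : p x) (h1 : ∀ᶠ t in 𝓝[<] x, p t)
    (h2 : ∀ᶠ t in 𝓝[>] x, p t) : ∀ᶠ t in 𝓝 x, p t := by
  rw [← nhdsLT_sup_nhdsGE, eventually_sup]
  refine ⟨h1, ?_⟩
  rw [← Ioi_insert, nhdsWithin_insert, eventually_sup]
  exact ⟨h0, h2⟩

theorem IsMovie.eventually {l r h : ℝ} {X : List C}
    (hM : IsMovie D l r h (edges X)) : ∀ᶠ t in 𝓝 h, IsLevel (D · t) l r (edges X) := by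
  refine eventually_nhds_of_sides hM.level ?_ ?_
  · simpa using hM.below
  · simpa using hM.above

theorem IsLocallyProgressive.eventually_single {θ h : ℝ} {x : C}
    (hp : IsLocallyProgressive D θ h) (hx : D θ h = .edge x) :
    ∃ δ > 0, ∀ l ∈ Ioo (θ - δ) θ, ∀ r ∈ Ioo θ (θ + δ),
      ∀ᶠ t in 𝓝 h, IsLevel (D · t) l r [.edge x] := by
  obtain ⟨δ, hδ, h1, h2⟩ := hp.isIsolated
  refine ⟨δ, hδ, fun l hl r hr => ?_⟩
  obtain ⟨W, hW⟩ := h2 l ⟨hl.1, hl.2.le⟩ r ⟨hr.1.le, hr.2⟩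
    (h1 l ⟨hl.1, by linarith [hl.2]⟩ hl.2.ne) (h1 r ⟨by linarith [hr.1], hr.2⟩ hr.1.ne')
  have h3 : IsLevel (D · h) l r [.edge x] := .single hl.2 hr.1
    (fun τ hτ hne => h1 τ ⟨by linarith [hτ.1, hl.1], by linarith [hτ.2, hr.2]⟩ hne) hx trivial
  have h4 : W = edges [x] := hW.level.unique h3
  subst h4
  exact hW.eventually

theorem not_isLocalExtr_of_edge {c : ℝ → ℝ × ℝ} {s : ℝ} {x : C}
    (hp : IsLocallyProgressive D (c s).1 (c s).2) (hx : D (c s).1 (c s).2 = .edge x)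
    {S : Set ℝ} (hS : S ∈ 𝓝 s) (hc : ContinuousOn c S) (hinj : InjOn c S)
    (hne : ∀ t ∈ S, D (c t).1 (c t).2 ≠ .empty) : ¬ IsLocalExtr (fun t => (c t).2) s := by
  obtain ⟨δ, hδ, h1⟩ := hp.eventually_single hx
  set l := (c s).1 - δ / 2 with hl
  set r := (c s).1 + δ / 2 with hr
  have h2 := h1 l ⟨by linarith, by linarith⟩ r ⟨by linarith, by linarith⟩
  have hcs : ContinuousAt c s := hc.continuousAt hS
  have h3 : ∀ᶠ t in 𝓝 s, IsLevel (D · (c t).2) l r [.edge x] ∧ (c t).1 ∈ Icc l r ∧ t ∈ S :=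
    ((hcs.snd.eventually h2).and ((hcs.fst.eventually
      (Icc_mem_nhds (by linarith) (by linarith))).and hS))
  obtain ⟨ε, hε, -, h4⟩ := exists_Icc_of_eventually h3 one_pos
  have h5 : InjOn (fun t => (c t).2) (Icc (s - ε) (s + ε)) := fun t ht t' ht' heq => by
    obtain ⟨hl1, hi1, hs1⟩ := h4 _ ht
    obtain ⟨hl2, hi2, hs2⟩ := h4 _ ht'
    have heq : (c t).2 = (c t').2 := heq
    refine hinj hs1 hs2 (Prod.ext ?_ heq)
    refine hl1.eq_of_single hi1 hi2 (hne t hs1) ?_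
    have := hne t' hs2
    rwa [← heq] at this
  have h6 : ContinuousOn (fun t => (c t).2) (Icc (s - ε) (s + ε)) := fun t ht =>
    (continuousOn_snd.comp hc (mapsTo_univ _ _) |>.mono fun t ht => (h4 _ ht).2.2) t ht
  have hR : ∀ᶠ t in 𝓝[>] s, t ∈ Ioo s (s + ε) := Ioo_mem_nhdsGT (by linarith)
  have hL : ∀ᶠ t in 𝓝[<] s, t ∈ Ioo (s - ε) s := Ioo_mem_nhdsLT (by linarith)
  have hs0 : s ∈ Icc (s - ε) (s + ε) := ⟨by linarith, by linarith⟩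
  rcases h6.strictMonoOn_of_injOn_Icc' (by linarith) h5 with hm | hm <;> rintro (he | he)
  · obtain ⟨t, h7, h8⟩ := (hL.and (he.filter_mono nhdsWithin_le_nhds)).exists
    exact absurd h8 (not_le.2 (hm ⟨h7.1.le, by linarith [h7.2]⟩ hs0 h7.2))
  · obtain ⟨t, h7, h8⟩ := (hR.and (he.filter_mono nhdsWithin_le_nhds)).exists
    exact absurd h8 (not_le.2 (hm hs0 ⟨by linarith [h7.1], h7.2.le⟩ h7.1))
  · obtain ⟨t, h7, h8⟩ := (hR.and (he.filter_mono nhdsWithin_le_nhds)).exists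
    exact absurd h8 (not_le.2 (hm hs0 ⟨by linarith [h7.1], h7.2.le⟩ h7.1))
  · obtain ⟨t, h7, h8⟩ := (hL.and (he.filter_mono nhdsWithin_le_nhds)).exists
    exact absurd h8 (not_le.2 (hm ⟨h7.1.le, by linarith [h7.2]⟩ hs0 h7.2))

variable {τ : Type*} [TopologicalSpace τ]

/-- The family `D` of progressive diagrams over the heights in `s` deforms the diagram `D t0`: near
`t0`, and locally in the plane, `D t` is the image of `D t0` under a homeomorphism close to the
identity. -/
structure IsDeformation (D : τ → Plan C) (t0 : τ) (s : Set ℝ) : Prop where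
  isOpen : IsOpen s
  prog : ∀ t θ, ∀ h ∈ s, IsLocallyProgressive (D t) θ h
  loc : ∀ z : ℝ × ℝ, z.2 ∈ s → ∃ y ζ : τ × (ℝ × ℝ) → ℝ × ℝ,
    (∀ᶠ p in 𝓝 (t0, z), ContinuousAt ζ p) ∧ ContinuousAt y (t0, z) ∧ y (t0, z) = z ∧
    (∀ᶠ z' in 𝓝 z, ζ (t0, z') = z') ∧
    (∀ᶠ p in 𝓝 (t0, z), D p.1 p.2.1 p.2.2 = D t0 (y p).1 (y p).2 ∧ ζ (p.1, y p) = p.2) ∧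
    ∀ᶠ p in 𝓝 (t0, z), D p.1 (ζ p).1 (ζ p).2 = D t0 p.2.1 p.2.2 ∧ y (p.1, ζ p) = p.2

namespace IsDeformation

variable {D : τ → Plan C} {t0 : τ} {s : Set ℝ} (hD : IsDeformation D t0 s)

include hD

theorem eventually {z : ℝ × ℝ} (hz : z.2 ∈ s) {Q : PointLabel C → Prop}
    (h : ∀ᶠ z' in 𝓝 z, Q (D t0 z'.1 z'.2)) :
    ∀ᶠ p in 𝓝 (t0, z), Q (D p.1 p.2.1 p.2.2) := by
  obtain ⟨y, ζ, -, h2, h3, -, h5, -⟩ := hD.loc z hz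
  have h6 : Tendsto y (𝓝 (t0, z)) (𝓝 z) := by simpa only [ContinuousAt, h3] using h2
  filter_upwards [h5, h6.eventually h] with p h7 h8
  rwa [h7.1]

theorem empty {z : ℝ × ℝ} (hz : z.2 ∈ s) (he : D t0 z.1 z.2 = .empty) :
    ∀ᶠ p in 𝓝 (t0, z), D p.1 p.2.1 p.2.2 = .empty :=
  hD.eventually (Q := fun w => w = .empty) hz
    ((hD.prog t0 z.1 z.2 hz).empty_nhds (θ := z.1) (h := z.2) he)

theorem empty_Icc {l r h : ℝ} (hh : h ∈ s) (he : ∀ θ ∈ Icc l r, D t0 θ h = .empty) :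
    ∀ᶠ p : τ × ℝ in 𝓝 (t0, h), ∀ θ ∈ Icc l r, D p.1 θ p.2 = .empty := by
  refine isCompact_Icc.eventually_forall_of_forall_eventually fun θ hθ => ?_
  have h1 : Tendsto (fun q : (τ × ℝ) × ℝ => (q.1.1, (q.2, q.1.2))) (𝓝 ((t0, h), θ))
      (𝓝 (t0, (θ, h))) := by
    apply Continuous.tendsto'
    · fun_prop
    · rfl
  exact h1.eventually (hD.empty (z := (θ, h)) hh (he θ hθ))

theorem strand {θ0 h0 : ℝ} {x : C} (hh : h0 ∈ s) (hx : D t0 θ0 h0 = .edge x) {l r : ℝ}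
    (hl : l < θ0) (hr : θ0 < r) (he : ∀ θ ∈ Icc l r, θ ≠ θ0 → D t0 θ h0 = .empty) :
    ∀ᶠ p : τ × ℝ in 𝓝 (t0, h0), IsLevel (D p.1 · p.2) l r [.edge x] := by
  obtain ⟨y, ζ, hζc, hyc, hy0, hζ0, hy, hζ⟩ := hD.loc (θ0, h0) hh
  have hζt : Tendsto ζ (𝓝 (t0, (θ0, h0))) (𝓝 (θ0, h0)) := by
    simpa only [ContinuousAt, hζ0.self_of_nhds] using hζc.self_of_nhds
  have hyt : Tendsto y (𝓝 (t0, (θ0, h0))) (𝓝 (θ0, h0)) := by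
    simpa only [ContinuousAt, hy0] using hyc
  have hζs : ∀ᶠ p in 𝓝 (t0, (θ0, h0)), (ζ p).2 ∈ s :=
    hζt.eventually ((continuous_snd.tendsto _).eventually (hD.isOpen.mem_nhds hh))
  have hall := hζc.and (hζ.and (hζs.and (hy.and ((continuous_snd.tendsto
    ((t0, (θ0, h0)) : τ × ℝ × ℝ)).eventually hζ0))))
  rw [nhds_prod_eq, eventually_prod_iff] at hall
  obtain ⟨pU, hU, pV, hV, hUV⟩ := hall
  obtain ⟨ε1, hε₁, hV⟩ := Metric.nhds_basis_closedBall.eventually_iff.1 hV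
  obtain ⟨δ, hδ, hsing⟩ := (hD.prog t0 θ0 h0 hh).eventually_single hx
  obtain ⟨ε, ⟨hε1, hεδ, hεl, hεr⟩, (hε : 0 < ε)⟩ := (((eventually_lt_of_pos hε₁).and
    ((eventually_lt_of_pos hδ).and ((eventually_lt_of_pos (by linarith : 0 < θ0 - l)).and
      (eventually_lt_of_pos (by linarith : 0 < r - θ0))))).and self_mem_nhdsWithin).exists
  set l1 := θ0 - ε with hl1
  set r1 := θ0 + ε with hr1
  have hbox : ∀ θ h, θ ∈ Icc l1 r1 → h ∈ Icc (h0 - ε) (h0 + ε) → pV (θ, h) := fun θ h h1 h2 =>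
    hV (by
      rw [← closedBall_prod_same, closedBall_eq_Icc, closedBall_eq_Icc]
      exact ⟨⟨by linarith [h1.1], by linarith [h1.2]⟩, ⟨by linarith [h2.1], by linarith [h2.2]⟩⟩)
  have hlev := (hsing l1 ⟨by linarith, by linarith⟩ r1 ⟨by linarith, by linarith⟩).and
    (hD.isOpen.mem_nhds hh)
  obtain ⟨η, hηpos, hηε, hlev⟩ := exists_Icc_of_eventually hlev hε
  have hex : ∀ h, ∃ θ, h ∈ Icc (h0 - η) (h0 + η) → θ ∈ Ioo l1 r1 ∧ D t0 θ h = .edge x ∧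
      ∀ θ' ∈ Icc l1 r1, D t0 θ' h ≠ .empty → θ' = θ := fun h => by
    by_cases h1 : h ∈ Icc (h0 - η) (h0 + η)
    · obtain ⟨-, θ, h2, h3⟩ := (hlev h h1).1.mem (List.mem_singleton_self _)
      exact ⟨θ, fun _ => ⟨h2, h3, fun θ' h4 h5 => (hlev h h1).1.eq_of_single h4 ⟨h2.1.le, h2.2.le⟩
        h5 (by rw [h3]; simp)⟩⟩
    · exact ⟨0, fun h2 => absurd h2 h1⟩
  choose w hw using hex
  have hw0 : w h0 = θ0 := ((hw h0 ⟨by linarith, by linarith⟩).2.2 θ0 ⟨by linarith, by linarith⟩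
    (by rw [hx]; simp)).symm
  have hwc : ContinuousOn w (Icc (h0 - η) (h0 + η)) := fun h h1 => by
    obtain ⟨⟨hw1, hw2⟩, hw3, hw4⟩ := hw h h1
    obtain ⟨δ', hδ', hs'⟩ := (hD.prog t0 (w h) h (hlev h h1).2).eventually_single hw3
    refine Metric.continuousWithinAt_iff'.2 fun κ hκ => ?_
    obtain ⟨ρ, ⟨h2, h3, h4, h11⟩, (hρ : 0 < ρ)⟩ := (((eventually_lt_of_pos hκ).and
      ((eventually_lt_of_pos hδ').and ((eventually_lt_of_pos (sub_pos.2 hw1)).and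
        (eventually_lt_of_pos (sub_pos.2 hw2))))).and self_mem_nhdsWithin).exists
    have h5 := hs' (w h - ρ) ⟨by linarith, by linarith⟩ (w h + ρ) ⟨by linarith, by linarith⟩
    filter_upwards [h5.filter_mono nhdsWithin_le_nhds, self_mem_nhdsWithin] with t h6 h7
    obtain ⟨-, θ, h8, h9⟩ := h6.mem (List.mem_singleton_self _)
    have h10 := (hw t h7).2.2 θ ⟨by linarith [h8.1], by linarith [h8.2]⟩ (by rw [h9]; simp)
    rw [← h10, dist_eq, abs_lt]
    exact ⟨by linarith [h8.1], by linarith [h8.2]⟩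
  have hwat : ContinuousAt w h0 := hwc.continuousAt (Icc_mem_nhds (by linarith) (by linarith))
  have hyb : ∀ᶠ p in 𝓝 (t0, (θ0, h0)), (y p).1 ∈ Icc l1 r1 ∧ (y p).2 ∈ Ioo (h0 - η) (h0 + η) :=
    (hyt.eventually ((continuous_fst.tendsto _).eventually
      (Icc_mem_nhds (by linarith) (by linarith)))).and
    (hyt.eventually ((continuous_snd.tendsto _).eventually
      (Ioo_mem_nhds (by linarith) (by linarith))))
  rw [nhds_prod_eq, nhds_prod_eq, eventually_prod_iff] at hyb
  obtain ⟨pU', hU', pV', hV', hyb⟩ := hyb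
  rw [eventually_prod_iff] at hV'
  obtain ⟨pθ, hpθ, ph, hph, hV'⟩ := hV'
  obtain ⟨ε', hε'pos, hε'ε, hpθ⟩ := exists_Icc_of_eventually hpθ hε
  have hcurve : Tendsto (fun p : τ × ℝ => ζ (p.1, (w p.2, p.2))) (𝓝 (t0, h0)) (𝓝 (θ0, h0)) := by
    refine hζt.comp ?_
    have h1 : ContinuousAt (fun p : τ × ℝ => (p.1, (w p.2, p.2))) (t0, h0) :=
      continuousAt_fst.prodMk ((ContinuousAt.comp (f := Prod.snd) hwat continuousAt_snd).prodMk
        continuousAt_snd)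
    simpa only [ContinuousAt, hw0] using h1
  have hcl : ∀ᶠ p : τ × ℝ in 𝓝 (t0, h0), (ζ (p.1, (w p.2, p.2))).1 ∈ Ioo (θ0 - ε') (θ0 + ε') :=
    hcurve.eventually ((continuous_fst.tendsto _).eventually
      (Ioo_mem_nhds (by linarith) (by linarith)))
  rw [nhds_prod_eq, eventually_prod_iff] at hcl
  obtain ⟨pU'', hU'', pη, hpη, hcl⟩ := hcl
  obtain ⟨η', hη'pos, hη'η, hpη⟩ := exists_Icc_of_eventually hpη hηpos
  have hUt : pU t0 := hU.self_of_nhds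
  have hend : ∀ h ∈ Icc (h0 - η) (h0 + η),
      Tendsto (fun p : τ × ℝ => (ζ (p.1, (w h, h))).2) (𝓝 (t0, h0)) (𝓝 h) := fun h h1 => by
    have h2 := hUV hUt (hbox (w h) h ⟨(hw h h1).1.1.le, (hw h h1).1.2.le⟩
      ⟨by linarith [h1.1], by linarith [h1.2]⟩)
    have h3 : ContinuousAt (fun p : τ × ℝ => (ζ (p.1, (w h, h))).2) (t0, h0) :=
      continuousAt_snd.comp (ContinuousAt.comp (f := fun p : τ × ℝ => (p.1, (w h, h)))
        (g := ζ) h2.1 (continuousAt_fst.prodMk continuousAt_const))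
    have h4 : (ζ (t0, (w h, h))).2 = h := by rw [h2.2.2.2.2]
    simpa only [ContinuousAt, h4] using h3
  have hlo := (hend (h0 - η') ⟨by linarith, by linarith⟩).eventually_lt
    (continuous_snd.tendsto (t0, h0)) (show h0 - η' < h0 by linarith)
  have hhi := (continuous_snd.tendsto (t0, h0)).eventually_lt
    (hend (h0 + η') ⟨by linarith, by linarith⟩) (show h0 < h0 + η' by linarith)
  have hEl := hD.empty_Icc hh (l := l) (r := θ0 - ε') fun θ hθ =>
    he θ ⟨hθ.1, by linarith [hθ.2]⟩ (by linarith [hθ.2] : θ < θ0).ne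
  have hEr := hD.empty_Icc hh (l := θ0 + ε') (r := r) fun θ hθ =>
    he θ ⟨by linarith [hθ.1], hθ.2⟩ (by linarith [hθ.1] : θ0 < θ).ne'
  have hfst := fun {q : τ → Prop} (hq : ∀ᶠ t in 𝓝 t0, q t) =>
    (continuous_fst.tendsto ((t0, h0) : τ × ℝ)).eventually hq
  have hsnd := fun {q : ℝ → Prop} (hq : ∀ᶠ t in 𝓝 h0, q t) =>
    (continuous_snd.tendsto ((t0, h0) : τ × ℝ)).eventually hq
  filter_upwards [hlo, hhi, hEl, hEr, hfst hU, hfst hU', hfst hU'', hsnd hph,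
    hsnd (Icc_mem_nhds (show h0 - ε < h0 by linarith) (show h0 < h0 + ε by linarith))]
    with ⟨t, h⟩ klo khi kEl kEr kU kU' kU'' kph kIcc
  dsimp only at klo khi kEl kEr kU kU' kU'' kph kIcc ⊢
  set c : ℝ → ℝ × ℝ := fun b => ζ (t, (w b, b)) with hc
  have hgood : ∀ b ∈ Icc (h0 - η) (h0 + η), _ := fun b hb =>
    hUV kU (hbox (w b) b ⟨(hw b hb).1.1.le, (hw b hb).1.2.le⟩
      ⟨by linarith [hb.1], by linarith [hb.2]⟩)
  have hcc : ContinuousOn c (Icc (h0 - η) (h0 + η)) := fun b hb =>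
    ContinuousAt.comp_continuousWithinAt (f := fun b => (t, (w b, b))) (hgood b hb).1
      (continuousWithinAt_const.prodMk ((hwc b hb).prodMk continuousWithinAt_id))
  have hcinj : InjOn c (Icc (h0 - η) (h0 + η)) := fun b hb b' hb' heq => by
    have h1 := (hgood b hb).2.1.2
    have h2 := (hgood b' hb').2.1.2
    have h3 : ζ (t, (w b, b)) = ζ (t, (w b', b')) := heq
    simp only at h1 h2
    rw [h3, h2] at h1
    exact (congrArg Prod.snd h1).symm
  have hce : ∀ b ∈ Icc (h0 - η) (h0 + η), D t (c b).1 (c b).2 = .edge x := fun b hb =>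
    (hgood b hb).2.1.1.trans (hw b hb).2.1
  have huniq : ∀ b ∈ Ioo (h0 - η) (h0 + η), ∀ b' ∈ Ioo (h0 - η) (h0 + η), (c b).2 = (c b').2 →
      b = b' := by
    have key : ∀ b ∈ Ioo (h0 - η) (h0 + η), ∀ b' ∈ Ioo (h0 - η) (h0 + η), b < b' →
        (c b).2 ≠ (c b').2 := fun b hb b' hb' hlt heq => by
      have hsub : Icc b b' ⊆ Icc (h0 - η) (h0 + η) := Icc_subset_Icc hb.1.le hb'.2.le
      obtain ⟨e, he1, he2⟩ := exists_isLocalExtr_Ioo (f := fun b => (c b).2) hlt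
        (continuousOn_snd.comp (hcc.mono hsub) (mapsTo_univ _ _)) heq
      have he3 : e ∈ Icc (h0 - η) (h0 + η) := hsub ⟨he1.1.le, he1.2.le⟩
      have he4 : Icc (h0 - η) (h0 + η) ∈ 𝓝 e :=
        Icc_mem_nhds (hb.1.trans he1.1) (he1.2.trans hb'.2)
      exact not_isLocalExtr_of_edge (hD.prog t _ _ (hgood e he3).2.2.1) (hce e he3) he4 hcc hcinj
        (fun b hb => by rw [hce b hb]; simp) he2
    intro b hb b' hb' heq
    rcases lt_trichotomy b b' with h1 | h1 | h1
    · exact absurd heq (key b hb b' hb' h1)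
    · exact h1
    · exact absurd heq.symm (key b' hb' b hb h1)
  obtain ⟨b, hb, hbh⟩ : ∃ b ∈ Icc (h0 - η') (h0 + η'), (c b).2 = h :=
    intermediate_value_Icc (by linarith) (continuousOn_snd.comp
      (hcc.mono (Icc_subset_Icc (by linarith) (by linarith))) (mapsTo_univ _ _)) ⟨klo.le, khi.le⟩
  have hb' : b ∈ Ioo (h0 - η) (h0 + η) := ⟨by linarith [hb.1], by linarith [hb.2]⟩
  have hcb : (c b).1 ∈ Ioo (θ0 - ε') (θ0 + ε') := hcl kU'' (hpη b hb)
  have hDb : D t (c b).1 h = .edge x := by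
    rw [← hbh]
    exact hce b ⟨hb'.1.le, hb'.2.le⟩
  refine IsLevel.extend_left (l := θ0 - ε') (IsLevel.extend_right (r := θ0 + ε')
    (.single hcb.1 hcb.2 (fun θ hθ hne => ?_) hDb trivial) (by linarith) kEr) (by linarith) kEl
  by_contra hne'
  have h1 := hUV kU (hbox θ h ⟨by linarith [hθ.1], by linarith [hθ.2]⟩ kIcc)
  obtain ⟨h2, h3⟩ := h1.2.2.2.1
  obtain ⟨h4, h5⟩ := hyb kU' (hV' (hpθ θ hθ) kph)
  simp only at h2 h3
  rw [h2] at hne'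
  have h6 := (hw _ ⟨h5.1.le, h5.2.le⟩).2.2 _ h4 hne'
  have h7 : c (y (t, (θ, h))).2 = (θ, h) := by
    rw [hc]
    dsimp only
    rw [← h6]
    exact h3
  have h8 := huniq _ h5 b hb' (by rw [h7, hbh])
  rw [h8] at h7
  exact hne (congrArg Prod.fst h7).symm

theorem level {l r h : ℝ} {X : List C} (hh : h ∈ s) (hX : IsLevel (D t0 · h) l r (edges X)) :
    ∀ᶠ p : τ × ℝ in 𝓝 (t0, h), IsLevel (D p.1 · p.2) l r (edges X) := by
  generalize hW : edges X = W at hX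
  induction hX generalizing X with
  | nil h1 h2 =>
    filter_upwards [hD.empty_Icc hh h2] with p hp
    exact .nil h1 hp
  | @cons l θ0 m r w W h1 h2 h3 h4 h5 h6 ih =>
    cases X with
    | nil => simp [edges] at hW
    | cons x X =>
      obtain ⟨rfl, hW2⟩ := List.cons_eq_cons.1 hW
      filter_upwards [ih hW2, hD.strand hh h4 h1 h2 h3] with p hp hp'
      exact hp'.append hp

end IsDeformation

end Deformation

section Sections

variable {σ : Type*}

/-- The label is not that of a vertex or a singularity. -/
def PointLabel.IsPlain (w : PointLabel C) : Prop := w = .empty ∨ ∃ x, w = .edge x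

theorem eq_edges_insW (h : ∀ w ∈ W, ∃ x, w = .edge x) :
    W = edges (insW W) := by
  induction W with
  | nil => rfl
  | cons w W ih =>
    obtain ⟨x, rfl⟩ := h w (List.mem_cons_self ..)
    have := ih fun w hw => h w (List.mem_cons_of_mem _ hw)
    conv_lhs => rw [this]
    rfl

theorem PointLabel.IsProper.ne_empty {w : PointLabel C} (hw : w.IsProper) : w ≠ .empty := by
  rintro rfl; exact hw

theorem IsLevel.eq_edges {d : ℝ → PointLabel C} {l r : ℝ}
    (h : IsLevel d l r W) (hp : ∀ θ ∈ Icc l r, (d θ).IsPlain) : W = edges (insW W) :=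
  eq_edges_insW fun w hw => by
    obtain ⟨h1, θ, h2, h3⟩ := h.mem hw
    subst h3
    exact (hp θ ⟨h2.1.le, h2.2.le⟩).resolve_left h1.ne_empty

theorem IsLevel.isPlain {d : ℝ → PointLabel C} {l r : ℝ} {X : List C}
    (h : IsLevel d l r (edges X)) {θ : ℝ} (hθ : θ ∈ Icc l r) : (d θ).IsPlain := by
  by_cases h1 : d θ = .empty
  · exact .inl h1
  · obtain ⟨x, -, hx⟩ := List.mem_map.1 (h.mem_of_ne_empty hθ h1)
    exact .inr ⟨x, hx.symm⟩

variable {fst : σ → List C} {step : Labels C → σ → σ → Prop}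
  {L R : ℝ → ℝ} {a b l r : ℝ} {P : ℝ → σ}

theorem IsSec.eq_of_isPlain (hs : IsStepRel fst step) (h : IsSec step D L R a b P)
    (hp : ∀ t ∈ Icc a b, ∀ θ ∈ Icc (L t) (R t), (D θ t).IsPlain) : ∀ x ∈ Icc a b, P x = P a := by
  refine Icc_induction rfl (fun x hx ih => ?_) fun x hx ih => ?_
  · obtain ⟨W, -, -, h1, -⟩ := h x ⟨hx.1.le, hx.2⟩
    obtain ⟨t, h2, h3⟩ :=
      (h1.and (show ∀ᶠ t in 𝓝[<] x, t ∈ Ioo a x from Ioo_mem_nhdsLT hx.1)).exists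
    rw [← h2 h3.1.le, ih t ⟨h3.1.le, h3.2⟩]
  · have hx' : x ∈ Icc a b := ⟨hx.1, hx.2.le⟩
    obtain ⟨W, hW, -, -, h1⟩ := h x hx'
    filter_upwards [h1, (show ∀ᶠ t in 𝓝[>] x, t ∈ Ioo x b from Ioo_mem_nhdsGT hx.2)] with t h2 h3
    have h4 := h2 h3.2.le
    have h5 := hs.fst_eq h4
    rw [hW.eq_edges (hp x hx'), ← h5] at h4
    rw [hs.unique h4 (hs.edges_self _), ih x ⟨hx.1, le_rfl⟩]

theorem IsStepRel.isSec_const (hs : IsStepRel fst step) (e : σ)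
    (h : ∀ t ∈ Icc a b, IsLevel (D · t) (L t) (R t) (edges (fst e))) :
    IsSec step D L R a b (fun _ => e) := fun t ht =>
  ⟨_, h t ht, ⟨e, hs.edges_self e⟩, .of_forall fun _ _ => rfl, .of_forall fun _ _ => hs.edges_self e⟩

theorem IsLevel.exists_split {d : ℝ → PointLabel C}
    (h : IsLevel d l r W) {θ : ℝ} (hθ : θ ∈ Icc l r) (hne : d θ ≠ .empty) :
    ∃ W1 W2, W = W1 ++ d θ :: W2 ∧
      ∀ w ∈ W1 ++ W2, w ≠ .empty ∧ ∃ θ' ∈ Icc l r, θ' ≠ θ ∧ d θ' = w := by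
  induction h with
  | nil h1 h2 => exact absurd (h2 θ hθ) hne
  | @cons l θ0 m r w W h1 h2 h3 h4 h5 h6 ih =>
    have hmr := h6.le
    rcases le_or_gt θ m with hm | hm
    · have : θ = θ0 := by
        by_contra h7
        exact hne (h3 θ ⟨hθ.1, hm⟩ h7)
      subst this
      refine ⟨[], W, by rw [h4]; rfl, fun v hv => ?_⟩
      obtain ⟨h7, θ', h8, h9⟩ := h6.mem hv
      exact ⟨h7.ne_empty, θ', ⟨by linarith [h8.1], h8.2.le⟩, by linarith [h8.1] |> fun h : θ < θ' => h.ne', h9⟩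
    · obtain ⟨W1, W2, h7, h8⟩ := ih ⟨hm.le, hθ.2⟩
      refine ⟨w :: W1, W2, by rw [h7]; rfl, fun v hv => ?_⟩
      rcases List.mem_cons.1 hv with rfl | hv
      · exact ⟨h5.ne_empty, θ0, ⟨h1.le, by linarith⟩, (by linarith : θ0 < θ).ne, h4⟩
      · obtain ⟨h9, θ', h10, h11⟩ := h8 v hv
        exact ⟨h9, θ', ⟨by linarith [h10.1], h10.2⟩, h11⟩

theorem IsLevel.eq_singleton {d : ℝ → PointLabel C}
    (h : IsLevel d l r W) {θ : ℝ} (hθ : θ ∈ Icc l r) {xs ys : List C} {f : tens xs ⟶ tens ys}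
    (hd : d θ = .vertex xs ys f) (hp : ∀ θ' ∈ Icc l r, θ' ≠ θ → (d θ').IsPlain)
    (hW : insW W = xs) : W = [.vertex xs ys f] := by
  obtain ⟨W1, W2, h1, h2⟩ := h.exists_split hθ (by rw [hd]; simp)
  rw [hd] at h1
  have h3 : ∀ w ∈ W1 ++ W2, ∃ x, w = .edge x := fun w hw => by
    obtain ⟨h3, θ', h4, h5, h6⟩ := h2 w hw
    subst h6
    exact (hp θ' h4 h5).resolve_left h3
  have h4 := eq_edges_insW fun w hw => h3 w (List.mem_append_left W2 hw)
  have h5 := eq_edges_insW fun w hw => h3 w (mem_append_right W1 hw)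
  rw [h1, insW_append] at hW
  have h6 := congrArg List.length hW
  simp only [insW, PointLabel.ins, length_append] at h6
  have h7 : insW W1 = [] := List.length_eq_zero_iff.1 (by omega)
  have h8 : insW W2 = [] := List.length_eq_zero_iff.1 (by omega)
  rw [h7] at h4
  rw [h8] at h5
  rw [h1, h4, h5]
  rfl

theorem IsSec.eq_of_vertex {xs ys : List C} {f : tens xs ⟶ tens ys} {K : ℝ → KState (tens xs)}
    (hK : IsSec (fun W => KStep W) D (fun _ => l) (fun _ => r) a b K) (ha : K a = ⟨xs, 𝟙 _⟩)
    {θ h : ℝ} (hθ : θ ∈ Icc l r) (hh : h ∈ Ioo a b) (hv : D θ h = .vertex xs ys f)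
    (hp : ∀ t ∈ Icc a b, ∀ θ' ∈ Icc l r, (θ', t) ≠ (θ, h) → (D θ' t).IsPlain) :
    K b = ⟨ys, f⟩ := by
  have hs := KStep.isStepRel (tens xs)
  have h1 : ∀ t ∈ Ico a h, K t = ⟨xs, 𝟙 _⟩ := fun t ht => by
    rw [← ha]
    refine (hK.restrict le_rfl (ht.2.le.trans hh.2.le)).eq_of_isPlain hs (fun t' ht' θ' hθ' => ?_) t
      ⟨ht.1, le_rfl⟩
    refine hp t' ⟨ht'.1, by linarith [ht'.2, ht.2, hh.2]⟩ θ' hθ' fun he => ?_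
    have := congrArg Prod.snd he
    simp only at this
    linarith [ht'.2, ht.2]
  obtain ⟨W, hW, -, h2, h3⟩ := hK h ⟨hh.1.le, hh.2.le⟩
  have h4 : K h = ⟨xs, 𝟙 _⟩ := by
    obtain ⟨t, h5, h6⟩ :=
      (h2.and (show ∀ᶠ t in 𝓝[<] h, t ∈ Ioo a h from Ioo_mem_nhdsLT hh.1)).exists
    rw [← h5 h6.1.le, h1 t ⟨h6.1.le, h6.2⟩]
  obtain ⟨t, h5, h6⟩ :=
    (h3.and (show ∀ᶠ t in 𝓝[>] h, t ∈ Ioo h b from Ioo_mem_nhdsGT hh.2)).exists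
  have h7 := h5 h6.2.le
  have h8 : W = [.vertex xs ys f] := by
    refine hW.eq_singleton hθ hv (fun θ' h9 h10 => hp h ⟨hh.1.le, hh.2.le⟩ θ' h9 fun he => h10
      (congrArg Prod.fst he)) ?_
    rw [← KStep.fst h7, h4]
  rw [h8, h4] at h7
  have h9 : K t = ⟨ys, 𝟙 _ ≫ f⟩ := by
    refine (hs.unique h7 ?_).trans rfl
    exact KStep.single (w := .vertex xs ys f) (𝟙 _)
  rw [Category.id_comp] at h9
  rw [← h9]
  refine (hK.restrict (hh.1.le.trans h6.1.le) le_rfl).eq_of_isPlain hs (fun t' ht' θ' hθ' => ?_) b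
    ⟨h6.2.le, le_rfl⟩
  refine hp t' ⟨by linarith [ht'.1, h6.1, hh.1], ht'.2⟩ θ' hθ' fun he => ?_
  have := congrArg Prod.snd he
  simp only at this
  linarith [ht'.1, h6.1]

end Sections

section Deformation

variable {τ : Type*} [TopologicalSpace τ]

theorem exists_Icc_of_nhds_prod {t0 : τ} {h : ℝ} {p : τ → ℝ → Prop}
    (hp : ∀ᶠ q : τ × ℝ in 𝓝 (t0, h), p q.1 q.2) :
    ∃ ε > 0, ∀ᶠ t in 𝓝 t0, ∀ x ∈ Icc (h - ε) (h + ε), p t x := by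
  rw [nhds_prod_eq, eventually_prod_iff] at hp
  obtain ⟨pU, hU, pV, hV, hUV⟩ := hp
  obtain ⟨ε, hε, -, hV⟩ := exists_Icc_of_eventually hV one_pos
  exact ⟨ε, hε, hU.mono fun t ht x hx => hUV ht (hV x hx)⟩

/-- Near the height `h` the diagrams `D t`, for `t` close to `t0`, have between `l` and `r` the
value `f`, with source `xs` and target `ys`. -/
def IsSlab (D : τ → Plan C) (t0 : τ) (l r h : ℝ) {xs ys : List C}
    (f : tens xs ⟶ tens ys) : Prop :=
  ∃ ε > 0, ∀ a ∈ Ico (h - ε) h, ∀ b ∈ Ioc h (h + ε), ∀ᶠ t in 𝓝 t0, ∃ K : ℝ → KState (tens xs),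
    IsSec (fun W => KStep W) (D t) (fun _ => l) (fun _ => r) a b K ∧ K a = ⟨xs, 𝟙 _⟩ ∧ K b = ⟨ys, f⟩

theorem IsSlab.of_level {D : τ → Plan C} {t0 : τ} {l r h : ℝ} {X : List C}
    (hX : ∀ᶠ p : τ × ℝ in 𝓝 (t0, h), IsLevel (D p.1 · p.2) l r (edges X)) :
    IsSlab D t0 l r h (𝟙 (tens X)) := by
  obtain ⟨ε, hε, h1⟩ := exists_Icc_of_nhds_prod (p := fun t y => IsLevel (D t · y) l r (edges X)) hX
  refine ⟨ε, hε, fun a ha b hb => h1.mono fun t ht => ⟨fun _ => ⟨X, 𝟙 _⟩, ?_, rfl, rfl⟩⟩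
  exact (KStep.isStepRel _).isSec_const _ fun y hy => ht y ⟨ha.1.trans hy.1, hy.2.trans hb.2⟩

theorem IsSlab.hprod {D : τ → Plan C} {t0 : τ} {l m r h : ℝ} {xs ys xs' ys' : List C}
    {f : tens xs ⟶ tens ys} {g : tens xs' ⟶ tens ys'} (hf : IsSlab D t0 l m h f)
    (hg : IsSlab D t0 m r h g) : IsSlab D t0 l r h (hprod f g) := by
  obtain ⟨ε, hε, h1⟩ := hf
  obtain ⟨ε', hε', h2⟩ := hg
  refine ⟨min ε ε', lt_min hε hε', fun a ha b hb => ?_⟩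
  have h3 := min_le_left ε ε'
  have h4 := min_le_right ε ε'
  filter_upwards [h1 a ⟨by linarith [ha.1], ha.2⟩ b ⟨hb.1, by linarith [hb.2]⟩,
    h2 a ⟨by linarith [ha.1], ha.2⟩ b ⟨hb.1, by linarith [hb.2]⟩] with t ⟨K, k1, k2, k3⟩ ⟨K', k1', k2', k3'⟩
  refine ⟨_, (k1.kprod k1').map (KState.pre (tensAppend xs xs').hom) fun W e e' h => h.pre _, ?_, ?_⟩
  · rw [k2, k2']
    simp [TwPiv.kprod, KState.pre]
  · rw [k3, k3']; rfl

namespace IsDeformation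

variable {D : τ → Plan C} {t0 : τ} {s : Set ℝ} (hD : IsDeformation D t0 s)

include hD

theorem vertex {θ0 h0 : ℝ} {xs ys : List C} {f : tens xs ⟶ tens ys} (hh : h0 ∈ s)
    (hx : D t0 θ0 h0 = .vertex xs ys f) {l r : ℝ}
    (hl : l < θ0) (hr : θ0 < r) (he : ∀ θ ∈ Icc l r, θ ≠ θ0 → D t0 θ h0 = .empty) :
    IsSlab D t0 l r h0 f := by
  have hlr : l < r := hl.trans hr
  obtain ⟨W, hW⟩ := exists_isMovie hlr.le (fun θ _ => hD.prog t0 θ h0 hh)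
    (he l ⟨le_rfl, hlr.le⟩ hl.ne) (he r ⟨hlr.le, le_rfl⟩ hr.ne')
  have hW1 : W = [.vertex xs ys f] := hW.level.unique (.single hl hr he hx trivial)
  have hb := hW.below
  have ht := hW.above
  simp only [hW1, insW, outsW, PointLabel.ins, PointLabel.outs, append_nil] at hb ht
  have hpl : ∀ᶠ h in 𝓝 h0, ∀ θ ∈ Icc l r, (θ, h) ≠ (θ0, h0) → (D t0 θ h).IsPlain := by
    refine eventually_nhds_of_sides (fun θ hθ hne => .inl (he θ hθ fun h => hne (by rw [h]))) ?_ ?_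
    · exact hb.mono fun h hh θ hθ _ => hh.isPlain hθ
    · exact ht.mono fun h hh θ hθ _ => hh.isPlain hθ
  have hw : ∀ θ, (∀ θ' ∈ Icc θ θ, D t0 θ' h0 = .empty) →
      ∀ᶠ p : τ × ℝ in 𝓝 (t0, h0), D p.1 θ p.2 = .empty := fun θ hθ =>
    (hD.empty_Icc hh hθ).mono fun p hp => hp θ ⟨le_rfl, le_rfl⟩
  have hwl := hw l fun θ hθ => by rw [le_antisymm hθ.2 hθ.1]; exact he l ⟨le_rfl, hlr.le⟩ hl.ne
  have hwr := hw r fun θ hθ => by rw [le_antisymm hθ.2 hθ.1]; exact he r ⟨hlr.le, le_rfl⟩ hr.ne'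
  obtain ⟨ε1, hε₁, hwall⟩ := exists_Icc_of_nhds_prod
    (p := fun t y => D t l y = .empty ∧ D t r y = .empty) (hwl.and hwr)
  obtain ⟨ε2, hε₂, h2⟩ := Metric.nhds_basis_ball.eventually_iff.1 (hpl.and (hD.isOpen.mem_nhds hh))
  rw [ball_eq_Ioo] at h2
  obtain ⟨y0, hy₀, hlow⟩ := exists_Ico_of_nhdsLT (a := h0 - 1) (by linarith) hb
  obtain ⟨ε, hε, hε1, hε2, hε3⟩ : ∃ ε > 0, ε ≤ ε1 ∧ ε < ε2 ∧ ε ≤ h0 - y0 := by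
    refine ⟨min ε1 (min (ε2 / 2) (h0 - y0)), lt_min hε₁ (lt_min (by linarith)
      (by linarith [hlow.1])), min_le_left _ _, ?_, (min_le_right _ _).trans (min_le_right _ _)⟩
    have := (min_le_right ε1 (min (ε2 / 2) (h0 - y0))).trans (min_le_left _ _)
    linarith
  obtain ⟨-, hlow⟩ := hlow
  refine ⟨ε, hε, fun a ha b hb => ?_⟩
  obtain ⟨y, ζ, hζc, hyc, hy0, hζ0, hy, hζ⟩ := hD.loc (θ0, h0) hh
  have hζt : Tendsto ζ (𝓝 (t0, (θ0, h0))) (𝓝 (θ0, h0)) := by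
    simpa only [ContinuousAt, hζ0.self_of_nhds] using hζc.self_of_nhds
  have hyt : Tendsto y (𝓝 (t0, (θ0, h0))) (𝓝 (θ0, h0)) := by
    simpa only [ContinuousAt, hy0] using hyc
  have hconst : Tendsto (fun t => ((t, (θ0, h0)) : τ × ℝ × ℝ)) (𝓝 t0) (𝓝 (t0, (θ0, h0))) :=
    (Continuous.prodMk_left _).tendsto _
  have hin : Ioo l r ×ˢ Ioo a b ∈ 𝓝 (θ0, h0) :=
    prod_mem_nhds (Ioo_mem_nhds hl hr) (Ioo_mem_nhds ha.2 hb.1)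
  have hsub : ∀ h ∈ Icc a b, h ∈ Ioo (h0 - ε2) (h0 + ε2) := fun h hh =>
    ⟨by linarith [hh.1, ha.1], by linarith [hh.2, hb.2]⟩
  have hplain : ∀ᶠ t in 𝓝 t0, ∀ z ∈ Icc l r ×ˢ Icc a b,
      (D t z.1 z.2).IsPlain ∨ z = ζ (t, (θ0, h0)) := by
    refine (isCompact_Icc.prod isCompact_Icc).eventually_forall_of_forall_eventually
      fun z hz => ?_
    by_cases hz0 : z = (θ0, h0)
    · subst hz0
      filter_upwards [hy, hyt.eventually hin] with p hp hp'
      by_cases h3 : y p = (θ0, h0)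
      · exact .inr (by rw [← h3]; exact hp.2.symm)
      · refine .inl ?_
        rw [hp.1]
        exact (h2 (hsub _ ⟨hp'.2.1.le, hp'.2.2.le⟩)).1 _ ⟨hp'.1.1.le, hp'.1.2.le⟩ h3
    · have hzs := (h2 (hsub _ hz.2)).2
      have hpl : ∀ᶠ z' in 𝓝 z, (D t0 z'.1 z'.2).IsPlain := by
        by_cases h3 : D t0 z.1 z.2 = .empty
        · exact ((hD.prog t0 z.1 z.2 hzs).empty_nhds h3).mono fun z' h => .inl h
        · have h4 : z.1 ∈ Ioo l r := by
            have hw := hwall.self_of_nhds z.2 ⟨by linarith [hz.2.1, ha.1], by linarith [hz.2.2, hb.2]⟩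
            refine ⟨lt_of_le_of_ne hz.1.1 fun h => h3 (h ▸ hw.1),
              lt_of_le_of_ne hz.1.2 fun h => h3 (h ▸ hw.2)⟩
          filter_upwards [prod_mem_nhds (Ioo_mem_nhds h4.1 h4.2)
            (Ioo_mem_nhds (hsub _ hz.2).1 (hsub _ hz.2).2), isOpen_ne.mem_nhds hz0] with z' h5 h6
          exact (h2 h5.2).1 _ ⟨h5.1.1.le, h5.1.2.le⟩ h6
      exact (hD.eventually hzs hpl).mono fun p hp => .inl hp
  have hlevel := hD.level (h2 (hsub a ⟨le_rfl, ha.2.le.trans hb.1.le⟩)).2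
    (hlow a ⟨by linarith [ha.1], ha.2⟩)
  have hlevel' : ∀ᶠ t in 𝓝 t0, IsLevel (D t · a) l r (edges xs) :=
    (show Tendsto (fun t => ((t, a) : τ × ℝ)) (𝓝 t0) (𝓝 (t0, a)) from
      (Continuous.prodMk_left _).tendsto _).eventually hlevel
  filter_upwards [hplain, hlevel', hwall, hconst.eventually hζ, (hζt.comp hconst).eventually hin]
    with t k1 k2 k3 k4 k5
  have hP : IsPlanar (D t) (fun _ => l) (fun _ => r) a b :=
    { left := continuousOn_const
      right := continuousOn_const
      lt := fun _ _ => hlr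
      prog := fun h hh θ _ => hD.prog t θ h (h2 (hsub h hh)).2
      left_empty := fun h hh => (k3 h ⟨by linarith [hh.1, ha.1], by linarith [hh.2, hb.2]⟩).1
      right_empty := fun h hh => (k3 h ⟨by linarith [hh.1, ha.1], by linarith [hh.2, hb.2]⟩).2 }
  obtain ⟨K, hK, hKa⟩ := hP.exists_isSec (KStep.isStepRel (tens xs)) (ha.2.le.trans hb.1.le) k2
    (e := ⟨xs, 𝟙 _⟩) (insW_edges xs).symm
  refine ⟨K, hK, hKa, hK.eq_of_vertex hKa (θ := (ζ (t, (θ0, h0))).1) (h := (ζ (t, (θ0, h0))).2)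
    ⟨k5.1.1.le, k5.1.2.le⟩ k5.2 (k4.1.trans hx) fun y hy θ hθ hne => ?_⟩
  exact (k1 (θ, y) ⟨hθ, hy⟩).resolve_right hne

theorem slab {l r h : ℝ} (hh : h ∈ s) (hW : IsLevel (D t0 · h) l r W) :
    IsSlab D t0 l r h (val W) := by
  induction hW with
  | nil h1 h2 =>
    exact IsSlab.of_level (X := []) ((hD.empty_Icc hh h2).mono fun p hp => .nil h1 hp)
  | @cons l θ0 m r w W h1 h2 h3 h4 h5 h6 ih =>
    refine IsSlab.hprod (f := w.mor) ?_ ih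
    cases w with
    | empty => exact h5.elim
    | singular => exact h5.elim
    | edge x => exact IsSlab.of_level (X := [x]) (hD.strand hh h4 h1 h2 h3)
    | vertex xs ys f => exact hD.vertex hh h4 h1 h2 h3

end IsDeformation

end Deformation

variable {γ : GroupLike k H}

open VState

variable (γ) in
/-- The transport with holonomy `γ` takes the state `e` at the cut `θ0` of the height `a` to the
state `f` at the cut `θ` of the height `y`. -/
def Reaches (D : Plan 𝓜) (θ0 a : ℝ) (e : VState k H) (θ y : ℝ)
    (f : VState k H) : Prop :=
  ∃ S, IsCylSec γ D a y S ∧ S θ0 a = e ∧ S θ y = f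

theorem Reaches.extend {D : Plan 𝓜} {θ0 a b y θ : ℝ} {e : VState k H}
    {X Y : List 𝓜} {z : (tens X).carrier} (hD : IsCylDiagram D a b) (hay : a ≤ y)
    (hyb : y ≤ b) (h : Reaches γ D θ0 a e θ y ⟨X, z⟩) {K : ℝ → KState (tens X)}
    (hK : IsSec (fun W => KStep W) D (fun _ => θ) (fun _ => θ + 2 * π) y b K)
    (hKy : K y = ⟨X, 𝟙 _⟩) {g : tens X ⟶ tens Y} (hKb : K b = ⟨Y, g⟩) :
    Reaches γ D θ0 a e θ b ⟨Y, g.toLin z⟩ := by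
  obtain ⟨S, h1, h2, h3⟩ := h
  obtain ⟨S', h4, h5⟩ := h1.extend hD hay hyb
  refine ⟨S', h4, by rw [h5 _ _ hay, h2], ?_⟩
  have h6 := (h4.mono hay le_rfl).eq_app (hD.mono hay le_rfl) (L := fun _ => θ) continuousOn_const hK
    (z := z) (by rw [h5 _ _ le_rfl, h3, hKy]; rfl) b ⟨hyb, le_rfl⟩
  rw [h6, hKb]
  rfl

namespace IsDeformation

variable {τ : Type*} [TopologicalSpace τ] {D : τ → Plan (FDMod k H)} {t0 : τ}
  {s : Set ℝ} (hD : IsDeformation D t0 s) {a b : ℝ} (hcyl : ∀ t, IsCylDiagram (D t) a b)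
  (hab : Icc a b ⊆ s) {θ0 : ℝ} {e : VState k H}

include hD hcyl hab

theorem reaches_move {θ θ' y : ℝ} {Y : List 𝓜} {f : VState k H} (hy : y ∈ Icc a b)
    (hY : IsLevel (D t0 · y) θ (θ + 2 * π) (edges Y))
    (hf : ∀ᶠ t in 𝓝 t0, Reaches γ (D t) θ0 a e θ y f) (hθ' : D t0 θ' y = .empty) :
    ∃ f', ∀ᶠ t in 𝓝 t0, Reaches γ (D t) θ0 a e θ' y f' := by
  have hpl : ∀ θ'', (D t0 θ'' y).IsPlain := fun θ'' => by
    obtain ⟨ϑ, h1, h2⟩ := ((hcyl t0).periodic y).exists_mem θ θ''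
    rw [← h2]
    exact hY.isPlain ⟨h1.1, h1.2.le⟩
  have hev : ∀ {ϑ ϑ' V}, IsLevel (D t0 · y) ϑ ϑ' V →
      ∀ᶠ t in 𝓝 t0, IsLevel (D t · y) ϑ ϑ' (edges (insW V)) := fun {ϑ ϑ' V} hV => by
    have h1 := hV.eq_edges fun θ _ => hpl θ
    rw [h1] at hV
    exact (show Tendsto (fun t => ((t, y) : τ × ℝ)) (𝓝 t0) (𝓝 (t0, y)) from
      (Continuous.prodMk_left _).tendsto _).eventually (hD.level (hab hy) hV)
  rcases le_total θ θ' with hle | hle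
  · obtain ⟨V, hV⟩ := (hcyl t0).exists_level hy hle hY.left_empty hθ'
    refine ⟨(rot γ)^[(insW V).length] f, ?_⟩
    filter_upwards [hf, hev hV] with t ⟨S, h1, h2, h3⟩ h4
    have h5 := h1.rotate y ⟨hy.1, le_rfl⟩ _ _ _ h4
    rw [insW_edges, h3] at h5
    exact ⟨S, h1, h2, h5⟩
  · obtain ⟨V, hV⟩ := (hcyl t0).exists_level hy hle hθ' hY.left_empty
    refine ⟨((rot γ) ^ (insW V).length).symm f, ?_⟩
    filter_upwards [hf, hev hV] with t ⟨S, h1, h2, h3⟩ h4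
    have h5 := h1.rotate y ⟨hy.1, le_rfl⟩ _ _ _ h4
    rw [insW_edges, h3, Equiv.Perm.iterate_eq_pow] at h5
    exact ⟨S, h1, h2, by rw [h5, Equiv.symm_apply_apply]⟩

theorem reaches_step {θ θ' x y : ℝ} {Y : List 𝓜} {f : VState k H} (hy : y ∈ Ico a x)
    (hx : x ∈ Ico a b) (hY : IsLevel (D t0 · y) θ (θ + 2 * π) (edges Y))
    (hf : ∀ᶠ t in 𝓝 t0, Reaches γ (D t) θ0 a e θ y f) {W : Labels 𝓜} {ε : ℝ}
    (hyε : x - ε ≤ y)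
    (hs : ∀ y ∈ Ico (x - ε) x, ∀ z ∈ Ioc x (x + ε), ∀ᶠ t in 𝓝 t0, ∃ K : ℝ → KState (tens (insW W)),
      IsSec (fun W => KStep W) (D t) (fun _ => θ') (fun _ => θ' + 2 * π) y z K ∧
        K y = ⟨insW W, 𝟙 _⟩ ∧ K z = ⟨outsW W, val W⟩)
    {z : ℝ} (hz : z ∈ Ioc x (x + ε)) (hzb : z ≤ b) :
    ∃ f', ∀ᶠ t in 𝓝 t0, Reaches γ (D t) θ0 a e θ' z f' := by
  have h1 := hs y ⟨hyε, hy.2⟩ z hz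
  obtain ⟨K, hK1, hK2, -⟩ := h1.self_of_nhds
  obtain ⟨V, hV, ⟨e', he'⟩, -⟩ := hK1 y ⟨le_rfl, hy.2.le.trans hz.1.le⟩
  have hyb : y ∈ Icc a b := ⟨hy.1, hy.2.le.trans hx.2.le⟩
  obtain ⟨f1, hf1⟩ := hD.reaches_move hcyl hab hyb hY hf hV.left_empty
  have h2 : f1.1 = insW W := by
    obtain ⟨S, g1, -, g3⟩ := hf1.self_of_nhds
    rw [← g3, (g1.loc y ⟨hy.1, le_rfl⟩ _ _ hV).1, ← he'.fst, hK2]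
  obtain ⟨X, v⟩ := f1
  obtain rfl : X = insW W := h2
  refine ⟨⟨outsW W, (val W).toLin v⟩, ?_⟩
  filter_upwards [h1, hf1] with t ⟨K, k1, k2, k3⟩ k4
  exact k4.extend ((hcyl t).mono le_rfl hzb) hy.1 (hy.2.le.trans hz.1.le) k1 k2 k3

theorem eventually_reaches {X : List 𝓜}
    (hX : IsLevel (D t0 · a) θ0 (θ0 + 2 * π) (edges X)) (he : e.1 = X) :
    ∀ c ∈ Ico a b, ∀ᶠ y in 𝓝[>] c, ∃ θ Y f, IsLevel (D t0 · y) θ (θ + 2 * π) (edges Y) ∧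
      ∀ᶠ t in 𝓝 t0, Reaches γ (D t) θ0 a e θ y f := by
  rintro c ⟨hac, hcb⟩
  have hsub : ∀ x ∈ Icc a c, x ∈ Ico a b := fun x hx => ⟨hx.1, hx.2.trans_lt hcb⟩
  refine Icc_induction (a := a) (b := c) (P := fun x => ∀ᶠ y in 𝓝[>] x, ∃ θ Y f,
    IsLevel (D t0 · y) θ (θ + 2 * π) (edges Y) ∧
      ∀ᶠ t in 𝓝 t0, Reaches γ (D t) θ0 a e θ y f) ?_ (fun x hx ih => ?_) (fun x hx ih => ?_) c
      ⟨hac, le_rfl⟩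
  · have hab' : a < b := hac.trans_lt hcb
    obtain ⟨ε, hε, h1⟩ := exists_Icc_of_nhds_prod
      (p := fun t y => IsLevel (D t · y) θ0 (θ0 + 2 * π) (edges X))
      (hD.level (hab ⟨le_rfl, hab'.le⟩) hX)
    filter_upwards [(show ∀ᶠ y in 𝓝[>] a, y ∈ Ioo a (a + ε) from Ioo_mem_nhdsGT (by linarith)),
      (show ∀ᶠ y in 𝓝[>] a, y ∈ Ioo a b from Ioo_mem_nhdsGT hab')] with y h2 h3
    refine ⟨θ0, X, e, h1.self_of_nhds y ⟨by linarith [h2.1], h2.2.le⟩, h1.mono fun t ht => ?_⟩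
    obtain ⟨S, h4, h5⟩ := ((hcyl t).mono le_rfl h3.2.le).exists_slab γ (h := y) ⟨h3.1.le, le_rfl⟩
      (ht y ⟨by linarith [h2.1], h2.2.le⟩) (e := e) (fun t' ht' => by
        rw [insW_edges]; exact ht t' ⟨by linarith [ht'.1], by linarith [ht'.2, h2.2]⟩)
      (fun t' ht' => absurd ht'.1 (not_lt.2 ht'.2)) (by rw [insW_edges, he])
    exact ⟨S, h4, h5 a ⟨le_rfl, h2.1.le⟩, h5 y ⟨h2.1.le, le_rfl⟩⟩
  · have hx' := hsub x ⟨hx.1.le, hx.2⟩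
    have hxb : x ∈ Icc a b := ⟨hx'.1, hx'.2.le⟩
    obtain ⟨θ', -, hθ'⟩ := (hcyl t0).exists_empty hxb 0 one_pos
    obtain ⟨W, hW⟩ := (hcyl t0).exists_window_movie hxb hθ'
    obtain ⟨ε, hε, hs⟩ := hD.slab (hab hxb) hW.level
    have h1 := ih (max a (x - ε / 2)) ⟨le_max_left _ _, max_lt hx.1 (by linarith)⟩
    obtain ⟨y, ⟨θ, Y, f, h2, h3⟩, h4⟩ := (h1.and (show ∀ᶠ y in 𝓝[>] (max a (x - ε / 2)),
      y ∈ Ioo (max a (x - ε / 2)) x from Ioo_mem_nhdsGT (max_lt hx.1 (by linarith)))).exists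
    have h5 := (le_max_left _ _).trans_lt h4.1
    have h6 := (le_max_right _ _).trans_lt h4.1
    filter_upwards [hW.above, (show ∀ᶠ z in 𝓝[>] x, z ∈ Ioo x (x + ε) from
      Ioo_mem_nhdsGT (by linarith)), (show ∀ᶠ z in 𝓝[>] x, z ∈ Ioo x b from Ioo_mem_nhdsGT hx'.2)]
      with z h7 h8 h9
    obtain ⟨f', hf'⟩ := hD.reaches_step hcyl hab ⟨h5.le, h4.2⟩ hx' h2 h3 (by linarith) hs
      ⟨h8.1, h8.2.le⟩ h9.2.le
    exact ⟨θ', _, f', h7, hf'⟩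
  · have := eventually_eventually_nhdsWithin.2 (ih x ⟨hx.1, le_rfl⟩)
    filter_upwards [this, self_mem_nhdsWithin] with y h1 h2
    exact nhdsWithin_le_iff.2 (mem_nhdsWithin_of_mem_nhds (isOpen_Ioi.mem_nhds h2)) h1

end IsDeformation

theorem continuous_pt : Continuous (fun z : ℝ × ℝ => pt z.1 z.2) := by
  refine Continuous.subtype_mk ?_ _
  refine (PiLp.continuous_toLp 2 _).comp (continuous_pi fun i => ?_)
  fin_cases i <;> simp <;> fun_prop

theorem pt_apply_zero (θ φ : ℝ) : (pt θ φ).1 0 = sin φ := rfl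
theorem pt_apply_one (θ φ : ℝ) : (pt θ φ).1 1 = cos φ * cos θ := rfl
theorem pt_apply_two (θ φ : ℝ) : (pt θ φ).1 2 = cos φ * sin θ := rfl

theorem continuous_height : Continuous (fun p : S2 => p.1 0) := by fun_prop

/-- The first two coordinates of the equatorial plane, turned by the angle `-θ0`. -/
def equator (θ0 : ℝ) (p : S2) : ℂ :=
  ((p.1 1 : ℂ) + (p.1 2 : ℂ) * Complex.I) * Complex.exp (-(θ0 * Complex.I))

theorem continuous_equator (θ0 : ℝ) : Continuous (equator θ0) := by
  unfold equator
  fun_prop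

theorem equator_pt (θ0 θ φ : ℝ) : equator θ0 (pt θ φ) =
    (cos φ : ℂ) * (Complex.cos ((θ - θ0 : ℝ) : ℂ) + Complex.sin ((θ - θ0 : ℝ) : ℂ) * Complex.I) := by
  rw [equator, pt_apply_one, pt_apply_two, ← Complex.exp_mul_I, Complex.ofReal_sub, sub_mul,
    sub_eq_add_neg, Complex.exp_add, Complex.exp_mul_I (θ : ℂ)]
  push_cast
  ring

/-- Longitude, close to `θ0`, and latitude. -/
def coords (θ0 : ℝ) (p : S2) : ℝ × ℝ := (θ0 + (equator θ0 p).arg, arcsin (p.1 0))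

theorem cos_pos_of_strip {φ : ℝ} (h1 : -(π / 2) < φ) (h2 : φ < π / 2) :
    0 < cos φ := cos_pos_of_mem_Ioo ⟨h1, h2⟩

theorem coords_pt {θ0 θ φ : ℝ} (h1 : -(π / 2) < φ) (h2 : φ < π / 2)
    (hθ : θ - θ0 ∈ Ioc (-π) π) : coords θ0 (pt θ φ) = (θ, φ) := by
  rw [coords, equator_pt, pt_apply_zero, arcsin_sin h1.le h2.le,
    Complex.arg_mul_cos_add_sin_mul_I (cos_pos_of_strip h1 h2) hθ]
  simp

theorem pt_coords {θ0 θ φ : ℝ} (h1 : -(π / 2) < φ) (h2 : φ < π / 2) :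
    pt (coords θ0 (pt θ φ)).1 (coords θ0 (pt θ φ)).2 = pt θ φ := by
  obtain ⟨n, hn, -⟩ := existsUnique_add_zsmul_mem_Ioc two_pi_pos (θ - θ0) (-π)
  have h3 : pt θ φ = pt (θ + n • (2 * π)) φ :=
    (pt_eq_iff h1 h2 h1 h2).2 ⟨rfl, -n, by simp⟩
  rw [h3, coords_pt h1 h2 (by
    rw [add_sub_right_comm]
    exact ⟨hn.1, hn.2.trans_eq (by ring)⟩)]

theorem continuousAt_coords {θ0 φ : ℝ} (h1 : -(π / 2) < φ) (h2 : φ < π / 2) :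
    ∀ᶠ p in 𝓝 (pt θ0 φ), ContinuousAt (coords θ0) p := by
  have h3 : equator θ0 (pt θ0 φ) ∈ Complex.slitPlane := by
    rw [equator_pt, sub_self]
    simpa [← Complex.ofReal_cos] using cos_pos_of_strip h1 h2
  filter_upwards [(continuous_equator θ0).continuousAt.eventually_mem
    (Complex.isOpen_slitPlane.mem_nhds h3)] with p hp
  exact (continuousAt_const.add (ContinuousAt.comp (g := Complex.arg) (Complex.continuousAt_arg hp)
    (continuous_equator θ0).continuousAt)).prodMk
    (continuous_arcsin.comp continuous_height).continuousAt

theorem eventually_strip {θ0 φ : ℝ} (h1 : -(π / 2) < φ) (h2 : φ < π / 2) :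
    ∀ᶠ p in 𝓝 (pt θ0 φ), ∃ θ' φ', -(π / 2) < φ' ∧ φ' < π / 2 ∧ p = pt θ' φ' := by
  have h3 : (pt θ0 φ).1 0 ∈ Ioo (-1 : ℝ) 1 := by
    rw [pt_apply_zero]
    refine ⟨?_, ?_⟩
    · rw [← sin_pi_div_two, ← sin_neg]
      exact sin_lt_sin_of_lt_of_le_pi_div_two le_rfl h2.le h1
    · rw [← sin_pi_div_two]
      exact sin_lt_sin_of_lt_of_le_pi_div_two h1.le le_rfl h2
  filter_upwards [continuous_height.continuousAt.eventually_mem (Ioo_mem_nhds h3.1 h3.2)] with p hp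
  obtain ⟨θ', φ', h4, h5, rfl⟩ := exists_pt p
  refine ⟨θ', φ', lt_of_le_of_ne h4 fun h => ?_, lt_of_le_of_ne h5 fun h => ?_, rfl⟩
  · have := hp.1
    rw [pt_apply_zero, ← h, sin_neg, sin_pi_div_two] at this
    exact lt_irrefl _ this
  · have := hp.2
    rw [pt_apply_zero, h, sin_pi_div_two] at this
    exact lt_irrefl _ this

section Isotopy

variable {τ : Type*} [TopologicalSpace τ]

theorem isDeformation_chart {T : τ → S2 → PointLabel C} {t0 : τ}
    (hp : ∀ t θ φ, φ ∈ Ioo (-(π / 2)) (π / 2) → IsLocallyProgressive (chart (T t)) θ φ)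
    {Y Z : τ × S2 → S2} (hY : Continuous Y) (hZ : Continuous Z) (hYZ : ∀ t p, Y (t, Z (t, p)) = p)
    (hZY : ∀ t p, Z (t, Y (t, p)) = p) (hZ0 : ∀ p, Z (t0, p) = p)
    (hT : ∀ t p, T t p = T t0 (Y (t, p))) :
    IsDeformation (fun t => chart (T t)) t0 (Ioo (-(π / 2)) (π / 2)) where
  isOpen := isOpen_Ioo
  prog t θ φ hφ := hp t θ φ hφ
  loc := by
    rintro ⟨θ0, φ0⟩ ⟨h1, h2⟩
    dsimp only at h1 h2
    have hY0 : ∀ p, Y (t0, p) = p := fun p => by conv_lhs => rw [← hZ0 p, hYZ]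
    have hptc : ∀ W : τ × S2 → S2, Continuous W → (∀ p, W (t0, p) = p) →
        Tendsto (fun p : τ × (ℝ × ℝ) => W (p.1, pt p.2.1 p.2.2)) (𝓝 (t0, (θ0, φ0)))
          (𝓝 (pt θ0 φ0)) := fun W hW hW0 => by
      apply Continuous.tendsto'
      · exact hW.comp (continuous_fst.prodMk (continuous_pt.comp continuous_snd))
      · exact hW0 _
    have hYt := hptc Y hY hY0
    have hZt := hptc Z hZ hZ0
    have hcp : ∀ᶠ z in 𝓝 (θ0, φ0), coords θ0 (pt z.1 z.2) = z := by
      have hpi := pi_pos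
      filter_upwards [prod_mem_nhds (Ioo_mem_nhds (show θ0 - π < θ0 by linarith)
        (show θ0 < θ0 + π by linarith)) (Ioo_mem_nhds h1 h2)] with z hz
      exact coords_pt hz.2.1 hz.2.2 ⟨by linarith [hz.1.1], by linarith [hz.1.2]⟩
    have hcp' : ∀ᶠ p : τ × (ℝ × ℝ) in 𝓝 (t0, (θ0, φ0)), coords θ0 (pt p.2.1 p.2.2) = p.2 :=
      (continuous_snd.tendsto ((t0, (θ0, φ0)) : τ × ℝ × ℝ)).eventually hcp
    have hpc : ∀ᶠ p in 𝓝 (pt θ0 φ0), pt (coords θ0 p).1 (coords θ0 p).2 = p := by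
      filter_upwards [eventually_strip h1 h2 (θ0 := θ0)] with p hp
      obtain ⟨θ', φ', h3, h4, rfl⟩ := hp
      exact pt_coords h3 h4
    have hcont := continuousAt_coords h1 h2 (θ0 := θ0)
    have hcomp : ∀ W : τ × S2 → S2, Continuous W → ∀ p : τ × (ℝ × ℝ),
        ContinuousAt (coords θ0) (W (p.1, pt p.2.1 p.2.2)) →
        ContinuousAt (fun p : τ × (ℝ × ℝ) => coords θ0 (W (p.1, pt p.2.1 p.2.2))) p :=
      fun W hW p hp => ContinuousAt.comp (g := coords θ0)
        (f := fun p : τ × (ℝ × ℝ) => W (p.1, pt p.2.1 p.2.2)) hp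
        (hW.comp (continuous_fst.prodMk (continuous_pt.comp continuous_snd))).continuousAt
    refine ⟨fun p => coords θ0 (Y (p.1, pt p.2.1 p.2.2)), fun p => coords θ0 (Z (p.1, pt p.2.1 p.2.2)),
      ?_, ?_, ?_, ?_, ?_, ?_⟩
    · filter_upwards [hZt.eventually hcont] with p hp
      exact hcomp Z hZ p hp
    · refine hcomp Y hY _ ?_
      simp only [hY0]
      exact hcont.self_of_nhds
    · simp only [hY0]
      exact hcp.self_of_nhds
    · simp only [hZ0]
      exact hcp
    · filter_upwards [hYt.eventually hpc, hcp'] with p h3 h4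
      refine ⟨?_, ?_⟩
      · rw [chart, chart, h3, hT]
      · rw [h3, hZY, h4]
    · filter_upwards [hZt.eventually hpc, hcp'] with p h3 h4
      refine ⟨?_, ?_⟩
      · rw [chart, chart, h3, hT, hYZ]
      · rw [h3, hYZ, h4]

theorem exists_continuous_inverse [CompactSpace τ] [T2Space τ] {X : Type*} [TopologicalSpace X]
    [CompactSpace X] [T2Space X] {Φ : τ → X → X}
    (hΦ : Continuous fun q : τ × X => Φ q.1 q.2) (hb : ∀ t, Function.Bijective (Φ t)) :
    ∃ Ψ : τ → X → X, (Continuous fun q : τ × X => Ψ q.1 q.2) ∧ (∀ t p, Ψ t (Φ t p) = p) ∧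
      ∀ t p, Φ t (Ψ t p) = p := by
  let E : τ × X ≃ τ × X :=
    { toFun := fun q => (q.1, Φ q.1 q.2)
      invFun := fun q => (q.1, (Equiv.ofBijective _ (hb q.1)).symm q.2)
      left_inv := fun q => by simp [Equiv.ofBijective_symm_apply_apply]
      right_inv := fun q => Prod.ext rfl ((Equiv.ofBijective _ (hb q.1)).apply_symm_apply q.2) }
  have hE : Continuous E := continuous_fst.prodMk hΦ
  refine ⟨fun t => (Equiv.ofBijective _ (hb t)).symm, ?_, fun t p => ?_, fun t p => ?_⟩
  · exact continuous_snd.comp (hE.homeoOfEquivCompactToT2 (f := E)).symm.continuous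
  · exact (Equiv.ofBijective _ (hb t)).symm_apply_apply p
  · exact (Equiv.ofBijective _ (hb t)).apply_symm_apply p

end Isotopy

theorem IsLevel.window_length {d : ℝ → PointLabel C} (hd : IsPeriodic d) {θ θ' : ℝ}
    {W W' : Labels C} (h : IsLevel d θ (θ + 2 * π) W)
    (h' : IsLevel d θ' (θ' + 2 * π) W') : W.length = W'.length := by
  obtain ⟨n, hn, -⟩ := existsUnique_add_zsmul_mem_Ico two_pi_pos θ' θ
  have h1 := h'.shift (s := n • (2 * π)) fun ϑ => hd.add_zsmul ϑ n
  obtain ⟨W1, W2, h2, h3, h4⟩ := h.cut ⟨hn.1, hn.2.le⟩ h1.left_empty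
  have h5 := h4.append (h3.shift hd)
  have h6 : θ' + 2 * π + n • (2 * π) = θ' + n • (2 * π) + 2 * π := by ring
  rw [h6] at h1
  rw [h1.unique h5, h2, length_append, length_append, add_comm]

theorem edges_length {C : Type u} [Category.{v} C] [MonoidalCategory C] (X : List C) :
    (edges X).length = X.length := by simp [edges]

theorem IsCylDiagram.window_length {D : Plan 𝓜} {a b : ℝ}
    (hD : IsCylDiagram D a b) (hp : ∀ x ∈ Icc a b, ∀ θ, (D θ x).IsPlain) {n : ℕ} {θ0 : ℝ} {W0}
    (hW0 : IsLevel (D · a) θ0 (θ0 + 2 * π) W0) (hn : W0.length = n) :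
    ∀ x ∈ Icc a b, ∀ θ W, IsLevel (D · x) θ (θ + 2 * π) W → W.length = n := by
  refine Icc_induction (fun θ W hW => ?_) (fun x hx ih θ W hW => ?_) fun x hx ih => ?_
  · rw [← hn, hW.window_length (hD.periodic a) hW0]
  · have hx' : x ∈ Icc a b := ⟨hx.1.le, hx.2⟩
    obtain ⟨V, hV⟩ := hD.exists_window_movie hx' hW.left_empty
    have h1 : V = W := hV.level.unique hW
    subst h1
    obtain ⟨y, h2, h3⟩ := (hV.below.and
      (show ∀ᶠ t in 𝓝[<] x, t ∈ Ioo a x from Ioo_mem_nhdsLT hx.1)).exists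
    rw [hW.eq_edges fun θ _ => hp x hx' θ, edges_length, ← edges_length]
    exact ih y ⟨h3.1.le, h3.2⟩ _ _ h2
  · have hx' : x ∈ Icc a b := ⟨hx.1, hx.2.le⟩
    obtain ⟨θ1, -, hθ1⟩ := hD.exists_empty hx' 0 one_pos
    obtain ⟨V, hV⟩ := hD.exists_window_movie hx' hθ1
    filter_upwards [hV.above] with y hy θ W hW
    rw [hW.window_length (hD.periodic y) hy, ← ih x ⟨hx.1, le_rfl⟩ _ _ hV.level]
    conv_rhs => rw [hV.level.eq_edges fun θ _ => hp x hx' θ]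
    rw [hV.level.eq_edges fun θ _ => hp x hx' θ, edges_length, edges_length, outsW_edges, insW_edges]

namespace StringNet

variable {T : StringNet α}

theorem isLocallyProgressive (T : StringNet α) {θ φ : ℝ} (h1 : -(π / 2) < φ)
    (h2 : φ < π / 2) : IsLocallyProgressive (chart T.label) θ φ :=
  (T.isCylDiagram h1 h2).prog φ ⟨le_rfl, le_rfl⟩ θ

theorem label_ne_singular (T : StringNet α) {θ φ : ℝ} (h1 : -(π / 2) < φ)
    (h2 : φ < π / 2) : chart T.label θ φ ≠ .singular := by
  intro hs
  have hD := T.isCylDiagram h1 h2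
  have hφ : φ ∈ Icc φ φ := ⟨le_rfl, le_rfl⟩
  obtain ⟨ϑ, -, hϑ⟩ := hD.exists_empty hφ 0 one_pos
  obtain ⟨W, hW⟩ := hD.exists_window hφ hϑ
  obtain ⟨σ, h3, h4⟩ := (hD.periodic φ).exists_mem ϑ θ
  have h5 := hW.mem_of_ne_empty (θ := σ) ⟨h3.1, h3.2.le⟩ (by rw [h4, hs]; simp)
  rw [h4, hs] at h5
  exact (hW.mem h5).1.elim

theorem eq_pole_of_singular {p : S2} (hp : T.label p = .singular) :
    p = southPole ∨ p = northPole := by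
  obtain ⟨θ, φ, h1, h2, rfl⟩ := exists_pt p
  rcases h1.eq_or_lt with h1 | h1
  · exact .inl (by rw [← h1, pt_neg_pi_div_two])
  rcases h2.eq_or_lt with h2 | h2
  · exact .inr (by rw [h2, pt_pi_div_two])
  · exact absurd hp (T.label_ne_singular h1 h2)

theorem IsSouth.label {a : ℝ} (ha : T.IsSouth a) {θ φ : ℝ} (h1 : -(π / 2) < φ) (h2 : φ ≤ a) :
    chart T.label θ φ = .empty ∨ chart T.label θ φ = .edge α := by
  have hD := T.isCylDiagram h1 (h2.trans_lt ha.lt)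
  have hφ : φ ∈ Icc φ φ := ⟨le_rfl, le_rfl⟩
  obtain ⟨ϑ, -, hϑ⟩ := hD.exists_empty hφ 0 one_pos
  obtain ⟨σ, h3, h4⟩ := (hD.periodic φ).exists_mem ϑ θ
  rw [← h4]
  by_cases h5 : chart T.label σ φ = .empty
  · exact .inl h5
  · exact .inr (List.mem_singleton.1 ((ha.window φ h1 h2 ϑ hϑ).mem_of_ne_empty ⟨h3.1, h3.2.le⟩ h5))

theorem IsNorth.label {b : ℝ} (hb : T.IsNorth b) {θ φ : ℝ} (h1 : b ≤ φ) (h2 : φ < π / 2) :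
    chart T.label θ φ = .empty ∨ chart T.label θ φ = .edge (dual α) := by
  have hD := T.isCylDiagram (hb.gt.trans_le h1) h2
  have hφ : φ ∈ Icc φ φ := ⟨le_rfl, le_rfl⟩
  obtain ⟨ϑ, -, hϑ⟩ := hD.exists_empty hφ 0 one_pos
  obtain ⟨σ, h3, h4⟩ := (hD.periodic φ).exists_mem ϑ θ
  rw [← h4]
  by_cases h5 : chart T.label σ φ = .empty
  · exact .inl h5
  · exact .inr (List.mem_singleton.1 ((hb.window φ h1 h2 ϑ hϑ).mem_of_ne_empty ⟨h3.1, h3.2.le⟩ h5))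

theorem eq_singleton_of_length {d : ℝ → PointLabel 𝓜} {l r : ℝ} {x : 𝓜} {W}
    (hW : IsLevel d l r W) (hl : W.length = 1) (hx : ∀ θ, d θ = .empty ∨ d θ = .edge x) :
    W = [.edge x] := by
  obtain ⟨w, rfl⟩ := List.length_eq_one_iff.1 hl
  obtain ⟨h1, θ, -, h2⟩ := hW.mem (List.mem_singleton_self w)
  rcases hx θ with h3 | h3
  · exact (h1.ne_empty (h2.symm.trans h3)).elim
  · rw [← h2, h3]

theorem isSouth_of_label {y : ℝ} (h1 : -(π / 2) < y) (h2 : y < π / 2)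
    (h : ∀ φ, -(π / 2) < φ → φ ≤ y → ∀ θ,
      chart T.label θ φ = .empty ∨ chart T.label θ φ = .edge α) : T.IsSouth y := by
  refine ⟨h1, h2, fun φ h3 h4 θ hθ => ?_⟩
  obtain ⟨a, ha⟩ := T.exists_isSouth
  have h5 := lt_min ha.gt h3
  have hD := T.isCylDiagram h5 (h4.trans_lt h2)
  have hle := min_le_right a φ
  obtain ⟨W, hW⟩ := hD.exists_window ⟨hle, le_rfl⟩ hθ
  obtain ⟨ϑ, -, hϑ⟩ := hD.exists_empty ⟨le_rfl, hle⟩ 0 one_pos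
  have h6 := hD.window_length (fun x hx θ => ?_) (ha.window _ h5 (min_le_left _ _) _ hϑ) rfl φ
    ⟨hle, le_rfl⟩ θ W hW
  · rwa [← eq_singleton_of_length hW h6 (h φ h3 h4)]
  · exact (h x (h5.trans_le hx.1) (hx.2.trans h4) θ).imp_right fun h => ⟨_, h⟩

theorem isNorth_of_label {y : ℝ} (h1 : -(π / 2) < y) (h2 : y < π / 2)
    (h : ∀ φ, y ≤ φ → φ < π / 2 → ∀ θ,
      chart T.label θ φ = .empty ∨ chart T.label θ φ = .edge (dual α)) : T.IsNorth y := by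
  refine ⟨h1, h2, fun φ h3 h4 θ hθ => ?_⟩
  obtain ⟨b, hb⟩ := T.exists_isNorth
  have h5 := max_lt hb.lt h4
  have hD := T.isCylDiagram (h1.trans_le h3) h5
  have hle := le_max_right b φ
  obtain ⟨W, hW⟩ := hD.exists_window ⟨le_rfl, hle⟩ hθ
  obtain ⟨ϑ, -, hϑ⟩ := hD.exists_empty ⟨hle, le_rfl⟩ 0 one_pos
  have h6 := hD.window_length (fun x hx θ => ?_) hW rfl _
    ⟨hle, le_rfl⟩ _ _ (hb.window _ (le_max_left _ _) h5 _ hϑ)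
  · rwa [← eq_singleton_of_length hW h6.symm (h φ h3 h4)]
  · exact (h x (h3.trans hx.1) (hx.2.trans_lt h5) θ).imp_right fun h => ⟨_, h⟩

variable {τ : Type*} [TopologicalSpace τ] {Ts : τ → StringNet α} {t0 : τ} {Y : τ × S2 → S2}
  (hY : Continuous Y) (hY0 : ∀ p, Y (t0, p) = p) (hinj : ∀ t p p', Y (t, p) = Y (t, p') → p = p')
  (hT : ∀ t p, (Ts t).label p = (Ts t0).label (Y (t, p)))

theorem sin_le_sin_iff {φ y : ℝ} (h1 : -(π / 2) ≤ φ) (h2 : φ ≤ π / 2)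
    (h3 : -(π / 2) ≤ y) (h4 : y ≤ π / 2) : sin φ ≤ sin y ↔ φ ≤ y :=
  strictMonoOn_sin.le_iff_le ⟨h1, h2⟩ ⟨h3, h4⟩

include hY hY0 in
theorem eventually_height {s : Set ℝ} (hs : IsClosed s) {s' : Set ℝ} (hs' : IsOpen s')
    (hss : s ⊆ s') : ∀ᶠ t in 𝓝 t0, ∀ p : S2, p.1 0 ∈ s → (Y (t, p)).1 0 ∈ s' := by
  have hK : IsCompact {p : S2 | p.1 0 ∈ s} := (hs.preimage continuous_height).isCompact
  refine hK.eventually_forall_of_forall_eventually fun p hp => ?_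
  have h1 : Tendsto (fun q : τ × S2 => (Y q).1 0) (𝓝 (t0, p)) (𝓝 (p.1 0)) := by
    refine (continuous_height.comp hY).tendsto' _ _ ?_
    simp only [Function.comp, hY0]
  exact h1.eventually_mem (hs'.mem_nhds (hss hp))

include hY hY0 hinj hT

theorem eventually_isSouth : ∃ y, ∀ᶠ t in 𝓝 t0, (Ts t).IsSouth y := by
  obtain ⟨a, ha⟩ := (Ts t0).exists_isSouth
  have hpi := pi_pos
  have h1 := ha.gt
  have h2 := ha.lt
  obtain ⟨y, hy1, hy2⟩ := exists_between h1
  refine ⟨y, ?_⟩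
  filter_upwards [eventually_height hY hY0 (isClosed_Iic (a := sin y))
    (isOpen_Iio (a := sin a)) fun z hz => lt_of_le_of_lt hz
      (sin_lt_sin_of_lt_of_le_pi_div_two hy1.le h2.le hy2)] with t ht
  have hsouth : Y (t, southPole) = southPole := by
    have h3 : (Ts t0).label (Y (t, southPole)) = .singular := by rw [← hT, (Ts t).south]
    refine (eq_pole_of_singular h3).resolve_right fun h4 => ?_
    have h5 := ht southPole (by
      rw [southPole, pt_apply_zero]
      exact (sin_le_sin_iff le_rfl (by linarith) hy1.le (by linarith)).2 hy1.le)
    rw [h4, northPole, pt_apply_zero, sin_pi_div_two] at h5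
    exact absurd h5 (not_lt.2 (sin_le_one a))
  refine isSouth_of_label hy1 (hy2.trans h2) fun φ h3 h4 θ => ?_
  have h5 := ht (pt θ φ) (by
    rw [pt_apply_zero]
    exact (sin_le_sin_iff h3.le (by linarith) hy1.le (by linarith)).2 h4)
  have h6 : Y (t, pt θ φ) ≠ southPole := fun h7 => by
    have h8 := hinj t _ _ (h7.trans hsouth.symm)
    have h9 := congrArg (fun p : S2 => p.1 0) h8
    simp only [southPole, pt_apply_zero] at h9
    exact absurd h9 (sin_lt_sin_of_lt_of_le_pi_div_two le_rfl (by linarith) h3).ne'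
  obtain ⟨θ', φ', h7, h8, h9⟩ := exists_pt (Y (t, pt θ φ))
  rw [h9, pt_apply_zero] at h5
  have h10 : -(π / 2) < φ' := lt_of_le_of_ne h7 fun h => h6 (by
    rw [h9, ← h, pt_neg_pi_div_two])
  have h11 := ha.label (θ := θ') h10 ((sin_le_sin_iff h7 h8 h1.le h2.le).1 (le_of_lt h5))
  rwa [chart, hT, h9]

theorem eventually_isNorth : ∃ y, ∀ᶠ t in 𝓝 t0, (Ts t).IsNorth y := by
  obtain ⟨b, hb⟩ := (Ts t0).exists_isNorth
  have hpi := pi_pos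
  have h1 := hb.gt
  have h2 := hb.lt
  obtain ⟨y, hy1, hy2⟩ := exists_between h2
  refine ⟨y, ?_⟩
  filter_upwards [eventually_height hY hY0 (isClosed_Ici (a := sin y))
    (isOpen_Ioi (a := sin b)) fun z hz => lt_of_lt_of_le
      (sin_lt_sin_of_lt_of_le_pi_div_two h1.le hy2.le hy1) hz] with t ht
  have hnorth : Y (t, northPole) = northPole := by
    have h3 : (Ts t0).label (Y (t, northPole)) = .singular := by rw [← hT, (Ts t).north]
    refine (eq_pole_of_singular h3).resolve_left fun h4 => ?_
    have h5 := ht northPole (by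
      rw [northPole, pt_apply_zero]
      exact (sin_le_sin_iff (by linarith) hy2.le (by linarith) le_rfl).2 hy2.le)
    rw [h4, southPole, pt_apply_zero, sin_neg, sin_pi_div_two] at h5
    exact absurd h5 (not_lt.2 (neg_one_le_sin b))
  refine isNorth_of_label (h1.trans hy1) hy2 fun φ h3 h4 θ => ?_
  have h5 := ht (pt θ φ) (by
    rw [pt_apply_zero]
    exact (sin_le_sin_iff (by linarith) hy2.le (by linarith) h4.le).2 h3)
  have h6 : Y (t, pt θ φ) ≠ northPole := fun h7 => by
    have h8 := hinj t _ _ (h7.trans hnorth.symm)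
    have h9 := congrArg (fun p : S2 => p.1 0) h8
    simp only [northPole, pt_apply_zero] at h9
    exact absurd h9 (sin_lt_sin_of_lt_of_le_pi_div_two (by linarith) le_rfl h4).ne
  obtain ⟨θ', φ', h7, h8, h9⟩ := exists_pt (Y (t, pt θ φ))
  rw [h9, pt_apply_zero] at h5
  have h10 : φ' < π / 2 := lt_of_le_of_ne h8 fun h => h6 (by
    rw [h9, h, pt_pi_div_two])
  have h11 := hb.label (θ := θ') ((sin_le_sin_iff h1.le h2.le h7 h8).1 (le_of_lt h5)) h10
  rwa [chart, hT, h9]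

end StringNet

open VState

namespace TwistedIntegral

variable {I : TwistedIntegral k H} {a0 : (tens [α]).carrier} {T T' : StringNet α}

theorem Fits.botAt_of_reaches (hI : I.Fits α a0) {a y θ0 θ : ℝ} {f : VState k H} (ha : T.IsSouth a)
    (hay : a ≤ y) (hy : y < π / 2) (h0 : chart T.label θ0 a = .empty)
    (hθ : chart T.label θ y = .empty)
    (hf : Reaches I.bot (chart T.label) θ0 a ⟨[α], a0⟩ θ y f) : I.BotAt a0 T θ y f := by
  obtain ⟨S, h1, h2, rfl⟩ := hf
  refine BotAt.of_section (θ := θ0) h1 hay hy ?_ hθ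
  rw [h2]
  exact hI.botAt_south ha h0

theorem Fits.topAt_of_reaches (hI : I.Fits α a0) {b y θ0 θ : ℝ} {e : VState k H}
    {c : (tens [dual α]).carrier} (hb : T.IsNorth b)
    (hy : -(π / 2) < y) (hyb : y ≤ b) (h0 : chart T.label θ0 y = .empty)
    (hθ : chart T.label θ b = .empty)
    (hf : Reaches I.top (chart T.label) θ0 y e θ b ⟨[dual α], c⟩) : I.TopAt T θ0 y e c := by
  obtain ⟨S, h1, rfl, h2⟩ := hf
  refine TopAt.of_section (θ' := θ) hy h1 hyb ?_ h0
  rw [h2]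
  exact hI.topAt_north hb hθ c

theorem Fits.eventually_fVal (hI : I.Fits α a0) {τ : Type*} [TopologicalSpace τ]
    {Ts : τ → StringNet α} {t0 : τ} {Y Z : τ × S2 → S2} (hY : Continuous Y) (hZ : Continuous Z)
    (hYZ : ∀ t p, Y (t, Z (t, p)) = p) (hZY : ∀ t p, Z (t, Y (t, p)) = p)
    (hZ0 : ∀ p, Z (t0, p) = p) (hT : ∀ t p, (Ts t).label p = (Ts t0).label (Y (t, p)))
    (hadm : (Ts t0).Admissible Projective) : ∃ c, ∀ᶠ t in 𝓝 t0, I.FVal a0 (Ts t) c := by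
  have hY0 : ∀ p, Y (t0, p) = p := fun p => by conv_lhs => rw [← hZ0 p, hYZ]
  have hinj : ∀ t p p', Y (t, p) = Y (t, p') → p = p' := fun t p p' h => by
    rw [← hZY t p, h, hZY]
  have hD : IsDeformation (fun t => chart (Ts t).label) t0 (Ioo (-(π / 2)) (π / 2)) :=
    isDeformation_chart (fun t θ φ hφ => (Ts t).isLocallyProgressive hφ.1 hφ.2) hY hZ hYZ hZY hZ0 hT
  have hempty : ∀ {θ φ : ℝ}, φ ∈ Ioo (-(π / 2)) (π / 2) →
      chart (Ts t0).label θ φ = .empty → ∀ᶠ t in 𝓝 t0, chart (Ts t).label θ φ = .empty :=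
    fun {θ φ} hφ h => (show Tendsto (fun t => ((t, (θ, φ)) : τ × ℝ × ℝ)) (𝓝 t0) (𝓝 (t0, (θ, φ))) from
      (Continuous.prodMk_left _).tendsto _).eventually (hD.empty (z := (θ, φ)) hφ h)
  obtain ⟨a, ha⟩ := StringNet.eventually_isSouth hY hY0 hinj hT
  obtain ⟨b, hb⟩ := StringNet.eventually_isNorth hY hY0 hinj hT
  obtain ⟨p, x, hpx, hx⟩ := hadm
  obtain ⟨θx, φ, h1, h2, rfl⟩ := StringNet.exists_pt_of_edge hpx
  obtain ⟨θ1, W, hW, hxW⟩ := (Ts t0).exists_window_of_edge h1 h2 hpx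
  obtain ⟨W', hW'⟩ := ((Ts t0).isCylDiagram h1 h2).exists_window_movie ⟨le_rfl, le_rfl⟩ hW.left_empty
  obtain rfl : W' = W := hW'.level.unique hW
  have hagt := ha.self_of_nhds.gt
  obtain ⟨a', ha1, ha2⟩ := exists_between (lt_min hagt h1)
  have ha3 := ha2.trans_le (min_le_left _ _)
  have ha4 := ha2.trans_le (min_le_right _ _)
  replace ha : ∀ᶠ t in 𝓝 t0, (Ts t).IsSouth a' := ha.mono fun t ht => ht.mono ha1 ha3.le
  have hcyl : ∀ t, IsCylDiagram (chart (Ts t).label) a' φ := fun t => (Ts t).isCylDiagram ha1 h2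
  obtain ⟨θa, -, hθa⟩ := (hcyl t0).exists_empty ⟨le_rfl, ha4.le⟩ 0 one_pos
  have hwa := ha.self_of_nhds.window a' ha1 le_rfl θa hθa
  obtain ⟨c0, hc1, hc2, hc3⟩ := exists_Ico_of_nhdsLT ha4 hW'.below
  have hreach := hD.eventually_reaches (γ := I.bot) hcyl
    (fun x hx => ⟨ha1.trans_le hx.1, hx.2.trans_lt h2⟩) (X := [α]) hwa (e := ⟨[α], a0⟩) rfl c0
    ⟨hc1.le, hc2⟩
  obtain ⟨y, ⟨θ, Y', f, hy1, hy2⟩, hy3⟩ := (hreach.and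
    (show ∀ᶠ y in 𝓝[>] c0, y ∈ Ioo c0 φ from Ioo_mem_nhdsGT hc2)).exists
  have hya : a' < y := hc1.trans hy3.1
  have hygt := ha1.trans hya
  have hylt := hy3.2.trans h2
  have hbot : ∀ᶠ t in 𝓝 t0, I.BotAt a0 (Ts t) θ y f := by
    filter_upwards [ha, hempty ⟨ha1, ha4.trans h2⟩ hθa, hempty ⟨hygt, hylt⟩ hy1.left_empty, hy2]
      with t k1 k2 k3 k4
    exact hI.botAt_of_reaches k1 hya.le hylt k2 k3 k4
  have hf1 : f.1 = Y' := by
    obtain ⟨S, g1, -, g3⟩ := hy2.self_of_nhds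
    rw [← g3, (g1.loc y ⟨hya.le, le_rfl⟩ _ _ hy1).1, insW_edges]
  obtain ⟨X, v⟩ := f
  obtain rfl : X = Y' := hf1
  have hxX : x ∈ X := by
    obtain ⟨-, σ, -, h3⟩ := (hc3 y ⟨hy3.1.le, hy3.2⟩).mem (w := .edge x) (List.mem_map.2 ⟨x, hxW, rfl⟩)
    obtain ⟨σ', h4, h5⟩ := ((hcyl t0).periodic y).exists_mem θ σ
    have h6 := hy1.mem_of_ne_empty (θ := σ') ⟨h4.1, h4.2.le⟩ (by rw [h5, h3]; simp)
    rw [h5, h3] at h6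
    obtain ⟨x', h7, h8⟩ := List.mem_map.1 h6
    cases h8
    exact h7
  have hproj := I.projective_tens hxX hx
  obtain ⟨s, hs⟩ := I.socle hproj v (hI.botAt_inv hylt hbot.self_of_nhds)
  have hblt := hb.self_of_nhds.lt
  obtain ⟨b', hb1, hb2⟩ := exists_between (max_lt hblt hylt)
  have hcyl' : ∀ t, IsCylDiagram (chart (Ts t).label) y b' := fun t => (Ts t).isCylDiagram hygt hb2
  have hreach' := hD.eventually_reaches (γ := I.top) hcyl'
    (fun x hx => ⟨hygt.trans_le hx.1, hx.2.trans_lt hb2⟩) hy1 (e := ⟨X, s⟩) rfl (max b y)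
    ⟨le_max_right _ _, hb1⟩
  obtain ⟨z, ⟨θ', Z', g, hz1, hz2⟩, hz3⟩ := (hreach'.and
    (show ∀ᶠ z in 𝓝[>] (max b y), z ∈ Ioo (max b y) b' from Ioo_mem_nhdsGT hb1)).exists
  have hbz := (le_max_left b y).trans hz3.1.le
  have hyz := (le_max_right b y).trans hz3.1.le
  have hzlt := hz3.2.trans hb2
  have hg1 : g.1 = [dual α] := by
    obtain ⟨S, g1, -, g3⟩ := hz2.self_of_nhds
    rw [← g3, (g1.loc z ⟨hyz, le_rfl⟩ _ _ (hb.self_of_nhds.window z hbz hzlt θ' hz1.left_empty)).1]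
    rfl
  obtain ⟨X', c⟩ := g
  obtain rfl : X' = [dual α] := hg1
  refine ⟨c, ?_⟩
  filter_upwards [hbot, hb, hempty ⟨hygt.trans_le hyz, hzlt⟩ hz1.left_empty, hz2,
    hempty ⟨hygt, hylt⟩ hy1.left_empty] with t k1 k2 k3 k4 k5
  exact ⟨θ, y, X, s, v, hygt, hylt, k1, hproj, hs,
    hI.topAt_of_reaches (k2.mono hzlt hbz) hygt hyz k5 k3 k4⟩

theorem _root_.TwPiv.StringNet.ext_label {T T' : StringNet α} (h : T.label = T'.label) : T = T' := by
  cases T; cases T'; cases h; rfl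

theorem Fits.isotopic (hI : I.Fits α a0) (h : Isotopic T T') (hT : T.Admissible Projective) {c}
    (hc : I.FVal a0 T c) : I.FVal a0 T' c := by
  obtain ⟨Φ, Ts, h1, h2, h3, h4, rfl⟩ := h
  obtain ⟨Ψ, h5, h6, h7⟩ := exists_continuous_inverse h1 h2
  have h0 : Ts 0 = T := StringNet.ext_label (funext fun p => by rw [← h4 0 p, h3])
  have hadm : ∀ t, (Ts t).Admissible Projective := fun t => by
    obtain ⟨p, x, hp, hx⟩ := hT
    exact ⟨Φ t p, x, (h4 t p).trans hp, hx⟩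
  have hloc : ∀ t0, ∃ c, ∀ᶠ t in 𝓝 t0, I.FVal a0 (Ts t) c := fun t0 => by
    have hc1 : Continuous fun q : unitInterval × S2 => Φ t0 (Ψ q.1 q.2) :=
      h1.comp (continuous_const.prodMk h5)
    have hc2 : Continuous fun q : unitInterval × S2 => Φ q.1 (Ψ t0 q.2) :=
      h1.comp (continuous_fst.prodMk (h5.comp (continuous_const.prodMk continuous_snd)))
    refine hI.eventually_fVal hc1 hc2 (fun t p => ?_) (fun t p => ?_) (fun p => h7 t0 p)
      (fun t p => ?_) (hadm t0)
    · dsimp only; rw [h6, h7]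
    · dsimp only; rw [h6, h7]
    · dsimp only; rw [h4, ← h4 t, h7]
  choose F hF using hloc
  have hFc : IsLocallyConstant F := (IsLocallyConstant.iff_eventually_eq F).2 fun t0 => by
    filter_upwards [hF t0] with t ht
    exact hI.fVal_unique (hF t).self_of_nhds ht
  have h8 : F 0 = F 1 := hFc.apply_eq_of_preconnectedSpace 0 1
  have h9 := (hF 0).self_of_nhds
  rw [h0] at h9
  rw [hI.fVal_unique hc h9, h8]
  exact (hF 1).self_of_nhds

end TwistedIntegral

namespace TwistedIntegral

variable {I : TwistedIntegral k H} {a0 : (tens [α]).carrier}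

/-- The value of the invariant on an admissible string net. -/
def Fits.value (hI : I.Fits α a0) (T : {T : StringNet α // T.Admissible Projective}) :
    (tens [dual α]).carrier :=
  (hI.exists_fVal T.2).choose

theorem Fits.fVal_value (hI : I.Fits α a0) (T : {T : StringNet α // T.Admissible Projective}) :
    I.FVal a0 T.1 (hI.value T) :=
  (hI.exists_fVal T.2).choose_spec

theorem Fits.relations_le_ker (hI : I.Fits α a0) {P : TwistedPivotalStructure α}
    (hP : IsSwapBy P I.bot.val) {β : H} (hPβ : IsSwapBy P β) (hβ : β * I.top.val = 1)
    (hne : α ≠ dual α) (hne' : dual α ≠ dual (dual α)) :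
    relations k P (fun V : 𝓜 => Projective V) ≤
      LinearMap.ker (Finsupp.linearCombination k hI.value) := by
  refine Submodule.span_le.2 ?_
  rintro c (hc | ⟨T, T', h, rfl⟩)
  · obtain ⟨L, R, a, b, xs, ys, f, h1, h2, h3, h4, h5, h6, h7, h8⟩ := hc
    rw [SetLike.mem_coe, LinearMap.mem_ker, Finsupp.linearCombination_apply, Finsupp.sum]
    rcases c.support.eq_empty_or_nonempty with h0 | ⟨T0, h0⟩
    · rw [h0, Finset.sum_empty]
    obtain ⟨p, hp, x, hpx, hx⟩ := h7 T0 h0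
    have : Nonempty c.support := ⟨⟨T0, h0⟩⟩
    rw [← Finset.sum_coe_sort]
    refine hI.skein (ι := c.support) (l := fun i => c i.1) (T := fun i => i.1.1) (f := fun i => f i.1) h1 h2 h3
      h4 (fun i => h5 i.1 i.2) (fun i j => h6 i.1 i.2 j.1 j.2) hp hx (fun i => ?_) ?_
      (fun i => hI.fVal_value i.1)
    · rw [h6 i.1 i.2 T0 h0 p hp, hpx]
    · exact (Finset.sum_coe_sort c.support fun i => c i • f i).trans h8
  · rw [SetLike.mem_coe, LinearMap.mem_ker, map_sub, Finsupp.linearCombination_single,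
      Finsupp.linearCombination_single, one_smul, one_smul, sub_eq_zero]
    refine hI.fVal_unique ?_ (hI.fVal_value T')
    rcases h with h | h | h
    · exact hI.isotopic h T.2 (hI.fVal_value T)
    · exact hI.slideZero hP hne h T.2 (hI.fVal_value T)
    · exact hI.slideTwo hPβ hβ hne' h T.2 (hI.fVal_value T)

theorem Fits.nontrivial_skein (hI : I.Fits α a0) {P : TwistedPivotalStructure α}
    (hP : IsSwapBy P I.bot.val) {β : H} (hPβ : IsSwapBy P β) (hβ : β * I.top.val = 1)
    (hne : α ≠ dual α) (hne' : dual α ≠ dual (dual α)) {T : StringNet α}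
    (hT : T.Admissible Projective) {c : (tens [dual α]).carrier} (hc : I.FVal a0 T c) (h0 : c ≠ 0) :
    Nontrivial (SphereSkein k P (fun V : 𝓜 => Projective V)) := by
  refine ⟨Submodule.Quotient.mk (Finsupp.single ⟨T, hT⟩ 1), 0, fun h => h0 ?_⟩
  have h1 := hI.relations_le_ker hP hPβ hβ hne hne' ((Submodule.Quotient.mk_eq_zero _).1 h)
  rw [LinearMap.mem_ker, Finsupp.linearCombination_single, one_smul] at h1
  rw [hI.fVal_unique hc (hI.fVal_value ⟨T, hT⟩), h1]

end TwistedIntegral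

theorem eq_of_cos_eq_one {θ θ' : ℝ} (h : cos θ = 1) (h' : cos θ' = 1)
    (hlt : |θ' - θ| < 2 * π) : θ' = θ := by
  obtain ⟨n, rfl⟩ := (cos_eq_one_iff _).1 h
  obtain ⟨m, rfl⟩ := (cos_eq_one_iff _).1 h'
  rw [← sub_mul, abs_mul, abs_of_pos two_pi_pos, mul_lt_iff_lt_one_left two_pi_pos,
    ← Int.cast_sub, ← Int.cast_abs, ← Int.cast_one, Int.cast_lt, Int.abs_lt_one_iff, sub_eq_zero] at hlt
  rw [hlt]

section Meridian

variable {α β P : C}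
  (f : tens [α] ⟶ tens [P]) (g : tens [P] ⟶ tens [β])

open Classical in
/-- The labels on a meridian with two vertices, at the latitudes `-1/2` and `1/2`. -/
def meridianLabel (φ : ℝ) : PointLabel C :=
  if φ < -(1 / 2) then .edge α else if φ = -(1 / 2) then .vertex [α] [P] f else
    if φ < 1 / 2 then .edge P else if φ = 1 / 2 then .vertex [P] [β] g else .edge β

open Classical in
/-- The labelled sphere that shows one meridian with two vertices. -/
def meridianNet (p : S2) : PointLabel C :=
  if p = southPole ∨ p = northPole then .singular
  else if p.1 2 = 0 ∧ 0 < p.1 1 then meridianLabel f g (arcsin (p.1 0)) else .empty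

theorem chart_meridianNet {θ φ : ℝ} (h1 : -(π / 2) < φ) (h2 : φ < π / 2) :
    (cos θ = 1 → chart (meridianNet f g) θ φ = meridianLabel f g φ) ∧
      (cos θ ≠ 1 → chart (meridianNet f g) θ φ = .empty) := by
  have hc := cos_pos_of_mem_Ioo ⟨h1, h2⟩
  have hpole : ¬(pt θ φ = southPole ∨ pt θ φ = northPole) := by
    rintro (h | h)
    · have := congrArg (fun p : S2 => p.1 0) h
      simp only [southPole, pt_apply_zero] at this
      exact h1.ne (injOn_sin ⟨le_rfl, by linarith⟩ ⟨h1.le, h2.le⟩ this.symm)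
    · have := congrArg (fun p : S2 => p.1 0) h
      simp only [northPole, pt_apply_zero] at this
      exact h2.ne (injOn_sin ⟨h1.le, h2.le⟩ ⟨by linarith, le_rfl⟩ this)
  have hiff : ((pt θ φ).1 2 = 0 ∧ 0 < (pt θ φ).1 1) ↔ cos θ = 1 := by
    rw [pt_apply_one, pt_apply_two, mul_eq_zero, or_iff_right hc.ne', mul_pos_iff_of_pos_left hc]
    constructor
    · rintro ⟨h3, h4⟩
      exact (sin_eq_zero_iff_cos_eq.1 h3).resolve_right fun h => by rw [h] at h4; linarith
    · intro h
      exact ⟨sin_eq_zero_iff_cos_eq.2 (.inl h), by rw [h]; norm_num⟩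
  rw [chart, meridianNet, if_neg hpole]
  constructor
  · intro h
    rw [if_pos (hiff.2 h), pt_apply_zero, arcsin_sin h1.le h2.le]
  · intro h
    rw [if_neg fun h' => h (hiff.1 h')]

variable {f g}

theorem isStrandFamily_meridian {θ l r : ℝ} (hθ : cos θ = 1) (hl : l < θ) (hr : θ < r)
    (hl' : θ - l < 2 * π) (hr' : r - θ < 2 * π) {s : Set ℝ} {x : C}
    (hs : ∀ φ ∈ s, -(π / 2) < φ ∧ φ < π / 2 ∧ meridianLabel f g φ = .edge x) :
    IsStrandFamily (chart (meridianNet f g)) (fun _ => l) (fun _ => r) s [x] (fun _ _ => θ) := by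
  refine ⟨fun _ => contDiffOn_const, fun φ hφ => ?_⟩
  obtain ⟨h1, h2, h3⟩ := hs φ hφ
  refine ⟨Subsingleton.strictMono (α := Fin 1) _, fun i => ⟨hl, hr, ?_⟩, fun θ' hθ' hne => ?_⟩
  · rw [(chart_meridianNet f g h1 h2).1 hθ, h3, show i = 0 from Subsingleton.elim (α := Fin 1) _ _]
    rfl
  · refine (chart_meridianNet f g h1 h2).2 fun h => hne 0 (eq_of_cos_eq_one hθ h ?_)
    rw [abs_lt]
    exact ⟨by linarith [hθ'.1], by linarith [hθ'.2]⟩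

theorem isCorolla_meridian {θ l r a b φ0 : ℝ} (hθ : cos θ = 1) (hl : l < θ) (hr : θ < r)
    (hl' : θ - l < 2 * π) (hr' : r - θ < 2 * π) (ha : -(π / 2) < a)
    (hb : b < π / 2) (ha' : a < φ0) (hb' : φ0 < b) {x y : C} {h : tens [x] ⟶ tens [y]}
    (h0 : meridianLabel f g φ0 = .vertex [x] [y] h)
    (h1 : ∀ φ, a ≤ φ → φ < φ0 → meridianLabel f g φ = .edge x)
    (h2 : ∀ φ, φ0 < φ → φ ≤ b → meridianLabel f g φ = .edge y) :
    IsCorolla (chart (meridianNet f g)) (fun _ => l) (fun _ => r) a b [x] [y] h := by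
  have h3 := fun θ => chart_meridianNet f g (θ := θ) (ha.trans ha') (hb'.trans hb)
  refine ⟨θ, φ0, ha', hb', hl, hr, ((h3 θ).1 hθ).trans h0, fun θ' hθ' hne => ?_,
    ⟨fun _ _ => θ, isStrandFamily_meridian hθ hl hr hl' hr' fun φ hφ => ?_, fun _ => tendsto_const_nhds⟩,
    ⟨fun _ _ => θ, isStrandFamily_meridian hθ hl hr hl' hr' fun φ hφ => ?_, fun _ => tendsto_const_nhds⟩⟩
  · refine (h3 θ').2 fun h => hne (eq_of_cos_eq_one hθ h ?_)
    rw [abs_lt]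
    exact ⟨by linarith [hθ'.1], by linarith [hθ'.2]⟩
  · exact ⟨ha.trans_le hφ.1, by linarith [hφ.2], h1 φ hφ.1 hφ.2⟩
  · exact ⟨by linarith [hφ.1], hφ.2.trans_lt hb, h2 φ hφ.1 hφ.2⟩

variable (f g)

theorem meridianLabel_south {φ : ℝ} (h : φ < -(1 / 2)) : meridianLabel f g φ = .edge α := if_pos h

theorem meridianLabel_first : meridianLabel f g (-(1 / 2)) = .vertex [α] [P] f := by
  rw [meridianLabel, if_neg (lt_irrefl _), if_pos rfl]

theorem meridianLabel_middle {φ : ℝ} (h : -(1 / 2) < φ) (h' : φ < 1 / 2) :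
    meridianLabel f g φ = .edge P := by
  rw [meridianLabel, if_neg h.not_gt, if_neg h.ne', if_pos h']

theorem meridianLabel_second : meridianLabel f g (1 / 2) = .vertex [P] [β] g := by
  rw [meridianLabel, if_neg (by norm_num), if_neg (by norm_num), if_neg (lt_irrefl _), if_pos rfl]

theorem meridianLabel_north {φ : ℝ} (h : 1 / 2 < φ) : meridianLabel f g φ = .edge β := by
  rw [meridianLabel, if_neg (by linarith), if_neg (by linarith), if_neg (by linarith),
    if_neg (by linarith)]

theorem isCorolla_first {θ l r a b : ℝ} (hθ : cos θ = 1) (hl : l < θ) (hr : θ < r)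
    (hl' : θ - l < 2 * π) (hr' : r - θ < 2 * π) (ha : -(π / 2) < a)
    (ha' : a < -(1 / 2)) (hb : -(1 / 2) < b) (hb' : b < 1 / 2) :
    IsCorolla (chart (meridianNet f g)) (fun _ => l) (fun _ => r) a b [α] [P] f :=
  isCorolla_meridian hθ hl hr hl' hr' ha (by linarith [pi_gt_three]) ha' hb
    (meridianLabel_first f g) (fun φ _ h => meridianLabel_south f g h)
    fun φ h h' => meridianLabel_middle f g h (h'.trans_lt hb')

theorem isCorolla_second {θ l r a b : ℝ} (hθ : cos θ = 1) (hl : l < θ) (hr : θ < r)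
    (hl' : θ - l < 2 * π) (hr' : r - θ < 2 * π) (ha : -(1 / 2) < a)
    (ha' : a < 1 / 2) (hb : 1 / 2 < b) (hb' : b < π / 2) :
    IsCorolla (chart (meridianNet f g)) (fun _ => l) (fun _ => r) a b [P] [β] g :=
  isCorolla_meridian hθ hl hr hl' hr' (by linarith [pi_gt_three]) hb' ha' hb
    (meridianLabel_second f g) (fun φ h h' => meridianLabel_middle f g (ha.trans_le h) h')
    fun φ h _ => meridianLabel_north f g h

theorem meridianNet_locally_progressive {θ φ : ℝ} (h1 : -(π / 2) < φ) (h2 : φ < π / 2) :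
    ∃ l r a b : ℝ, l < θ ∧ θ < r ∧ -(π / 2) < a ∧ a < φ ∧ φ < b ∧ b < π / 2 ∧
      ((∃ xs u, IsStrandFamily (chart (meridianNet f g)) (fun _ => l) (fun _ => r) (Set.Icc a b) xs u) ∨
        ∃ xs ys h, IsCorolla (chart (meridianNet f g)) (fun _ => l) (fun _ => r) a b xs ys h) := by
  have hpi := pi_gt_three
  by_cases hθ : cos θ = 1
  · have strand : ∀ {c d : ℝ} {x : C}, c < φ → φ < d → (∀ ψ, c < ψ → ψ < d →
        meridianLabel f g ψ = .edge x) → ∃ l r a b : ℝ, l < θ ∧ θ < r ∧ -(π / 2) < a ∧ a < φ ∧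
        φ < b ∧ b < π / 2 ∧ ((∃ xs u, IsStrandFamily (chart (meridianNet f g)) (fun _ => l)
          (fun _ => r) (Set.Icc a b) xs u) ∨
        ∃ xs ys h, IsCorolla (chart (meridianNet f g)) (fun _ => l) (fun _ => r) a b xs ys h) := by
      intro c d x h3 h4 h5
      obtain ⟨a, ha1, ha2⟩ := exists_between (max_lt h1 h3)
      obtain ⟨b, hb1, hb2⟩ := exists_between (lt_min h2 h4)
      have h6 := (le_max_left _ _).trans_lt ha1
      have h7 := (le_max_right _ _).trans_lt ha1
      have h8 := hb2.trans_le (min_le_left _ _)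
      have h9 := hb2.trans_le (min_le_right _ _)
      exact ⟨θ - 1, θ + 1, a, b, by linarith, by linarith, h6, ha2, hb1, h8, .inl ⟨[x], _,
        isStrandFamily_meridian hθ (by linarith) (by linarith) (by linarith) (by linarith)
        fun ψ hψ => ⟨h6.trans_le hψ.1, hψ.2.trans_lt h8, h5 ψ (h7.trans_le hψ.1) (hψ.2.trans_lt h9)⟩⟩⟩
    rcases lt_trichotomy φ (-(1 / 2)) with h3 | rfl | h3
    · exact strand (c := φ - 1) (by linarith) h3 fun ψ _ h => meridianLabel_south f g h
    · exact ⟨θ - 1, θ + 1, -1, 0, by linarith, by linarith, by linarith, by norm_num, by norm_num,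
        by linarith, .inr ⟨_, _, _, isCorolla_first f g hθ (by linarith) (by linarith) (by linarith)
          (by linarith) (by linarith) (by norm_num) (by norm_num) (by norm_num)⟩⟩
    rcases lt_trichotomy φ (1 / 2) with h4 | rfl | h4
    · exact strand h3 h4 fun ψ h h' => meridianLabel_middle f g h h'
    · exact ⟨θ - 1, θ + 1, 0, 1, by linarith, by linarith, by linarith, by norm_num, by norm_num,
        by linarith, .inr ⟨_, _, _, isCorolla_second f g hθ (by linarith) (by linarith) (by linarith)
          (by linarith) (by norm_num) (by norm_num) (by norm_num) (by linarith)⟩⟩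
    · exact strand (d := φ + 1) h4 (by linarith) fun ψ h _ => meridianLabel_north f g h
  · have hn : ∀ᶠ θ' in 𝓝 θ, cos θ' ≠ 1 :=
      continuous_cos.continuousAt.eventually_ne hθ
    obtain ⟨ε, hε, -, h3⟩ := exists_Icc_of_eventually hn one_pos
    obtain ⟨a, ha1, ha2⟩ := exists_between h1
    obtain ⟨b, hb1, hb2⟩ := exists_between h2
    refine ⟨θ - ε, θ + ε, a, b, by linarith, by linarith, ha1, ha2, hb1, hb2, .inl ⟨[], fun i => i.elim0,
      fun i => i.elim0, fun ψ hψ => ⟨fun i => i.elim0, fun i => i.elim0, fun θ' hθ' _ => ?_⟩⟩⟩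
    exact (chart_meridianNet f g (ha1.trans_le hψ.1) (hψ.2.trans_lt hb2)).2 (h3 _ hθ')

theorem isSingleStrand_meridian {s : Set ℝ} {x : C}
    (hs : ∀ φ ∈ s, -(π / 2) < φ ∧ φ < π / 2 ∧ meridianLabel f g φ = .edge x) :
    IsSingleStrand (meridianNet f g) s x (fun _ => 0) := fun φ hφ θ => by
  obtain ⟨h1, h2, h3⟩ := hs φ hφ
  have h4 : cos θ = 1 ↔ ∃ n : ℤ, θ = 0 + n * (2 * π) := by
    rw [cos_eq_one_iff]
    simp only [zero_add, eq_comm]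
  refine ⟨fun h => ((chart_meridianNet f g h1 h2).1 (h4.2 h)).trans h3, fun h =>
    (chart_meridianNet f g h1 h2).2 fun h' => ?_⟩
  obtain ⟨n, hn⟩ := h4.1 h'
  exact h n hn

/-- The string net that consists of a meridian with two vertices. -/
def meridian [RightRigidCategory C] (f : tens [α] ⟶ tens [P]) (g : tens [P] ⟶ tens [dual α]) :
    StringNet α where
  label := meridianNet f g
  south := if_pos (.inl rfl)
  north := if_pos (.inr rfl)
  local_progressive _ _ h1 h2 := meridianNet_locally_progressive f g h1 h2
  near_south := ⟨-1, fun _ => 0, by linarith [pi_gt_three], continuousOn_const,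
    isSingleStrand_meridian f g fun φ hφ => ⟨hφ.1, by linarith [pi_gt_three, hφ.2],
      meridianLabel_south f g (by linarith [hφ.2])⟩⟩
  near_north := ⟨1, fun _ => 0, by linarith [pi_gt_three], continuousOn_const,
    isSingleStrand_meridian f g fun φ hφ => ⟨by linarith [pi_gt_three, hφ.1], hφ.2,
      meridianLabel_north f g (by linarith [hφ.1])⟩⟩

end Meridian

variable {α P : FDMod k H}
  (f : tens [α] ⟶ tens [P]) (g : tens [P] ⟶ tens [dual α])

theorem meridian_admissible {I : 𝓜 → Prop} (hP : I P) : (meridian f g).Admissible I := by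
  have hpi := pi_gt_three
  refine ⟨pt 0 0, P, ?_, hP⟩
  exact ((chart_meridianNet f g (by linarith) (by linarith)).1 cos_zero).trans
    (meridianLabel_middle f g (by norm_num) (by norm_num))

open VState

theorem TwistedIntegral.Fits.fVal_meridian {I : TwistedIntegral k H} {a0 : (tens [α]).carrier} (hI : I.Fits α a0)
    (hP : Projective (tens [P])) {s : (tens [P]).carrier} (hs : (tens [P]).ρ I.Λ s = f.toLin a0) :
    I.FVal a0 (meridian f g) (g.toLin s) := by
  have hpi := pi_gt_three
  set T := meridian f g with hT
  have hempty : ∀ φ, -(π / 2) < φ → φ < π / 2 → chart T.label π φ = .empty :=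
    fun φ h1 h2 => (chart_meridianNet f g h1 h2).2 (by rw [cos_pi]; norm_num)
  have hsouth : T.IsSouth (-1) := by
    refine ⟨by linarith, by linarith, fun φ h1 h2 θ hθ => ?_⟩
    exact (isSingleStrand_meridian f g (s := Ioc (-(π / 2)) (-1)) fun φ hφ =>
      ⟨hφ.1, by linarith [hφ.2], meridianLabel_south f g (by linarith [hφ.2])⟩).window ⟨h1, h2⟩ hθ
  have hnorth : T.IsNorth 1 := by
    refine ⟨by linarith, by linarith, fun φ h1 h2 θ hθ => ?_⟩
    exact (isSingleStrand_meridian f g (s := Ico 1 (π / 2)) fun φ hφ =>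
      ⟨by linarith [hφ.1], hφ.2, meridianLabel_north f g (by linarith [hφ.1])⟩).window ⟨h1, h2⟩ hθ
  have hbox : ∀ {a b : ℝ}, a < b → IsBox (fun _ => π) (fun _ => π + 2 * π) a b :=
    fun h => ⟨h, continuousOn_const, continuousOn_const, fun _ _ => by linarith⟩
  obtain ⟨K, hK, hK1, hK2, -⟩ := (isCorolla_first f g (θ := 2 * π) (l := π)
    (r := π + 2 * π) (a := -1) (b := 0) cos_two_pi (by linarith) (by linarith)
    (by linarith) (by linarith) (by linarith) (by norm_num) (by norm_num) (by norm_num)).isSec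
    (hbox (by norm_num))
  obtain ⟨K', hK', hK1', hK2', hK3', -⟩ := (isCorolla_second f g (θ := 2 * π) (l := π)
    (r := π + 2 * π) (a := 0) (b := 1) cos_two_pi (by linarith) (by linarith)
    (by linarith) (by linarith) (by norm_num) (by norm_num) (by norm_num) (by linarith)).isSec
    (hbox (by norm_num))
  have h1 : I.BotAt a0 T π (-1) ⟨[α], a0⟩ :=
    hI.botAt_south hsouth (hempty _ (by linarith) (by linarith))
  obtain ⟨S, hS1, hS2, hS3⟩ := h1.extend (h₂ := 0) (by norm_num) (by linarith)
  have h2 := hS3 π 0 (by norm_num) le_rfl (hempty _ (by linarith) (by linarith))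
  have h3 := hS1.eq_app (T.isCylDiagram (by linarith) (by linarith)) (L := fun _ => π)
    continuousOn_const hK (z := a0) (by rw [hS2, hK1]; rfl) 0 ⟨by norm_num, le_rfl⟩
  rw [hK2] at h3
  rw [h3] at h2
  have hcyl : IsCylDiagram (chart T.label) 0 1 := T.isCylDiagram (by linarith) (by linarith)
  obtain ⟨S', hS1', hS2'⟩ := hcyl.exists_isCylSec I.top zero_le_one hK3' (e := ⟨[P], s⟩) rfl
  have h4 := hS1'.eq_app hcyl (L := fun _ => π) continuousOn_const hK' (z := s)
    (by rw [hS2', hK1']; rfl) 1 ⟨by norm_num, le_rfl⟩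
  rw [hK2'] at h4
  have h5 := TwistedIntegral.TopAt.of_section (I := I) (T := T) (θ := π) (θ' := π) (c := g.toLin s)
    (by linarith) hS1' zero_le_one (by
      rw [h4]
      exact hI.topAt_north hnorth (hempty _ (by linarith) (by linarith)) _)
    (hempty _ (by linarith) (by linarith))
  rw [hS2'] at h5
  exact ⟨π, 0, [P], s, f.toLin a0, by linarith, by linarith, h2, hP, hs, h5⟩

theorem dual_ext {V : 𝓜} {ξ η : (dual V).carrier} (h : ∀ v, pair V ξ v = pair V η v) :
    ξ = η :=
  lext h

/-- The pairing of a second right dual with `V`. -/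
def pairOf {V Y : 𝓜} (p : ExactPairing V Y) (ξ : Y.carrier) (v : V.carrier) : k :=
  (p.evaluation' : Y ⊗ V ⟶ 𝟙_ 𝓜).toLin (ξ ⊗ₜ v)

theorem pairOf_mate {V W X Y : 𝓜} (p : ExactPairing V X) (q : ExactPairing W Y)
    (f : V ⟶ W) (ξ : Y.carrier) (v : V.carrier) :
    pairOf p ((@rightAdjointMate _ _ _ V W ⟨X⟩ ⟨Y⟩ f).toLin ξ) v = pairOf q ξ (f.toLin v) :=
  toLin_congr (@rightAdjointMate_comp_evaluation _ _ _ V W ⟨X⟩ ⟨Y⟩ f) (ξ ⊗ₜ v)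

theorem pair_dualMap {V W : 𝓜} (f : V ⟶ W) (ξ : (dual W).carrier) (v : V.carrier) :
    pair V ((dualMap f).toLin ξ) v = pair W ξ (f.toLin v) :=
  pairOf_mate (pairing V) (pairing W) f ξ v

theorem dualMap_dualMap {V W : 𝓜} (f : V ⟶ W) (v : V.carrier) :
    (dualMap (dualMap f)).toLin (evalD V v) = evalD W (f.toLin v) :=
  dual_ext fun ξ => (pair_dualMap _ _ _).trans (pair_dualMap f ξ v)

theorem pairOf_rightDualIso {V X Y : 𝓜} (p : ExactPairing V X) (q : ExactPairing V Y)
    (ξ : X.carrier) (v : V.carrier) :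
    pairOf q ((rightDualIso p q).hom.toLin ξ) v = pairOf p ξ v :=
  pairOf_mate q p (𝟙 V) ξ v

theorem pairOf_rightDualIso_inv {V X Y : 𝓜} (p : ExactPairing V X) (q : ExactPairing V Y)
    (ξ : Y.carrier) (v : V.carrier) :
    pairOf p ((rightDualIso p q).inv.toLin ξ) v = pairOf q ξ v :=
  pairOf_mate p q (𝟙 V) ξ v

theorem toLin_hom_inv {V W : 𝓜} (e : V ≅ W) (w : W.carrier) :
    e.hom.toLin (e.inv.toLin w) = w :=
  toLin_congr e.inv_hom_id w

theorem toLin_inv_hom {V W : 𝓜} (e : V ≅ W) (v : V.carrier) :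
    e.inv.toLin (e.hom.toLin v) = v :=
  toLin_congr e.hom_inv_id v

theorem pairOf_tensor {V W : 𝓜} (η : (dual W).carrier) (ξ : (dual V).carrier)
    (v : V.carrier) (w : W.carrier) :
    pairOf (@ExactPairing.tensor _ _ _ V W (dual V) (dual W) (pairing V) (pairing W)) (η ⊗ₜ ξ)
      (v ⊗ₜ w) = pair V ξ v * pair W η w :=
  map_smul (show Dual k W.carrier from η) (pair V ξ v) w

theorem ddUnit_evalD (c : k) : (ddUnit (C := 𝓜)).toLin (evalD (𝟙_ 𝓜) c) = c := by
  have h1 : ∀ ζ c, pairOf (exactPairingUnit (C := 𝓜)) ζ c = (c * ζ : k) := fun _ _ => rfl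
  have h2 : ∀ ζ, (dualUnit (C := 𝓜)).hom.toLin ζ = pair (𝟙_ 𝓜) ζ (1 : k) :=
    fun ζ => (one_mul (M := k) _).symm.trans ((h1 _ _).symm.trans
      (pairOf_rightDualIso (pairing (𝟙_ 𝓜)) exactPairingUnit ζ _))
  exact (h2 _).trans ((pair_dualMap _ _ _).trans ((pairOf_rightDualIso_inv
    (pairing (𝟙_ 𝓜)) exactPairingUnit (1 : k) c).trans ((h1 _ _).trans (mul_one c))))

theorem ddTensor_evalD (V W : 𝓜) (v : V.carrier) (w : W.carrier) :
    (ddTensor V W).toLin (evalD (V ⊗ W) (v ⊗ₜ w)) = evalD V v ⊗ₜ evalD W w := by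
  have h : (dualTensor (dual W) (dual V)).inv.toLin (evalD V v ⊗ₜ[k] evalD W w) =
      (dualMap (dualTensor V W).inv).toLin (evalD (V ⊗ W) (v ⊗ₜ w)) := by
    refine TensorProduct.ext' (N := Dual k V.carrier) (M := Dual k W.carrier)
      fun η ξ => ?_
    exact (pairOf_rightDualIso_inv (pairing (dual W ⊗ dual V)) (@ExactPairing.tensor _ _ _ (dual W)
      (dual V) _ _ (pairing _) (pairing _)) (evalD V v ⊗ₜ[k] evalD W w) (η ⊗ₜ ξ)).trans
      ((pairOf_tensor (evalD V v) (evalD W w) η ξ).trans ((mul_comm _ _).trans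
        ((pairOf_tensor η ξ v w).symm.trans ((pairOf_rightDualIso_inv (pairing (V ⊗ W))
          (@ExactPairing.tensor _ _ _ V W _ _ (pairing V) (pairing W)) (η ⊗ₜ ξ) (v ⊗ₜ w)).symm.trans
          (pair_dualMap (dualTensor V W).inv (evalD (V ⊗ W) (v ⊗ₜ w)) (η ⊗ₜ ξ)).symm))))
  exact (congrArg (dualTensor (dual W) (dual V)).hom.toLin h).symm.trans (toLin_hom_inv _ _)

section Swap

open VState

variable {α : FDMod k H}

theorem isIso_of_bijective {V W : 𝓜} {f : V ⟶ W} (hf : Function.Bijective f.toLin) :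
    IsIso f :=
  (FDMod.mkIso (LinearEquiv.ofBijective f.toLin hf) f.comm).isIso_hom

/-- The map `v** ⊗ a ↦ a ⊗ γ v`. -/
def swapEquiv (α : 𝓜) (γ : GroupLike k H) (V : 𝓜) :
    (dual (dual V) ⊗ α).carrier ≃ₗ[k] (α ⊗ V).carrier :=
  (TensorProduct.congr ((evalEquiv k V.carrier).symm ≪≫ₗ actEquiv γ V)
    (LinearEquiv.refl k α.carrier)).trans (tcomm k V.carrier α.carrier)

theorem swapEquiv_evalD (γ : GroupLike k H) (V : 𝓜) (v : V.carrier) (a : α.carrier) :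
    swapEquiv α γ V (evalD V v ⊗ₜ[k] a) = a ⊗ₜ V.ρ γ.val v :=
  congrArg (fun w => a ⊗ₜ[k] V.ρ γ.val w) ((evalEquiv k V.carrier).symm_apply_apply v)

theorem ddTmul_ext {α V : 𝓜} {M : Type*} [AddCommGroup M] [Module k M]
    {f g : (dual (dual V) ⊗ α).carrier →ₗ[k] M}
    (h : ∀ v a, f (evalD V v ⊗ₜ[k] a) = g (evalD V v ⊗ₜ[k] a)) : f = g :=
  TensorProduct.ext' fun z a => by
    obtain ⟨v, rfl⟩ := (evalEquiv k V.carrier).surjective z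
    exact h v a

theorem ddTensor_ext {α V W X : 𝓜} {f g : dual (dual (V ⊗ W)) ⊗ α ⟶ X}
    (h : ∀ v w a, f.toLin (evalD (V ⊗ W) (v ⊗ₜ w) ⊗ₜ[k] a) =
      g.toLin (evalD (V ⊗ W) (v ⊗ₜ w) ⊗ₜ[k] a)) : f = g :=
  FDMod.hom_ext <| ddTmul_ext fun t a => lcongr (TensorProduct.ext' fun v w => h v w a :
    f.toLin ∘ₗ (tmk k (dual (dual (V ⊗ W))).carrier α.carrier).flip a ∘ₗ
      evalD (V ⊗ W) = g.toLin ∘ₗ (tmk k (dual (dual (V ⊗ W))).carrier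
        α.carrier).flip a ∘ₗ evalD (V ⊗ W)) t

theorem exists_coev_line {a0 : α.carrier} {ξ0 : (dual α).carrier}
    (h : ∀ a, pair α ξ0 a • a0 = a) : (coev α).toLin (1 : k) = a0 ⊗ₜ[k] ξ0 := by
  obtain ⟨e, he, hinj⟩ := exists_dualTensorEnd (k := k) α.carrier
  exact hinj ((dualTensorEnd_coevaluation _ he).trans (lext fun a =>
    (h a).symm.trans (he a0 ξ0 a).symm))

section Line

variable {a0 : α.carrier} {ξ0 : (dual α).carrier}

theorem isInvertible_line (h : ∀ a, pair α ξ0 a • a0 = a) (h1 : pair α ξ0 a0 = 1) :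
    IsInvertible α := by
  have hξ : ∀ ξ : (dual α).carrier, pair α ξ a0 • ξ0 = ξ := fun ξ => dual_ext fun a =>
    (mul_comm _ _).trans ((map_smul (show Dual k α.carrier from ξ) _ a0).symm.trans
      (congrArg (pair α ξ) (h a)))
  have ht : ∀ (ξ : (dual α).carrier) (a : α.carrier) {r s : k}, r * s = pair α ξ0 a * pair α ξ a0 →
      pair α ξ a = r * s := fun ξ a r s hr => (congrArg (pair α ξ) (h a)).symm.trans ((map_smul
        (show Dual k α.carrier from ξ) _ a0).trans hr.symm)
  have hc : ∀ c : k, (coev α).toLin c = c • (a0 ⊗ₜ[k] ξ0) := fun c =>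
    (congrArg _ (mul_one c).symm).trans ((map_smul (coev α).toLin c (1 : k)).trans
      (congrArg _ (exists_coev_line h)))
  constructor
  · refine isIso_of_bijective (Function.bijective_iff_has_inverse.2
      ⟨contractLeft k α.carrier ∘ₗ (tcomm k _ _).toLinearMap, fun c => ?_,
        lcongr (TensorProduct.ext' (N := (dual α).carrier) fun a ξ => ?_ :
          (coev α).toLin ∘ₗ contractLeft k _ ∘ₗ
            (tcomm k _ _).toLinearMap = LinearMap.id)⟩)
    · exact (congrArg _ (hc c)).trans ((map_smul (contractLeft k α.carrier ∘ₗ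
        (tcomm k _ _).toLinearMap) c _).trans
          ((congrArg _ h1).trans (mul_one (M := k) c)))
    · exact (hc _).trans ((congrArg (· • (a0 ⊗ₜ[k] ξ0)) (ht ξ a rfl)).trans
        ((smul_tmul_smul _ _ a0 ξ0).symm.trans
          (congrArg₂ (· ⊗ₜ[k] ·) (h a) (hξ ξ))))
  · refine isIso_of_bijective (Function.bijective_iff_has_inverse.2
      ⟨LinearMap.toSpanSingleton k _ (ξ0 ⊗ₜ[k] a0), lcongr (TensorProduct.ext'
        (M := (dual α).carrier) fun ξ a => ?_ : LinearMap.toSpanSingleton k _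
          (ξ0 ⊗ₜ[k] a0) ∘ₗ (ev α).toLin = LinearMap.id), fun c => ?_⟩)
    · exact (congrArg (· • (ξ0 ⊗ₜ[k] a0)) (ht ξ a (mul_comm _ _))).trans
        ((smul_tmul_smul _ _ ξ0 a0).symm.trans
          (congrArg₂ (· ⊗ₜ[k] ·) (hξ ξ) (h a)))
    · exact (map_smul (ev α).toLin c _).trans ((congrArg _ h1).trans (mul_one (M := k) c))

theorem inv_coev_line (h : ∀ a, pair α ξ0 a • a0 = a) (hα : IsInvertible α) (a : α.carrier) :
    (leftPairing hα).evaluation'.toLin (a ⊗ₜ[k] ξ0) = pair α ξ0 a := by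
  have := hα.1
  have h2 : (inv (coev α)).toLin (a0 ⊗ₜ[k] ξ0) = (1 : k) :=
    (congrArg _ (exists_coev_line h).symm).trans
      (toLin_congr (IsIso.hom_inv_id (coev α)) (1 : k))
  have h3 : (a ⊗ₜ[k] ξ0 : α.carrier ⊗[k] (dual α).carrier) = pair α ξ0 a • (a0 ⊗ₜ[k] ξ0) := by
    rw [TensorProduct.smul_tmul', h]
  exact (congrArg (inv (coev α)).toLin h3).trans ((map_smul (inv (coev α)).toLin _ _).trans
    ((congrArg _ h2).trans (mul_one (M := k) _)))

theorem doubleDualLeft_line (h : ∀ a, pair α ξ0 a • a0 = a) (hα : IsInvertible α) :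
    (dualMap (doubleDualLeft hα).inv).toLin ξ0 = evalD (dual α) ξ0 := by
  refine dual_ext fun z => (pair_dualMap _ _ z).trans ?_
  obtain ⟨a, rfl⟩ : ∃ a, (doubleDualLeft hα).hom.toLin a = z := ⟨_, toLin_hom_inv _ z⟩
  exact (congrArg (pair α ξ0) (toLin_inv_hom (doubleDualLeft hα) a)).trans
    ((inv_coev_line h hα a).symm.trans (pairOf_rightDualIso (leftPairing hα) (pairing (dual α))
      a ξ0).symm)

/-- A group-like element that acts trivially on a line `α` gives a twisted pivotal structure. -/
def ofGroupLike (γ : GroupLike k H) (h : ∀ a, pair α ξ0 a • a0 = a) (h1 : pair α ξ0 a0 = 1)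
    (hγ : ∀ a, α.ρ γ.val a = a)
    (hlin : ∀ (V : 𝓜) (c : H), (swapEquiv α γ V).toLinearMap ∘ₗ (dual (dual V) ⊗ α).ρ c =
      (α ⊗ V).ρ c ∘ₗ (swapEquiv α γ V).toLinearMap) :
    TwistedPivotalStructure α where
  invertible := isInvertible_line h h1
  app V := FDMod.mkIso (swapEquiv α γ V) (hlin V)
  naturality {V W} f := FDMod.hom_ext <| ddTmul_ext fun v a =>
    (congrArg (fun z => swapEquiv α γ W (z ⊗ₜ[k] a)) (dualMap_dualMap f v)).trans
      ((swapEquiv_evalD γ W _ a).trans ((congrArg (a ⊗ₜ[k] ·)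
        (comm_apply f γ.val v).symm).trans
          (congrArg (α ◁ f).toLin (swapEquiv_evalD γ V v a)).symm))
  app_unit := FDMod.hom_ext <| ddTmul_ext fun c a => by
    refine (swapEquiv_evalD γ _ c a).trans (.trans ?_
      (congrArg (fun z : k => (z • a) ⊗ₜ[k] (1 : k)) (ddUnit_evalD (H := H) c)).symm)
    rw [smul_tmul]
    exact congrArg (a ⊗ₜ[k] ·) ((congrArg (· * c) γ.2.counit_eq_one).trans
      ((one_mul c).trans (mul_one c).symm))
  app_tensor V W := ddTensor_ext fun v w a => by
    refine (swapEquiv_evalD γ _ _ a).trans (.trans ?_ (congrArg (((α_ _ _ _).hom ≫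
      dual (dual V) ◁ (FDMod.mkIso (swapEquiv α γ W) _).hom ≫ (α_ _ _ _).inv ≫
        (FDMod.mkIso (swapEquiv α γ V) _).hom ▷ W ≫ (α_ _ _ _).hom).toLin ∘ₗ
          (tmk k _ _).flip a) (ddTensor_evalD V W v w)).symm)
    refine .trans (congrArg (a ⊗ₜ[k] ·) (rho_tensor γ V W v w)) (.symm ?_)
    exact (congrArg (((α_ _ _ _).inv ≫ (FDMod.mkIso (swapEquiv α γ V) _).hom ▷ W ≫
        (α_ _ _ _).hom).toLin ∘ₗ tmk k _ _ (evalD V v))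
          (swapEquiv_evalD γ W w a)).trans (congrArg ((α_ α V W).hom.toLin ∘ₗ
            (tmk k _ _).flip (W.ρ γ.val w)) (swapEquiv_evalD γ V v a))
  twist := FDMod.hom_ext (lext fun a => by
    have hd : (dual α).ρ γ.val ξ0 = ξ0 := dual_ext fun b =>
      congrArg (pair α ξ0) ((congrArg _ (hγ b).symm).trans ((actEquiv γ α).symm_apply_apply b))
    have hi := isInvertible_line h h1
    refine (congrArg (((α_ _ _ _).hom ≫ α ◁ (dualMap (doubleDualLeft hi).inv ▷ α ≫
      (FDMod.mkIso (swapEquiv α γ (dual α)) _).hom ≫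
        (leftPairing hi).evaluation') ≫ (ρ_ α).hom).toLin ∘ₗ
      (tmk k _ _).flip a) (exists_coev_line h)).trans ?_
    refine (congrArg ((α ◁ ((FDMod.mkIso (swapEquiv α γ (dual α)) _).hom ≫
      (leftPairing hi).evaluation') ≫ (ρ_ α).hom).toLin ∘ₗ tmk k _ _ a0 ∘ₗ
        (tmk k _ _).flip a) (doubleDualLeft_line h hi)).trans ?_
    refine (congrArg ((α ◁ ((leftPairing hi).evaluation') ≫ (ρ_ α).hom).toLin ∘ₗ
      tmk k _ _ a0) ((swapEquiv_evalD γ (dual α) ξ0 a).trans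
        (congrArg (a ⊗ₜ[k] ·) hd))).trans ?_
    exact (congrArg ((ρ_ α).hom.toLin ∘ₗ tmk k _ _ a0) (inv_coev_line h hi a)).trans
      (h a))

theorem ofGroupLike_isSwapBy (γ : GroupLike k H) (h : ∀ a, pair α ξ0 a • a0 = a)
    (h1 : pair α ξ0 a0 = 1) (hγ hlin) :
    IsSwapBy (ofGroupLike γ h h1 hγ hlin) γ.val :=
  fun V v a => swapEquiv_evalD γ V v a

end Line

end Swap

end TwPiv

namespace TwPiv

open Set Filter Topology

section Category

variable {k : Type u} [Field k] {H : Type v} [Ring H] [Algebra k H]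

theorem epi_of_surjective {V W : FDMod k H} {f : V ⟶ W} (hf : Function.Surjective f.toLin) :
    Epi f where
  left_cancellation _ _ h := FDMod.hom_ext (LinearMap.ext fun w => by
    obtain ⟨v, rfl⟩ := hf w
    exact toLin_congr h v)

/-- An `H`-stable subspace as a module. -/
def subMod (V : FDMod k H) (p : Submodule k V.carrier) (hp : ∀ h, ∀ v ∈ p, V.ρ h v ∈ p) :
    FDMod k H where
  carrier := p
  ρ := AlgHom.ofLinearMap
    { toFun := fun h => (V.ρ h).restrict (hp h)
      map_add' := fun a b => LinearMap.ext fun v => Subtype.ext (by simp)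
      map_smul' := fun c a => LinearMap.ext fun v => Subtype.ext (by simp) }
    (LinearMap.ext fun v => Subtype.ext (by simp))
    fun a b => LinearMap.ext fun v => Subtype.ext (by simp)

/-- The quotient by an `H`-stable subspace. -/
def quotMod (V : FDMod k H) (p : Submodule k V.carrier) (hp : ∀ h, ∀ v ∈ p, V.ρ h v ∈ p) :
    FDMod k H where
  carrier := V.carrier ⧸ p
  ρ := AlgHom.ofLinearMap
    { toFun := fun h => p.mapQ p (V.ρ h) (hp h)
      map_add' := fun a b => Submodule.linearMap_qext _ (by ext; simp)
      map_smul' := fun c a => Submodule.linearMap_qext _ (by ext; simp) }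
    (Submodule.linearMap_qext _ (by ext; simp))
    fun a b => Submodule.linearMap_qext _ (by ext; simp)

theorem surjective_of_epi {V W : FDMod k H} (f : V ⟶ W) [Epi f] : Function.Surjective f.toLin := by
  have hp : ∀ h, ∀ w ∈ LinearMap.range f.toLin, W.ρ h w ∈ LinearMap.range f.toLin := by
    rintro h _ ⟨v, rfl⟩
    exact ⟨V.ρ h v, comm_apply f h v⟩
  let π : W ⟶ quotMod W _ hp := ⟨Submodule.mkQ _, fun h => rfl⟩
  have h0 : π = 0 := (cancel_epi f).1 (FDMod.hom_ext (LinearMap.ext fun v =>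
    (Submodule.Quotient.mk_eq_zero _).2 ⟨v, rfl⟩))
  intro w
  exact (Submodule.Quotient.mk_eq_zero _).1 (toLin_congr h0 w)

theorem injective_of_mono {V W : FDMod k H} (f : V ⟶ W) [Mono f] : Function.Injective f.toLin := by
  have hp : ∀ h, ∀ v ∈ LinearMap.ker f.toLin, V.ρ h v ∈ LinearMap.ker f.toLin := fun h v hv =>
    (comm_apply f h v).trans ((congrArg (W.ρ h) hv).trans (map_zero _))
  let ι : subMod V _ hp ⟶ V := ⟨Submodule.subtype _, fun h => rfl⟩
  have h0 : ι = 0 := (cancel_mono f).1 (FDMod.hom_ext (LinearMap.ext fun v =>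
    v.2.trans (map_zero f.toLin).symm))
  rw [← LinearMap.ker_eq_bot, eq_bot_iff]
  exact fun v hv => toLin_congr h0 ⟨v, hv⟩

theorem exists_lift {V W U : FDMod k H} (hV : Projective V) (f : V ⟶ W) {g : U ⟶ W}
    (hg : Function.Surjective g.toLin) : ∃ l : V ⟶ U, ∀ v, g.toLin (l.toLin v) = f.toLin v := by
  have := epi_of_surjective hg
  exact ⟨Projective.factorThru f g, fun v =>
    toLin_congr (Projective.factorThru_comp f g) v⟩

end Category

section Rigid

variable {k : Type u} [Field k] {H : Type v} [Ring H] [HopfAlgebra k H]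

theorem exists_leftDual (hS : ∀ h : H, (HopfAlgebra.antipode k)^[6] h = h) (V : FDMod k H) :
    ∃ W : FDMod k H, Nonempty (ExactPairing W V) := by
  have i : V ≅ dual (dual (dual (dual (dual (dual V))))) := FDMod.mkIso
    (((Module.evalEquiv k V.carrier).trans (Module.evalEquiv k (dual (dual V)).carrier)).trans
      (Module.evalEquiv k (dual (dual (dual (dual V)))).carrier)) fun h => LinearMap.ext fun v =>
    congrArg (fun h' => evalD (dual (dual (dual (dual V)))) (evalD (dual (dual V)) (evalD V
      (V.ρ h' v)))) (hS h).symm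
  exact ⟨_, ⟨@exactPairingCongrRight _ _ _ _ _ _ (pairing (dual (dual (dual (dual (dual V)))))) i⟩⟩

theorem projective_tensor_left (hd : ∀ V : FDMod k H, ∃ W : FDMod k H, Nonempty (ExactPairing W V))
    (V : FDMod k H) {P : FDMod k H} (hP : Projective P) : Projective (V ⊗ P) := by
  obtain ⟨W, ⟨p⟩⟩ := hd V
  obtain ⟨U, ⟨q⟩⟩ := hd W
  have := Functor.preservesEpimorphisms_of_adjunction (tensorLeftAdjunction U W)
  exact (tensorLeftAdjunction W V).map_projective P hP

theorem projective_tensor_right (V : FDMod k H) {P : FDMod k H} (hP : Projective P) :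
    Projective (P ⊗ V) := by
  have := pairing V
  have := pairing (dual V)
  have := Functor.preservesEpimorphisms_of_adjunction (tensorRightAdjunction (dual V) (dual (dual V)))
  exact (tensorRightAdjunction V (dual V)).map_projective P hP

theorem projective_tens (hd : ∀ V : FDMod k H, ∃ W : FDMod k H, Nonempty (ExactPairing W V))
    {X : List (FDMod k H)} {x : FDMod k H} (hx : x ∈ X) (hp : Projective x) :
    Projective (tens X) := by
  induction X with
  | nil => simp at hx
  | cons y X ih =>
    obtain rfl | hx := List.mem_cons.1 hx
    · exact projective_tensor_right _ hp
    · exact projective_tensor_left hd y (ih hx)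

end Rigid

theorem isFiniteTensorCategory {k : Type u} [Field k] {H : Type u} [Ring H] [HopfAlgebra k H]
    [FiniteDimensional k H] (hS : ∀ h : H, (HopfAlgebra.antipode k)^[6] h = h) :
    IsFiniteTensorCategory k (FDMod k H) := by
  have hM : MonoidalPreadditive (FDMod k H) :=
    { whiskerLeft_zero := FDMod.hom_ext (TensorProduct.map_zero_right _)
      zero_whiskerRight := FDMod.hom_ext (TensorProduct.map_zero_left _)
      whiskerLeft_add := fun _ _ => FDMod.hom_ext (TensorProduct.map_add_right _ _ _)
      add_whiskerRight := fun _ _ => FDMod.hom_ext (TensorProduct.map_add_left _ _ _) }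
  refine ⟨exists_leftDual hS, ⟨hM,
    { whiskerLeft_smul := fun _ _ _ _ _ => FDMod.hom_ext (TensorProduct.map_smul_right _ _ _)
      smul_whiskerRight := fun _ _ _ _ _ => FDMod.hom_ext (TensorProduct.map_smul_left _ _ _) }⟩,
    ?_, H, inferInstance, inferInstance, inferInstance, CategoryTheory.Equivalence.refl, ?_, ?_⟩
  · refine (finrank_eq_one_iff_of_nonzero' (𝟙 (𝟙_ (FDMod k H))) fun h => ?_).2 fun f =>
      ⟨f.toLin (1 : k), FDMod.hom_ext (LinearMap.ext_ring (mul_one _))⟩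
    exact one_ne_zero (toLin_congr h (1 : k))
  · exact inferInstanceAs (𝟭 (FDMod k H)).Additive
  · exact inferInstanceAs ((𝟭 (FDMod k H)).Linear k)

end TwPiv

namespace GenTaft

open TwPiv
open Module (Dual evalEquiv End)
open LinearMap renaming congr_fun → lcongr, ext → lext
open Finset (sum_congr)
open TensorProduct renaming map → tmap, comm → tcomm, mk → tmk
open TensorProduct (rid lid smul_tmul tmul_smul tmul_add smul_tmul_smul map_tmul)

variable {D : TaftData}

theorem q_ne_zero (D : TaftData) : D.q ≠ 0 := D.primitive.ne_zero (by have := D.two_le; omega)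

instance finiteDimensional : FiniteDimensional ℂ (GenTaft D) := by
  set s : Set (GenTaft D) := {a | ∃ i j l : ℕ, a = x D ^ i * y D ^ j * g D ^ l} with hs
  have hyx : y D * x D = (D.q ^ (D.a₁ * D.b₂))⁻¹ • (x D * y D) := by
    rw [(rels D).xy, smul_smul, inv_mul_cancel₀ (pow_ne_zero _ (q_ne_zero D)), one_smul]
  have hm : ∀ i j l, x D ^ i * y D ^ j * g D ^ l ∈ Submodule.span ℂ s := fun i j l =>
    Submodule.subset_span ⟨i, j, l, rfl⟩
  have key : ∀ a, ∀ t ∈ Submodule.span ℂ s, a * t ∈ Submodule.span ℂ s := by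
    have hgen : ∀ a, (∀ i j l, a * (x D ^ i * y D ^ j * g D ^ l) ∈ Submodule.span ℂ s) →
        ∀ t ∈ Submodule.span ℂ s, a * t ∈ Submodule.span ℂ s := fun a ha t ht =>
      (Submodule.span_le.2 (by rintro _ ⟨i, j, l, rfl⟩; exact ha i j l) :
        Submodule.span ℂ s ≤ (Submodule.span ℂ s).comap (LinearMap.mulLeft ℂ a)) ht
    intro a
    induction a using induction with
    | hc c =>
      refine fun t ht => ?_
      rw [← Algebra.smul_def]
      exact Submodule.smul_mem _ c ht
    | hg =>
      refine hgen _ fun i j l => ?_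
      rw [← mul_assoc, ← mul_assoc, comm_pow (rels D).gx, smul_mul_assoc, mul_assoc (x D ^ i),
          comm_pow (rels D).gy, mul_smul_comm, smul_smul, smul_mul_assoc, ← mul_assoc, mul_assoc _ _
          (g D ^ l), ← pow_succ']
      exact Submodule.smul_mem _ _ (hm _ _ _)
    | hx =>
      refine hgen _ fun i j l => ?_
      rw [← mul_assoc, ← mul_assoc, ← pow_succ']
      exact hm _ _ _
    | hy =>
      refine hgen _ fun i j l => ?_
      rw [← mul_assoc, ← mul_assoc, comm_pow hyx, smul_mul_assoc, mul_assoc (x D ^ i),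
          ← pow_succ', smul_mul_assoc]
      exact Submodule.smul_mem _ _ (hm _ _ _)
    | hmul a b ha hb => exact fun t ht => by rw [mul_assoc]; exact ha _ (hb t ht)
    | hadd a b ha hb =>
      refine fun t ht => ?_
      rw [add_mul]
      exact Submodule.add_mem _ (ha t ht) (hb t ht)
  refine ⟨⟨Set.Finite.toFinset (s := s) ?_, ?_⟩⟩
  · refine Set.Finite.subset ((((Finset.range D.n ×ˢ Finset.range D.m ×ˢ Finset.range D.N).finite_toSet).image
      fun ijl : ℕ × ℕ × ℕ => x D ^ ijl.1 * y D ^ ijl.2.1 * g D ^ ijl.2.2).insert 0) ?_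
    rintro _ ⟨i, j, l, rfl⟩
    rcases lt_or_ge i D.n with hi | hi
    · rcases lt_or_ge j D.m with hj | hj
      · refine Or.inr ⟨(i, j, l % D.N), ?_, ?_⟩
        · simp [hi, hj, Nat.mod_lt l (by have := D.two_le; omega : 0 < D.N)]
        · dsimp only
          rw [← pow_eq_pow_mod l (rels D).g_pow]
      · left; rw [← Nat.sub_add_cancel hj, pow_add, (rels D).y_pow]; simp
    · left; rw [← Nat.sub_add_cancel hi, pow_add, (rels D).x_pow]; simp
  · rw [Set.Finite.coe_toFinset, eq_top_iff]
    exact fun a _ => mul_one a ▸ key a 1 (by simpa using hm 0 0 0)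

theorem antipode_antipode_g : antipode D (antipode D (g D)) = g D := by
  have h : antipode D (ginv D) * antipode D (g D) = 1 := by
    rw [← antipode_mul, g_mul_ginv, ← map_one (algebraMap ℂ (GenTaft D)), antipode_algebraMap]
  rw [antipode_g] at h ⊢
  rw [← mul_one (antipode D (ginv D)), ← ginv_mul_g, ← mul_assoc, h, one_mul]

theorem antipode_antipode_of_gx {a : GenTaft D} {r s : ℕ}
    (ha : antipode D a = -(a * ginv D ^ r)) (hg : g D * a = D.q ^ s • (a * g D)) :
    antipode D (antipode D a) = D.q ^ (r * s) • a := by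
  have h : antipode D (ginv D) = g D := by rw [← antipode_g, antipode_antipode_g]
  have hp : ∀ r, antipode D (ginv D ^ r) = g D ^ r := fun r => by
    induction r with
    | zero => simpa using antipode_algebraMap D 1
    | succ r ih => rw [pow_succ, antipode_mul, ih, h, ← pow_succ']
  rw [ha, map_neg, antipode_mul, hp, ha, mul_neg, neg_neg, ← mul_assoc, pow_comm hg, smul_mul_assoc,
    mul_assoc, g_pow_mul_ginv_pow, mul_one, ← pow_mul, mul_comm]

theorem antipode_antipode_x :
    antipode D (antipode D (x D)) = D.q ^ (D.a₁ * D.a₂) • x D :=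
  antipode_antipode_of_gx (antipode_x D) (rels D).gx

theorem antipode_antipode_y :
    antipode D (antipode D (y D)) = D.q ^ (D.b₁ * D.b₂) • y D :=
  antipode_antipode_of_gx (antipode_y D) (rels D).gy

theorem antipode_iterate_six (ha : D.N ∣ 3 * (D.a₁ * D.a₂)) (hb : D.N ∣ 3 * (D.b₁ * D.b₂))
    (h : GenTaft D) : (HopfAlgebra.antipode ℂ)^[6] h = h := by
  change antipode D (antipode D (antipode D (antipode D (antipode D (antipode D h))))) = h
  have ha' := (D.primitive.pow_eq_one_iff_dvd _).2 ha
  have hb' := (D.primitive.pow_eq_one_iff_dvd _).2 hb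
  induction h using induction with
  | hc c => simp only [antipode_algebraMap]
  | hg => simp only [antipode_antipode_g]
  | hx =>
    simp only [antipode_antipode_x, map_smul, smul_smul, ← pow_add]
    rw [show _ + _ = 3 * (D.a₁ * D.a₂) by ring, ha', one_smul]
  | hy =>
    simp only [antipode_antipode_y, map_smul, smul_smul, ← pow_add]
    rw [show _ + _ = 3 * (D.b₁ * D.b₂) by ring, hb', one_smul]
  | hmul a b ha hb => simp only [antipode_mul, ha, hb]
  | hadd a b ha hb => simp only [map_add, ha, hb]

theorem comm_of_generators {V W : FDMod ℂ (GenTaft D)} {f : V.carrier →ₗ[ℂ] W.carrier}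
    (hg : f ∘ₗ V.ρ (g D) = W.ρ (g D) ∘ₗ f) (hx : f ∘ₗ V.ρ (x D) = W.ρ (x D) ∘ₗ f)
    (hy : f ∘ₗ V.ρ (y D) = W.ρ (y D) ∘ₗ f) (h : GenTaft D) : f ∘ₗ V.ρ h = W.ρ h ∘ₗ f := by
  induction h using induction with
  | hc c => ext; simp [AlgHom.commutes, Module.algebraMap_end_apply]
  | hg => exact hg
  | hx => exact hx
  | hy => exact hy
  | hmul a b ha hb =>
    rw [map_mul, map_mul, End.mul_eq_comp, End.mul_eq_comp, ← LinearMap.comp_assoc,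
      ha, LinearMap.comp_assoc, hb, LinearMap.comp_assoc]
  | hadd a b ha hb => rw [map_add, map_add, LinearMap.comp_add, LinearMap.add_comp, ha, hb]

section Tensor

variable {V W : FDMod ℂ (GenTaft D)} (v : V.carrier) (w : W.carrier)

theorem rho_g_tmul : (V ⊗ W).ρ (g D) (v ⊗ₜ[ℂ] w) = V.ρ (g D) v ⊗ₜ W.ρ (g D) w := by
  exact lcongr (congrArg (HopfRep.act₂ V.ρ W.ρ) (lift_g (rels_comul D))) (v ⊗ₜ w)

theorem rho_x_tmul : (V ⊗ W).ρ (x D) (v ⊗ₜ[ℂ] w) =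
    v ⊗ₜ W.ρ (x D) w + V.ρ (x D) v ⊗ₜ W.ρ (g D ^ D.a₁) w := by
  refine (lcongr (congrArg (HopfRep.act₂ V.ρ W.ρ) (lift_x (rels_comul D)))
    (v ⊗ₜ w)).trans ?_
  simp [HopfRep.act₂_tmul]

theorem rho_y_tmul : (V ⊗ W).ρ (y D) (v ⊗ₜ[ℂ] w) =
    v ⊗ₜ W.ρ (y D) w + V.ρ (y D) v ⊗ₜ W.ρ (g D ^ D.b₁) w := by
  refine (lcongr (congrArg (HopfRep.act₂ V.ρ W.ρ) (lift_y (rels_comul D)))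
    (v ⊗ₜ w)).trans ?_
  simp [HopfRep.act₂_tmul]

end Tensor

/-- The group-like element `g`. -/
def groupLike (D : TaftData) : GroupLike ℂ (GenTaft D) where
  val := g D
  isGroupLikeElem_val := ⟨lift_g (rels_counit D), lift_g (rels_comul D)⟩

theorem T_g (c : ℕ) (a : (T D c).carrier) : (T D c).ρ (g D) a = D.q ^ c • a :=
  congrArg (· * (show ℂ from a)) (lift_g _)

theorem T_x (c : ℕ) (a : (T D c).carrier) : (T D c).ρ (x D) a = 0 :=
  (congrArg (· * (show ℂ from a)) (lift_x _)).trans (zero_mul (M₀ := ℂ) a)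

theorem T_y (c : ℕ) (a : (T D c).carrier) : (T D c).ρ (y D) a = 0 :=
  (congrArg (· * (show ℂ from a)) (lift_y _)).trans (zero_mul (M₀ := ℂ) a)

theorem rho_g_pow {V : FDMod ℂ (GenTaft D)} {v : V.carrier} {c : ℂ} (h : V.ρ (g D) v = c • v)
    (d : ℕ) : V.ρ (g D ^ d) v = c ^ d • v := by
  induction d with
  | zero => simp
  | succ d ih => rw [pow_succ', map_mul, End.mul_apply, ih, map_smul, h, smul_smul, pow_succ]

theorem swap_comm_of_generator {c d r s : ℕ} (V : FDMod ℂ (GenTaft D)) {z : GenTaft D}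
    (hz : ∀ {V W : FDMod ℂ (GenTaft D)} (v : V.carrier) (w : W.carrier), (V ⊗ W).ρ z (v ⊗ₜ[ℂ] w) =
      v ⊗ₜ W.ρ z w + V.ρ z v ⊗ₜ W.ρ (g D ^ r) w)
    (hS : antipode D (antipode D z) = D.q ^ (r * s) • z) (hg : g D * z = D.q ^ s • (z * g D))
    (hT : ∀ a, (T D c).ρ z a = 0) (h : D.N ∣ r * s + c * r + s * d) :
    (swapEquiv (T D c) (groupLike D ^ d) V).toLinearMap ∘ₗ (dual (dual V) ⊗ T D c).ρ z =
      (T D c ⊗ V).ρ z ∘ₗ (swapEquiv (T D c) (groupLike D ^ d) V).toLinearMap := by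
  refine ddTmul_ext fun v a => ?_
  set φ := swapEquiv (T D c) (groupLike D ^ d) V with hφ
  have hd : (dual (dual V)).ρ z (evalD V v) = D.q ^ (r * s) • evalD V (V.ρ z v) :=
    (congrArg (fun z' => evalD V (V.ρ z' v)) hS).trans (by
      rw [map_smul, LinearMap.smul_apply, map_smul])
  have h1 : φ ((dual (dual V) ⊗ T D c).ρ z (evalD V v ⊗ₜ[ℂ] a)) =
      (D.q ^ (r * s) * D.q ^ (c * r)) • (a ⊗ₜ[ℂ] V.ρ (g D ^ d) (V.ρ z v)) := by
    rw [hz, hT, TensorProduct.tmul_zero, zero_add, hd, rho_g_pow (T_g c a), ← pow_mul,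
      smul_tmul_smul, map_smul]
    exact congrArg _ (swapEquiv_evalD _ _ _ _)
  have h2 : (T D c ⊗ V).ρ z (φ (evalD V v ⊗ₜ[ℂ] a)) = a ⊗ₜ[ℂ] V.ρ z (V.ρ (g D ^ d) v) := by
    refine (congrArg _ (swapEquiv_evalD _ _ _ _)).trans ?_
    rw [hz, hT, TensorProduct.zero_tmul, add_zero]
    rfl
  refine h1.trans (.trans ?_ h2.symm)
  rw [← End.mul_apply, ← End.mul_apply, ← map_mul, ← map_mul, pow_comm hg, map_smul,
    LinearMap.smul_apply, tmul_smul, smul_smul, ← pow_mul, ← pow_add, ← pow_add,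
    (D.primitive.pow_eq_one_iff_dvd _).2 h, one_smul]

theorem exists_isSwapBy {c d : ℕ} (ha : D.N ∣ D.a₁ * D.a₂ + c * D.a₁ + D.a₂ * d)
    (hb : D.N ∣ D.b₁ * D.b₂ + c * D.b₁ + D.b₂ * d) (hcd : D.N ∣ c * d) :
    ∃ P : TwistedPivotalStructure (T D c), IsSwapBy P (g D ^ d) := by
  have hT : ∀ a : ℂ, pair (T D c) (LinearMap.id : ℂ →ₗ[ℂ] ℂ) a • (1 : ℂ) = a := fun a => mul_one a
  refine ⟨ofGroupLike (groupLike D ^ d) hT rfl (fun a => ?_) fun V => comm_of_generators ?_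
    (swap_comm_of_generator V rho_x_tmul antipode_antipode_x (rels D).gx (T_x c) ha)
    (swap_comm_of_generator V rho_y_tmul antipode_antipode_y (rels D).gy (T_y c) hb),
    ofGroupLike_isSwapBy (groupLike D ^ d) hT rfl _ _⟩
  · refine (rho_g_pow (T_g c a) d).trans ?_
    rw [← pow_mul, (D.primitive.pow_eq_one_iff_dvd _).2 hcd, one_smul]
  · refine ddTmul_ext fun v a => ?_
    have hd : (dual (dual V)).ρ (g D) (evalD V v) = evalD V (V.ρ (g D) v) :=
      congrArg (fun z' => evalD V (V.ρ z' v)) antipode_antipode_g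
    refine (congrArg (swapEquiv (T D c) (groupLike D ^ d) V) ((rho_g_tmul _ _).trans
      (congrArg (· ⊗ₜ[ℂ] _) hd))).trans ((swapEquiv_evalD _ _ _ _).trans
        (.trans ?_ ((congrArg _ (swapEquiv_evalD _ _ _ _)).trans (rho_g_tmul _ _)).symm))
    change _ ⊗ₜ[ℂ] V.ρ (g D ^ d) (V.ρ (g D) v) = _ ⊗ₜ[ℂ] V.ρ (g D) (V.ρ (g D ^ d) v)
    rw [← End.mul_apply, ← End.mul_apply, ← map_mul, ← map_mul, pow_mul_comm']

theorem isGivenBy_of_isSwapBy {D : TaftData} {c d : ℕ} {P : TwistedPivotalStructure (T D c)}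
    (h : IsSwapBy P (g D ^ d)) : IsGivenBy D P d :=
  fun V v => h V v (1 : ℂ)

theorem addOrderOf_eq_three {N : ℕ} {a : ZMod N} (h : 3 • a = 0) (h0 : a ≠ 0) : addOrderOf a = 3 :=
  have := Fact.mk Nat.prime_three
  addOrderOf_eq_prime h h0

variable {q : ℂ}

section Three

variable (hq : IsPrimitiveRoot q 3)

theorem taftThree_n : (taftThree q hq).n = 3 :=
  addOrderOf_eq_three (a := ((1 * 1 : ℕ) : ZMod 3)) (by decide) (by decide)

theorem taftThree_m : (taftThree q hq).m = 3 :=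
  addOrderOf_eq_three (a := ((2 * 1 : ℕ) : ZMod 3)) (by decide) (by decide)

theorem rels_taftThree : (taftThree q hq).Rels !![1, 0; 0, q] !![0, 0; 1, 0] !![0, 0; 1, 0] where
  g_pow := by
    have h3 : q ^ 3 = 1 := hq.pow_eq_one
    change _ ^ 3 = _
    rw [pow_succ, pow_two, Matrix.mul_fin_two, Matrix.mul_fin_two, Matrix.one_fin_two]
    ext i j
    fin_cases i <;> fin_cases j <;> simp
    linear_combination h3
  x_pow := by
    rw [taftThree_n]
    rw [pow_succ, pow_two, Matrix.mul_fin_two]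
    ext i j
    fin_cases i <;> fin_cases j <;> simp
  y_pow := by
    rw [taftThree_m]
    rw [pow_succ, pow_two, Matrix.mul_fin_two]
    ext i j
    fin_cases i <;> fin_cases j <;> simp
  gx := by simp [taftThree]
  gy := by simp [taftThree]
  xy := by simp [taftThree]

/-- The module with basis `v0`, `v1` on which `g` acts by `1`, `q`, and both `x` and `y` map `v0`
to `v1`. -/
def jordanMod : FDMod ℂ (GenTaft (taftThree q hq)) :=
  ⟨Fin 2 → ℂ, (Matrix.toLinAlgEquiv' : Matrix (Fin 2) (Fin 2) ℂ ≃ₐ[ℂ] _).toAlgHom.comp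
    (lift (rels_taftThree hq))⟩

theorem isEmpty_pivotalStructure :
    IsEmpty (PivotalStructure (FDMod ℂ (GenTaft (taftThree q hq)))) := by
  refine ⟨fun P => ?_⟩
  set D := taftThree q hq
  set V := jordanMod hq
  set φ : V.carrier →ₗ[ℂ] V.carrier := (P.app V).hom.toLin ∘ₗ evalD V with hφ
  have hφS : ∀ h v, φ (V.ρ (antipode D (antipode D h)) v) = V.ρ h (φ v) := fun h v =>
    comm_apply (P.app V).hom h (evalD V v)
  have hinj : Function.Injective φ := Function.Injective.comp (g := (P.app V).hom.toLin)
    (Function.LeftInverse.injective (toLin_inv_hom (P.app V)))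
    (evalEquiv ℂ V.carrier).injective
  have hxy : V.ρ (x D) = V.ρ (y D) := (congrArg (fun M => Matrix.toLinAlgEquiv' M)
    ((lift_x (rels_taftThree hq)).trans (lift_y (rels_taftThree hq)).symm))
  have hx : ∀ v, q • φ (V.ρ (x D) v) = V.ρ (x D) (φ v) := fun v => by
    rw [← hφS, antipode_antipode_x, map_smul, LinearMap.smul_apply, map_smul]
    simp [D, taftThree]
  have hy : ∀ v, q ^ 2 • φ (V.ρ (x D) v) = V.ρ (x D) (φ v) := fun v => by
    rw [hxy, ← hφS, antipode_antipode_y, map_smul, LinearMap.smul_apply, map_smul]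
    simp [D, taftThree]
  obtain ⟨v0, hv0⟩ : ∃ v : V.carrier, v = (![1, 0] : Fin 2 → ℂ) := ⟨_, rfl⟩
  have h0 : (q - q ^ 2) • φ (V.ρ (x D) v0) = 0 := by
    rw [sub_smul, hx, hy, sub_self]
  have hx0 : V.ρ (x D) v0 ≠ 0 := fun h => by
    have h1 : Matrix.mulVec (lift (rels_taftThree hq) (x D)) ![1, 0] = 0 := by subst hv0; exact h
    rw [lift_x] at h1
    simpa using congrFun h1 1
  have hq0 : q - q ^ 2 ≠ 0 := fun h => hq.ne_one (by norm_num)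
    (mul_left_cancel₀ (hq.ne_zero (by norm_num)) (by linear_combination -h))
  exact hx0 (hinj (((smul_eq_zero.1 h0).resolve_left hq0).trans (map_zero φ).symm))

end Three

theorem taftThree_spec {q : ℂ} (hq : IsPrimitiveRoot q 3) :
    IsFiniteTensorCategory ℂ (FDMod ℂ (GenTaft (taftThree q hq))) ∧
      (∃ P : TwistedPivotalStructure (T (taftThree q hq) 2), IsGivenBy (taftThree q hq) P 0) ∧
      IsEmpty (PivotalStructure (FDMod ℂ (GenTaft (taftThree q hq)))) := by
  refine ⟨isFiniteTensorCategory (antipode_iterate_six ?_ ?_), ?_, isEmpty_pivotalStructure hq⟩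
  · exact (by decide : 3 ∣ 3 * (1 * 1))
  · exact (by decide : 3 ∣ 3 * (2 * 1))
  · obtain ⟨P, hP⟩ := exists_isSwapBy (D := taftThree q hq) (c := 2) (d := 0)
      (by decide : 3 ∣ 1 * 1 + 2 * 1 + 1 * 0) (by decide : 3 ∣ 2 * 1 + 2 * 2 + 1 * 0)
      (by decide : 3 ∣ 2 * 0)
    exact ⟨P, isGivenBy_of_isSwapBy hP⟩

variable (hq : IsPrimitiveRoot q 9)

local notation "𝓓" => taftNine q hq
local notation "𝓑" => FDMod ℂ (GenTaft 𝓓)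

theorem taftNine_n : (𝓓).n = 3 :=
  addOrderOf_eq_three (a := ((1 * 3 : ℕ) : ZMod 9)) (by decide) (by decide)

theorem taftNine_m : (𝓓).m = 3 :=
  addOrderOf_eq_three (a := ((5 * 3 : ℕ) : ZMod 9)) (by decide) (by decide)

include hq in
theorem q_pow_congr {m n : ℕ} (h : m % 9 = n % 9) : q ^ m = q ^ n := by
  rw [pow_eq_pow_mod m hq.pow_eq_one, h, ← pow_eq_pow_mod n hq.pow_eq_one]

include hq in
theorem q_smul_congr {X : Type*} [AddCommGroup X] [Module ℂ X] {l m n : ℕ} (v : X)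
    (h : l % 9 = (m + n) % 9) : q ^ l • v = q ^ m • q ^ n • v := by
  rw [smul_smul, ← pow_add, q_pow_congr hq h]

section Induced

variable {X : Type} [AddCommGroup X] [Module ℂ X]

/-- Shift of the components of a triple. -/
def shift (X : Type*) [AddCommGroup X] [Module ℂ X] : (Fin 3 → X) →ₗ[ℂ] (Fin 3 → X) where
  toFun φ := ![0, φ 0, φ 1]
  map_add' _ _ := by ext i; fin_cases i <;> simp
  map_smul' _ _ := by ext i; fin_cases i <;> simp

def indY (q : ℂ) (X : Type*) [AddCommGroup X] [Module ℂ X] :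
    (Fin 3 → Fin 3 → X) →ₗ[ℂ] (Fin 3 → Fin 3 → X) where
  toFun φ i := q ^ (6 * i.val) • shift X (φ i)
  map_add' _ _ := by ext i : 1; simp
  map_smul' c _ := by ext i : 1; simp [smul_comm c]

def indG (q : ℂ) (G : Module.End ℂ X) : (Fin 3 → Fin 3 → X) →ₗ[ℂ] (Fin 3 → Fin 3 → X) where
  toFun φ i j := q ^ (3 * (i.val + j.val)) • G (φ i j)
  map_add' _ _ := by ext i j; simp
  map_smul' c _ := by ext i j; simp [smul_comm c]

theorem indG_pow (G : Module.End ℂ X) (l : ℕ) (φ : Fin 3 → Fin 3 → X) (i j : Fin 3) :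
    (indG q G ^ l) φ i j = q ^ (3 * (i.val + j.val) * l) • (G ^ l) (φ i j) := by
  induction l generalizing φ with
  | zero => simp
  | succ l ih =>
    rw [pow_succ, End.mul_apply, ih, pow_succ G, mul_add (_ * _) l 1, mul_one, pow_add, mul_smul]
    exact congrArg _ (map_smul _ _ _)

theorem rels_ind {G : Module.End ℂ X} (hG : G ^ 9 = 1) :
    (𝓓).Rels (A := Module.End ℂ (Fin 3 → Fin 3 → X)) (indG q G) (shift (Fin 3 → X))
      (indY q X) where
  g_pow := by
    refine lext fun φ => funext fun i => funext fun j => (indG_pow G 9 φ i j).trans ?_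
    rw [hG, q_pow_congr hq (n := 0) (by omega), pow_zero, one_smul]
    rfl
  x_pow := by
    rw [taftNine_n]
    refine lext fun φ => funext fun i => ?_
    fin_cases i <;> rfl
  y_pow := by
    rw [taftNine_m]
    refine lext fun φ => funext fun i => ?_
    change q ^ (6 * i.val) • shift X (q ^ (6 * i.val) • shift X (q ^ (6 * i.val) • shift X (φ i))) = 0
    simp only [map_smul]
    rw [show shift X (shift X (shift X (φ i))) = 0 by ext j; fin_cases j <;> rfl]
    simp only [smul_zero]
  gx := by
    refine lext fun φ => funext fun i => funext fun j => ?_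
    fin_cases i
    · exact (congrArg _ (map_zero G)).trans ((smul_zero _).trans (smul_zero (q ^ 3)).symm)
    all_goals exact q_smul_congr hq _ (by simp [taftNine]; omega)
  gy := by
    refine lext fun φ => funext fun i => funext fun j => ?_
    change q ^ (3 * (i.val + j.val)) • G (q ^ (6 * i.val) • shift X (φ i) j) =
      q ^ 3 • q ^ (6 * i.val) • shift X (fun j => q ^ (3 * (i.val + j.val)) • G (φ i j)) j
    rw [map_smul, smul_comm, smul_comm (q ^ 3)]
    congr 1
    fin_cases j
    · exact (congrArg _ (map_zero G)).trans ((smul_zero _).trans (smul_zero _).symm)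
    all_goals exact q_smul_congr hq _ (by simp; omega)
  xy := by
    refine lext fun φ => funext fun i => ?_
    change shift (Fin 3 → X) (indY q X φ) i = q ^ (1 * 3) • q ^ (6 * i.val) •
      shift X (shift (Fin 3 → X) φ i)
    fin_cases i
    · exact ((congrArg _ ((congrArg _ (map_zero (shift X))).trans (smul_zero _))).trans
        (smul_zero _)).symm
    all_goals exact q_smul_congr hq _ (by simp)

/-- The inclusion of the inducing representation. -/
def unitVec (i j : Fin 3) : X →ₗ[ℂ] (Fin 3 → Fin 3 → X) :=
  LinearMap.single ℂ (fun _ => Fin 3 → X) i ∘ₗ LinearMap.single ℂ (fun _ => X) j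

theorem indG_unitVec (G : Module.End ℂ X) (v : X) :
    indG q G (unitVec 0 0 v) = unitVec 0 0 (G v) := by
  refine funext fun i => funext fun j => ?_
  fin_cases i <;> fin_cases j <;> simp [indG, unitVec]

/-- The module induced from the representation `G` of the cyclic group generated by `g`. -/
def ind [FiniteDimensional ℂ X] {G : Module.End ℂ X} (hG : G ^ 9 = 1) :
    𝓑 :=
  ⟨Fin 3 → Fin 3 → X, lift (rels_ind hq hG)⟩

variable [FiniteDimensional ℂ X] {G : Module.End ℂ X} (hG : G ^ 9 = 1)

theorem ind_g (φ : Fin 3 → Fin 3 → X) : (ind hq hG).ρ (g _) φ = indG q G φ :=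
  lcongr (lift_g (rels_ind hq hG)) φ

theorem ind_x (φ : Fin 3 → Fin 3 → X) : (ind hq hG).ρ (x _) φ = shift _ φ :=
  lcongr (lift_x (rels_ind hq hG)) φ

theorem ind_y (φ : Fin 3 → Fin 3 → X) : (ind hq hG).ρ (y _) φ = indY q X φ :=
  lcongr (lift_y (rels_ind hq hG)) φ

variable {V W : FDMod ℂ (GenTaft (taftNine q hq))}

theorem sum_shift {M : Type*} [AddCommGroup M] [Module ℂ M] {Z : Module.End ℂ M} (hZ : Z ^ 3 = 0)
    {X : Type*} [AddCommGroup X] [Module ℂ X] (f : X →ₗ[ℂ] M) (φ : Fin 3 → X) :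
    ∑ i, (Z ^ i.val) (f (shift X φ i)) = Z (∑ i, (Z ^ i.val) (f (φ i))) := by
  have h := lcongr hZ (f (φ 2))
  rw [Fin.sum_univ_three, Fin.sum_univ_three, map_add, map_add]
  simp only [pow_succ', pow_zero] at h
  simp [shift, pow_succ', End.mul_apply] at h ⊢
  simp [h]

theorem rho_rels (V : 𝓑) :
    (𝓓).Rels (V.ρ (g _)) (V.ρ (x _)) (V.ρ (y _)) := by
  have h := rels 𝓓
  constructor <;> simp only [← map_mul, ← map_pow, ← map_smul, h.g_pow, h.x_pow, h.y_pow, h.gx, h.gy,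
    h.xy, map_one, map_zero]

theorem rho_y_mul_x (V : 𝓑) :
    V.ρ (y _) * V.ρ (x _) = q ^ 6 • (V.ρ (x _) * V.ρ (y _)) := by
  rw [(rho_rels hq V).xy]
  exact (one_smul ℂ _).symm.trans ((congrArg (· • _) (q_pow_congr hq (m := 0) (n := 6 + 3) rfl)).trans
    (by rw [pow_add, mul_smul]; rfl))

/-- The homomorphism from an induced module that extends a homomorphism of representations. -/
def indHom (w : X →ₗ[ℂ] V.carrier) (hw : ∀ v, V.ρ (g _) (w v) = w (G v)) : ind hq hG ⟶ V where
  toLin := ∑ i : Fin 3, (V.ρ (x _) ^ i.val) ∘ₗ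
    (∑ j : Fin 3, (V.ρ (y _) ^ j.val) ∘ₗ w ∘ₗ LinearMap.proj j) ∘ₗ LinearMap.proj i
  comm := by
    have hx3 : V.ρ (x _) ^ 3 = 0 := taftNine_n hq ▸ (rho_rels hq V).x_pow
    have hy3 : V.ρ (y _) ^ 3 = 0 := taftNine_m hq ▸ (rho_rels hq V).y_pow
    set M : (Fin 3 → X) →ₗ[ℂ] V.carrier := ∑ j : Fin 3, (V.ρ (y _) ^ j.val) ∘ₗ w ∘ₗ
      LinearMap.proj j with hM
    have hL : ∀ φ : Fin 3 → Fin 3 → X, (∑ i : Fin 3, (V.ρ (x _) ^ i.val) ∘ₗ M ∘ₗ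
      LinearMap.proj i : (Fin 3 → Fin 3 → X) →ₗ[ℂ] V.carrier) φ = ∑ i, (V.ρ (x _) ^ i.val) (M (φ i)) :=
      fun φ => by simp
    have hM' : ∀ φ, M φ = ∑ j, (V.ρ (y _) ^ j.val) (w (φ j)) := fun φ => by simp [hM]
    refine comm_of_generators ?_ ?_ ?_
    all_goals refine lext fun φ : Fin 3 → Fin 3 → X => ?_
    · refine (congrArg _ (ind_g hq hG φ)).trans ((hL _).trans (.trans ?_
        (congrArg _ (hL φ)).symm))
      refine .trans (sum_congr rfl fun i _ => ?_) (map_sum (V.ρ (g _)) _ _).symm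
      rw [hM', hM', ← End.mul_apply (V.ρ (g _)), comm_pow (rho_rels hq V).gx,
        LinearMap.smul_apply, End.mul_apply, map_sum, map_sum, map_sum, Finset.smul_sum]
      refine sum_congr rfl fun j _ => ?_
      rw [← End.mul_apply (V.ρ (g _)), comm_pow (rho_rels hq V).gy, LinearMap.smul_apply,
        map_smul, End.mul_apply, hw]
      change (V.ρ (x _) ^ i.val) ((V.ρ (y _) ^ j.val) (w (q ^ (3 * (i.val + j.val)) • G (φ i j)))) =
        (q ^ 3) ^ i.val • (q ^ 3) ^ j.val • _
      rw [map_smul, map_smul, map_smul, ← pow_mul, ← pow_mul]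
      exact q_smul_congr hq _ (by rw [mul_add])
    · exact (congrArg _ (ind_x hq hG φ)).trans ((hL _).trans ((sum_shift hx3 M φ).trans
        (congrArg _ (hL φ)).symm))
    · refine (congrArg _ (ind_y hq hG φ)).trans ((hL _).trans (.trans ?_
        (congrArg _ (hL φ)).symm))
      refine .trans (sum_congr rfl fun i _ => ?_) (map_sum (V.ρ (y _)) _ _).symm
      rw [← End.mul_apply (V.ρ (y _)), comm_pow (rho_y_mul_x hq V), LinearMap.smul_apply,
        End.mul_apply, hM' (φ i), ← sum_shift hy3 w, ← hM', ← pow_mul, ← map_smul, ← map_smul]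
      rfl

theorem indHom_unitVec {w : X →ₗ[ℂ] V.carrier} (hw : ∀ v, V.ρ (g _) (w v) = w (G v)) (v : X) :
    (indHom hq hG w hw).toLin (unitVec 0 0 v) = w v := by
  change (∑ i : Fin 3, (V.ρ (x _) ^ i.val) ∘ₗ
    (∑ j : Fin 3, (V.ρ (y _) ^ j.val) ∘ₗ w ∘ₗ LinearMap.proj j) ∘ₗ LinearMap.proj i) (unitVec 0 0 v) = _
  simp [Fin.sum_univ_three, unitVec]

theorem sum_unitVec (φ : Fin 3 → Fin 3 → X) : ∑ i : Fin 3, ((ind hq hG).ρ (x _) ^ i.val)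
    (∑ j : Fin 3, ((ind hq hG).ρ (y _) ^ j.val) (unitVec 0 0 (φ i j))) = φ := by
  change ∑ i : Fin 3, (lift (rels_ind hq hG) (x _) ^ i.val)
    (∑ j : Fin 3, (lift (rels_ind hq hG) (y _) ^ j.val) (unitVec 0 0 (φ i j))) = φ
  rw [lift_x, lift_y]
  refine funext fun i => funext fun j => ?_
  fin_cases i <;> fin_cases j <;>
    simp [Fin.sum_univ_three, unitVec, shift, indY, pow_succ, End.mul_apply]

theorem toLin_ind (f : ind hq hG ⟶ V) (φ : Fin 3 → Fin 3 → X) : f.toLin φ =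
    ∑ i : Fin 3, (V.ρ (x _) ^ i.val)
      (∑ j : Fin 3, (V.ρ (y _) ^ j.val) (f.toLin (unitVec 0 0 (φ i j)))) := by
  have hf : ∀ h (k : ℕ) ψ, f.toLin (((ind hq hG).ρ h ^ k) ψ) = (V.ρ h ^ k) (f.toLin ψ) :=
    fun h k ψ => by
      rw [← map_pow, ← map_pow]
      exact comm_apply f _ ψ
  refine (congrArg f.toLin (sum_unitVec hq hG φ).symm).trans ?_
  exact (map_sum f.toLin _ _).trans (sum_congr rfl fun i _ => (hf _ _ _).trans
    (congrArg _ ((map_sum f.toLin _ _).trans (sum_congr rfl fun j _ => hf _ _ _))))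

theorem ind_ext {f f' : ind hq hG ⟶ V}
    (h : ∀ v, f.toLin (unitVec 0 0 v) = f'.toLin (unitVec 0 0 v)) : f = f' :=
  FDMod.hom_ext (lext fun φ => (toLin_ind hq hG f φ).trans
    (.trans (sum_congr rfl fun _ _ => congrArg _ (sum_congr rfl fun _ _ =>
      congrArg _ (h _))) (toLin_ind hq hG f' φ).symm))

theorem projective_ind : Projective (ind hq hG) where
  factors {V W} f e _ := by
    obtain ⟨r, hr⟩ := LinearMap.exists_rightInverse_of_surjective e.toLin
      (LinearMap.range_eq_top.2 (surjective_of_epi e))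
    set u : X →ₗ[ℂ] W.carrier := f.toLin ∘ₗ unitVec 0 0
    have hu : ∀ v, W.ρ (g _) (u v) = u (G v) := fun v =>
      (comm_apply f (g _) _).symm.trans (congrArg f.toLin
        ((ind_g hq hG _).trans (indG_unitVec G v)))
    have hul : ∀ l v, (W.ρ (g _) ^ l) (u v) = u ((G ^ l) v) := fun l v => by
      induction l generalizing v with
      | zero => rfl
      | succ l ih => rw [pow_succ, End.mul_apply, hu, ih, pow_succ, End.mul_apply]
    have he : ∀ l v, e.toLin ((V.ρ (g _) ^ l) v) = (W.ρ (g _) ^ l) (e.toLin v) := fun l v => by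
      rw [← map_pow, ← map_pow]
      exact comm_apply e _ v
    set F : ℕ → X →ₗ[ℂ] V.carrier := fun l => (V.ρ (g _) ^ (8 * l)) ∘ₗ r ∘ₗ u ∘ₗ (G ^ l) with hF
    have h9 : ∀ V : 𝓑, V.ρ (g _) ^ 9 = 1 := fun V =>
      (rho_rels hq V).g_pow
    have hF9 : F 9 = F 0 := by
      have h72 : V.ρ (g _) ^ (8 * 9) = 1 := by rw [mul_comm, pow_mul, h9, one_pow]
      simp only [hF, hG, h72, mul_zero, pow_zero]
    have hgF : ∀ l v, V.ρ (g _) (F (l + 1) v) = F l (G v) := fun l v => by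
      simp only [hF, LinearMap.comp_apply]
      rw [← End.mul_apply, ← pow_succ', ← End.mul_apply, ← pow_succ,
        show 8 * (l + 1) + 1 = 8 * l + 9 by ring, pow_add, h9, mul_one]
    have hsum : ∑ l ∈ Finset.range 9, F (l + 1) = ∑ l ∈ Finset.range 9, F l := by
      have := (Finset.sum_range_succ F 9).symm.trans (Finset.sum_range_succ' F 9)
      rw [hF9] at this
      exact (add_right_cancel this).symm
    refine ⟨indHom hq hG ((1 / 9 : ℂ) • ∑ l ∈ Finset.range 9, F l) fun v => ?_,
      ind_ext hq hG fun v => ?_⟩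
    · conv_lhs => rw [← hsum]
      simp only [LinearMap.smul_apply, LinearMap.sum_apply, map_smul, map_sum, hgF]
    · refine (congrArg e.toLin (indHom_unitVec hq hG _ v)).trans ?_
      have h1 : ∀ l, e.toLin (F l v) = u v := fun l => by
        simp only [hF, LinearMap.comp_apply]
        rw [he, show e.toLin (r _) = _ from lcongr hr _, LinearMap.id_apply,
          ← hul l, ← End.mul_apply, ← pow_add, show 8 * l + l = 9 * l by ring, pow_mul,
          h9, one_pow, End.one_apply]
      simp only [LinearMap.smul_apply, LinearMap.sum_apply, map_smul, map_sum, h1]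
      rw [Finset.sum_const, Finset.card_range, ← Nat.cast_smul_eq_nsmul ℂ, smul_smul]
      norm_num
      rfl

end Induced

/-- The character with `g ↦ q ^ c` and `x, y ↦ 0`. -/
def character (D : TaftData) (c : ℕ) : GenTaft D →ₐ[ℂ] ℂ :=
  lift (g' := D.q ^ c) (x' := 0) (y' := 0)
    { (rels_counit D) with
      g_pow := by rw [← pow_mul, mul_comm, pow_mul, D.primitive.pow_eq_one, one_pow]
      gx := by simp
      gy := by simp }

theorem character_g (D : TaftData) (c : ℕ) : character D c (g D) = D.q ^ c := lift_g _

theorem character_x (D : TaftData) (c : ℕ) : character D c (x D) = 0 := lift_x _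

theorem character_y (D : TaftData) (c : ℕ) : character D c (y D) = 0 := lift_y _

/-- The projection to the eigenvectors of `g` with eigenvalue `q ^ 3`. -/
def idem : GenTaft 𝓓 :=
  (1 / 9 : ℂ) • ∑ l ∈ Finset.range 9, q ^ (6 * l) • g 𝓓 ^ l

theorem map_idem {A : Type*} [Ring A] [Algebra ℂ A] (f : GenTaft 𝓓 →ₐ[ℂ] A) :
    f (idem hq) = (1 / 9 : ℂ) • ∑ l ∈ Finset.range 9, q ^ (6 * l) • f (g _) ^ l := by
  simp [idem]

theorem g_mul_idem : g _ * idem hq = q ^ 3 • idem hq := by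
  set F : ℕ → GenTaft 𝓓 := fun l => q ^ (6 * l) • g 𝓓 ^ l with hF
  have hF9 : F 9 = F 0 := by
    simp only [hF]
    rw [q_pow_congr hq (m := 6 * 9) (n := 6 * 0) rfl, pow_zero (g _),
      show g 𝓓 ^ 9 = 1 from (rels _).g_pow]
  have hsum := (Finset.sum_range_succ F 9).symm.trans (Finset.sum_range_succ' F 9)
  rw [hF9] at hsum
  rw [idem, mul_smul_comm, smul_comm]
  refine congrArg _ ((Finset.mul_sum _ _ _).trans ((sum_congr rfl fun l _ => ?_).trans
    ((Finset.smul_sum (r := q ^ 3) (f := fun l => F (l + 1))).symm.trans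
      (congrArg (q ^ 3 • ·) (add_right_cancel hsum).symm))))
  rw [mul_smul_comm, ← pow_succ']
  exact q_smul_congr hq _ (by omega)

theorem rho_idem {V : 𝓑} {v : V.carrier}
    (h : V.ρ (g _) v = q ^ 3 • v) : V.ρ (idem hq) v = v := by
  have h1 : ∀ l, q ^ (6 * l) • (V.ρ (g _) ^ l) v = v := fun l => by
    rw [← map_pow, rho_g_pow h, ← pow_mul, smul_smul, ← pow_add,
      q_pow_congr hq (n := 0) (by omega), pow_zero, one_smul]
  rw [map_idem, LinearMap.smul_apply, LinearMap.sum_apply]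
  simp only [LinearMap.smul_apply, h1]
  rw [Finset.sum_const, Finset.card_range, ← Nat.cast_smul_eq_nsmul ℂ, smul_smul]
  norm_num

/-- An element of the socle of the regular module. -/
def integral : GenTaft 𝓓 := x _ ^ 2 * y _ ^ 2 * idem hq

section Induced

variable {X : Type} [AddCommGroup X] [Module ℂ X] [FiniteDimensional ℂ X] {G : Module.End ℂ X}
  (hG : G ^ 9 = 1)

theorem ind_integral (φ ψ : Fin 3 → Fin 3 → X) (h : (ind hq hG).ρ (idem hq) φ = ψ) :
    (ind hq hG).ρ (integral hq) φ = unitVec 2 2 (ψ 0 0) := by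
  have h1 : (ind hq hG).ρ (integral hq) φ = (shift (Fin 3 → X) ^ 2) ((indY q X ^ 2) ψ) := by
    subst h
    rw [integral, map_mul, map_mul, map_pow, map_pow]
    exact congrArg₂ (fun a b : Module.End ℂ (Fin 3 → Fin 3 → X) =>
      (a ^ 2) ((b ^ 2) ((ind hq hG).ρ (idem hq) φ)))
      (lift_x (rels_ind hq hG)) (lift_y (rels_ind hq hG))
  refine h1.trans (funext fun i => funext fun j => ?_)
  fin_cases i <;> fin_cases j <;>
    simp [unitVec, shift, indY, pow_succ, End.mul_apply]

theorem isInvFun_ind {c : ℕ} {f : (ind hq hG).carrier →ₗ[ℂ] ℂ}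
    (hf : IsInvFun (character _ c) f) (φ : Fin 3 → Fin 3 → X) :
    f φ = f (unitVec 0 0 (φ 0 0)) := by
  have h0 : ∀ h : GenTaft 𝓓, character _ c h = 0 → ∀ (l : ℕ) v,
      f (((ind hq hG).ρ h ^ l) v) = 0 ^ l * f v := fun h hh l v => by
    rw [← map_pow, hf, map_pow, hh]
  refine (congrArg f (sum_unitVec hq hG φ).symm).trans ?_
  have h1 := h0 _ (character_x _ c)
  have h2 := h0 _ (character_y _ c)
  refine (map_sum f _ _).trans ((sum_congr rfl fun i _ => (h1 _ _).trans (congrArg _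
    ((map_sum f _ _).trans (sum_congr rfl fun j _ => h2 _ _)))).trans ?_)
  simp [Fin.sum_univ_three]

end Induced

section Projective

variable {V : FDMod ℂ (GenTaft (taftNine q hq))} (hV : Projective V)

/-- The module induced from the restriction of a module. -/
abbrev freeCover (V : 𝓑) : 𝓑 :=
  ind hq (G := V.ρ (g _)) (rho_rels hq V).g_pow

include hV in
theorem exists_section : ∃ (π : freeCover hq V ⟶ V) (σ : V ⟶ freeCover hq V),
    (∀ v, π.toLin (unitVec 0 0 v) = v) ∧ ∀ v, π.toLin (σ.toLin v) = v := by
  set π := indHom hq (G := V.ρ (g _)) (rho_rels hq V).g_pow (V := V) LinearMap.id fun v => rfl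
  have hπ := indHom_unitVec hq (G := V.ρ (g _)) (rho_rels hq V).g_pow (V := V)
    (w := LinearMap.id) fun v => rfl
  obtain ⟨σ, hσ⟩ := exists_lift hV (𝟙 V) (g := π) fun v => ⟨_, hπ v⟩
  exact ⟨π, σ, hπ, hσ⟩

include hV in
theorem socle_projective (v : V.carrier) (hv : IsInvVec (character _ 6) v) :
    ∃ s, V.ρ (integral hq) s = v := by
  obtain ⟨π, σ, hπ, hσ⟩ := exists_section hq hV
  obtain ⟨Φ, hΦ⟩ : ∃ Φ : Fin 3 → Fin 3 → V.carrier, Φ = σ.toLin v := ⟨_, rfl⟩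
  have hinv : ∀ h, (freeCover hq V).ρ h Φ =
      character _ 6 h • Φ := fun h => by
    subst hΦ
    exact (comm_apply σ h v).symm.trans ((congrArg σ.toLin (hv h)).trans
      (map_smul σ.toLin _ _))
  have hx : shift _ Φ = 0 := (ind_x hq _ Φ).symm.trans ((hinv _).trans
    ((congrArg (· • Φ) (character_x _ 6)).trans (zero_smul ℂ Φ)))
  have hy : indY q _ Φ = 0 := (ind_y hq _ Φ).symm.trans ((hinv _).trans
    ((congrArg (· • Φ) (character_y _ 6)).trans (zero_smul ℂ Φ)))
  have hg : indG q (V.ρ (g _)) Φ = q ^ 6 • Φ := (ind_g hq _ Φ).symm.trans ((hinv _).trans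
    (congrArg (· • Φ) (character_g _ 6)))
  have h0 : Φ 0 = 0 := congrFun hx 1
  have h1 : Φ 1 = 0 := congrFun hx 2
  have hq0 : q ^ 12 ≠ 0 := pow_ne_zero _ (hq.ne_zero (by norm_num))
  have h20 : Φ 2 0 = 0 := (smul_eq_zero.1 (congrFun (congrFun hy 2) 1)).resolve_left hq0
  have h21 : Φ 2 1 = 0 := (smul_eq_zero.1 (congrFun (congrFun hy 2) 2)).resolve_left hq0
  have hΦ22 : Φ = unitVec 2 2 (Φ 2 2) := funext fun i => funext fun j => by
    fin_cases i <;> fin_cases j <;> simp [unitVec, h0, h1, h20, h21]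
  have hG : V.ρ (g _) (Φ 2 2) = q ^ 3 • Φ 2 2 := by
    have h := congrArg (q ^ 6 • ·) (congrFun (congrFun hg 2) 2)
    exact (one_smul ℂ _).symm.trans (((congrArg (· • _) (pow_zero q).symm).trans
      (q_smul_congr hq _ rfl)).trans (h.trans (q_smul_congr hq (l := 3) _ rfl).symm))
  refine ⟨Φ 2 2, ?_⟩
  have he := rho_idem hq (V := freeCover hq V)
    (v := unitVec 0 0 (Φ 2 2)) ((ind_g hq _ _).trans ((indG_unitVec _ _).trans
      ((congrArg _ hG).trans (map_smul _ _ _))))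
  conv_lhs => rw [← hπ (Φ 2 2)]
  refine (comm_apply π _ _).symm.trans ((congrArg π.toLin
    ((ind_integral hq _ _ _ he).trans ((congrArg (unitVec 2 2) ?_).trans hΦ22.symm))).trans
      ((congrArg π.toLin hΦ).trans (hσ v)))
  simp [unitVec]

include hV in
theorem ker_projective (v : V.carrier) (hv : V.ρ (integral hq) v = 0) :
    IsRadVec (character _ 3) v := by
  intro f hf
  obtain ⟨π, σ, hπ, hσ⟩ := exists_section hq hV
  obtain ⟨Ψ, hΨ⟩ : ∃ Ψ : Fin 3 → Fin 3 → V.carrier, (freeCover hq V).ρ (idem hq) (σ.toLin v) = Ψ := ⟨_, rfl⟩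
  have h0 : Ψ 0 0 = 0 := by
    have h1 : unitVec 2 2 (Ψ 0 0) = 0 := (ind_integral hq _ _ _ hΨ).symm.trans
      ((comm_apply σ _ v).symm.trans ((congrArg σ.toLin hv).trans (map_zero _)))
    simpa [unitVec] using congrFun (congrFun h1 2) 2
  have hfπ : IsInvFun (V := freeCover hq V) (character _ 3) (f ∘ₗ π.toLin) := fun h w =>
    (congrArg f (comm_apply π h w)).trans (hf h _)
  have he : character _ 3 (idem hq) = 1 := by
    have h1 : ∀ l, q ^ (6 * l) • (q ^ 3) ^ l = 1 := fun l => by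
      rw [← pow_mul, smul_eq_mul, ← pow_add, q_pow_congr hq (n := 0) (by omega), pow_zero]
    rw [map_idem, character_g]
    refine (congrArg _ (sum_congr rfl fun l _ => h1 l)).trans ?_
    simp
  calc f v = (f ∘ₗ π.toLin) (σ.toLin v) := (congrArg f (hσ v)).symm
    _ = (f ∘ₗ π.toLin) ((freeCover hq V).ρ (idem hq) (σ.toLin v)) := by rw [hfπ, he, one_mul]
    _ = 0 := (congrArg _ hΨ).trans ((isInvFun_ind hq _ hfπ Ψ).trans
      ((congrArg (f ∘ₗ π.toLin ∘ₗ unitVec 0 0) h0).trans (map_zero _)))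

end Projective

theorem simple_T (D : TaftData) (c : ℕ) : Simple (T D c) where
  mono_isIso_iff_nonzero {Y} f _ := by
    constructor
    · intro _ h0
      have := toLin_congr (IsIso.inv_hom_id f) (1 : ℂ)
      subst h0
      exact zero_ne_one (α := ℂ) this
    · intro h0
      refine isIso_of_bijective ⟨injective_of_mono f, ?_⟩
      obtain ⟨y, hy⟩ : ∃ y, f.toLin y ≠ 0 := by
        by_contra! h
        exact h0 (FDMod.hom_ext (lext h))
      intro z
      refine ⟨((show ℂ from z) / (show ℂ from f.toLin y)) • y, (map_smul f.toLin _ _).trans ?_⟩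
      exact div_mul_cancel₀ (G₀ := ℂ) _ hy

theorem unitVec_injective (i j : Fin 3) : Function.Injective (unitVec (X := ℂ) i j) :=
  fun a b h => by simpa [unitVec] using congrFun (congrFun h i) j

theorem mono_of_injective {D : TaftData} {V W : FDMod ℂ (GenTaft D)} {f : V ⟶ W}
    (hf : Function.Injective f.toLin) : Mono f where
  right_cancellation _ _ h := FDMod.hom_ext (lext fun v =>
    hf (toLin_congr h v))

/-- The inclusion of the socle of an induced module. -/
def socleHom {d : ℕ} {G : Module.End ℂ ℂ} (hG : G ^ 9 = 1) (h : ∀ a, q ^ 12 • G a = q ^ d • a) :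
    T 𝓓 d ⟶ ind hq hG where
  toLin := unitVec (X := ℂ) 2 2
  comm := by
    refine comm_of_generators (V := T _ d) (W := ind hq hG) ?_ ?_ ?_
    all_goals refine lext fun a : ℂ => ?_
    · refine (congrArg (unitVec (X := ℂ) 2 2) ((T_g d a).trans (h a).symm)).trans
        (.trans (funext fun i => funext fun j => ?_) (ind_g hq hG (unitVec (X := ℂ) 2 2 a)).symm)
      fin_cases i <;> fin_cases j <;> simp [unitVec, indG]
    · refine (congrArg (unitVec (X := ℂ) 2 2) (T_x d a)).trans
        (.trans (funext fun i => funext fun j => ?_) (ind_x hq hG (unitVec (X := ℂ) 2 2 a)).symm)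
      fin_cases i <;> fin_cases j <;> simp [unitVec, shift] <;> rfl
    · refine (congrArg (unitVec (X := ℂ) 2 2) (T_y d a)).trans
        (.trans (funext fun i => funext fun j => ?_) (ind_y hq hG (unitVec (X := ℂ) 2 2 a)).symm)
      fin_cases i <;> fin_cases j <;> simp [unitVec, shift, indY] <;> rfl

theorem span_of_apply_zero {z : Fin 3 → Fin 3 → ℂ} (hz : z 0 0 = 1) (ψ : Fin 3 → Fin 3 → ℂ) :
    ∃ φ : Fin 3 → Fin 3 → ℂ, ∑ i : Fin 3, (shift (Fin 3 → ℂ) ^ i.val)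
      (∑ j : Fin 3, (indY q ℂ ^ j.val) (φ i j • z)) = ψ := by
  let L : (Fin 3 → Fin 3 → ℂ) →ₗ[ℂ] (Fin 3 → Fin 3 → ℂ) := ∑ i : Fin 3, (shift _ ^ i.val) ∘ₗ
    (∑ j : Fin 3, (indY q ℂ ^ j.val) ∘ₗ (LinearMap.proj j).smulRight z) ∘ₗ LinearMap.proj i
  have hL : ∀ φ, L φ = ∑ i : Fin 3, (shift (Fin 3 → ℂ) ^ i.val)
      (∑ j : Fin 3, (indY q ℂ ^ j.val) (φ i j • z)) := fun φ => by simp [L]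
  have hinj : Function.Injective L := by
    rw [← LinearMap.ker_eq_bot, LinearMap.ker_eq_bot']
    intro φ hφ
    have h : ∀ i j, L φ i j = 0 := fun i j => congrFun (congrFun hφ i) j
    simp only [hL, Fin.sum_univ_three, pow_succ, pow_zero, Fin.val_zero, Fin.val_one, Fin.val_two,
      End.mul_apply, End.one_apply, shift, indY, LinearMap.coe_mk, AddHom.coe_mk,
      Pi.add_apply, one_mul] at h
    have h00 : φ 0 0 = 0 := by simpa [hz, Matrix.vecHead] using h 0 0
    have h01 : φ 0 1 = 0 := by simpa [hz, Matrix.vecHead, h00] using h 0 1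
    have h02 : φ 0 2 = 0 := by simpa [hz, Matrix.vecHead, h00, h01] using h 0 2
    have h10 : φ 1 0 = 0 := by simpa [hz, Matrix.vecHead, h00, h01, h02] using h 1 0
    have h11 : φ 1 1 = 0 := by simpa [hz, Matrix.vecHead, h00, h01, h02, h10] using h 1 1
    have h12 : φ 1 2 = 0 := by simpa [hz, Matrix.vecHead, h00, h01, h02, h10, h11] using h 1 2
    have h20 : φ 2 0 = 0 := by simpa [hz, Matrix.vecHead, h00, h01, h02, h10, h11, h12] using h 2 0
    have h21 : φ 2 1 = 0 := by simpa [hz, Matrix.vecHead, h00, h01, h02, h10, h11, h12, h20] using h 2 1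
    have h22 : φ 2 2 = 0 := by simpa [hz, Matrix.vecHead, h00, h01, h02, h10, h11, h12, h20, h21] using h 2 2
    refine funext fun i => funext fun j => ?_
    fin_cases i <;> fin_cases j <;> assumption
  obtain ⟨φ, hφ⟩ := (LinearMap.injective_iff_surjective.1 hinj) ψ
  exact ⟨φ, (hL φ).symm.trans hφ⟩

theorem not_isUnimodular : ¬ IsUnimodular (𝓑) := by
  intro hU
  have hw : ∀ v : ℂ, (𝟙_ (𝓑)).ρ (g _) v = v := fun v =>
    (congrArg (· * v) (lift_g (rels_counit _))).trans (one_mul v)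
  let π : ind hq (X := ℂ) (one_pow 9) ⟶ 𝟙_ _ := indHom hq (one_pow 9) LinearMap.id hw
  have hπ : ∀ φ, π.toLin φ = (φ 0 0 : ℂ) := fun φ => by
    have hc : IsInvFun (character 𝓓 0) π.toLin := fun h v =>
      (comm_apply π h v).trans (congrArg (· * (show ℂ from π.toLin v))
        (DFunLike.congr_fun (algHom_ext (by simp [counit, character_g])
          (by simp [counit, character_x]) (by simp [counit, character_y]) :
            counit _ = character 𝓓 0) h))
    exact (isInvFun_ind hq _ hc φ).trans (indHom_unitVec hq _ hw _)
  have hcov : IsProjectiveCover π := by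
    refine ⟨projective_ind hq _, epi_of_surjective fun c => ⟨unitVec 0 0 (show ℂ from c),
      indHom_unitVec hq _ hw c⟩, fun Q h _ => epi_of_surjective fun ψ => ?_⟩
    obtain ⟨d, hd⟩ := surjective_of_epi (h ≫ π) (1 : ℂ)
    obtain ⟨φ, hφ⟩ := span_of_apply_zero (q := q) (z := h.toLin d) ((hπ _).symm.trans hd) ψ
    refine ⟨∑ i : Fin 3, (Q.ρ (x _) ^ i.val) (∑ j : Fin 3, (Q.ρ (y _) ^ j.val) (φ i j • d)), ?_⟩
    have hf : ∀ a (k : ℕ) v, h.toLin ((Q.ρ a ^ k) v) =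
        ((ind hq (X := ℂ) (one_pow 9)).ρ a ^ k) (h.toLin v) := fun a k v => by
      rw [← map_pow, ← map_pow]
      exact comm_apply h _ v
    refine (map_sum h.toLin _ _).trans ((sum_congr rfl fun i _ => (hf _ _ _).trans
      (congrArg _ ((map_sum h.toLin _ _).trans (sum_congr rfl fun j _ => (hf _ _ _).trans
        (congrArg _ (map_smul h.toLin _ _)))))).trans (.trans ?_ hφ))
    exact congrArg₂ (fun a b : Module.End ℂ (Fin 3 → Fin 3 → ℂ) => ∑ i : Fin 3, (a ^ i.val)
      (∑ j : Fin 3, (b ^ j.val) (φ i j • h.toLin d)))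
      (lift_x (rels_ind hq (one_pow 9))) (lift_y (rels_ind hq (one_pow 9)))
  have hmono : Mono (socleHom hq (d := 3) (one_pow 9) fun a =>
      congrArg (· • a) (q_pow_congr hq rfl)) :=
    mono_of_injective (unitVec_injective 2 2)
  obtain ⟨e⟩ := hU _ _ π _ hcov (simple_T _ 3) hmono
  have h1 := (comm_apply e.hom (g _) (1 : ℂ)).trans (hw _)
  have h2 : q ^ 3 • (show ℂ from e.hom.toLin (1 : ℂ)) = e.hom.toLin (1 : ℂ) :=
    (map_smul e.hom.toLin _ _).symm.trans ((congrArg e.hom.toLin (T_g 3 (1 : ℂ)).symm).trans h1)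
  have h3 : (show ℂ from e.hom.toLin (1 : ℂ)) ≠ 0 := fun h =>
    one_ne_zero (α := ℂ) ((toLin_inv_hom e (1 : ℂ)).symm.trans
      ((congrArg e.inv.toLin h).trans (map_zero _)))
  exact hq.pow_ne_one_of_pos_of_lt (l := 3) (by norm_num) (by norm_num)
    (mul_right_cancel₀ h3 (h2.trans (one_mul _).symm))

section Skew

variable {A : Type*} [Ring A] [Algebra ℂ A] (g2 z1 z2 : A)
  (r : ℕ)

/-- The coproduct `z2 + z1 g2 ^ r` of a skew-primitive element, with the first term rescaled. -/
def skew (c : ℂ) : A := c • z2 + z1 * g2 ^ r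

variable {g1 g2 z1 z2} (h11 : g1 * z1 = q ^ 3 • (z1 * g1)) (h12 : Commute g1 z2)
  (h21 : Commute g2 z1) (h22 : g2 * z2 = q ^ 3 • (z2 * g2)) (hz : Commute z1 z2)
  (hg : Commute g1 g2) (hg2 : g2 ^ 9 = 1)

include h21 h22 in
theorem pow_mul_skew (k : ℕ) (c : ℂ) :
    g2 ^ k * skew g2 z1 z2 r c = skew g2 z1 z2 r (q ^ (3 * k) * c) * g2 ^ k := by
  rw [skew, skew, mul_add, add_mul, mul_smul_comm, pow_comm h22, smul_smul, smul_mul_assoc,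
    ← mul_assoc, (h21.pow_left k).eq, mul_assoc, mul_assoc, ← pow_add, ← pow_add, add_comm k r,
    mul_comm c, ← pow_mul]

include h21 h22 hz in
theorem skew_mul_skew {c d : ℂ} (h : c * d = 1) (h' : c + d * q ^ (3 * r) = 1 + q ^ (3 * r)) :
    skew g2 z1 z2 r c * skew g2 z1 z2 r d = skew g2 z1 z2 r 1 * skew g2 z1 z2 r 1 := by
  have key : ∀ c d, skew g2 z1 z2 r c * skew g2 z1 z2 r d = (c * d) • (z2 * z2) +
      (c + d * q ^ (3 * r)) • (z1 * z2 * g2 ^ r) + z1 * (z1 * (g2 ^ r * g2 ^ r)) := fun c d => by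
    have h1 : z1 * g2 ^ r * z2 = q ^ (3 * r) • (z1 * z2 * g2 ^ r) := by
      rw [mul_assoc, pow_comm h22, mul_smul_comm, ← mul_assoc, ← pow_mul]
    have h2 : z1 * g2 ^ r * (z1 * g2 ^ r) = z1 * (z1 * (g2 ^ r * g2 ^ r)) := by
      rw [mul_assoc, ← mul_assoc _ z1, (h21.pow_left r).eq, mul_assoc]
    rw [skew, skew, add_mul, mul_add, mul_add, smul_mul_smul_comm, mul_smul_comm, h1, h2,
      smul_mul_assoc, ← mul_assoc z2, ← hz.eq, add_smul, smul_smul]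
    abel
  rw [key, key, h, h', one_mul, one_mul]

include h11 h12 h21 h22 hg in
theorem mul_coskew {u : A} {κ : ℂ} (hu : g1 * g2 * u = κ • u) :
    g1 * g2 * ((z1 + z2 * g1 ^ r) * u) = (q ^ 3 * κ) • ((z1 + z2 * g1 ^ r) * u) := by
  have h1 : g1 * g2 * (z1 + z2 * g1 ^ r) = q ^ 3 • ((z1 + z2 * g1 ^ r) * (g1 * g2)) := by
    have h3 : g1 * g2 * z1 = q ^ 3 • (z1 * (g1 * g2)) := by
      rw [mul_assoc, h21.eq, ← mul_assoc, h11, smul_mul_assoc, mul_assoc]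
    have h4 : g1 * g2 * z2 = q ^ 3 • (z2 * (g1 * g2)) := by
      rw [mul_assoc, h22, mul_smul_comm, ← mul_assoc, h12.eq, mul_assoc]
    have h5 : g1 * g2 * g1 ^ r = g1 ^ r * (g1 * g2) :=
      (((Commute.refl g1).mul_left hg.symm).pow_right r).eq
    rw [mul_add, add_mul, smul_add, h3, ← mul_assoc _ z2, h4, smul_mul_assoc, mul_assoc z2, h5,
      mul_assoc z2]
  rw [← mul_assoc, h1, smul_mul_assoc, mul_assoc, hu, mul_smul_comm, smul_smul]

include h21 h22 hg in
theorem pow_mul_coskew {u : A} {κ : ℂ} (hu : g1 * g2 * u = κ • u) :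
    g2 ^ r * ((z1 + z2 * g1 ^ r) * u) = skew g2 z1 z2 r (q ^ (3 * r) * κ ^ r) * u := by
  have h1 : ∀ r, (g1 * g2) ^ r * u = κ ^ r • u := fun r => by
    induction r with
    | zero => simp
    | succ r ih => rw [pow_succ', mul_assoc, ih, mul_smul_comm, hu, smul_smul, pow_succ]
  have h2 : g2 ^ r * (z2 * g1 ^ r * u) = (q ^ (3 * r) * κ ^ r) • (z2 * u) := by
    rw [← mul_assoc, ← mul_assoc, pow_comm h22, smul_mul_assoc, smul_mul_assoc, mul_assoc z2,
      ← (hg.pow_pow r r).eq, ← hg.mul_pow, mul_assoc, h1, mul_smul_comm, smul_smul, ← pow_mul]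
  rw [skew, add_mul, mul_add, h2, ← mul_assoc, (h21.pow_left r).eq, add_mul, smul_mul_assoc,
    add_comm]

include hq h11 h12 h21 h22 hz hg hg2 in
theorem coskew_mul_coskew {u : A} {i j s : ℕ} (hs : r + s = 9) (hu : g1 * g2 * u = q ^ i • u)
    (h : (i * r + 24 * j) % 9 = 3 * r % 9) :
    (z1 + z2 * g1 ^ r) * ((z1 + z2 * g1 ^ r) * (g2 ^ j * u)) =
      g2 ^ (2 * s + j) * (skew g2 z1 z2 r 1 * (skew g2 z1 z2 r 1 * u)) := by
  have hsr : ∀ v : A, g2 ^ s * (g2 ^ r * v) = v := fun v => by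
    rw [← mul_assoc, ← pow_add, add_comm s, hs, hg2, one_mul]
  have hj : g1 * g2 * (g2 ^ j * u) = q ^ i • (g2 ^ j * u) := by
    rw [← mul_assoc, ((hg.mul_left (Commute.refl g2)).pow_right j).eq, mul_assoc, hu, mul_smul_comm]
  have h1 := pow_mul_coskew r h21 h22 hg hj
  have h2 := pow_mul_coskew r h21 h22 hg (mul_coskew r h11 h12 h21 h22 hg hj)
  have hm : ∀ (k : ℕ) c (v : A), skew g2 z1 z2 r c * (g2 ^ k * v) =
      g2 ^ k * (skew g2 z1 z2 r (q ^ (24 * k) * c) * v) := fun k c v => by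
    rw [← mul_assoc, ← mul_assoc, pow_mul_skew r h21 h22, ← mul_assoc, ← pow_add,
      q_pow_congr hq (n := 0) (by omega), pow_zero, one_mul]
  rw [← hsr (_ * (_ * (g2 ^ j * u))), h2, ← hsr (_ * (g2 ^ j * u)), h1, hm j, ← mul_assoc (g2 ^ s) (g2 ^ j),
    ← pow_add g2 s j, hm (s + j), ← mul_assoc (skew ..), skew_mul_skew r h21 h22 hz, mul_assoc (skew ..),
    ← mul_assoc, ← pow_add g2, ← add_assoc, two_mul]
  · simp only [← pow_mul, ← pow_add]
    refine (q_pow_congr hq (n := 0) ?_).trans (pow_zero q)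
    rw [add_mul]
    omega
  · simp only [← pow_mul, ← pow_add]
    rw [add_comm, add_mul]
    exact congrArg₂ _ ((q_pow_congr hq (n := 0) (by omega)).trans (pow_zero q))
      (q_pow_congr hq (by omega))

end Skew

theorem comm_comul_integral (q : ℂ) (hq : IsPrimitiveRoot q 9) :
    comul _ (integral hq) * (1 ⊗ₜ[ℂ] (g (taftNine q hq) ^ 3)) =
      1 ⊗ₜ[ℂ] (g (taftNine q hq) ^ 6) *
        Algebra.TensorProduct.comm ℂ _ _ (comul _ (integral hq)) := by
  set D := taftNine q hq
  set g1 : GenTaft D ⊗[ℂ] GenTaft D := g D ⊗ₜ 1 with hg1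
  set g2 : GenTaft D ⊗[ℂ] GenTaft D := 1 ⊗ₜ g D with hg2
  set E := comul D (idem hq) with hE
  have hx : g D * x D = q ^ 3 • (x D * g D) := (rels D).gx
  have hy : g D * y D = q ^ 3 • (y D * g D) := (rels D).gy
  have hgg : Commute g1 g2 := by simp [hg1, hg2, Commute, SemiconjBy]
  have h9 : g2 ^ 9 = 1 := by
    rw [hg2, Algebra.TensorProduct.tmul_pow, one_pow, show g D ^ 9 = 1 from (rels D).g_pow]
    rfl
  have hK : comul D (g D) = g1 * g2 := by simp [comul, hg1, hg2]
  have hKE : g1 * g2 * E = q ^ 3 • E := by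
    rw [← hK, hE, ← map_mul, g_mul_idem, map_smul]
  have hEs : E = (1 / 9 : ℂ) • ∑ l ∈ Finset.range 9, q ^ (6 * l) • (g D ⊗ₜ[ℂ] g D) ^ l := by
    rw [hE, map_idem, hK, hg1, hg2, Algebra.TensorProduct.tmul_mul_tmul, one_mul, mul_one]
  have hcE : Algebra.TensorProduct.comm ℂ _ _ E = E := by simp [hEs]
  have hgE : Commute (g2 ^ 3) E := by
    rw [hEs]
    refine (Commute.sum_right _ _ _ fun l _ => ((Commute.pow_right ?_ l).smul_right _)).smul_right _
    exact Commute.pow_left (by simp [hg2, Commute, SemiconjBy]) 3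
  have key : ∀ {z : GenTaft D} (r s : ℕ), r + s = 9 → g D * z = q ^ 3 • (z * g D) →
      comul D z = 1 ⊗ₜ z + z ⊗ₜ (g D ^ r) → ∀ {u : GenTaft D ⊗[ℂ] GenTaft D} {i j : ℕ},
      g1 * g2 * u = q ^ i • u → (i * r + 24 * j) % 9 = 3 * r % 9 →
      Commute (g2 ^ 3) (comul D z) ∧
      Algebra.TensorProduct.comm ℂ _ _ (comul D z) ^ 2 * (g2 ^ j * u) =
        g2 ^ (2 * s + j) * (comul D z ^ 2 * u) ∧
      g1 * g2 * (comul D z ^ 2 * u) = q ^ (6 + i) • (comul D z ^ 2 * u) := by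
    intro z r s hrs hgz hz u i j hu h
    have h1 : comul D z = skew g2 (z ⊗ₜ 1) (1 ⊗ₜ z) r 1 := by
      rw [hz, skew, hg2, one_smul, Algebra.TensorProduct.tmul_pow, one_pow,
        Algebra.TensorProduct.tmul_mul_tmul, one_mul, mul_one]
    have h2 : Algebra.TensorProduct.comm ℂ _ _ (comul D z) = z ⊗ₜ 1 + 1 ⊗ₜ z * g1 ^ r := by
      rw [hz, hg1, Algebra.TensorProduct.tmul_pow, one_pow,
        Algebra.TensorProduct.tmul_mul_tmul, one_mul, mul_one, map_add]
      rfl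
    have h21 : Commute g2 (z ⊗ₜ[ℂ] 1) := by simp [hg2, Commute, SemiconjBy]
    have h22 : g2 * (1 ⊗ₜ[ℂ] z) = q ^ 3 • ((1 ⊗ₜ[ℂ] z) * g2) := by simp [hg2, hgz]
    have h3 := coskew_mul_coskew hq (z1 := z ⊗ₜ[ℂ] 1) r
      (by simp [hg1, hgz, TensorProduct.smul_tmul'])
      (by simp [hg1, Commute, SemiconjBy]) h21 h22 (by simp [Commute, SemiconjBy]) hgg h9 hrs hu h
    refine ⟨?_, ?_, ?_⟩
    · have h4 := pow_mul_skew r h21 h22 3 1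
      rwa [mul_one, q_pow_congr hq (m := 3 * 3) (n := 0) rfl, pow_zero, ← h1] at h4
    · rw [h2, pow_two, mul_assoc, h3, h1, pow_two, mul_assoc]
    · have h4 : g1 * g2 * comul D z = q ^ 3 • (comul D z * (g1 * g2)) := by
        rw [← hK, ← map_mul, hgz, map_smul, map_mul]
      rw [← mul_assoc, comm_pow h4, smul_mul_assoc, mul_assoc, hu, mul_smul_comm, smul_smul,
        ← pow_mul, ← pow_add]
  obtain ⟨hy0, hy1, hy2⟩ := key 5 4 rfl hy (lift_y (rels_comul D)) hKE (j := 0) rfl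
  obtain ⟨hx0, hx1, -⟩ := key 1 8 rfl hx (lift_x (rels_comul D)) hy2 (j := 8) rfl
  have h3 : 1 ⊗ₜ[ℂ] (g D ^ 3) = g2 ^ 3 ∧ 1 ⊗ₜ[ℂ] (g D ^ 6) = g2 ^ 6 := by
    simp [hg2, Algebra.TensorProduct.tmul_pow]
  rw [pow_zero, one_mul] at hy1
  rw [h3.1, h3.2, integral, map_mul, map_mul, map_mul, map_mul, map_pow, map_pow, map_pow, map_pow,
    ← hE, hcE, mul_assoc, mul_assoc, mul_assoc, hy1, hx1, ← mul_assoc (g2 ^ 6), ← pow_add]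
  have hc := ((hx0.pow_right 2).mul_right ((hy0.pow_right 2).mul_right hgE)).eq
  have h30 : g2 ^ (6 + (2 * 8 + 8)) = g2 ^ 3 := by
    rw [show 6 + (2 * 8 + 8) = 9 * 3 + 3 from rfl, pow_add, pow_mul, h9, one_pow, one_mul]
  simp only [mul_assoc] at hc
  rw [h30]
  exact hc.symm

/-- The map `v ⊗ w ↦ w ⊗ h v`. -/
def swapBy {D : TaftData} (h : GenTaft D) (V W : FDMod ℂ (GenTaft D)) :
    (V ⊗ W).carrier →ₗ[ℂ] (W ⊗ V).carrier :=
  (tcomm ℂ V.carrier W.carrier).toLinearMap ∘ₗ tmap (V.ρ h) LinearMap.id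

section Swap

variable {V W : FDMod ℂ (GenTaft (taftNine q hq))}

theorem act₂_comm (t : GenTaft 𝓓 ⊗[ℂ] GenTaft 𝓓)
    (v : V.carrier ⊗[ℂ] W.carrier) :
    HopfRep.act₂ W.ρ V.ρ (Algebra.TensorProduct.comm ℂ _ _ t) (tcomm ℂ _ _ v) =
      tcomm ℂ _ _ (HopfRep.act₂ V.ρ W.ρ t v) := by
  induction t with
  | zero => simp
  | add a b ha hb => simp only [map_add, LinearMap.add_apply, ha, hb]
  | tmul a b => induction v with
    | zero => simp
    | add v w hv hw => simp only [map_add, hv, hw]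
    | tmul v w => rfl

theorem integral_swap (v : (V ⊗ W).carrier) :
    (W ⊗ V).ρ (integral hq) (swapBy (g _ ^ 3) V W v) =
      swapBy (g _ ^ 6) V W ((V ⊗ W).ρ (integral hq) v) := by
  have h1 : ∀ (k : ℕ) (v : V.carrier ⊗[ℂ] W.carrier), swapBy (g _ ^ k) V W v =
      HopfRep.act₂ W.ρ V.ρ (1 ⊗ₜ[ℂ] (g _ ^ k)) (tcomm ℂ _ _ v) := fun k v => by
    induction v with
    | zero => exact (map_zero _).trans (by simp)
    | add v w hv hw => exact (map_add _ _ _).trans ((congrArg₂ _ hv hw).trans (by simp))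
    | tmul v w =>
      have h := lcongr (map_one W.ρ) w
      exact congrArg (fun w' => w' ⊗ₜ[ℂ] V.ρ (g _ ^ k) v) h.symm
  refine (congrArg _ (h1 3 v)).trans (.trans ?_ (h1 6 _).symm)
  refine (lcongr ((map_mul (HopfRep.act₂ W.ρ V.ρ) _ _).symm.trans
    ((congrArg _ (comm_comul_integral q hq)).trans (map_mul _ _ _))) _).trans ?_
  exact congrArg _ (act₂_comm hq _ v)

theorem rho_g_pow_tmul (k : ℕ) (v : V.carrier) (w : W.carrier) :
    (V ⊗ W).ρ (g _ ^ k) (v ⊗ₜ[ℂ] w) = V.ρ (g _ ^ k) v ⊗ₜ W.ρ (g _ ^ k) w := by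
  induction k with
  | zero => simp
  | succ k ih =>
    rw [pow_succ', map_mul, End.mul_apply, ih, rho_g_tmul, map_mul, map_mul]
    rfl

variable {z : GenTaft (taftNine q hq)} {r : ℕ}
  (hz : ∀ {V W : FDMod ℂ (GenTaft (taftNine q hq))} (v : V.carrier) (w : W.carrier),
    (V ⊗ W).ρ z (v ⊗ₜ[ℂ] w) = v ⊗ₜ W.ρ z w + V.ρ z v ⊗ₜ W.ρ (g _ ^ r) w)
  (hgz : g _ * z = q ^ 3 • (z * g _))

theorem rho_g_swapBy {s : GenTaft 𝓓} (hs : Commute (g _) s) (v : (V ⊗ W).carrier) :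
    (W ⊗ V).ρ (g _) (swapBy s V W v) = swapBy s V W ((V ⊗ W).ρ (g _) v) := by
  have h : (W ⊗ V).ρ (g _) ∘ₗ swapBy s V W = swapBy s V W ∘ₗ (V ⊗ W).ρ (g _) :=
    TensorProduct.ext' fun v w => by
      refine (rho_g_tmul w (V.ρ s v)).trans (.trans ?_
        (congrArg (swapBy s V W) (rho_g_tmul v w)).symm)
      rw [← End.mul_apply, ← map_mul, hs.eq, map_mul]
      rfl
  exact lcongr h v

include hz hgz

theorem rho_swapBy_eq_zero {v : (V ⊗ W).carrier} (hg : (V ⊗ W).ρ (g _) v = q ^ 6 • v)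
    (hv : (V ⊗ W).ρ z v = 0) : (W ⊗ V).ρ z (swapBy (g _ ^ 6) V W v) = 0 := by
  have key : (W ⊗ V).ρ z ∘ₗ swapBy (g _ ^ 6) V W =
      tmap .id (V.ρ (g _ ^ r)) ∘ₗ swapBy (g _ ^ 6) V W ∘ₗ (V ⊗ W).ρ z +
      (swapBy (z * g _ ^ 6) V W -
        q ^ (3 * r) • swapBy (z * g _ ^ 6) V W ∘ₗ (V ⊗ W).ρ (g _ ^ r)) := by
    refine TensorProduct.ext' fun v w => ?_
    have he : V.ρ (g _ ^ r) (V.ρ (g _ ^ 6) (V.ρ z v)) =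
        q ^ (3 * r) • V.ρ (z * g _ ^ 6) (V.ρ (g _ ^ r) v) := by
      simp only [← End.mul_apply, ← map_mul]
      rw [← LinearMap.smul_apply, ← map_smul, ← mul_assoc, ← pow_add, pow_comm hgz, mul_assoc z,
        ← pow_add, add_comm r, ← pow_mul, q_pow_congr hq (n := 3 * r) (by omega)]
    refine (hz w _).trans (.trans ?_ (congrArg₂ HAdd.hAdd (congrArg (fun t => tmap
      LinearMap.id (V.ρ (g _ ^ r)) (swapBy (g _ ^ 6) V W t)) (hz v w)).symm
      (congrArg (fun t => _ - q ^ (3 * r) • swapBy (z * g _ ^ 6) V W t)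
        (rho_g_pow_tmul hq r v w)).symm))
    rw [map_add, map_add]
    change _ = W.ρ z w ⊗ₜ V.ρ (g _ ^ r) (V.ρ (g _ ^ 6) v) +
      W.ρ (g _ ^ r) w ⊗ₜ V.ρ (g _ ^ r) (V.ρ (g _ ^ 6) (V.ρ z v)) + (w ⊗ₜ V.ρ (z * g _ ^ 6) v -
        q ^ (3 * r) • W.ρ (g _ ^ r) w ⊗ₜ V.ρ (z * g _ ^ 6) (V.ρ (g _ ^ r) v))
    rw [he, tmul_smul, map_mul V.ρ z, End.mul_apply, End.mul_apply]
    abel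
  refine (lcongr key v).trans ?_
  have h1 : swapBy (z * g _ ^ 6) V W v - q ^ (3 * r) • swapBy (z * g _ ^ 6) V W
      ((V ⊗ W).ρ (g _ ^ r) v) = 0 := by
    rw [rho_g_pow hg, map_smul, smul_smul, ← pow_mul, ← pow_add,
      q_pow_congr hq (n := 0) (by omega), pow_zero, one_smul, sub_self]
  refine (congrArg₂ HAdd.hAdd (congrArg (tmap .id (V.ρ (g _ ^ r)) ∘ₗ
    swapBy (g _ ^ 6) V W) hv) h1).trans ?_
  rw [map_zero, add_zero]

theorem invFun_swapBy {p : ℕ} (hp : (r + p) % 9 = 3) {f : (W ⊗ V).carrier →ₗ[ℂ] ℂ}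
    (hg : ∀ v, f ((W ⊗ V).ρ (g _) v) = q ^ 3 * f v) (hf : ∀ v, f ((W ⊗ V).ρ z v) = 0)
    (v : (V ⊗ W).carrier) : f (swapBy (g _ ^ 3) V W ((V ⊗ W).ρ z v)) = 0 := by
  have key : swapBy (g _ ^ 3) V W ∘ₗ (V ⊗ W).ρ z = (W ⊗ V).ρ z ∘ₗ swapBy (g _ ^ p) V W +
      (q ^ (3 * p) • (W ⊗ V).ρ (g _ ^ r) ∘ₗ swapBy (z * g _ ^ p) V W -
        swapBy (z * g _ ^ p) V W) := by
    refine TensorProduct.ext' fun v w => ?_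
    have he : V.ρ (g _ ^ 3) (V.ρ z v) =
        q ^ (3 * p) • V.ρ (g _ ^ r) (V.ρ (z * g _ ^ p) v) := by
      simp only [← End.mul_apply, ← map_mul]
      rw [← LinearMap.smul_apply, ← map_smul, ← mul_assoc, pow_comm hgz, pow_comm hgz,
        smul_mul_assoc, smul_smul, mul_assoc z (g _ ^ r), ← pow_add,
        pow_eq_pow_mod (r + p) (show g 𝓓 ^ 9 = 1 from (rels _).g_pow), hp, ← pow_mul,
        ← pow_mul, ← pow_add, q_pow_congr hq (n := 3 * p + 3 * r) (by omega)]
    refine (congrArg (swapBy (g _ ^ 3) V W) (hz v w)).trans (.trans ?_ (congrArg₂ HAdd.hAdd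
      (hz w (V.ρ (g _ ^ p) v)) (congrArg (fun t => q ^ (3 * p) • t - _)
        (rho_g_pow_tmul hq r w (V.ρ (z * g _ ^ p) v)))).symm)
    rw [map_add]
    change W.ρ z w ⊗ₜ V.ρ (g _ ^ 3) v + W.ρ (g _ ^ r) w ⊗ₜ V.ρ (g _ ^ 3) (V.ρ z v) =
      w ⊗ₜ V.ρ z (V.ρ (g _ ^ p) v) + W.ρ z w ⊗ₜ V.ρ (g _ ^ r) (V.ρ (g _ ^ p) v) +
      (q ^ (3 * p) • (W.ρ (g _ ^ r) w ⊗ₜ V.ρ (g _ ^ r) (V.ρ (z * g _ ^ p) v)) -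
        w ⊗ₜ V.ρ (z * g _ ^ p) v)
    rw [he, tmul_smul, map_mul V.ρ z, End.mul_apply,
      ← End.mul_apply (V.ρ (g _ ^ r)) (V.ρ (g _ ^ p)), ← map_mul, ← pow_add,
      pow_eq_pow_mod (r + p) (show g 𝓓 ^ 9 = 1 from (rels _).g_pow), hp]
    abel
  have hgr : ∀ k v, f ((W ⊗ V).ρ (g _ ^ k) v) = q ^ (3 * k) * f v := fun k => by
    induction k with
    | zero => simp
    | succ k ih =>
      intro v
      rw [pow_succ', map_mul, End.mul_apply, hg, ih, ← mul_assoc, ← pow_add,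
        show 3 + 3 * k = 3 * (k + 1) by ring]
  refine (congrArg f (lcongr key v)).trans ((map_add f _ _).trans ?_)
  refine (congrArg₂ HAdd.hAdd (hf _) ((map_sub f _ _).trans (congrArg (· - _)
    ((map_smul f _ _).trans (congrArg (q ^ (3 * p) • ·) (hgr r _)))))).trans ?_
  rw [zero_add, smul_eq_mul, ← mul_assoc, ← pow_add, q_pow_congr hq (n := 0) (by omega), pow_zero,
    one_mul, sub_self]

end Swap

theorem isInvVec_of_generators {c : ℕ} {V : 𝓑} {v : V.carrier}
    (hg : V.ρ (g _) v = q ^ c • v) (hx : V.ρ (x _) v = 0) (hy : V.ρ (y _) v = 0) :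
    IsInvVec (character _ c) v := fun h => by
  induction h using induction with
  | hc a => simp [AlgHom.commutes, Module.algebraMap_end_apply]
  | hg => rw [hg, character_g]; rfl
  | hx => rw [hx, character_x, zero_smul]
  | hy => rw [hy, character_y, zero_smul]
  | hmul a b ha hb => rw [map_mul, End.mul_apply, hb, map_smul, ha, map_mul, mul_comm,
      mul_smul]
  | hadd a b ha hb => rw [map_add, LinearMap.add_apply, ha, hb, map_add, add_smul]

theorem isInvFun_of_generators {c : ℕ} {V : 𝓑}
    {f : V.carrier →ₗ[ℂ] ℂ} (hg : ∀ v, f (V.ρ (g _) v) = q ^ c * f v)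
    (hx : ∀ v, f (V.ρ (x _) v) = 0) (hy : ∀ v, f (V.ρ (y _) v) = 0) :
    IsInvFun (character _ c) f := fun h => by
  change ∀ v, f (V.ρ h v) = character _ c h * f v
  induction h using induction with
  | hc a => simp [AlgHom.commutes, Module.algebraMap_end_apply]
  | hg => exact fun v => (hg v).trans (congrArg (· * f v) (character_g 𝓓 c).symm)
  | hx => exact fun v => by rw [hx, character_x, zero_mul]
  | hy => exact fun v => by rw [hy, character_y, zero_mul]
  | hmul a b ha hb =>
    intro v
    rw [map_mul, End.mul_apply, ha, hb, map_mul, mul_assoc]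
  | hadd a b ha hb =>
    intro v
    rw [map_add, LinearMap.add_apply, map_add, ha, hb, map_add, add_mul]

theorem swapAct_groupLike {D : TaftData} (k : ℕ) (V W : FDMod ℂ (GenTaft D)) :
    swapAct (groupLike D ^ k) V W = swapBy (g D ^ k) V W :=
  congrArg (fun h => swapBy h V W) (GroupLike.val_pow _ _)

/-- The integral of the generalized Taft algebra for `N = 9`. -/
def twistedIntegral : TwistedIntegral ℂ (GenTaft 𝓓) where
  bot := groupLike _ ^ 6
  top := groupLike _ ^ 3
  χ := character _ 6
  ψ := character _ 3
  Λ := integral hq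
  χ_bot := by
    rw [GroupLike.val_pow, map_pow]
    refine (congrArg (· ^ 6) (character_g _ 6)).trans ((pow_mul q 6 6).symm.trans
      ((q_pow_congr hq (m := 6 * 6) (n := 0) rfl).trans (pow_zero q)))
  ψ_top := by
    rw [GroupLike.val_pow, map_pow]
    refine (congrArg (· ^ 3) (character_g _ 3)).trans ((pow_mul q 3 3).symm.trans
      ((q_pow_congr hq (m := 3 * 3) (n := 0) rfl).trans (pow_zero q)))
  inv_swap {V W} v hv := by
    rw [swapAct_groupLike]
    have hg := (hv _).trans (congrArg (· • v) (character_g _ 6))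
    have hx := (hv _).trans ((congrArg (· • v) (character_x _ 6)).trans (zero_smul ℂ v))
    have hy := (hv _).trans ((congrArg (· • v) (character_y _ 6)).trans (zero_smul ℂ v))
    refine isInvVec_of_generators hq ((rho_g_swapBy hq (s := g _ ^ 6) (Commute.self_pow _ _) v).trans
      ((congrArg _ hg).trans (map_smul _ _ _))) ?_ ?_
    · exact rho_swapBy_eq_zero hq rho_x_tmul (rels _).gx hg hx
    · exact rho_swapBy_eq_zero hq rho_y_tmul (rels _).gy hg hy
  fun_swap {V W} f hf := by
    rw [swapAct_groupLike]
    have hg := fun v => (hf _ v).trans (congrArg (· * f v) (character_g _ 3))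
    have hx := fun v => (hf _ v).trans ((congrArg (· * f v) (character_x _ 3)).trans (zero_mul _))
    have hy := fun v => (hf _ v).trans ((congrArg (· * f v) (character_y _ 3)).trans (zero_mul _))
    refine isInvFun_of_generators hq (fun v => ?_) (fun v => ?_) fun v => ?_
    · exact (congrArg f (rho_g_swapBy hq (s := g _ ^ 3) (Commute.self_pow _ _) v).symm).trans (hg _)
    · exact invFun_swapBy hq rho_x_tmul (rels _).gx (p := 2) rfl hg hx v
    · exact invFun_swapBy hq rho_y_tmul (rels _).gy (p := 7) (show (5 + 7) % 9 = 3 from rfl) hg hy v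
  Λ_swap {V W} v := by
    rw [swapAct_groupLike, swapAct_groupLike]
    exact integral_swap hq v
  socle := socle_projective hq
  ker := ker_projective hq
  projective_tens := projective_tens (exists_leftDual
    (antipode_iterate_six (D := 𝓓) ⟨1, rfl⟩ ⟨5, rfl⟩))

theorem dual_g {V : 𝓑} {c : ℕ}
    (h : ∀ v, V.ρ (g _) v = q ^ c • v) (ξ : (dual V).carrier) :
    (dual V).ρ (g _) ξ = q ^ (8 * c) • ξ := by
  refine lext fun v => (congrArg (fun z => (show Dual ℂ V.carrier from ξ) (V.ρ z v))
    (antipode_g 𝓓)).trans ?_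
  refine (congrArg (show Dual ℂ V.carrier from ξ) (rho_g_pow (h v) 8)).trans
    ((map_smul (show Dual ℂ V.carrier from ξ) _ _).trans ?_)
  rw [← pow_mul, mul_comm c]
  rfl

theorem dual_T_g (ξ : (dual (T 𝓓 6)).carrier) :
    (dual (T 𝓓 6)).ρ (g _) ξ = q ^ 3 • ξ :=
  (dual_g hq (T_g 6) ξ).trans (congrArg (· • ξ) (q_pow_congr hq rfl))

theorem isInvVec_T : IsInvVec (V := T 𝓓 6) (character _ 6) (1 : ℂ) :=
  isInvVec_of_generators hq (T_g 6 (1 : ℂ)) (T_x 6 (1 : ℂ)) (T_y 6 (1 : ℂ))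

theorem isInvVec_dual_T (ξ : (dual (T 𝓓 6)).carrier) :
    IsInvVec (character _ 3) ξ := by
  have h0 : ∀ {z} (r : ℕ), antipode 𝓓 z = -(z * ginv _ ^ r) →
      (∀ a, (T 𝓓 6).ρ z a = 0) → (dual (T 𝓓 6)).ρ z ξ = 0 :=
    fun {z} r hS hz => lext fun a => by
      refine (congrArg (fun z => (show Dual ℂ ℂ from ξ) ((T 𝓓 6).ρ z a))
        hS).trans ?_
      have h1 : (T 𝓓 6).ρ (-(z * ginv _ ^ r)) a = 0 := by
        rw [map_neg, map_mul]
        exact (congrArg (- ·) (hz _)).trans neg_zero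
      exact (congrArg (show Dual ℂ ℂ from ξ) h1).trans (map_zero _)
  exact isInvVec_of_generators hq (dual_T_g hq ξ) (h0 _ (antipode_x _) (T_x 6))
    (h0 _ (antipode_y _) (T_y 6))

theorem ne_of_rho_g {V W : 𝓑} {c d : ℕ} (hcd : q ^ c ≠ q ^ d)
    (hV : ∀ v, V.ρ (g _) v = q ^ c • v) (hW : ∀ v, W.ρ (g _) v = q ^ d • v) {v : V.carrier}
    (hv : v ≠ 0) : V ≠ W := by
  rintro rfl
  exact hcd (smul_left_injective ℂ hv ((hV v).symm.trans (hW v)))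

theorem taftNine_fits : (twistedIntegral hq).Fits (T 𝓓 6)
    ((ρ_ (T 𝓓 6)).inv.toLin (1 : ℂ)) where
  bot := (isInvVec_T hq).map (ρ_ (T 𝓓 6)).inv
  top h v := by
    obtain ⟨w, rfl⟩ : ∃ w, (ρ_ (dual (T 𝓓 6))).inv.toLin w = v :=
      ⟨_, toLin_inv_hom (ρ_ (dual (T 𝓓 6))) v⟩
    exact (isInvVec_dual_T hq w).map (ρ_ (dual (T 𝓓 6))).inv h

theorem nontrivial_skein {P : TwistedPivotalStructure (T 𝓓 6)}
    (hP : IsSwapBy P (g _ ^ 6)) :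
    Nontrivial (SphereSkein ℂ P
      (fun V : 𝓑 => Projective V)) := by
  have hG : (q ^ 3 • (1 : Module.End ℂ ℂ)) ^ 9 = 1 := by
    rw [smul_pow, one_pow, ← pow_mul, q_pow_congr hq (m := 3 * 9) (n := 0) rfl, pow_zero, one_smul]
  have hs : ∀ a : ℂ, q ^ 12 • (q ^ 3 • (1 : Module.End ℂ ℂ)) a = q ^ 6 • a := fun a =>
    (q_smul_congr hq a (l := 6) (m := 12) (n := 3) rfl).symm
  set Q := ind hq hG with hQ
  have hQp : Projective Q := projective_ind hq hG
  have h69 : q ^ 6 ≠ q ^ 3 := fun h => hq.pow_ne_one_of_pos_of_lt (l := 3) (by norm_num)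
    (by norm_num) (mul_left_cancel₀ (pow_ne_zero 3 (hq.ne_zero (by norm_num)))
      ((pow_add q 3 3).symm.trans (h.trans (mul_one _).symm)))
  obtain ⟨ε, hε⟩ : ∃ ε : (dual (T 𝓓 6)).carrier,
      ε = (LinearMap.id : ℂ →ₗ[ℂ] ℂ) := ⟨_, rfl⟩
  have hε0 : ε ≠ 0 := by
    subst hε
    exact fun h => one_ne_zero (lcongr (h : (LinearMap.id : ℂ →ₗ[ℂ] ℂ) = 0) (1 : ℂ))
  have hw : ∀ v : ℂ, (dual (T 𝓓 6)).ρ (g _) (LinearMap.toSpanSingleton ℂ _ ε v) =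
      LinearMap.toSpanSingleton ℂ _ ε ((q ^ 3 • (1 : Module.End ℂ ℂ)) v) := fun v =>
    (dual_T_g hq _).trans (map_smul (LinearMap.toSpanSingleton ℂ _ ε) _ v).symm
  have hI := taftNine_fits hq
  obtain ⟨s, hs0⟩ : ∃ s : Q.carrier, s = unitVec (X := ℂ) 0 0 1 := ⟨_, rfl⟩
  have hg : Q.ρ (g _) s = q ^ 3 • s := by
    subst hs0
    exact (ind_g hq hG _).trans ((indG_unitVec _ _).trans (map_smul (unitVec (X := ℂ) 0 0) (q ^ 3) _))
  have hΛ : Q.ρ (integral hq) s = unitVec (X := ℂ) 2 2 1 := by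
    have h1 := rho_idem hq hg
    subst hs0
    refine (ind_integral hq hG _ _ h1).trans ?_
    simp [unitVec]
    rfl
  have hval : ∀ k : ℕ, (groupLike 𝓓 ^ k).val = g _ ^ k := GroupLike.val_pow _
  have hM := hI.fVal_meridian ((ρ_ _).hom ≫ socleHom hq hG hs ≫ (ρ_ Q).inv)
    ((ρ_ Q).hom ≫ indHom hq hG _ hw ≫ (ρ_ _).inv)
    ((twistedIntegral hq).projective_tens (List.mem_singleton_self Q) hQp)
    (s := (ρ_ Q).inv.toLin s) ((comm_apply (ρ_ Q).inv _ s).symm.trans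
      (congrArg (ρ_ Q).inv.toLin (hΛ.trans (congrArg (socleHom hq hG hs).toLin
        (toLin_hom_inv (ρ_ (T 𝓓 6)) (1 : ℂ)).symm))))
  refine hI.nontrivial_skein (β := g _ ^ 6) (by rwa [show (twistedIntegral hq).bot.val = _ from hval 6])
    hP ?_ ?_ ?_ (meridian_admissible _ _ hQp) hM ?_
  · rw [show (twistedIntegral hq).top.val = _ from hval 3, ← pow_add]
    exact (rels _).g_pow
  · exact ne_of_rho_g hq h69 (T_g 6) (dual_T_g hq) (v := (1 : ℂ)) (one_ne_zero (α := ℂ))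
  · exact ne_of_rho_g hq (d := 8 * 3)
      (fun h => h69 ((q_pow_congr hq (m := 6) (n := 8 * 3) rfl).trans h.symm)) (dual_T_g hq)
      (dual_g hq (dual_T_g hq)) hε0
  · intro h
    have h1 : (indHom hq hG _ hw).toLin s = ε := by
      subst hs0
      exact (indHom_unitVec hq hG hw _).trans (one_smul ℂ ε)
    refine hε0 ((h1.symm.trans (congrArg _ (toLin_hom_inv (ρ_ Q) s).symm)).trans
      ((toLin_hom_inv (ρ_ (dual (T 𝓓 6))) _).symm.trans ((congrArg _ h).trans
        (map_zero _))))

end GenTaft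

end

theorem theoremB :
    (∀ (q : ℂ) (hq : IsPrimitiveRoot q 3),
      TwPiv.IsFiniteTensorCategory ℂ (FDMod ℂ (GenTaft (taftThree q hq))) ∧
      (∃ P : TwPiv.TwistedPivotalStructure (GenTaft.T (taftThree q hq) 2),
        GenTaft.IsGivenBy (taftThree q hq) P 0) ∧
      IsEmpty (TwPiv.PivotalStructure (FDMod ℂ (GenTaft (taftThree q hq))))) ∧
    (∀ (q : ℂ) (hq : IsPrimitiveRoot q 9),
      TwPiv.IsFiniteTensorCategory ℂ (FDMod ℂ (GenTaft (taftNine q hq))) ∧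
      ¬ TwPiv.IsUnimodular (FDMod ℂ (GenTaft (taftNine q hq))) ∧
      ∃ P : TwPiv.TwistedPivotalStructure (GenTaft.T (taftNine q hq) 6),
        GenTaft.IsGivenBy (taftNine q hq) P 6 ∧
        Nontrivial (TwPiv.SphereSkein ℂ P
          (fun V : FDMod ℂ (GenTaft (taftNine q hq)) => CategoryTheory.Projective V))) := by
  refine ⟨fun q hq => GenTaft.taftThree_spec hq, fun q hq => ⟨?_, GenTaft.not_isUnimodular hq, ?_⟩⟩
  · exact TwPiv.isFiniteTensorCategory
      (GenTaft.antipode_iterate_six (D := taftNine q hq) ⟨1, rfl⟩ ⟨5, rfl⟩)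
  · obtain ⟨P, hP⟩ := GenTaft.exists_isSwapBy (D := taftNine q hq) (c := 6) (d := 6)
      (by decide : 9 ∣ 1 * 3 + 6 * 1 + 3 * 6) (by decide : 9 ∣ 5 * 3 + 6 * 5 + 3 * 6)
      (by decide : 9 ∣ 6 * 6)
    exact ⟨P, GenTaft.isGivenBy_of_isSwapBy hP, GenTaft.nontrivial_skein hq hP⟩
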